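/- Let $N\ge 0$, let $\Bbbk$ be a commutative ring and let $p(x,y)=1+\sum_{(k,\ell)\ne(0,0)}\beta_{k,\ell}x^ky^\ell\in\Bbbk[[x,y]]$ be a power series with constant term $1$; put $p_{ij}=p(x_i,x_j)$. A closed $GL(N)$-foam $F$ is a compact piecewise-linear two-dimensional complex in $\mathbb R^3$ in which every point is a regular (surface) point, a point of a singular edge (locally a tripod times an interval), or a singular vertex where four singular edges and six corners meet (locally the cone over the $1$-skeleton of a tetrahedron). Its facets, i.e. the connected components of the complement of the set of singular points, are oriented and carry a thickness $\ell(f)\in\{0,\dots,N\}$. Along each singular edge facets of thickness $a$, $b$, $a+b$ meet, and the two thin ones induce the same orientation of the edge as their boundary, the thick one the opposite orientation; the edge is oriented as boundary of the thin facets. (At a singular vertex the corners then have thickness $a,b,c,a+b,b+c,a+b+c$.) Each facet $f$ carries a symmetric polynomial $P_f$ in $\ell(f)$ variables with coefficients in $\Bbbk$ (the product of its dots). A coloring $c$ of $F$ assigns to each facet $f$ a subset $c(f)\subset\{1,\dots,N\}$ with $\ell(f)$ elements such that $c(f_3)=c(f_1)\sqcup c(f_2)$ whenever $f_1,f_2,f_3$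 meet along a singular edge and $\ell(f_3)=\ell(f_1)+\ell(f_2)$. Let $\chi_i(c)$ and, for $i\neq j$, $\chi_{ij}(c)$ be the Euler characteristics of the unions of the closed facets $f$ for which $c(f)$ contains $i$, respectively contains exactly one of $i,j$. The singular edges at which a facet with color $i$ but not $j$, a facet with color $j$ but not $i$, and a facet with both colors meet form disjoint circles; for $i<j$ let $\theta^+_{ij}(c)$ be the number of those circles around which these three facets follow each other in this cyclic order by the left hand rule, with the thumb along the orientation of the circle. Let $P_f(c)$ be $P_f$ evaluated at the variables $x_k$, $k\in c(f)$. Then all $\chi_i(c)$, and all $\chi_{ij}(c)$ with $i\ne j$, are even, and the deformed Robert–Wagner evaluation $$\langle\!\langle F\rangle\!\rangle=\sum_{c}(-1)^{\sum_{i<j}\theta^+_{ij}(c)+\sum_{j=1}^N(j-1)\chi_j(c)/2}\ \prod_{f}P_f(c)\ \prod_{1\le i<j\le N}\frac{p_{ij}^{\chi_i(c)/2}\,p_{ji}^{\chi_j(c)/2}}{(x_i-x_j)^{\chi_{ij}(c)/2}},$$ the sum over all colorings $c$ of $F$, which is defined as an element of $\Bbbk[[x_1,\dots,x_N]]\big[(x_i-x_j)^{-1},\,i<j\big]$,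 is (the image of) a power series in $\Bbbk[[x_1,\dots,x_N]]$ that is invariant under all permutations of $x_1,\dots,x_N$. In particular, it has no denominators. -/

import Mathlib

open MvPowerSeries

noncomputable section

/-! ### Triangulated two-dimensional complexes in three-space -/

/-- Real three-space (only its linear structure and its orientation are used). -/
abbrev Space3 : Type := Fin 3 → ℝ

/-- Geometric simplicial complexes in `ℝ³`. -/
abbrev Complex3 : Type := Geometry.SimplicialComplex ℝ Space3

namespace Complex3

/-- The points `u, v, w` are the three distinct vertices of a triangle of `K`. -/
def IsTriangle (K : Complex3) (u v w : Space3) : Prop :=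
  ({u, v, w} : Finset Space3) ∈ K.faces ∧ ({u, v, w} : Finset Space3).card = 3

/-- The triangles of `K`. -/
def Triangle (K : Complex3) : Type :=
  {t : Finset Space3 // t ∈ K.faces ∧ t.card = 3}

/-- The triangle of `K` with vertices `u, v, w`. -/
def tri (K : Complex3) {u v w : Space3} (h : K.IsTriangle u v w) : K.Triangle := ⟨{u, v, w}, h⟩

/-- The number of triangles of `K` that contain `e`. -/
def edgeDegree (K : Complex3) (e : Finset Space3) : ℕ :=
  {t : Finset Space3 | t ∈ K.faces ∧ t.card = 3 ∧ e ⊆ t}.ncard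

/-- An edge at which exactly two triangles meet. -/
def IsRegularEdge (K : Complex3) (e : Finset Space3) : Prop :=
  e ∈ K.faces ∧ e.card = 2 ∧ K.edgeDegree e = 2

/-- An edge at which exactly three triangles meet (a tripod times an interval). -/
def IsSingularEdge (K : Complex3) (e : Finset Space3) : Prop :=
  e ∈ K.faces ∧ e.card = 2 ∧ K.edgeDegree e = 3

/-- Two triangles with a common regular edge. -/
def FacetRel (K : Complex3) (s t : K.Triangle) : Prop :=
  ∃ e, K.IsRegularEdge e ∧ e ⊆ s.1 ∧ e ⊆ t.1

/-- The facets, i.e. the connected components of the complement of the singular set: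
classes of triangles for the equivalence relation generated by having a common regular edge. -/
def Facet (K : Complex3) : Type := Quot K.FacetRel

/-- The facet that contains a given triangle. -/
def facetOf (K : Complex3) (t : K.Triangle) : K.Facet := Quot.mk _ t

/-- The link of the vertex `v` in a complex of dimension at most two, as a graph. -/
def link (K : Complex3) (v : Space3) :
    SimpleGraph {w : Space3 // w ≠ v ∧ ({v, w} : Finset Space3) ∈ K.faces} :=
  SimpleGraph.fromRel fun a b => ({v, a.1, b.1} : Finset Space3) ∈ K.faces

/-- Euler characteristic of the union of a set `S` of (closed) triangles of `K`:
vertices minus edges plus triangles. -/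
def eulerChar (K : Complex3) (S : Set K.Triangle) : ℤ :=
  ({s : Finset Space3 | s ∈ K.faces ∧ s.card = 1 ∧ ∃ t ∈ S, s ⊆ t.1}.ncard : ℤ)
    - ({s : Finset Space3 | s ∈ K.faces ∧ s.card = 2 ∧ ∃ t ∈ S, s ⊆ t.1}.ncard : ℤ)
    + ({s : Finset Space3 | s ∈ K.faces ∧ s.card = 3 ∧ ∃ t ∈ S, s ⊆ t.1}.ncard : ℤ)

theorem finite_facet (K : Complex3) (h : K.faces.Finite) : Finite K.Facet := by
  have h1 : Finite K.Triangle := (h.subset (fun _ ht => ht.1) :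
    {t : Finset Space3 | t ∈ K.faces ∧ t.card = 3}.Finite).to_subtype
  exact Quot.finite _

end Complex3

/-! ### The three possible links: subdivided circle, theta graph, tetrahedral graph -/

namespace LinkGraph

variable {V : Type*} (G : SimpleGraph V)

/-- The number of neighbours of a vertex. -/
def deg (x : V) : ℕ := (G.neighborSet x).ncard

variable {G} in
/-- A path whose interior vertices all have exactly two neighbours in the graph. -/
def IsArc {a b : V} (p : G.Walk a b) : Prop :=
  p.IsPath ∧ ∀ x ∈ p.support, x ≠ a → x ≠ b → deg G x = 2

/-- A cycle. -/
def IsCircle : Prop := G.Connected ∧ ∀ x, deg G x = 2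

/-- A subdivision of the theta graph: two trivalent vertices joined by three arcs. -/
def IsTheta : Prop :=
  G.Connected ∧ ∃ a b : V, a ≠ b ∧ deg G a = 3 ∧ deg G b = 3 ∧
    (∀ x, x ≠ a → x ≠ b → deg G x = 2) ∧
    ∀ x, G.Adj a x → ∃ p : G.Walk a b, IsArc p ∧ s(a, x) ∈ p.edges

/-- A subdivision of the tetrahedral graph: four trivalent vertices, any two of them joined
by an arc. -/
def IsTetrahedral : Prop :=
  G.Connected ∧ ∃ q : Fin 4 → V, Function.Injective q ∧ (∀ m, deg G (q m) = 3) ∧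
    (∀ x, x ∉ Set.range q → deg G x = 2) ∧
    ∀ m n, m ≠ n → ∃ p : G.Walk (q m) (q n), IsArc p

end LinkGraph

/-! ### Closed foams -/

/-- A closed `GL(N)`-foam: a compact piecewise-linear two-dimensional complex in `ℝ³`
(given with a triangulation) with oriented facets of thickness between `0` and `N`, decorated by
symmetric polynomials with coefficients in `R`. -/
structure GLFoam (N : ℕ) (R : Type*) [CommRing R] where
  /-- the triangulated complex -/
  K : Complex3
  finite : K.faces.Finite
  /-- every simplex lies in a triangle, and there are no simplices of dimension above two -/
  pure : ∀ s ∈ K.faces, ∃ t ∈ K.faces, t.card = 3 ∧ s ⊆ t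
  /-- a vertex is a regular point, a point of a singular edge, or a singular vertex with four
  singular edges and six corners. (Together with `seam` this gives the corners at a singular
  vertex the thicknesses `a, b, c, a + b, b + c, a + b + c` in the usual arrangement: this is the
  only way to orient the tetrahedral graph with no sources and sinks.) -/
  locallyFoam : ∀ v, {v} ∈ K.faces →
    LinkGraph.IsCircle (K.link v) ∨ LinkGraph.IsTheta (K.link v) ∨
      LinkGraph.IsTetrahedral (K.link v)
  /-- thickness of the facets -/
  thickness : K.Facet → ℕ
  thickness_le : ∀ f, thickness f ≤ N
  /-- orientation of the facets: `orient u v w` says that the triangle `u, v, w` is positively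
  oriented by this order of its vertices (only the values on triangles matter) -/
  orient : Space3 → Space3 → Space3 → Prop
  orient_rotate : ∀ u v w, K.IsTriangle u v w → (orient v w u ↔ orient u v w)
  orient_swap : ∀ u v w, K.IsTriangle u v w → (orient v u w ↔ ¬ orient u v w)
  /-- two triangles with a common regular edge have the same orientation -/
  orient_coherent : ∀ u v a b, K.IsRegularEdge {u, v} → K.IsTriangle u v a →
    K.IsTriangle u v b → a ≠ b → (orient u v a ↔ ¬ orient u v b)
  /-- along a singular edge two facets of thickness `a`, `b` merge into a facet of thickness
  `a + b`, compatibly with the orientations: the two thin facets induce the same orientation of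
  the edge as their boundary, and the thick facet induces the opposite one -/
  seam : ∀ u v, K.IsSingularEdge {u, v} →
    ∃ (a b w : Space3) (ha : K.IsTriangle u v a) (hb : K.IsTriangle u v b)
      (hw : K.IsTriangle u v w), a ≠ b ∧ a ≠ w ∧ b ≠ w ∧
      thickness (K.facetOf (K.tri hw)) =
        thickness (K.facetOf (K.tri ha)) + thickness (K.facetOf (K.tri hb)) ∧
      (orient u v a ↔ orient u v b) ∧ (orient u v w ↔ ¬ orient u v a)
  /-- decoration of a facet (the product of its dots): a symmetric polynomial in as many
  variables as its thickness -/
  dots : (f : K.Facet) → MvPolynomial (Fin (thickness f)) R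
  dots_symmetric : ∀ f, (dots f).IsSymmetric

/-- The determinant of three vectors of `ℝ³`. -/
def det3 (a b c : Space3) : ℝ := Matrix.det (Matrix.of ![a, b, c])

/-- Three half-planes bounded by a line of direction `d`, pairwise distinct and pointing to
`a`, `b`, `c`, are met in the cyclic order `a, b, c` when one turns around the line by the left
hand rule with the thumb along `d` (two of the three successive turns are by a negative angle
less than `π`). -/
def IsLeftHanded (d a b c : Space3) : Prop :=
  (det3 d a b < 0 ∧ det3 d b c < 0) ∨ (det3 d b c < 0 ∧ det3 d c a < 0) ∨
    (det3 d c a < 0 ∧ det3 d a b < 0)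

/-! ### The ring that contains the evaluations -/

section Ring

variable (N : ℕ) (R : Type*) [CommRing R]

/-- The product of all `x_i - x_j` with `i < j`. -/
def discr : MvPowerSeries (Fin N) R :=
  ∏ q : {q : Fin N × Fin N // q.1 < q.2}, (X q.1.1 - X q.1.2)

/-- Power series in `x_1, …, x_N` with all `x_i - x_j`, `i < j`, inverted. -/
abbrev EvalRing : Type _ := Localization.Away (discr N R)

theorem isUnit_root (q : {q : Fin N × Fin N // q.1 < q.2}) :
    IsUnit (algebraMap (MvPowerSeries (Fin N) R) (EvalRing N R) (X q.1.1 - X q.1.2)) :=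
  IsLocalization.Away.isUnit_of_dvd (discr N R)
    (Finset.dvd_prod_of_mem
      (fun q : {q : Fin N × Fin N // q.1 < q.2} =>
        (X q.1.1 - X q.1.2 : MvPowerSeries (Fin N) R)) (Finset.mem_univ q))

/-- `x_i - x_j` for `i < j`, as an invertible element. -/
def rootUnit (q : {q : Fin N × Fin N // q.1 < q.2}) : (EvalRing N R)ˣ := (isUnit_root N R q).unit

variable {R}

/-- The power series `p(x_i, x_j)`. -/
def pSeries (p : MvPowerSeries (Fin 2) R) (i j : Fin N) : MvPowerSeries (Fin N) R :=
  rename ![i, j] p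

theorem isUnit_pSeries (p : MvPowerSeries (Fin 2) R) (hp : constantCoeff p = 1) (i j : Fin N) :
    IsUnit (pSeries N p i j) := by
  have h : IsUnit p := by rw [MvPowerSeries.isUnit_iff_constantCoeff, hp]; exact isUnit_one
  exact h.map (rename ![i, j])

/-- `p(x_i, x_j)` as an invertible element. -/
def pUnit (p : MvPowerSeries (Fin 2) R) (hp : constantCoeff p = 1) (i j : Fin N) :
    (EvalRing N R)ˣ :=
  ((isUnit_pSeries N p hp i j).map (algebraMap (MvPowerSeries (Fin N) R) (EvalRing N R))).unit

end Ring

/-! ### Colorings and the evaluation -/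

namespace GLFoam

variable {N : ℕ} {R : Type*} [CommRing R] (F : GLFoam N R)

instance : Finite F.K.Facet := F.K.finite_facet F.finite

instance : Fintype F.K.Facet := Fintype.ofFinite _

/-- A coloring: a facet of thickness `a` gets a set of `a` colors, and along a singular edge the
set of the thick facet is the disjoint union of the sets of the two thin ones. -/
def IsColoring (c : F.K.Facet → Finset (Fin N)) : Prop :=
  (∀ f, (c f).card = F.thickness f) ∧
  ∀ (u v a b w : Space3) (ha : F.K.IsTriangle u v a) (hb : F.K.IsTriangle u v b)
    (hw : F.K.IsTriangle u v w), F.K.IsSingularEdge {u, v} → a ≠ b → a ≠ w → b ≠ w →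
    F.thickness (F.K.facetOf (F.K.tri hw)) =
      F.thickness (F.K.facetOf (F.K.tri ha)) + F.thickness (F.K.facetOf (F.K.tri hb)) →
    Disjoint (c (F.K.facetOf (F.K.tri ha))) (c (F.K.facetOf (F.K.tri hb))) ∧
    c (F.K.facetOf (F.K.tri hw)) =
      c (F.K.facetOf (F.K.tri ha)) ∪ c (F.K.facetOf (F.K.tri hb))

/-- The colorings of `F`. -/
def Coloring : Type := {c : F.K.Facet → Finset (Fin N) // F.IsColoring c}

instance : Finite F.Coloring := Subtype.finite

instance : Fintype F.Coloring := Fintype.ofFinite _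

namespace Coloring

variable {F} (c : F.Coloring)

/-- The set of colors of a triangle. -/
def color (t : F.K.Triangle) : Finset (Fin N) := c.1 (F.K.facetOf t)

/-- Euler characteristic of the surface `F_i(c)`, the union of the facets whose colors
contain `i`. -/
def chi (i : Fin N) : ℤ := F.K.eulerChar {t | i ∈ c.color t}

/-- Euler characteristic of the surface `F_ij(c)`, the union of the facets whose colors contain
exactly one of `i` and `j`. -/
def chiPair (i j : Fin N) : ℤ :=
  F.K.eulerChar {t | (i ∈ c.color t ∧ j ∉ c.color t) ∨ (j ∈ c.color t ∧ i ∉ c.color t)}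

/-- The edge `u v` is the common edge of a triangle with apex `a` that has color `i` but not `j`,
a triangle with apex `b` that has color `j` but not `i`, and a triangle with apex `w` that has
both colors. -/
def IsSeam (i j : Fin N) (u v a b w : Space3) : Prop :=
  ∃ (ha : F.K.IsTriangle u v a) (hb : F.K.IsTriangle u v b) (hw : F.K.IsTriangle u v w),
    (i ∈ c.color (F.K.tri ha) ∧ j ∉ c.color (F.K.tri ha)) ∧
    (j ∈ c.color (F.K.tri hb) ∧ i ∉ c.color (F.K.tri hb)) ∧
    (i ∈ c.color (F.K.tri hw) ∧ j ∈ c.color (F.K.tri hw))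

/-- The graph formed by the edges along which the colors `i` and `j` meet. It is a disjoint union
of circles (and isolated vertices), the circular seams on `F_ij(c)`. -/
def seamGraph (i j : Fin N) : SimpleGraph Space3 :=
  SimpleGraph.fromRel fun u v => ∃ a b w, c.IsSeam i j u v a b w

/-- The seam through the edge `u v` is oriented from `u` to `v` (as boundary of the thin facets),
and the facets with color `i` only, with color `j` only and with both colors are around it in
this cyclic order by the left hand rule. -/
def IsPositiveEdge (i j : Fin N) (u v : Space3) : Prop :=
  ∃ a b w, c.IsSeam i j u v a b w ∧ F.orient u v a ∧
    IsLeftHanded (v - u) (a - u) (b - u) (w - u)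

/-- The number of positive circular seams on `F_ij(c)`. -/
def thetaPlus (i j : Fin N) : ℕ :=
  {C : (c.seamGraph i j).ConnectedComponent |
    ∃ u v, c.IsPositiveEdge i j u v ∧ (c.seamGraph i j).connectedComponentMk u = C}.ncard

/-- The exponent of the sign: the sum of all `θ⁺_ij(c)`, `i < j`, and all `(j - 1) χ_j(c) / 2`
(the colors are counted from `0` here, so that `j.val` stands for `j - 1`). -/
def signExponent : ℤ :=
  ∑ q : {q : Fin N × Fin N // q.1 < q.2}, (c.thetaPlus q.1.1 q.1.2 : ℤ)
    + ∑ j : Fin N, (j.val : ℤ) * (c.chi j / 2)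

/-- The decoration of the facet `f` evaluated at the variables `x_k`, `k ∈ c(f)`. -/
def facetValue (f : F.K.Facet) : MvPowerSeries (Fin N) R :=
  MvPolynomial.aeval
    (fun m => (X ((c.1 f).orderEmbOfFin (c.2.1 f) m) : MvPowerSeries (Fin N) R)) (F.dots f)

/-- The contribution of the coloring `c` to the deformed evaluation. -/
def evaluation (p : MvPowerSeries (Fin 2) R) (hp : constantCoeff p = 1) : EvalRing N R :=
  (((-1 : (EvalRing N R)ˣ) ^ c.signExponent : (EvalRing N R)ˣ) : EvalRing N R) *
    algebraMap (MvPowerSeries (Fin N) R) (EvalRing N R) (∏ f, c.facetValue f) *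
    ((∏ q : {q : Fin N × Fin N // q.1 < q.2},
      pUnit N p hp q.1.1 q.1.2 ^ (c.chi q.1.1 / 2) * pUnit N p hp q.1.2 q.1.1 ^ (c.chi q.1.2 / 2) /
        rootUnit N R q ^ (c.chiPair q.1.1 q.1.2 / 2) : (EvalRing N R)ˣ) : EvalRing N R)

end Coloring

/-- The deformed evaluation of a closed foam: the sum over all colorings. -/
def evaluation (p : MvPowerSeries (Fin 2) R) (hp : constantCoeff p = 1) : EvalRing N R :=
  ∑ c : F.Coloring, c.evaluation p hp

end GLFoam

end

/-!
# The deformed Robert–Wagner evaluation of a closed foam has no denominators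

*Surfaces.* Let `c` be a coloring of the foam. The facets with color `i` form an oriented closed
surface `F_i(c)` (`isFlow_eps`), and the facets with exactly one of the colors `i, j` form another
one, `F_ij(c)`, when the orientation of those with color `j` is reversed (`isFlow_sub`). Their
links at the vertices of the foam are two-regular subgraphs of a circle, of a theta graph or of a
tetrahedral graph, hence connected (`LinkGraph.IsTwoRegular.mem_of_closed`). An oriented surface is
the same as a pair of permutations of its directed edges, and a comparison of signs shows that its
Euler characteristic is even (`IsOrientedSurface.even_euler`); no embedding is used here. This gives
`even_chi` and `even_chiPair`. In the presence of a boundary the Euler characteristic has the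
parity of the number of boundary circles.

*Seams.* The edges between a facet with color `i` only, one with color `j` only and one with both
form circles, the seams (`isCirculation_seam`). Along a seam the cyclic order of the three facets is
constant (`isPositive_iff_of_seam`): at a vertex, the seam meets the sphere of directions in two
points, which are joined by three arcs, and the cyclic orders of the arcs of a planar theta graph at
its two vertices are opposite (`IsSphereGraph.isLeftHanded_iff`). This is the only place where the
embedding in space matters. Planarity enters through a version of the Jordan curve theorem modulo
two: the side of a curve on which a point lies is the parity of the number of arcs of the curve
below that point, seen from a pole. So `θ⁺_ij(c)` counts the circles of positive seams
(`thetaPlus_eq`).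

*Kempe moves.* Let `j = i + 1` and let `S` be a union of connected components of `F_ij(c)`. The
exchange of the colors `i, j` on `S` yields another coloring. As the positive seams correspond to
permutations, whose signs are multiplicative, the total of the numbers `θ⁺` changes by the number of
seams on `S` modulo two, and the sign of `c` changes by `(-1) ^ (χ(S) / 2)`
(`even_signExponent_kempe`). The other factors change by a quotient that becomes `1` for
`x_i = x_j` (`kempeRatio_mem_diagOne`). All colorings that arise from `c` in this way are obtained
by an independent choice for each component, so the sum over them is a product over the components
(`sum_kempe_class_evaluation`). The denominator `(x_i - x_j) ^ (χ_ij(c) / 2)` is distributed over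
the components according to their Euler characteristics, which are at most two
(`eulerChar_compSet_le`). For a sphere the two choices have opposite signs and cancel along
`x_i = x_j`, so that the factor is divisible by `x_i - x_j`; for the other components there is no
denominator (`comp_factor_mem`). Consequently the evaluation has no pole along `x_i = x_j`.

*Symmetry.* The exchange of `i` and `j = i + 1` on the whole of `F_ij(c)` permutes the colorings and
exchanges the variables `x_i, x_j` in their contributions: the change of sign by
`(-1) ^ (χ_ij(c) / 2)` is that of the power of `x_i - x_j` (`permHom_swap_evaluation`). So the
evaluation is symmetric (`permHom_evaluation`), and being regular along one diagonal it is regular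
along all of them (`evaluation_mem_diagSubring`). A power of the product of all `x_k - x_l` is a
denominator of the evaluation; since each `x_k - x_l` generates the kernel of the substitution
`x_l ↦ x_k`, under which the other factors remain nonzerodivisors, the denominator can be cancelled
factor by factor (`mem_range_algebraMap_of_mem_diagSubring`).
-/

noncomputable section

/-! ### Circulations and their cycles -/

section Circulation

open Equiv Equiv.Perm

/-- The sign of a permutation through the number of its nontrivial cycles. -/
theorem sign_eq_neg_one_pow_support_add_cycles {V : Type*} [Fintype V] [DecidableEq V]
    (π : Perm V) :
    sign π = (-1 : ℤˣ) ^ (π.support.card + Multiset.card π.cycleType) := by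
  rw [sign_of_cycleType, sum_cycleType]

theorem Finset.card_image_congr_ker {V A B : Type*} [DecidableEq A] [DecidableEq B]
    (s : Finset V) (f : V → A) (g : V → B)
    (h : ∀ x ∈ s, ∀ y ∈ s, f x = f y ↔ g x = g y) : (s.image f).card = (s.image g).card := by
  have h1 : s.image f = (s.image fun x => (f x, g x)).image Prod.fst := by
    rw [Finset.image_image]; rfl
  have h2 : s.image g = (s.image fun x => (f x, g x)).image Prod.snd := by
    rw [Finset.image_image]; rfl
  rw [h1, h2, Finset.card_image_of_injOn (s := s.image fun x => (f x, g x)),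
    Finset.card_image_of_injOn (s := s.image fun x => (f x, g x))]
  · intro p hp q hq hpq
    simp only [Finset.coe_image, Set.mem_image, Finset.mem_coe] at hp hq
    obtain ⟨x, hx, rfl⟩ := hp
    obtain ⟨y, hy, rfl⟩ := hq
    exact Prod.ext ((h x hx y hy).2 hpq) hpq
  · intro p hp q hq hpq
    simp only [Finset.coe_image, Set.mem_image, Finset.mem_coe] at hp hq
    obtain ⟨x, hx, rfl⟩ := hp
    obtain ⟨y, hy, rfl⟩ := hq
    exact Prod.ext hpq ((h x hx y hy).1 hpq)

/-- The nontrivial cycles of a permutation may be counted by any function that separates exactly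
the cycles. -/
theorem card_cycleType_eq_ncard_image {V A : Type*} [Fintype V] [DecidableEq V] (π : Perm V)
    (f : V → A) (hf : ∀ x ∈ π.support, ∀ y ∈ π.support, f x = f y ↔ π.SameCycle x y) :
    Multiset.card π.cycleType = (f '' (π.support : Set V)).ncard := by
  classical
  have h1 : Multiset.card π.cycleType = (π.support.image π.cycleOf).card := by
    rw [cycleType_def, Multiset.card_map]
    change π.cycleFactorsFinset.card = _
    congr 1
    ext c
    rw [Finset.mem_image]
    constructor
    · intro hc
      obtain ⟨a, ha⟩ := (mem_cycleFactorsFinset_iff.1 hc).1.nonempty_support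
      exact ⟨a, mem_cycleFactorsFinset_support_le hc ha,
        (cycle_is_cycleOf ha hc).symm⟩
    · rintro ⟨a, ha, rfl⟩
      exact cycleOf_mem_cycleFactorsFinset_iff.2 ha
  rw [h1, ← Finset.coe_image, Set.ncard_coe_finset]
  refine Finset.card_image_congr_ker _ _ _ fun x hx y hy => ?_
  rw [hf x hx y hy, sameCycle_iff_cycleOf_eq_of_mem_support hx hy]

/-- A directed graph without loops in which every vertex has at most one outgoing and at most one
incoming edge, and has an outgoing edge if and only if it has an incoming one: a disjoint union of
directed circles (and isolated vertices). -/
structure IsCirculation {V : Type*} (B : V → V → Prop) : Prop where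
  ne : ∀ u v, B u v → u ≠ v
  out_unique : ∀ u v w, B u v → B u w → v = w
  in_unique : ∀ u v w, B u w → B v w → u = v
  out_of_in : ∀ u v, B u v → ∃ w, B v w
  in_of_out : ∀ v w, B v w → ∃ u, B u v

variable {V : Type*} {B B₁ B₂ : V → V → Prop}

open scoped Classical in
theorem IsCirculation.bijective [Finite V] (h : IsCirculation B) :
    Function.Bijective fun v => if h : ∃ w, B v w then h.choose else v := by
  refine Finite.injective_iff_bijective.1 fun x y hxy => ?_
  by_cases hx : ∃ w, B x w <;> by_cases hy : ∃ w, B y w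
  · simp only [dif_pos hx, dif_pos hy] at hxy
    have h1 := hx.choose_spec
    have h2 := hy.choose_spec
    rw [hxy] at h1
    exact h.in_unique _ _ _ h1 h2
  · simp only [dif_pos hx, dif_neg hy] at hxy
    exact absurd (h.out_of_in _ _ hx.choose_spec) (by rwa [hxy])
  · simp only [dif_neg hx, dif_pos hy] at hxy
    exact absurd (h.out_of_in _ _ hy.choose_spec) (by rwa [← hxy])
  · simpa only [dif_neg hx, dif_neg hy] using hxy

open scoped Classical in
/-- The permutation that moves every vertex of a union of directed circles one step forward and
fixes all other vertices (the identity if `B` is not a union of directed circles). -/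
def circPerm [Finite V] (B : V → V → Prop) : Perm V :=
  if h : IsCirculation B then Equiv.ofBijective _ h.bijective else 1

theorem IsCirculation.circPerm_apply [Finite V] (h : IsCirculation B) {u v : V} (huv : B u v) :
    circPerm B u = v := by
  classical
  have hex : ∃ w, B u w := ⟨v, huv⟩
  rw [circPerm, dif_pos h]
  simp only [Equiv.ofBijective_apply, dif_pos hex]
  exact h.out_unique _ _ _ hex.choose_spec huv

theorem IsCirculation.circPerm_apply_of_not [Finite V] (h : IsCirculation B) {u : V}
    (hu : ¬ ∃ v, B u v) : circPerm B u = u := by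
  classical
  rw [circPerm, dif_pos h]
  simp only [Equiv.ofBijective_apply, dif_neg hu]

variable [Fintype V] [DecidableEq V]

theorem IsCirculation.mem_support (h : IsCirculation B) {u : V} :
    u ∈ (circPerm B).support ↔ ∃ v, B u v := by
  rw [Equiv.Perm.mem_support]
  by_cases hu : ∃ v, B u v
  · obtain ⟨v, hv⟩ := hu
    rw [h.circPerm_apply hv]
    exact ⟨fun _ => ⟨v, hv⟩, fun _ => (h.ne _ _ hv).symm⟩
  · rw [h.circPerm_apply_of_not hu]
    exact ⟨fun h => absurd rfl h, fun h => absurd h hu⟩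

/-- The number of circles of a disjoint union of directed circles. -/
def circleCount (B : V → V → Prop) : ℕ := Multiset.card (circPerm B).cycleType

theorem sign_circPerm (B : V → V → Prop) :
    sign (circPerm B) = (-1 : ℤˣ) ^ ((circPerm B).support.card + circleCount B) :=
  sign_eq_neg_one_pow_support_add_cycles _

theorem circleCount_congr (h : ∀ u v, B₁ u v ↔ B₂ u v) : circleCount B₁ = circleCount B₂ := by
  have : B₁ = B₂ := by
    funext u v
    exact propext (h u v)
  rw [this]

omit [Fintype V] [DecidableEq V] in
/-- Unions of circles on disjoint sets of vertices. -/
theorem IsCirculation.or (h₁ : IsCirculation B₁) (h₂ : IsCirculation B₂)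
    (hd : ∀ u v w, B₁ u v → ¬ B₂ u w) : IsCirculation fun u v => B₁ u v ∨ B₂ u v where
  ne u v := by
    rintro (h | h)
    exacts [h₁.ne _ _ h, h₂.ne _ _ h]
  out_unique u v w := by
    rintro (h | h) (h' | h')
    exacts [h₁.out_unique _ _ _ h h', absurd h' (hd _ _ _ h), absurd h (hd _ _ _ h'),
      h₂.out_unique _ _ _ h h']
  in_unique u v w := by
    rintro (h | h) (h' | h')
    · exact h₁.in_unique _ _ _ h h'
    · obtain ⟨x, hx⟩ := h₁.out_of_in _ _ h
      obtain ⟨y, hy⟩ := h₂.out_of_in _ _ h'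
      exact absurd hy (hd _ _ _ hx)
    · obtain ⟨x, hx⟩ := h₂.out_of_in _ _ h
      obtain ⟨y, hy⟩ := h₁.out_of_in _ _ h'
      exact absurd hx (hd _ _ _ hy)
    · exact h₂.in_unique _ _ _ h h'
  out_of_in u v := by
    rintro (h | h)
    · exact (h₁.out_of_in _ _ h).imp fun _ => Or.inl
    · exact (h₂.out_of_in _ _ h).imp fun _ => Or.inr
  in_of_out u v := by
    rintro (h | h)
    · exact (h₁.in_of_out _ _ h).imp fun _ => Or.inl
    · exact (h₂.in_of_out _ _ h).imp fun _ => Or.inr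

theorem circleCount_or (h₁ : IsCirculation B₁) (h₂ : IsCirculation B₂)
    (hd : ∀ u v w, B₁ u v → ¬ B₂ u w) :
    circleCount (fun u v => B₁ u v ∨ B₂ u v) = circleCount B₁ + circleCount B₂ := by
  have h := h₁.or h₂ hd
  have hdis : (circPerm B₁).Disjoint (circPerm B₂) := by
    intro x
    by_cases hx : ∃ v, B₁ x v
    · obtain ⟨v, hv⟩ := hx
      exact Or.inr (h₂.circPerm_apply_of_not fun ⟨w, hw⟩ => hd _ _ _ hv hw)
    · exact Or.inl (h₁.circPerm_apply_of_not hx)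
  have hmul : circPerm (fun u v => B₁ u v ∨ B₂ u v) = circPerm B₁ * circPerm B₂ := by
    ext x
    rw [Perm.mul_apply]
    by_cases hx : ∃ v, B₂ x v
    · obtain ⟨v, hv⟩ := hx
      rw [h.circPerm_apply (Or.inr hv), h₂.circPerm_apply hv, h₁.circPerm_apply_of_not]
      rintro ⟨w, hw⟩
      obtain ⟨y, hy⟩ := h₂.out_of_in _ _ hv
      exact hd _ _ _ hw hy
    · rw [h₂.circPerm_apply_of_not hx]
      by_cases hx1 : ∃ v, B₁ x v
      · obtain ⟨v, hv⟩ := hx1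
        rw [h.circPerm_apply (Or.inl hv), h₁.circPerm_apply hv]
      · rw [h₁.circPerm_apply_of_not hx1, h.circPerm_apply_of_not]
        rintro ⟨v, hv | hv⟩
        exacts [hx1 ⟨v, hv⟩, hx ⟨v, hv⟩]
  rw [circleCount, hmul, hdis.cycleType_mul, Multiset.card_add]
  rfl

theorem even_of_neg_one_pow_eq {a b : ℕ} (h : (-1 : ℤˣ) ^ a = (-1) ^ b) : Even (a + b) := by
  have h1 : (-1 : ℤˣ) ^ (a + b) = 1 := by rw [pow_add, h, ← pow_add, ← two_mul, pow_mul]; simp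
  by_contra hodd
  rw [Nat.not_even_iff_odd] at hodd
  rw [hodd.neg_one_pow] at h1
  exact absurd h1 (by decide)

/-- If two permutations map `X` to the same set, then exchanging their restrictions to `X` does
not change the product of their signs. -/
theorem sign_mul_sign_exchange (a b a' b' : Perm V) (X : Set V)
    (ha : ∀ x ∈ X, a' x = b x) (ha' : ∀ x ∉ X, a' x = a x)
    (hb : ∀ x ∈ X, b' x = a x) (hb' : ∀ x ∉ X, b' x = b x) :
    sign a' * sign b' = sign a * sign b := by
  have key : b' = b * (a⁻¹ * a')⁻¹ := by
    rw [eq_mul_inv_iff_mul_eq]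
    ext x
    simp only [Perm.mul_apply]
    by_cases hx : x ∈ X
    · rw [ha x hx]
      by_cases hy : a⁻¹ (b x) ∈ X
      · rw [hb _ hy]; simp
      · have h1 := ha' _ hy
        rw [show a (a⁻¹ (b x)) = b x by simp, ← ha x hx] at h1
        have h2 := a'.injective h1
        rw [ha x hx] at h2
        exact absurd hx (by rwa [h2] at hy)
    · rw [ha' x hx, show a⁻¹ (a x) = x by simp, hb' x hx]
  rw [key]
  simp only [Perm.sign_mul, Perm.sign_inv]
  rcases Int.units_eq_one_or (sign a) with h | h <;>
    rcases Int.units_eq_one_or (sign b) with h' | h' <;>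
    rcases Int.units_eq_one_or (sign a') with h'' | h'' <;> simp [h, h', h'']

/-- If two unions of circles exchange their outgoing edges at the vertices of a set `X`, then the
parity of the total number of circles does not change. -/
theorem even_circleCount_exchange {B₁' B₂' : V → V → Prop} (h₁ : IsCirculation B₁)
    (h₂ : IsCirculation B₂) (h₁' : IsCirculation B₁') (h₂' : IsCirculation B₂') (X : Set V)
    (hX : ∀ u ∈ X, ∀ v, (B₁' u v ↔ B₂ u v) ∧ (B₂' u v ↔ B₁ u v))
    (hX' : ∀ u ∉ X, ∀ v, (B₁' u v ↔ B₁ u v) ∧ (B₂' u v ↔ B₂ u v)) :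
    Even (circleCount B₁' + circleCount B₂' + (circleCount B₁ + circleCount B₂)) := by
  classical
  have step : ∀ {C C' : V → V → Prop} (hC : IsCirculation C) (hC' : IsCirculation C') (u : V),
      (∀ v, C u v ↔ C' u v) → circPerm C u = circPerm C' u := by
    intro C C' hC hC' u huv
    by_cases hu : ∃ v, C u v
    · obtain ⟨v, hv⟩ := hu
      rw [hC.circPerm_apply hv, hC'.circPerm_apply ((huv v).1 hv)]
    · rw [hC.circPerm_apply_of_not hu, hC'.circPerm_apply_of_not fun ⟨v, hv⟩ =>
        hu ⟨v, (huv v).2 hv⟩]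
  have hs := sign_mul_sign_exchange (circPerm B₁) (circPerm B₂) (circPerm B₁') (circPerm B₂') X
    (fun u hu => step h₁' h₂ u fun v => (hX u hu v).1)
    (fun u hu => step h₁' h₁ u fun v => (hX' u hu v).1)
    (fun u hu => step h₂' h₁ u fun v => (hX u hu v).2)
    (fun u hu => step h₂' h₂ u fun v => (hX' u hu v).2)
  -- The support of `circPerm` consists of the sources, which the exchange permutes.
  have hcard : (circPerm B₁').support.card + (circPerm B₂').support.card =
      (circPerm B₁).support.card + (circPerm B₂).support.card := by
    have e : ∀ (C : V → V → Prop), IsCirculation C →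
        (circPerm C).support.card = ∑ u : V, if ∃ v, C u v then 1 else 0 := by
      intro C hC
      rw [Finset.sum_boole, Nat.cast_id]
      congr 1
      ext u
      simp [hC.mem_support]
    rw [e _ h₁, e _ h₂, e _ h₁', e _ h₂', ← Finset.sum_add_distrib, ← Finset.sum_add_distrib]
    refine Finset.sum_congr rfl fun u _ => ?_
    by_cases hu : u ∈ X
    · simp only [(hX u hu _).1, (hX u hu _).2, add_comm]
    · simp only [(hX' u hu _).1, (hX' u hu _).2]
  simp only [sign_circPerm, ← pow_add] at hs
  have h := even_of_neg_one_pow_eq hs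
  have h2 : Even (2 * ((circPerm B₁).support.card + (circPerm B₂).support.card)) := even_two_mul _
  have h3 : circleCount B₁' + circleCount B₂' + (circleCount B₁ + circleCount B₂) +
    2 * ((circPerm B₁).support.card + (circPerm B₂).support.card) =
    (circPerm B₁').support.card + circleCount B₁' +
        ((circPerm B₂').support.card + circleCount B₂') +
      ((circPerm B₁).support.card + circleCount B₁ +
        ((circPerm B₂).support.card + circleCount B₂)) := by omega
  rw [← h3, Nat.even_add] at h
  exact h.2 h2

end Circulation

/-! ### Two-regular subgraphs of the links -/

namespace LinkGraph

variable {L : Type*} {G : SimpleGraph L}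

theorem eq_or_eq_of_deg_eq_two {x y z : L} (hd : deg G y = 2) (hx : G.Adj y x) (hz : G.Adj y z)
    (hxz : x ≠ z) {w : L} (hw : G.Adj y w) : w = x ∨ w = z := by
  obtain ⟨a, b, hab, h⟩ := Set.ncard_eq_two.1 hd
  have m : ∀ t, G.Adj y t → t = a ∨ t = b := fun t ht => by
    have : t ∈ G.neighborSet y := ht
    rwa [h] at this
  rcases m x hx with rfl | rfl <;> rcases m z hz with rfl | rfl <;>
    rcases m w hw with rfl | rfl <;> simp_all

/-- A property of directed edges that is passed on at vertices of degree two is passed on from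
the first to the last edge of an arc. -/
theorem propagate_aux (Q : L → L → Prop)
    (hQ : ∀ x y z, G.Adj x y → G.Adj y z → x ≠ z → deg G y = 2 → Q x y → Q y z)
    {x b : L} (p : G.Walk x b) : ∀ w, G.Adj w x → w ∉ p.support → p.IsPath →
      (∀ y ∈ p.support, y ≠ b → deg G y = 2) → Q w x → ∃ y, G.Adj y b ∧ Q y b := by
  induction p with
  | nil => exact fun w hw _ _ _ hq => ⟨w, hw, hq⟩
  | @cons x z b h p ih =>
    intro w hw hws hp hd hq
    rw [SimpleGraph.Walk.cons_isPath_iff] at hp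
    rw [SimpleGraph.Walk.support_cons, List.mem_cons, not_or] at hws
    have hxb : x ≠ b := fun e => hp.2 (e ▸ p.end_mem_support)
    refine ih x h hp.2 hp.1 (fun y hy hyb => hd y ?_ hyb) (hQ w x z hw h ?_ ?_ hq)
    · exact List.mem_cons_of_mem _ hy
    · rintro rfl
      exact hws.2 p.start_mem_support
    · exact hd x (by simp) hxb

theorem IsArc.propagate {a b x : L} {h : G.Adj a x} {p : G.Walk x b}
    (hp : IsArc (SimpleGraph.Walk.cons h p)) (Q : L → L → Prop)
    (hQ : ∀ x y z, G.Adj x y → G.Adj y z → x ≠ z → deg G y = 2 → Q x y → Q y z)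
    (hq : Q a x) : ∃ y, G.Adj y b ∧ Q y b := by
  have h1 := hp.1
  rw [SimpleGraph.Walk.cons_isPath_iff] at h1
  refine propagate_aux Q hQ p a h h1.2 h1.1 (fun y hy hyb => hp.2 y ?_ ?_ hyb) hq
  · exact List.mem_cons_of_mem _ hy
  · rintro rfl
    exact h1.2 hy

theorem end_unique_aux {x b : L} (p : G.Walk x b) : ∀ (b' : L) (p' : G.Walk x b') (w : L),
    G.Adj x w → w ∉ p.support → w ∉ p'.support → p.IsPath → p'.IsPath →
    (∀ y ∈ p.support, y ≠ b → deg G y = 2) → (∀ y ∈ p'.support, y ≠ b' → deg G y = 2) →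
    deg G b ≠ 2 → deg G b' ≠ 2 → b = b' := by
  induction p with
  | @nil x =>
    intro b' p' w _ _ _ _ _ _ h2 h3 _
    by_contra hne
    exact h3 (h2 x p'.start_mem_support hne)
  | @cons x z b h p ih =>
    intro b' p' w hw hws hws' hp hp' hd hd' hb hb'
    rw [SimpleGraph.Walk.cons_isPath_iff] at hp
    rw [SimpleGraph.Walk.support_cons, List.mem_cons, not_or] at hws
    have hxb : x ≠ b := fun e => hp.2 (e ▸ p.end_mem_support)
    have hdx : deg G x = 2 := hd x (by simp) hxb
    cases p' with
    | nil => exact absurd hdx hb'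
    | @cons _ z' _ h' p' =>
      rw [SimpleGraph.Walk.cons_isPath_iff] at hp'
      rw [SimpleGraph.Walk.support_cons, List.mem_cons, not_or] at hws'
      have hzw : z ≠ w := by
        rintro rfl
        exact hws.2 p.start_mem_support
      have hzw' : z' ≠ w := by
        rintro rfl
        exact hws'.2 p'.start_mem_support
      have hz : z' = z := (eq_or_eq_of_deg_eq_two hdx hw h hzw.symm h').resolve_left hzw'
      subst hz
      refine ih b' p' x h.symm hp.2 hp'.2 hp.1 hp'.1 (fun y hy => hd y ?_) (fun y hy => hd' y ?_)
        hb hb'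
      · exact List.mem_cons_of_mem _ hy
      · exact List.mem_cons_of_mem _ hy

/-- Two arcs that begin with the same edge and end at vertices of degree other than two have the
same end. -/
theorem IsArc.end_unique {a x b b' : L} {h : G.Adj a x} {p : G.Walk x b} {p' : G.Walk x b'}
    (hp : IsArc (SimpleGraph.Walk.cons h p)) (hp' : IsArc (SimpleGraph.Walk.cons h p'))
    (hb : deg G b ≠ 2) (hb' : deg G b' ≠ 2) : b = b' := by
  have h1 := hp.1
  have h1' := hp'.1
  rw [SimpleGraph.Walk.cons_isPath_iff] at h1 h1'
  refine end_unique_aux p b' p' a h.symm h1.2 h1'.2 h1.1 h1'.1 (fun y hy hyb => hp.2 y ?_ ?_ hyb)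
    (fun y hy hyb => hp'.2 y ?_ ?_ hyb) hb hb'
  · exact List.mem_cons_of_mem _ hy
  · rintro rfl
    exact h1.2 hy
  · exact List.mem_cons_of_mem _ hy
  · rintro rfl
    exact h1'.2 hy

theorem IsArc.reverse {a b : L} {p : G.Walk a b} (hp : IsArc p) : IsArc p.reverse := by
  refine ⟨hp.1.reverse, fun x hx hb ha => hp.2 x ?_ ha hb⟩
  simpa using hx

variable (G) in
/-- The three possible links of a vertex of a foam. -/
def IsFoamLink : Prop := IsCircle G ∨ IsTheta G ∨ IsTetrahedral G

/-- Any two trivalent vertices of a foam link are joined by an arc. -/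
theorem IsFoamLink.exists_arc (hG : IsFoamLink G) {x y : L} (hx : deg G x = 3)
    (hy : deg G y = 3) (hxy : x ≠ y) : ∃ p : G.Walk x y, IsArc p := by
  rcases hG with hG | ⟨_, a, b, _, ha, _, h2, harc⟩ | ⟨_, q, _, _, h2, harc⟩
  · have := hG.2 x
    omega
  · have hm : ∀ z, deg G z = 3 → z = a ∨ z = b := by
      intro z hz
      by_contra h
      rw [not_or] at h
      have := h2 z h.1 h.2
      omega
    have hab : ∃ p : G.Walk a b, IsArc p := by
      have hne : (G.neighborSet a).Nonempty := by
        apply Set.nonempty_of_ncard_ne_zero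
        change deg G a ≠ 0
        omega
      obtain ⟨t, ht⟩ := hne
      obtain ⟨p, hp, _⟩ := harc t ht
      exact ⟨p, hp⟩
    obtain ⟨p, hp⟩ := hab
    rcases hm x hx with rfl | rfl <;> rcases hm y hy with rfl | rfl
    · exact absurd rfl hxy
    · exact ⟨p, hp⟩
    · exact ⟨p.reverse, hp.reverse⟩
    · exact absurd rfl hxy
  · have hm : ∀ z, deg G z = 3 → z ∈ Set.range q := by
      intro z hz
      by_contra h
      have := h2 z h
      omega
    obtain ⟨m, rfl⟩ := hm x hx
    obtain ⟨n, rfl⟩ := hm y hy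
    exact harc m n fun h => hxy (by rw [h])

variable (G) in
/-- A set of edges (as a symmetric relation) that meets every vertex in none or in two edges. -/
structure IsTwoRegular (H : L → L → Prop) : Prop where
  symm : ∀ x y, H x y → H y x
  adj : ∀ x y, H x y → G.Adj x y
  two : ∀ x y, H x y → ∃ z, z ≠ y ∧ H x z ∧ ∀ w, H x w → w = y ∨ w = z

namespace IsTwoRegular

variable {H K : L → L → Prop}

theorem of_deg_two (hH : IsTwoRegular G H) {x y z : L} (hxy : H x y) (hd : deg G x = 2)
    (hz : G.Adj x z) : H x z := by
  obtain ⟨t, hty, hxt, -⟩ := hH.two x y hxy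
  rcases eq_or_eq_of_deg_eq_two hd (hH.adj _ _ hxy) (hH.adj _ _ hxt) hty.symm hz with rfl | rfl
  exacts [hxy, hxt]

/-- A nonempty two-regular subgraph that avoids the vertices of degree three is everything. -/
theorem all_of_deg_two (hH : IsTwoRegular G H) (hG : G.Connected) {x y : L} (hxy : H x y)
    (hd : ∀ a b, H a b → deg G a = 2) (z : L) : ∃ w, H z w := by
  obtain ⟨p⟩ := hG.preconnected x z
  induction p generalizing y with
  | nil => exact ⟨y, hxy⟩
  | cons h p ih => exact ih (hH.symm _ _ (hH.of_deg_two hxy (hd _ _ hxy) h))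

theorem end_of_arc (hH : IsTwoRegular G H) {a b x : L} {h : G.Adj a x} {p : G.Walk x b}
    (hp : IsArc (SimpleGraph.Walk.cons h p)) (hax : H a x) : ∃ y, H b y := by
  obtain ⟨y, -, hy⟩ := hp.propagate H
    (fun x y z _ hyz _ hd hxy => hH.of_deg_two (hH.symm _ _ hxy) hd hyz) hax
  exact ⟨y, hH.symm _ _ hy⟩

/-- In a tetrahedral link, a nonempty two-regular subgraph misses at most one trivalent vertex. -/
theorem card_missed_le_one (hH : IsTwoRegular G H) (hG : G.Connected) {q : Fin 4 → L}
    (hinj : Function.Injective q) (h3 : ∀ m, deg G (q m) = 3)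
    (h2 : ∀ x, x ∉ Set.range q → deg G x = 2)
    (harc : ∀ m n, m ≠ n → ∃ p : G.Walk (q m) (q n), IsArc p) {x y : L} (hxy : H x y)
    [DecidablePred fun n => ∃ y, H (q n) y] :
    (Finset.univ.filter fun n => ¬ ∃ y, H (q n) y).card ≤ 1 := by
  have hm : ∃ m, ∃ y, H (q m) y := by
    by_contra hno
    refine hno ⟨0, hH.all_of_deg_two hG hxy (fun a b hab => h2 a ?_) _⟩
    rintro ⟨m, rfl⟩
    exact hno ⟨m, b, hab⟩
  -- The vertex `q m` has two neighbours along the subgraph; the arcs to two missed vertices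
  -- would start with two further ones, while the degree is three.
  obtain ⟨m, y, hy⟩ := hm
  obtain ⟨z, hzy, hz, -⟩ := hH.two _ _ hy
  rw [Finset.card_le_one]
  intro n hn n' hn'
  simp only [Finset.mem_filter, Finset.mem_univ, true_and] at hn hn'
  by_contra hnn
  have hmn : m ≠ n := by
    rintro rfl
    exact hn ⟨y, hy⟩
  have hmn' : m ≠ n' := by
    rintro rfl
    exact hn' ⟨y, hy⟩
  obtain ⟨p, hp⟩ := harc m n hmn
  obtain ⟨p', hp'⟩ := harc m n' hmn'
  generalize hqn : q n = b at *
  generalize hqn' : q n' = b' at *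
  have hb : deg G b = 3 := hqn ▸ h3 n
  have hb' : deg G b' = 3 := hqn' ▸ h3 n'
  cases p with
  | nil => exact hn ⟨y, hy⟩
  | @cons _ s _ hs p =>
    cases p' with
    | nil => exact hn' ⟨y, hy⟩
    | @cons _ s' _ hs' p' =>
      have hsH : ¬ H (q m) s := fun h => hn (hH.end_of_arc hp h)
      have hsH' : ¬ H (q m) s' := fun h => hn' (hH.end_of_arc hp' h)
      have hss : s ≠ s' := by
        rintro rfl
        have hbb : b = b' := hp.end_unique hp' (by omega) (by omega)
        exact hnn (hinj (by rw [hqn, hqn', hbb]))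
      have hfin : (G.neighborSet (q m)).Finite := by
        apply Set.finite_of_ncard_ne_zero
        change deg G (q m) ≠ 0
        rw [h3 m]
        omega
      have hsub : ({y, z, s, s'} : Set L) ⊆ G.neighborSet (q m) := by
        rintro t (rfl | rfl | rfl | rfl)
        exacts [hH.adj _ _ hy, hH.adj _ _ hz, hs, hs']
      have hle := Set.ncard_le_ncard hsub hfin
      have hd : (G.neighborSet (q m)).ncard = 3 := h3 m
      have hn1 : y ≠ s := fun e => hsH (e ▸ hy)
      have hn2 : y ≠ s' := fun e => hsH' (e ▸ hy)
      have hn3 : z ≠ s := fun e => hsH (e ▸ hz)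
      have hn4 : z ≠ s' := fun e => hsH' (e ▸ hz)
      rw [hd, Set.ncard_insert_of_notMem (by simp [hzy.symm, hn1, hn2]),
        Set.ncard_insert_of_notMem (by simp [hn3, hn4]), Set.ncard_pair hss] at hle
      omega

/-- Two nonempty two-regular subgraphs of a foam link have a common vertex. -/
theorem exists_common (hG : IsFoamLink G) (hH : IsTwoRegular G H) (hK : IsTwoRegular G K)
    {x y x' y' : L} (hxy : H x y) (hxy' : K x' y') : ∃ z, (∃ w, H z w) ∧ ∃ w, K z w := by
  classical
  rcases hG with hG | ⟨hG, a, b, _, ha, _, h2, harc⟩ | ⟨hG, q, hinj, h3, h2, harc⟩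
  · exact ⟨x', hH.all_of_deg_two hG.1 hxy (fun a _ _ => hG.2 a) x', y', hxy'⟩
  -- In a theta graph both subgraphs contain the trivalent vertex `b`.
  · have key : ∀ {H : L → L → Prop}, IsTwoRegular G H → (∃ x y, H x y) → ∃ w, H b w := by
      rintro H hH ⟨x, y, hxy⟩
      by_contra hb
      have hnoa : ¬ ∃ w, H a w := by
        rintro ⟨w, hw⟩
        obtain ⟨p, hp, he⟩ := harc w (hH.adj _ _ hw)
        cases p with
        | nil => simp at he
        | @cons _ s _ hs p =>
          have hsw : s = w := by
            rw [SimpleGraph.Walk.edges_cons, List.mem_cons] at he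
            rcases he with he | he
            · rcases Sym2.eq_iff.1 he with h | h
              · exact h.2.symm
              · exact absurd h.1 hs.ne
            · have := SimpleGraph.Walk.fst_mem_support_of_mem_edges _ he
              exact absurd this ((SimpleGraph.Walk.cons_isPath_iff _ _).1 hp.1).2
          subst hsw
          exact hb (hH.end_of_arc hp hw)
      refine hb (hH.all_of_deg_two hG hxy (fun u v huv => h2 u ?_ ?_) b)
      · rintro rfl
        exact hnoa ⟨v, huv⟩
      · rintro rfl
        exact hb ⟨v, huv⟩
    exact ⟨b, key hH ⟨x, y, hxy⟩, key hK ⟨x', y', hxy'⟩⟩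
  -- Each subgraph misses at most one of the four trivalent vertices, so some is in both.
  · by_contra hno
    have h1 := hH.card_missed_le_one hG hinj h3 h2 harc hxy
    have h1' := hK.card_missed_le_one hG hinj h3 h2 harc hxy'
    have hun : (Finset.univ : Finset (Fin 4)) ⊆
        (Finset.univ.filter fun n => ¬ ∃ y, H (q n) y) ∪
          (Finset.univ.filter fun n => ¬ ∃ y, K (q n) y) := by
      intro n _
      rw [Finset.mem_union, Finset.mem_filter, Finset.mem_filter]
      by_contra hn
      refine hno ⟨q n, ?_⟩
      simp only [Finset.mem_univ, true_and, not_or, not_not] at hn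
      exact hn
    have h4 := (Finset.card_le_card hun).trans (Finset.card_union_le _ _)
    simp only [Finset.card_univ, Fintype.card_fin] at h4
    omega

/-- A two-regular subgraph of a foam link is connected: otherwise two disjoint parts of it would be
two-regular, contrary to `exists_common`. -/
theorem mem_of_closed (hG : IsFoamLink G) (hH : IsTwoRegular G H) (X : Set L)
    (hX : ∀ x y, H x y → (x ∈ X ↔ y ∈ X)) {x y : L} (hxy : H x y) (hx : x ∈ X) {z w : L}
    (hzw : H z w) : z ∈ X := by
  by_contra hz
  have h1 : IsTwoRegular G fun a b => H a b ∧ a ∈ X :=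
    { symm := fun a b h => ⟨hH.symm _ _ h.1, (hX _ _ h.1).1 h.2⟩
      adj := fun a b h => hH.adj _ _ h.1
      two := fun a b h => by
        obtain ⟨t, h1, h2, h3⟩ := hH.two _ _ h.1
        exact ⟨t, h1, ⟨h2, h.2⟩, fun w hw => h3 w hw.1⟩ }
  have h2 : IsTwoRegular G fun a b => H a b ∧ a ∉ X :=
    { symm := fun a b h => ⟨hH.symm _ _ h.1, fun hb => h.2 ((hX _ _ h.1).2 hb)⟩
      adj := fun a b h => hH.adj _ _ h.1
      two := fun a b h => by
        obtain ⟨t, h1, h2, h3⟩ := hH.two _ _ h.1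
        exact ⟨t, h1, ⟨h2, h.2⟩, fun w hw => h3 w hw.1⟩ }
  obtain ⟨t, ⟨_, h3⟩, ⟨_, h4⟩⟩ := exists_common hG h1 h2 ⟨hxy, hx⟩ ⟨hzw, hz⟩
  exact h4.2 h3.2

end IsTwoRegular

end LinkGraph

/-! ### The parity of the Euler characteristic of an oriented surface -/

section EulerParity

open Equiv Equiv.Perm

theorem sameCycle_invariant {V A : Type*} {π : Perm V} {f : V → A} (hf : ∀ x, f (π x) = f x)
    {x y : V} (h : π.SameCycle x y) : f x = f y := by
  obtain ⟨n, rfl⟩ := h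
  have hinv : ∀ x, f (π⁻¹ x) = f x := fun x => by
    rw [← hf (π⁻¹ x)]
    simp
  induction n with
  | zero => simp
  | succ n ih => rw [add_comm, zpow_add, zpow_one, Perm.mul_apply, hf, ih]
  | pred n ih => rw [sub_eq_add_neg, add_comm, zpow_add, zpow_neg_one, Perm.mul_apply, hinv, ih]

/-- An oriented triangulated surface, possibly with boundary, as a set of positively ordered
triangles: `O u v w` says that the vertices `u, v, w`, in this order, form a triangle of the
surface and give it its orientation. No edge is induced twice with the same direction. -/
structure IsOrientedSurface {V : Type*} (O : V → V → V → Prop) : Prop where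
  ne : ∀ u v w, O u v w → u ≠ v
  rot : ∀ u v w, O u v w → O v w u
  uniq : ∀ u v w w', O u v w → O u v w' → w = w'
  anti : ∀ u v w, O u v w → ¬ O v u w

/-- The directed edge `u v` is induced by a triangle of the surface. -/
def IsDart {V : Type*} (O : V → V → V → Prop) (u v : V) : Prop := ∃ w, O u v w

variable {V : Type*} {O : V → V → V → Prop}

theorem IsOrientedSurface.eq_or_of_triangle_eq [DecidableEq V] (hO : IsOrientedSurface O)
    {u v w u' v' w' : V}
    (h : O u v w) (h' : O u' v' w') (he : ({u, v, w} : Finset V) = {u', v', w'}) :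
    (u' = u ∧ v' = v ∧ w' = w) ∨ (u' = v ∧ v' = w ∧ w' = u) ∨ (u' = w ∧ v' = u ∧ w' = v) := by
  have hr := hO.rot _ _ _ h
  have hrr := hO.rot _ _ _ hr
  have hr' := hO.rot _ _ _ h'
  have hrr' := hO.rot _ _ _ hr'
  have n1 := hO.ne _ _ _ h'
  have n2 := hO.ne _ _ _ hr'
  have n3 := hO.ne _ _ _ hrr'
  have mu : u' ∈ ({u, v, w} : Finset V) := by rw [he]; simp
  have mv : v' ∈ ({u, v, w} : Finset V) := by rw [he]; simp
  have mw : w' ∈ ({u, v, w} : Finset V) := by rw [he]; simp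
  have a1 := hO.anti _ _ _ h
  have a2 := hO.anti _ _ _ hr
  have a3 := hO.anti _ _ _ hrr
  simp only [Finset.mem_insert, Finset.mem_singleton] at mu mv mw
  rcases mu with rfl | rfl | rfl <;> rcases mv with rfl | rfl | rfl <;>
    rcases mw with rfl | rfl | rfl <;> first | contradiction | simp

variable (O) in
/-- The directed edges of a surface, with both directions. -/
abbrev SurfaceDart : Type _ := {p : V × V // IsDart O p.1 p.2 ∨ IsDart O p.2 p.1}

namespace SurfaceDart

/-- Reversal of directed edges. -/
def rev : Perm (SurfaceDart O) where
  toFun p := ⟨(p.1.2, p.1.1), p.2.symm⟩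
  invFun p := ⟨(p.1.2, p.1.1), p.2.symm⟩
  left_inv _ := rfl
  right_inv _ := rfl

/-- One step along the boundary of the face to which a directed edge belongs. The faces are the
triangles of the surface and the discs that fill the boundary circles `B`. -/
def IsNext (O : V → V → V → Prop) (B : V → V → Prop) (p q : SurfaceDart O) : Prop :=
  q.1.1 = p.1.2 ∧ (O p.1.1 p.1.2 q.1.2 ∨ (B q.1.2 q.1.1 ∧ B p.1.2 p.1.1))

variable {B : V → V → Prop}

theorem exists_isNext (hO : IsOrientedSurface O) (hB : IsCirculation B)
    (hBO : ∀ u v, B u v ↔ IsDart O u v ∧ ¬ IsDart O v u) (p : SurfaceDart O) :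
    ∃ q, IsNext O B p q := by
  obtain ⟨⟨u, v⟩, hp⟩ := p
  by_cases h : IsDart O u v
  · obtain ⟨w, hw⟩ := h
    exact ⟨⟨(v, w), Or.inl ⟨u, hO.rot _ _ _ hw⟩⟩, rfl, Or.inl hw⟩
  · have hvu : B v u := (hBO v u).2 ⟨hp.resolve_left h, h⟩
    obtain ⟨x, hx⟩ := hB.in_of_out _ _ hvu
    exact ⟨⟨(v, x), Or.inr ((hBO x v).1 hx).1⟩, rfl, Or.inr ⟨hx, hvu⟩⟩

theorem isNext_injective (hO : IsOrientedSurface O) (hB : IsCirculation B)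
    (hBO : ∀ u v, B u v ↔ IsDart O u v ∧ ¬ IsDart O v u) {p p' q : SurfaceDart O}
    (h : IsNext O B p q) (h' : IsNext O B p' q) : p = p' := by
  obtain ⟨⟨u, v⟩, hp⟩ := p
  obtain ⟨⟨u', v'⟩, hp'⟩ := p'
  obtain ⟨⟨x, y⟩, hq⟩ := q
  obtain ⟨h1, h2⟩ := h
  obtain ⟨h1', h2'⟩ := h'
  simp only at h1 h1' h2 h2'
  subst h1 h1'
  have huu : u = u' := by
    rcases h2 with h | ⟨ha, hb⟩ <;> rcases h2' with h' | ⟨ha', hb'⟩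
    · exact hO.uniq _ _ _ _ (hO.rot _ _ _ h) (hO.rot _ _ _ h')
    · exact absurd ⟨u, hO.rot _ _ _ h⟩ ((hBO _ _).1 ha').2
    · exact absurd ⟨u', hO.rot _ _ _ h'⟩ ((hBO _ _).1 ha).2
    · exact hB.out_unique _ _ _ hb hb'
  subst huu
  rfl

theorem isNext_unique (hO : IsOrientedSurface O) (hB : IsCirculation B)
    (hBO : ∀ u v, B u v ↔ IsDart O u v ∧ ¬ IsDart O v u) {p q q' : SurfaceDart O}
    (h : IsNext O B p q) (h' : IsNext O B p q') : q = q' := by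
  obtain ⟨⟨u, v⟩, hp⟩ := p
  obtain ⟨⟨x', y'⟩, hq'⟩ := q'
  obtain ⟨⟨x, y⟩, hq⟩ := q
  obtain ⟨h1, h2⟩ := h
  obtain ⟨h1', h2'⟩ := h'
  simp only at h1 h1' h2 h2'
  subst h1 h1'
  have hyy : y = y' := by
    rcases h2 with h | ⟨ha, hb⟩ <;> rcases h2' with h' | ⟨ha', hb'⟩
    · exact hO.uniq _ _ _ _ h h'
    · exact absurd ⟨y, h⟩ ((hBO _ _).1 hb').2
    · exact absurd ⟨y', h'⟩ ((hBO _ _).1 hb).2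
    · exact hB.in_unique _ _ _ ha ha'
  subst hyy
  rfl

/-- The permutation of the directed edges whose cycles are the faces. -/
def next [Finite V] (hO : IsOrientedSurface O) (hB : IsCirculation B)
    (hBO : ∀ u v, B u v ↔ IsDart O u v ∧ ¬ IsDart O v u) : Perm (SurfaceDart O) :=
  Equiv.ofBijective (fun p => (exists_isNext hO hB hBO p).choose) <| by
    refine Finite.injective_iff_bijective.1 fun p p' h => ?_
    have h1 := (exists_isNext hO hB hBO p).choose_spec
    have h2 := (exists_isNext hO hB hBO p').choose_spec
    change (exists_isNext hO hB hBO p).choose = (exists_isNext hO hB hBO p').choose at h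
    rw [← h] at h2
    exact isNext_injective hO hB hBO h1 h2

theorem isNext_next [Finite V] (hO : IsOrientedSurface O) (hB : IsCirculation B)
    (hBO : ∀ u v, B u v ↔ IsDart O u v ∧ ¬ IsDart O v u) (p : SurfaceDart O) :
    IsNext O B p (next hO hB hBO p) :=
  (exists_isNext hO hB hBO p).choose_spec

theorem next_eq [Finite V] (hO : IsOrientedSurface O) (hB : IsCirculation B)
    (hBO : ∀ u v, B u v ↔ IsDart O u v ∧ ¬ IsDart O v u) {p q : SurfaceDart O}
    (h : IsNext O B p q) : next hO hB hBO p = q :=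
  isNext_unique hO hB hBO (isNext_next hO hB hBO p) h

theorem ne (hO : IsOrientedSurface O) (p : SurfaceDart O) : p.1.1 ≠ p.1.2 := by
  obtain ⟨⟨u, v⟩, ⟨w, h⟩ | ⟨w, h⟩⟩ := p
  · exact hO.ne _ _ _ h
  · exact (hO.ne _ _ _ h).symm

end SurfaceDart

variable (O) in
/-- The edges of a surface. -/
def surfaceEdges [DecidableEq V] : Set (Finset V) := {e | ∃ u v, IsDart O u v ∧ e = {u, v}}

variable (O) in
/-- The triangles of a surface. -/
def surfaceTriangles [DecidableEq V] : Set (Finset V) := {t | ∃ u v w, O u v w ∧ t = {u, v, w}}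

variable (O) in
/-- The vertices of a surface. -/
def surfaceVertices : Set V := {v | ∃ x y, O v x y}

open SurfaceDart

variable [Fintype V] [DecidableEq V] {B : V → V → Prop}

omit [Fintype V] in
open scoped Classical in
/-- The cycles of `rev` are the edges. -/
theorem card_cycles_rev [Fintype (SurfaceDart O)] (hO : IsOrientedSurface O) :
    Multiset.card (rev (O := O)).cycleType = (surfaceEdges O).ncard ∧
      (rev (O := O)).support = Finset.univ := by
  have hsup : (rev (O := O)).support = Finset.univ := by
    ext p
    simp only [Perm.mem_support, Finset.mem_univ, iff_true]
    intro h
    exact p.ne hO (congrArg (fun q : SurfaceDart O => q.1.2) h)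
  refine ⟨?_, hsup⟩
  rw [card_cycleType_eq_ncard_image _ fun p : SurfaceDart O => ({p.1.1, p.1.2} : Finset V)]
  · congr 1
    ext e
    simp only [hsup, Finset.coe_univ, Set.image_univ, Set.mem_range, surfaceEdges, Set.mem_ofPred_eq]
    constructor
    · rintro ⟨⟨⟨u, v⟩, h | h⟩, rfl⟩
      · exact ⟨u, v, h, rfl⟩
      · exact ⟨v, u, h, Finset.pair_comm _ _⟩
    · rintro ⟨u, v, h, rfl⟩
      exact ⟨⟨(u, v), Or.inl h⟩, rfl⟩
  · intro p _ q _
    constructor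
    · intro h
      have hpq : p.1 = q.1 ∨ (p.1.2, p.1.1) = q.1 := by
        have n1 := p.ne hO
        have n2 := q.ne hO
        have m1 : q.1.1 ∈ ({p.1.1, p.1.2} : Finset V) := by rw [h]; simp
        have m2 : q.1.2 ∈ ({p.1.1, p.1.2} : Finset V) := by rw [h]; simp
        simp only [Finset.mem_insert, Finset.mem_singleton] at m1 m2
        rcases m1 with m1 | m1 <;> rcases m2 with m2 | m2
        · exact absurd (m1.trans m2.symm) n2
        · exact Or.inl (Prod.ext m1.symm m2.symm)
        · exact Or.inr (Prod.ext m1.symm m2.symm)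
        · exact absurd (m1.trans m2.symm) n2
      rcases hpq with hpq | hpq
      · rw [Subtype.ext hpq]
      · have : q = rev p := Subtype.ext hpq.symm
        rw [this]
        exact (SameCycle.refl _ _).apply_right
    · refine sameCycle_invariant (f := fun p : SurfaceDart O => ({p.1.1, p.1.2} : Finset V))
        fun p => ?_
      exact Finset.pair_comm _ _

open scoped Classical in
/-- The cycles of `next` are the triangles and the discs that fill the boundary circles. -/
theorem card_cycles_next [Fintype (SurfaceDart O)] (hO : IsOrientedSurface O)
    (hB : IsCirculation B) (hBO : ∀ u v, B u v ↔ IsDart O u v ∧ ¬ IsDart O v u) :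
    Multiset.card (next hO hB hBO).cycleType = (surfaceTriangles O).ncard + circleCount B ∧
      (next hO hB hBO).support = Finset.univ := by
  set φ := next hO hB hBO with hφ
  have hsup : φ.support = Finset.univ := by
    ext p
    simp only [Perm.mem_support, Finset.mem_univ, iff_true]
    intro h
    have h1 := (isNext_next hO hB hBO p).1
    rw [← hφ, h] at h1
    exact p.ne hO h1
  refine ⟨?_, hsup⟩
  -- `f p` is the face along `p`: a triangle, or else a boundary circle, as a cycle of `circPerm B`.
  let f : SurfaceDart O → Finset V ⊕ Perm V := fun p =>
    if h : IsDart O p.1.1 p.1.2 then Sum.inl {p.1.1, p.1.2, h.choose}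
    else Sum.inr ((circPerm B).cycleOf p.1.2)
  have f1 : ∀ (p : SurfaceDart O) (w : V), O p.1.1 p.1.2 w → f p = Sum.inl {p.1.1, p.1.2, w} := by
    intro p w hw
    have h : IsDart O p.1.1 p.1.2 := ⟨w, hw⟩
    have : h.choose = w := hO.uniq _ _ _ _ h.choose_spec hw
    simp only [f, dif_pos h, this]
  have f2 : ∀ p : SurfaceDart O, B p.1.2 p.1.1 → f p = Sum.inr ((circPerm B).cycleOf p.1.2) := by
    intro p hp
    have h : ¬ IsDart O p.1.1 p.1.2 := ((hBO _ _).1 hp).2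
    simp only [f, dif_neg h]
  have hcases : ∀ p : SurfaceDart O, (∃ w, O p.1.1 p.1.2 w) ∨ B p.1.2 p.1.1 := by
    intro p
    by_cases h : IsDart O p.1.1 p.1.2
    · exact Or.inl h
    · exact Or.inr ((hBO _ _).2 ⟨p.2.resolve_left h, h⟩)
  have hinv : ∀ p, f (φ p) = f p := by
    intro p
    obtain ⟨h1, h | ⟨h2, h3⟩⟩ := isNext_next hO hB hBO p
    · rw [f1 p _ h]
      have h' := hO.rot _ _ _ h
      rw [← h1] at h'
      rw [← hφ] at h1 h'
      rw [f1 (φ p) _ h', h1]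
      congr 1
      ext x
      simp only [Finset.mem_insert, Finset.mem_singleton]
      tauto
    · rw [f2 p h3]
      rw [← hφ] at h1 h2
      have h4 := h2
      rw [h1] at h2
      have hd : B (φ p).1.2 (φ p).1.1 := h4
      rw [f2 _ hd]
      congr 1
      apply SameCycle.cycleOf_eq
      have : (circPerm B) (φ p).1.2 = p.1.2 := hB.circPerm_apply h2
      rw [← this]
      exact (SameCycle.refl _ _).apply_right
  have hsame : ∀ p q, f p = f q → φ.SameCycle p q := by
    intro p q hpq
    rcases hcases p with ⟨w, hp⟩ | hp <;> rcases hcases q with ⟨w', hq⟩ | hq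
    · rw [f1 p _ hp, f1 q _ hq, Sum.inl.injEq] at hpq
      have s1 : φ p = ⟨(p.1.2, w), Or.inl ⟨_, hO.rot _ _ _ hp⟩⟩ :=
        next_eq hO hB hBO ⟨rfl, Or.inl hp⟩
      have s2 : φ (φ p) = ⟨(w, p.1.1), Or.inl ⟨_, hO.rot _ _ _ (hO.rot _ _ _ hp)⟩⟩ := by
        rw [s1]
        exact next_eq hO hB hBO ⟨rfl, Or.inl (hO.rot _ _ _ hp)⟩
      rcases hO.eq_or_of_triangle_eq hp hq hpq with ⟨h1, h2, -⟩ | ⟨h1, h2, -⟩ | ⟨h1, h2, -⟩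
      · have : q = p := Subtype.ext (Prod.ext h1 h2)
        rw [this]
      · have : q = φ p := by rw [s1]; exact Subtype.ext (Prod.ext h1 h2)
        rw [this]
        exact (SameCycle.refl _ _).apply_right
      · have : q = φ (φ p) := by rw [s2]; exact Subtype.ext (Prod.ext h1 h2)
        rw [this]
        exact (SameCycle.refl _ _).apply_right.apply_right
    · rw [f1 p _ hp, f2 q hq] at hpq
      exact absurd hpq (by simp)
    · rw [f2 p hp, f1 q _ hq] at hpq
      exact absurd hpq (by simp)
    · rw [f2 p hp, f2 q hq, Sum.inr.injEq] at hpq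
      have hs : (circPerm B).SameCycle p.1.2 q.1.2 :=
        (sameCycle_iff_cycleOf_eq_of_mem_support (hB.mem_support.2 ⟨_, hp⟩)
          (hB.mem_support.2 ⟨_, hq⟩)).2 hpq
      obtain ⟨n, hn⟩ := hs.exists_nat_pow_eq
      have key : ∀ (n : ℕ) (r : SurfaceDart O), B r.1.2 r.1.1 →
          ((circPerm B) ^ n) p.1.2 = r.1.2 → φ.SameCycle p r := by
        intro n
        induction n with
        | zero =>
          intro r hr hn
          have h2 : p.1.2 = r.1.2 := by simpa using hn
          have h1 : p.1.1 = r.1.1 := by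
            rw [h2] at hp
            exact hB.out_unique _ _ _ hp hr
          have : p = r := Subtype.ext (Prod.ext h1 h2)
          rw [this]
        | succ n ih =>
          intro r hr hn
          have hnr : IsNext O B r (φ r) := isNext_next hO hB hBO r
          obtain ⟨e1, h | ⟨e2, -⟩⟩ := hnr
          · exact absurd ⟨_, h⟩ ((hBO _ _).1 hr).2
          · have e3 : circPerm B (φ r).1.2 = r.1.2 := by rw [hB.circPerm_apply e2, e1]
            have e4 := ih (φ r) e2 (by
              rw [pow_succ', Perm.mul_apply, ← e3] at hn
              exact (circPerm B).injective hn)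
            exact (sameCycle_apply_right.1 e4)
      exact key n q hq hn
  rw [card_cycleType_eq_ncard_image φ f fun p _ q _ => ⟨hsame p q, sameCycle_invariant hinv⟩]
  have himg : f '' (φ.support : Set (SurfaceDart O)) = Sum.inl '' (surfaceTriangles O) ∪
      Sum.inr '' ((circPerm B).cycleOf '' ((circPerm B).support : Set V)) := by
    rw [hsup, Finset.coe_univ, Set.image_univ]
    ext x
    simp only [Set.mem_range, Set.mem_union, Set.mem_image, Finset.mem_coe]
    constructor
    · rintro ⟨p, rfl⟩
      rcases hcases p with ⟨w, hp⟩ | hp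
      · exact Or.inl ⟨_, ⟨_, _, _, hp, rfl⟩, (f1 p _ hp).symm⟩
      · exact Or.inr ⟨_, ⟨p.1.2, hB.mem_support.2 ⟨_, hp⟩, rfl⟩, (f2 p hp).symm⟩
    · rintro (⟨t, ⟨u, v, w, h, rfl⟩, rfl⟩ | ⟨c, ⟨v, hv, rfl⟩, rfl⟩)
      · exact ⟨⟨(u, v), Or.inl ⟨w, h⟩⟩, f1 _ _ h⟩
      · obtain ⟨w, hw⟩ := hB.mem_support.1 hv
        exact ⟨⟨(w, v), Or.inr ((hBO _ _).1 hw).1⟩, f2 _ hw⟩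
  rw [himg, Set.ncard_union_eq _ (Set.toFinite _) (Set.toFinite _),
    Set.ncard_image_of_injective _ Sum.inl_injective,
    Set.ncard_image_of_injective _ Sum.inr_injective, circleCount,
    card_cycleType_eq_ncard_image (circPerm B) (circPerm B).cycleOf]
  · intro x hx y hy
    exact (sameCycle_iff_cycleOf_eq_of_mem_support hx hy).symm
  · rw [Set.disjoint_left]
    rintro x ⟨a, -, rfl⟩ ⟨b, -, hb⟩
    exact absurd hb (by simp)

open scoped Classical in
/-- The parity of the Euler characteristic of an oriented surface whose boundary circles are
`B` and in which the link of every vertex is connected (a circle, or an arc at the boundary):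
it is the parity of the number of boundary circles. The discs that fill the boundary circles turn
the surface into a combinatorial map, i.e. into permutations of its directed edges whose cycles
are the vertices, the edges and the faces, and the product of these permutations is trivial;
compare the signs. -/
theorem IsOrientedSurface.even_euler (hO : IsOrientedSurface O)
    (hB : IsCirculation B) (hBO : ∀ u v, B u v ↔ IsDart O u v ∧ ¬ IsDart O v u)
    (hconn : ∀ (v : V) (X : Set V), (∀ x y, O v x y → (x ∈ X ↔ y ∈ X)) →
      (∀ x y, B x v → B v y → (x ∈ X ↔ y ∈ X)) →
      ∀ x y, (IsDart O v x ∨ IsDart O x v) → (IsDart O v y ∨ IsDart O y v) → x ∈ X → y ∈ X) :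
    Even ((surfaceVertices O).ncard + (surfaceEdges O).ncard + (surfaceTriangles O).ncard +
      circleCount B) := by
  have : Fintype (SurfaceDart O) := Fintype.ofFinite _
  set φ := next hO hB hBO with hφ
  set τ : Perm (SurfaceDart O) := φ * rev with hτ
  -- `τ` turns a directed edge around its source, past one triangle or one filling disc.
  have hτ1 : ∀ p, (τ p).1.1 = p.1.1 := fun p => (isNext_next hO hB hBO (rev p)).1
  have hsup : τ.support = Finset.univ := by
    ext p
    simp only [Perm.mem_support, Finset.mem_univ, iff_true]
    intro h
    obtain ⟨-, h2 | ⟨h2, h3⟩⟩ := isNext_next hO hB hBO (rev p)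
    · have h4 := hO.rot _ _ _ (hO.rot _ _ _ h2)
      refine hO.ne _ _ _ h4 ?_
      exact congrArg (fun q : SurfaceDart O => q.1.2) h
    · have e1 : (next hO hB hBO (rev p)) = p := h
      rw [e1] at h2
      exact ((hBO _ _).1 h2).2 ((hBO _ _).1 h3).1
  have hcard : Multiset.card τ.cycleType = (surfaceVertices O).ncard := by
    rw [card_cycleType_eq_ncard_image τ fun p : SurfaceDart O => p.1.1]
    · congr 1
      ext v
      simp only [hsup, Finset.coe_univ, Set.image_univ, Set.mem_range, surfaceVertices,
        Set.mem_ofPred_eq]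
      constructor
      · rintro ⟨⟨⟨u, v⟩, ⟨w, h⟩ | ⟨w, h⟩⟩, rfl⟩
        · exact ⟨v, w, h⟩
        · exact ⟨w, v, hO.rot _ _ _ h⟩
      · rintro ⟨x, y, h⟩
        exact ⟨⟨(v, x), Or.inl ⟨y, h⟩⟩, rfl⟩
    · rintro ⟨⟨u, x⟩, hp⟩ - ⟨⟨v, y⟩, hq⟩ -
      constructor
      · intro huv
        simp only at huv
        subst huv
        have := hconn u {z | ∃ h, τ.SameCycle ⟨(u, x), hp⟩ ⟨(u, z), h⟩} ?_ ?_ x y hp hq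
          ⟨hp, SameCycle.refl _ _⟩
        · obtain ⟨h, h'⟩ := this
          exact h'
        · intro a b hab
          have hba := hO.rot _ _ _ (hO.rot _ _ _ hab)
          have ha : IsDart O u a ∨ IsDart O a u := Or.inl ⟨b, hab⟩
          have hb : IsDart O u b ∨ IsDart O b u := Or.inr ⟨a, hba⟩
          have hst : τ ⟨(u, b), hb⟩ = ⟨(u, a), ha⟩ := next_eq hO hB hBO ⟨rfl, Or.inl hba⟩
          constructor
          · rintro ⟨_, h⟩
            rw [← hst, sameCycle_apply_right] at h
            exact ⟨hb, h⟩
          · rintro ⟨_, h⟩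
            refine ⟨ha, ?_⟩
            rw [← hst, sameCycle_apply_right]
            exact h
        · intro a b hau hub
          have ha : IsDart O u a ∨ IsDart O a u := Or.inr ((hBO _ _).1 hau).1
          have hb : IsDart O u b ∨ IsDart O b u := Or.inl ((hBO _ _).1 hub).1
          have hst : τ ⟨(u, b), hb⟩ = ⟨(u, a), ha⟩ :=
            next_eq hO hB hBO ⟨rfl, Or.inr ⟨hau, hub⟩⟩
          constructor
          · rintro ⟨_, h⟩
            rw [← hst, sameCycle_apply_right] at h
            exact ⟨hb, h⟩
          · rintro ⟨_, h⟩
            refine ⟨ha, ?_⟩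
            rw [← hst, sameCycle_apply_right]
            exact h
      · exact sameCycle_invariant (f := fun p : SurfaceDart O => p.1.1) hτ1
  obtain ⟨hc1, hs1⟩ := card_cycles_rev hO
  obtain ⟨hc2, hs2⟩ := card_cycles_next hO hB hBO
  have hsign : sign τ = sign φ * sign (rev (O := O)) := Perm.sign_mul _ _
  rw [sign_eq_neg_one_pow_support_add_cycles, sign_eq_neg_one_pow_support_add_cycles,
    sign_eq_neg_one_pow_support_add_cycles, hsup, hcard, hc1, hs1, hc2, hs2, ← pow_add] at hsign
  have hev := even_of_neg_one_pow_eq hsign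
  have hcev : Even (Finset.univ : Finset (SurfaceDart O)).card := by
    have hpow : (rev (O := O) : SurfaceDart O → SurfaceDart O)^[2 ^ 1] = id := rfl
    have := Equiv.Perm.card_fixedPoints_modEq (p := 2) hpow
    have h0 : Fintype.card (Function.fixedPoints (rev (O := O))) = 0 := by
      rw [Fintype.card_eq_zero_iff]
      refine ⟨fun ⟨p, hp⟩ => ?_⟩
      have : p ∈ (rev (O := O)).support := by rw [hs1]; exact Finset.mem_univ _
      exact Perm.mem_support.1 this hp
    rw [h0] at this
    exact Nat.even_iff.2 this
  rw [Nat.even_iff] at *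
  omega

end EulerParity

/-! ### The Euler characteristic of a connected closed surface is at most two -/

section EulerBound

/-- A matrix whose kernel consists of constant vectors has corank at most one. -/
theorem Matrix.card_le_rank_add_one_of_ker {m n : Type*} [Fintype m] [Fintype n] [DecidableEq n]
    (M : Matrix m n (ZMod 2))
    (h : ∀ x : n → ZMod 2, M.mulVec x = 0 → ∀ i j, x i = x j) :
    Fintype.card n ≤ M.rank + 1 := by
  have h1 := LinearMap.finrank_range_add_finrank_ker M.mulVecLin
  rw [Module.finrank_fintype_fun_eq_card] at h1
  have h2 : Module.finrank (ZMod 2) (LinearMap.ker M.mulVecLin) ≤ 1 := by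
    by_cases hne : ∃ x : n → ZMod 2, M.mulVec x = 0 ∧ x ≠ 0
    · obtain ⟨x, hx, hx0⟩ := hne
      refine finrank_le_one (⟨x, hx⟩ : LinearMap.ker M.mulVecLin) ?_
      rintro ⟨y, hy⟩
      obtain ⟨i, hi⟩ := Function.ne_iff.1 hx0
      refine ⟨y i, Subtype.ext (funext fun j => ?_)⟩
      have hxi : x i = 1 := by
        have : ∀ a : ZMod 2, a ≠ 0 → a = 1 := by decide
        exact this _ hi
      change y i * x j = y j
      rw [h x hx j i, hxi, mul_one]
      exact h y hy i j
    · have : LinearMap.ker M.mulVecLin = ⊥ := by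
        rw [LinearMap.ker_eq_bot']
        intro x hx
        by_contra h0
        exact hne ⟨x, hx, h0⟩
      rw [this, finrank_bot]
      exact zero_le_one
  change M.rank + _ = _ at h1
  omega

theorem sum_indicator_pair {ι R : Type*} [Fintype ι] [DecidableEq ι] [CommRing R] (p : ι → Prop)
    [DecidablePred p] (x : ι → R) {a b : ι} (hab : a ≠ b) (hp : ∀ i, p i ↔ i = a ∨ i = b) :
    ∑ i, (if p i then 1 else 0) * x i = x a + x b := by
  simp only [ite_mul, one_mul, zero_mul]
  rw [← Finset.sum_filter]
  have : Finset.univ.filter p = {a, b} := by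
    ext i
    simp [hp i]
  rw [this, Finset.sum_pair hab]

/-- `V - E + F ≤ 2` for a connected surface in which every edge belongs to exactly two triangles:
the incidence matrices modulo two have ranks at least `V - 1` and `F - 1`, and their product
vanishes. -/
theorem card_vertices_add_card_triangles_le {α : Type*} [DecidableEq α] (Vs : Finset α)
    (E T : Finset (Finset α))
    (hE : ∀ e ∈ E, ∃ u v, u ≠ v ∧ u ∈ Vs ∧ v ∈ Vs ∧ e = {u, v})
    (hT : ∀ t ∈ T, ∃ u v w, u ≠ v ∧ v ≠ w ∧ u ≠ w ∧ t = {u, v, w} ∧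
      {u, v} ∈ E ∧ {v, w} ∈ E ∧ {u, w} ∈ E)
    (hV : ∀ v ∈ Vs, ∃ t ∈ T, v ∈ t)
    (h2 : ∀ e ∈ E, ∃ t ∈ T, ∃ t' ∈ T, t ≠ t' ∧ ∀ s ∈ T, e ⊆ s ↔ s = t ∨ s = t')
    (hc : ∀ X ⊆ T, X.Nonempty →
      (∀ t ∈ X, ∀ t' ∈ T, ∀ e ∈ E, e ⊆ t → e ⊆ t' → t' ∈ X) → X = T) :
    Vs.card + T.card ≤ E.card + 2 := by
  let M : Matrix E T (ZMod 2) := fun e t => if e.1 ⊆ t.1 then 1 else 0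
  let N : Matrix Vs E (ZMod 2) := fun v e => if v.1 ∈ e.1 then 1 else 0
  have two : ∀ a b : ZMod 2, a + b = 0 → a = b := by decide
  -- A vertex of a triangle is on exactly two of its edges.
  have hNM : N * M = 0 := by
    ext v t
    obtain ⟨t, ht⟩ := t
    obtain ⟨v, hv⟩ := v
    obtain ⟨a, b, c, hab, hbc, hac, rfl, h1, h2, h3⟩ := hT t ht
    rw [Matrix.mul_apply]
    simp only [N, M, Matrix.zero_apply, ite_zero_mul_ite_zero, mul_one]
    rw [Finset.sum_coe_sort E fun e => if v ∈ e ∧ e ⊆ {a, b, c} then (1 : ZMod 2) else 0,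
      Finset.sum_boole]
    have key : ∀ x y z : α, x ≠ y → y ≠ z → x ≠ z → {x, y} ∈ E → {x, z} ∈ E →
        ((E.filter fun e => x ∈ e ∧ e ⊆ {x, y, z}).card : ZMod 2) = 0 := by
      intro x y z hxy hyz hxz h1 h2
      have : (E.filter fun e => x ∈ e ∧ e ⊆ {x, y, z}) = {{x, y}, {x, z}} := by
        ext e
        simp only [Finset.mem_filter, Finset.mem_insert, Finset.mem_singleton]
        constructor
        · rintro ⟨he, hx, hs⟩
          obtain ⟨p, q, hpq, -, -, rfl⟩ := hE e he
          have m1 := hs (Finset.mem_insert_self p _)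
          have m2 := hs (Finset.mem_insert_of_mem (Finset.mem_singleton_self q))
          simp only [Finset.mem_insert, Finset.mem_singleton] at m1 m2 hx
          rcases hx with rfl | rfl
          · rcases m2 with rfl | rfl | rfl
            exacts [absurd rfl hpq, Or.inl rfl, Or.inr rfl]
          · rcases m1 with rfl | rfl | rfl
            exacts [absurd rfl hpq, Or.inl (Finset.pair_comm _ _), Or.inr (Finset.pair_comm _ _)]
        · rintro (rfl | rfl)
          · exact ⟨h1, by simp, by intro w; simp; tauto⟩
          · exact ⟨h2, by simp, by intro w; simp; tauto⟩
      rw [this, Finset.card_pair]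
      · decide
      · intro h
        have : y ∈ ({x, z} : Finset α) := h ▸ by simp
        simp only [Finset.mem_insert, Finset.mem_singleton] at this
        rcases this with rfl | rfl
        exacts [hxy rfl, hyz rfl]
    by_cases ha : v = a
    · subst ha
      exact key v b c hab hbc hac h1 h3
    by_cases hb : v = b
    · subst hb
      have := key v c a hbc hac.symm hab.symm h2 (by rwa [Finset.pair_comm])
      convert this using 6
      ext w
      simp only [Finset.mem_insert, Finset.mem_singleton]
      tauto
    by_cases hc : v = c
    · subst hc
      have := key v a b hac.symm hab hbc.symm (by rwa [Finset.pair_comm])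
        (by rwa [Finset.pair_comm])
      convert this using 6
      ext w
      simp only [Finset.mem_insert, Finset.mem_singleton]
      tauto
    · rw [Finset.filter_false_of_mem]
      · simp
      · rintro e - ⟨h4, h5⟩
        have := h5 h4
        simp only [Finset.mem_insert, Finset.mem_singleton] at this
        tauto
  have hrank := Matrix.rank_add_rank_le_card_of_mul_eq_zero hNM
  have hM : Fintype.card T ≤ M.rank + 1 := by
    refine M.card_le_rank_add_one_of_ker fun x hx => ?_
    have hedge : ∀ t ∈ T, ∀ t' ∈ T, ∀ (ht : t ∈ T) (ht' : t' ∈ T), ∀ e ∈ E, e ⊆ t → e ⊆ t' →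
        x ⟨t, ht⟩ = x ⟨t', ht'⟩ := by
      intro t _ t' _ ht ht' e he h1 h1'
      obtain ⟨s, hs, s', hs', hss, hall⟩ := h2 e he
      have hrow := congrFun hx ⟨e, he⟩
      have hsum : x ⟨s, hs⟩ + x ⟨s', hs'⟩ = 0 := by
        refine Eq.trans ?_ hrow
        symm
        refine sum_indicator_pair (fun r : T => e ⊆ r.1) x
          (fun h => hss (congrArg Subtype.val h)) fun r => ?_
        rw [hall r.1 r.2, Subtype.ext_iff, Subtype.ext_iff]
      have heq := two _ _ hsum
      rcases (hall t ht).1 h1 with rfl | rfl <;> rcases (hall t' ht').1 h1' with rfl | rfl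
      exacts [rfl, heq, heq.symm, rfl]
    rintro ⟨t0, ht0⟩ ⟨t1, ht1⟩
    have := hc (T.filter fun t => ∃ h : t ∈ T, x ⟨t, h⟩ = x ⟨t0, ht0⟩) (Finset.filter_subset _ _)
      ⟨t0, Finset.mem_filter.2 ⟨ht0, ht0, rfl⟩⟩ ?_
    · rw [← this, Finset.mem_filter] at ht1
      exact ht1.2.2.symm
    · intro t ht t' ht' e he h1 h1'
      rw [Finset.mem_filter] at ht ⊢
      obtain ⟨ht, _, hxt⟩ := ht
      exact ⟨ht', ht', (hedge t' ht' t ht ht' ht e he h1' h1).trans hxt⟩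
  have hN : Fintype.card Vs ≤ N.rank + 1 := by
    rw [← Matrix.rank_transpose]
    refine N.transpose.card_le_rank_add_one_of_ker fun x hx => ?_
    let y : α → ZMod 2 := fun v => if h : v ∈ Vs then x ⟨v, h⟩ else 0
    have hy : ∀ v (h : v ∈ Vs), y v = x ⟨v, h⟩ := fun v h => dif_pos h
    have hedge : ∀ u v, {u, v} ∈ E → y u = y v := by
      intro u v he
      obtain ⟨a, b, hab, ha, hb, huv⟩ := hE _ he
      have hrow := congrFun hx ⟨_, he⟩
      have hsum : y a + y b = 0 := by
        rw [hy a ha, hy b hb]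
        refine Eq.trans ?_ hrow
        symm
        refine sum_indicator_pair (fun r : Vs => r.1 ∈ ({u, v} : Finset α)) x
          (fun h => hab (congrArg Subtype.val h)) fun r => ?_
        rw [huv, Finset.mem_insert, Finset.mem_singleton, Subtype.ext_iff, Subtype.ext_iff]
      have heq := two _ _ hsum
      have m1 : u ∈ ({a, b} : Finset α) := by rw [← huv]; simp
      have m2 : v ∈ ({a, b} : Finset α) := by rw [← huv]; simp
      simp only [Finset.mem_insert, Finset.mem_singleton] at m1 m2
      rcases m1 with rfl | rfl <;> rcases m2 with rfl | rfl
      exacts [rfl, heq, heq.symm, rfl]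
    have htri : ∀ t ∈ T, ∀ u ∈ t, ∀ v ∈ t, y u = y v := by
      intro t ht u hu v hv
      obtain ⟨a, b, c, -, -, -, rfl, h1, h2, h3⟩ := hT t ht
      have e1 := hedge _ _ h1
      have e2 := hedge _ _ h2
      have e3 := hedge _ _ h3
      simp only [Finset.mem_insert, Finset.mem_singleton] at hu hv
      have key : ∀ w, w = a ∨ w = b ∨ w = c → y w = y a := by
        rintro w (rfl | rfl | rfl)
        exacts [rfl, e1.symm, e3.symm]
      rw [key u hu, key v hv]
    rintro ⟨u, hu⟩ ⟨v, hv⟩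
    rw [← hy u hu, ← hy v hv]
    obtain ⟨t0, ht0, hu0⟩ := hV u hu
    obtain ⟨t1, ht1, hv1⟩ := hV v hv
    have := hc (T.filter fun t => ∀ w ∈ t, y w = y u) (Finset.filter_subset _ _)
      ⟨t0, Finset.mem_filter.2 ⟨ht0, fun w hw => htri _ ht0 _ hw _ hu0⟩⟩ ?_
    · rw [← this, Finset.mem_filter] at ht1
      exact (ht1.2 v hv1).symm
    · intro t ht t' ht' e he h1 h1'
      rw [Finset.mem_filter] at ht ⊢
      obtain ⟨a, b, -, -, -, rfl⟩ := hE e he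
      refine ⟨ht', fun w hw => ?_⟩
      rw [htri t' ht' w hw a (h1' (by simp))]
      exact ht.2 a (h1 (by simp))
  simp only [Fintype.card_coe] at hrank hM hN
  omega

end EulerBound

/-! ### Graphs on the sphere: arcs of great circles in general position -/

section Sphere

theorem det3_eq (a b c : Space3) : det3 a b c =
    a 0 * b 1 * c 2 - a 0 * b 2 * c 1 - a 1 * b 0 * c 2 + a 1 * b 2 * c 0 + a 2 * b 0 * c 1 -
      a 2 * b 1 * c 0 := by
  simp [det3, Matrix.det_fin_three]

/-- Cramer's rule. -/
theorem cramer3 {x y e : Space3} (h : det3 x y e ≠ 0) (z : Space3) :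
    z = (det3 z y e / det3 x y e) • x + (det3 x z e / det3 x y e) • y +
      (det3 x y z / det3 x y e) • e := by
  have key : ∀ i, det3 x y e * z i = det3 z y e * x i + det3 x z e * y i + det3 x y z * e i := by
    intro i
    simp only [det3_eq]
    fin_cases i <;> simp <;> ring
  ext i
  simp only [Pi.add_apply, Pi.smul_apply, smul_eq_mul]
  field_simp
  linarith [key i]

theorem exists_coords {x y e : Space3} (h : det3 x y e ≠ 0) (z : Space3) :
    ∃ s t r : ℝ, z = s • x + t • y + r • e := ⟨_, _, _, cramer3 h z⟩

theorem coords_unique {x y e : Space3} (h : det3 x y e ≠ 0) {s t r s' t' r' : ℝ}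
    (hz : s • x + t • y + r • e = s' • x + t' • y + r' • e) : s = s' ∧ t = t' ∧ r = r' := by
  have h0 : ∀ i, s * x i + t * y i + r * e i = s' * x i + t' * y i + r' * e i := fun i => by
    simpa using congrFun hz i
  have a0 := h0 0
  have a1 := h0 1
  have a2 := h0 2
  rw [det3_eq] at h
  have hs : (s - s') * (x 0 * y 1 * e 2 - x 0 * y 2 * e 1 - x 1 * y 0 * e 2 + x 1 * y 2 * e 0 +
      x 2 * y 0 * e 1 - x 2 * y 1 * e 0) = 0 := by
    linear_combination (y 1 * e 2 - y 2 * e 1) * a0 - (y 0 * e 2 - y 2 * e 0) * a1 +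
      (y 0 * e 1 - y 1 * e 0) * a2
  have ht : (t - t') * (x 0 * y 1 * e 2 - x 0 * y 2 * e 1 - x 1 * y 0 * e 2 + x 1 * y 2 * e 0 +
      x 2 * y 0 * e 1 - x 2 * y 1 * e 0) = 0 := by
    linear_combination -(x 1 * e 2 - x 2 * e 1) * a0 + (x 0 * e 2 - x 2 * e 0) * a1 -
      (x 0 * e 1 - x 1 * e 0) * a2
  have hr : (r - r') * (x 0 * y 1 * e 2 - x 0 * y 2 * e 1 - x 1 * y 0 * e 2 + x 1 * y 2 * e 0 +
      x 2 * y 0 * e 1 - x 2 * y 1 * e 0) = 0 := by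
    linear_combination (x 1 * y 2 - x 2 * y 1) * a0 - (x 0 * y 2 - x 2 * y 0) * a1 +
      (x 0 * y 1 - x 1 * y 0) * a2
  refine ⟨?_, ?_, ?_⟩
  · linarith [(mul_eq_zero.1 hs).resolve_right h]
  · linarith [(mul_eq_zero.1 ht).resolve_right h]
  · linarith [(mul_eq_zero.1 hr).resolve_right h]

/-- The open cone spanned by three vectors. -/
def InCone (x y e z : Space3) : Prop :=
  ∃ s t r : ℝ, 0 < s ∧ 0 < t ∧ 0 < r ∧ z = s • x + t • y + r • e

/-- The half-plane spanned by the line through `a` and the direction `z` lies between the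
half-planes with directions `x` and `e`. -/
def InWedge (a x e z : Space3) : Prop :=
  ∃ s t r : ℝ, 0 < t ∧ 0 < r ∧ z = s • a + t • x + r • e

/-- The indicator of a proposition, modulo two. -/
def ind (P : Prop) : ZMod 2 := by classical exact if P then 1 else 0

theorem ind_true {P : Prop} (h : P) : ind P = 1 := if_pos h

theorem ind_false {P : Prop} (h : ¬ P) : ind P = 0 := if_neg h

theorem ind_congr {P Q : Prop} (h : P ↔ Q) : ind P = ind Q := by rw [propext h]

theorem ind_add_self (P : Prop) : ind P + ind P = 0 := CharTwo.add_self_eq_zero _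

theorem ind_eq_ind {P Q : Prop} (h : ind P = ind Q) : P ↔ Q := by
  by_cases hP : P <;> by_cases hQ : Q <;>
    simp_all [ind]

theorem inCone_iff {x y e : Space3} (h : det3 x y e ≠ 0) {s t r : ℝ} :
    InCone x y e (s • x + t • y + r • e) ↔ 0 < s ∧ 0 < t ∧ 0 < r := by
  constructor
  · rintro ⟨s', t', r', h1, h2, h3, he⟩
    obtain ⟨rfl, rfl, rfl⟩ := coords_unique h he
    exact ⟨h1, h2, h3⟩
  · rintro ⟨h1, h2, h3⟩
    exact ⟨s, t, r, h1, h2, h3, rfl⟩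

theorem inWedge_iff {x y e : Space3} (h : det3 x y e ≠ 0) {s t r : ℝ} :
    InWedge x y e (s • x + t • y + r • e) ↔ 0 < t ∧ 0 < r := by
  constructor
  · rintro ⟨s', t', r', h2, h3, he⟩
    obtain ⟨rfl, rfl, rfl⟩ := coords_unique h he
    exact ⟨h2, h3⟩
  · rintro ⟨h2, h3⟩
    exact ⟨s, t, r, h2, h3, rfl⟩

theorem inCone_comm (x y e z : Space3) : InCone x y e z ↔ InCone y x e z := by
  constructor <;>
  · rintro ⟨s, t, r, hs, ht, hr, rfl⟩
    exact ⟨t, s, r, ht, hs, hr, by abel⟩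

/-! The next lemmas are about the segment between the points `(s, t, r)` and `(s', t', r')` that
does not meet the part `r = 0` of the closed octant. It crosses the two other faces of the octant
(`FaceCross`) as often, modulo two, as it has ends in the octant. -/

/-- The segment between `(s, t, r)` and `(s', t', r')` crosses the face `t = 0` of the octant. -/
def FaceCross (s t r s' t' r' : ℝ) : Prop :=
  ∃ p q : ℝ, 0 < p ∧ 0 < q ∧ 0 < p * s + q * s' ∧ p * t + q * t' = 0 ∧ 0 < p * r + q * r'

theorem faceCross_comm (s t r s' t' r' : ℝ) :
    FaceCross s t r s' t' r' ↔ FaceCross s' t' r' s t r := by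
  constructor <;>
  · rintro ⟨p, q, hp, hq, h1, h2, h3⟩
    exact ⟨q, p, hq, hp, by linarith, by linarith, by linarith⟩

/-- The segment avoids the face `r = 0` of the closed octant, and its ends avoid the other two
faces of the closed octant over the axes. -/
structure AvoidsFloor (s t r s' t' r' : ℝ) : Prop where
  floor : ∀ p q : ℝ, 0 ≤ p → 0 ≤ q → 0 ≤ p * s + q * s' → 0 ≤ p * t + q * t' →
    p * r + q * r' = 0 → p = 0 ∧ q = 0
  left : ¬ (t = 0 ∧ 0 < s)
  right : ¬ (s = 0 ∧ 0 < t)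
  left' : ¬ (t' = 0 ∧ 0 < s')
  right' : ¬ (s' = 0 ∧ 0 < t')
  minor : t * s' - s * t' ≠ 0

variable {s t r s' t' r' : ℝ}

theorem AvoidsFloor.swap (h : AvoidsFloor s t r s' t' r') : AvoidsFloor t s r t' s' r' where
  floor p q hp hq h1 h2 h3 := h.floor p q hp hq h2 h1 h3
  left := h.right
  right := h.left
  left' := h.right'
  right' := h.left'
  minor := fun h0 => h.minor (by linarith)

theorem AvoidsFloor.comm (h : AvoidsFloor s t r s' t' r') : AvoidsFloor s' t' r' s t r where
  floor p q hp hq h1 h2 h3 := (h.floor q p hq hp (by linarith) (by linarith) (by linarith)).symm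
  left := h.left'
  right := h.right'
  left' := h.left
  right' := h.right
  minor := fun h0 => h.minor (by linarith)

/-- Along the part of the segment over the closed quadrant the height does not change sign. -/
theorem AvoidsFloor.height_pos (h : AvoidsFloor s t r s' t' r') {p q p' q' : ℝ}
    (hp : 0 ≤ p) (hq : 0 ≤ q) (hp' : 0 ≤ p') (hq' : 0 ≤ q') (hne : p' ≠ 0 ∨ q' ≠ 0)
    (h1 : 0 ≤ p * s + q * s') (h2 : 0 ≤ p * t + q * t') (h3 : 0 < p * r + q * r')
    (h1' : 0 ≤ p' * s + q' * s') (h2' : 0 ≤ p' * t + q' * t') : 0 < p' * r + q' * r' := by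
  by_contra hneg
  push Not at hneg
  have hz := h.floor (-(p' * r + q' * r') * p + (p * r + q * r') * p')
    (-(p' * r + q' * r') * q + (p * r + q * r') * q')
    (add_nonneg (mul_nonneg (by linarith) hp) (mul_nonneg h3.le hp'))
    (add_nonneg (mul_nonneg (by linarith) hq) (mul_nonneg h3.le hq'))
    (by
      have e1 := mul_nonneg (neg_nonneg.2 hneg) h1
      have e2 := mul_nonneg h3.le h1'
      linarith)
    (by
      have e1 := mul_nonneg (neg_nonneg.2 hneg) h2
      have e2 := mul_nonneg h3.le h2'
      linarith)
    (by ring)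
  have m1 := mul_nonneg (neg_nonneg.2 hneg) hp
  have m2 := mul_nonneg h3.le hp'
  have m3 := mul_nonneg (neg_nonneg.2 hneg) hq
  have m4 := mul_nonneg h3.le hq'
  rcases hne with hne | hne
  · have : 0 < (p * r + q * r') * p' := mul_pos h3 (lt_of_le_of_ne hp' hne.symm)
    linarith [hz.1]
  · have : 0 < (p * r + q * r') * q' := mul_pos h3 (lt_of_le_of_ne hq' hne.symm)
    linarith [hz.2]

/-- A segment that leaves the octant crosses one of the two faces only; the sign of the minor tells
which one. -/
theorem AvoidsFloor.cross_of_inside (h : AvoidsFloor s t r s' t' r') (hs : 0 < s) (ht : 0 < t)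
    (hr : 0 < r) (hout : ¬ (0 < s' ∧ 0 < t' ∧ 0 < r')) (hm : 0 < t * s' - s * t') :
    FaceCross s t r s' t' r' ∧ ¬ FaceCross t s r t' s' r' := by
  have hin : ∀ {p q : ℝ}, 0 ≤ p → 0 ≤ q → (p ≠ 0 ∨ q ≠ 0) → 0 ≤ p * s + q * s' →
      0 ≤ p * t + q * t' → 0 < p * r + q * r' := fun hp hq hne h1 h2 =>
    h.height_pos (p := 1) (q := 0) zero_le_one le_rfl hp hq hne (by linarith) (by linarith)
      (by linarith) h1 h2
  constructor
  · have ht' : t' < 0 := by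
      by_contra hneg
      push Not at hneg
      have hs' : 0 < s' := by
        by_contra hs'
        push Not at hs'
        nlinarith [mul_nonneg hs.le hneg, mul_nonneg ht.le (neg_nonneg.2 hs')]
      have hr' := hin (p := 0) (q := 1) le_rfl zero_le_one (Or.inr one_ne_zero) (by linarith)
        (by linarith)
      rcases hneg.eq_or_lt with h0 | h0
      · exact h.left' ⟨h0.symm, hs'⟩
      · exact hout ⟨hs', h0, by linarith⟩
    refine ⟨-t', t, by linarith, ht, by linarith, by ring, ?_⟩
    exact hin (by linarith) ht.le (Or.inr ht.ne') (by linarith) (by linarith)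
  · rintro ⟨p, q, hp, hq, h1, h2, -⟩
    have e1 : 0 < s * (p * t + q * t') := mul_pos hs h1
    have e2 : t * (p * s + q * s') = 0 := by rw [h2, mul_zero]
    nlinarith [mul_pos hq hm]

/-- A segment with both ends outside the octant that crosses one face crosses the other, too. -/
theorem AvoidsFloor.cross_of_outside (h : AvoidsFloor s t r s' t' r')
    (hout : ¬ (0 < s ∧ 0 < t ∧ 0 < r)) (hout' : ¬ (0 < s' ∧ 0 < t' ∧ 0 < r'))
    (hc : FaceCross s t r s' t' r') : FaceCross t s r t' s' r' := by
  have key : ∀ {s t r s' t' r' : ℝ}, AvoidsFloor s t r s' t' r' → ¬ (0 < s ∧ 0 < t ∧ 0 < r) →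
      FaceCross s t r s' t' r' → 0 < t → FaceCross t s r t' s' r' := by
    intro s t r s' t' r' h hout ⟨p, q, hp, hq, h1, h2, h3⟩ ht
    have hin : ∀ {p' q' : ℝ}, 0 ≤ p' → 0 ≤ q' → (p' ≠ 0 ∨ q' ≠ 0) → 0 ≤ p' * s + q' * s' →
        0 ≤ p' * t + q' * t' → 0 < p' * r + q' * r' := fun hp' hq' hne h1' h2' =>
      h.height_pos hp.le hq.le hp' hq' hne h1.le h2.ge h3 h1' h2'
    have hs : s < 0 := by
      by_contra hneg
      push Not at hneg
      have hr := hin (p' := 1) (q' := 0) zero_le_one le_rfl (Or.inl one_ne_zero) (by linarith)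
        (by linarith)
      rcases hneg.eq_or_lt with h0 | h0
      · exact h.right ⟨h0.symm, ht⟩
      · exact hout ⟨h0, ht, by linarith⟩
    have hs' : 0 < s' := by
      have : 0 < q * s' := by nlinarith [mul_pos hp (neg_pos.2 hs)]
      exact (pos_iff_pos_of_mul_pos this).1 hq
    have hm : 0 < s' * t + -s * t' := by
      have e1 : 0 < t * (p * s + q * s') := mul_pos ht h1
      have e2 : s * (p * t + q * t') = 0 := by rw [h2, mul_zero]
      have : 0 < q * (s' * t + -s * t') := by linarith
      exact (pos_iff_pos_of_mul_pos this).1 hq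
    refine ⟨s', -s, hs', by linarith, hm, by ring, ?_⟩
    exact hin hs'.le (by linarith) (Or.inl hs'.ne') (by linarith) hm.le
  obtain ⟨p, q, hp, hq, h1, h2, h3⟩ := hc
  rcases lt_trichotomy t 0 with ht | ht | ht
  · have ht' : 0 < t' := by
      have : 0 < q * t' := by nlinarith [mul_pos hp (neg_pos.2 ht)]
      exact (pos_iff_pos_of_mul_pos this).1 hq
    rw [faceCross_comm]
    exact key h.comm hout' ((faceCross_comm _ _ _ _ _ _).1 ⟨p, q, hp, hq, h1, h2, h3⟩) ht'
  · have ht' : t' = 0 := by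
      subst ht
      simpa [hq.ne'] using h2
    exact absurd (by rw [ht, ht']; ring) h.minor
  · exact key h hout ⟨p, q, hp, hq, h1, h2, h3⟩ ht

/-- Modulo two, the number of ends in the octant is the number of crossings of its two faces. -/
theorem AvoidsFloor.ind_eq (h : AvoidsFloor s t r s' t' r') :
    ind (0 < s ∧ 0 < t ∧ 0 < r) + ind (0 < s' ∧ 0 < t' ∧ 0 < r') =
      ind (FaceCross s t r s' t' r') + ind (FaceCross t s r t' s' r') := by
  have one : ∀ {s t r s' t' r' : ℝ}, AvoidsFloor s t r s' t' r' → (0 < s ∧ 0 < t ∧ 0 < r) →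
      ¬ (0 < s' ∧ 0 < t' ∧ 0 < r') →
      ind (FaceCross s t r s' t' r') + ind (FaceCross t s r t' s' r') = 1 := by
    intro s t r s' t' r' h h1 h2
    rcases lt_or_gt_of_ne h.minor with hm | hm
    · obtain ⟨h3, h4⟩ := h.swap.cross_of_inside h1.2.1 h1.1 h1.2.2
        (fun h' => h2 ⟨h'.2.1, h'.1, h'.2.2⟩) (by linarith)
      rw [ind_true h3, ind_false h4, zero_add]
    · obtain ⟨h3, h4⟩ := h.cross_of_inside h1.1 h1.2.1 h1.2.2 h2 hm
      rw [ind_true h3, ind_false h4, add_zero]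
  by_cases h1 : 0 < s ∧ 0 < t ∧ 0 < r <;> by_cases h2 : 0 < s' ∧ 0 < t' ∧ 0 < r'
  · have n1 : ¬ FaceCross s t r s' t' r' := by
      rintro ⟨p, q, hp, hq, -, h3, -⟩
      nlinarith [mul_pos hp h1.2.1, mul_pos hq h2.2.1]
    have n2 : ¬ FaceCross t s r t' s' r' := by
      rintro ⟨p, q, hp, hq, -, h3, -⟩
      nlinarith [mul_pos hp h1.1, mul_pos hq h2.1]
    rw [ind_true h1, ind_true h2, ind_false n1, ind_false n2]
    decide
  · rw [ind_true h1, ind_false h2, one h h1 h2, add_zero]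
  · rw [ind_false h1, ind_true h2, faceCross_comm s, faceCross_comm t, one h.comm h2 h1, zero_add]
  · rw [ind_false h1, ind_false h2, add_zero, ind_congr (Q := FaceCross t s r t' s' r')
      ⟨h.cross_of_outside h1 h2, h.swap.cross_of_outside (fun h' => h1 ⟨h'.2.1, h'.1, h'.2.2⟩)
        (fun h' => h2 ⟨h'.2.1, h'.1, h'.2.2⟩)⟩, ind_add_self]

end Sphere

section SphereGraph

theorem det3_swap (x y e : Space3) : det3 y x e = -det3 x y e := by
  simp only [det3_eq]
  ring

theorem inCone_neg_iff {x x' e : Space3} (h : det3 x x' e ≠ 0) {s t r s' t' r' : ℝ} :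
    InCone (s • x + t • x' + r • e) (s' • x + t' • x' + r' • e) (-e) x ↔
      FaceCross s t r s' t' r' := by
  have e1 : ∀ p q m : ℝ, p • (s • x + t • x' + r • e) + q • (s' • x + t' • x' + r' • e) + m • -e =
      (p * s + q * s') • x + (p * t + q * t') • x' + (p * r + q * r' - m) • e := by
    intro p q m
    module
  constructor
  · rintro ⟨p, q, m, hp, hq, hm, hx⟩
    rw [e1] at hx
    have hx' : (1 : ℝ) • x + (0 : ℝ) • x' + (0 : ℝ) • e = (p * s + q * s') • x +
        (p * t + q * t') • x' + (p * r + q * r' - m) • e := by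
      rw [← hx]
      module
    obtain ⟨h1, h2, h3⟩ := coords_unique h hx'
    exact ⟨p, q, hp, hq, by linarith, h2.symm, by linarith⟩
  · rintro ⟨p, q, hp, hq, h1, h2, h3⟩
    refine ⟨p / (p * s + q * s'), q / (p * s + q * s'), (p * r + q * r') / (p * s + q * s'),
      div_pos hp h1, div_pos hq h1, div_pos h3 h1, ?_⟩
    rw [e1]
    have f1 : p / (p * s + q * s') * s + q / (p * s + q * s') * s' = 1 := by
      field_simp
    have f2 : p / (p * s + q * s') * t + q / (p * s + q * s') * t' = 0 := by
      rw [div_mul_eq_mul_div, div_mul_eq_mul_div, ← add_div, h2, zero_div]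
    have f3 : p / (p * s + q * s') * r + q / (p * s + q * s') * r' -
        (p * r + q * r') / (p * s + q * s') = 0 := by
      rw [div_mul_eq_mul_div, div_mul_eq_mul_div, ← add_div, sub_self]
    rw [f1, f2, f3]
    module

/-- A graph on the sphere (of directions at a vertex), given by the vectors `p` of its vertices
and the relation `A` of adjacency; adjacent vertices are joined by arcs of great circles which
meet in common endpoints only. The pole `e` is in general position. -/
structure IsSphereGraph {L : Type*} (A : L → L → Prop) (p : L → Space3) (e : Space3) : Prop where
  symm : ∀ x y, A x y → A y x
  det_ne : ∀ x y, A x y → det3 (p x) (p y) e ≠ 0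
  general : ∀ x y, x ≠ y → ¬ ∃ s r : ℝ, 0 < s ∧ p y = s • p x + r • e
  disjoint : ∀ x x' a y, A x x' → A a y → a ≠ x → a ≠ x' → y ≠ x → y ≠ x' →
    ∀ s t u v : ℝ, 0 ≤ s → 0 ≤ t → 0 ≤ u → 0 ≤ v →
      s • p a + t • p y = u • p x + v • p x' → s = 0 ∧ t = 0
  overlap : ∀ a x y, A a x → A a y → x ≠ y → ¬ ∃ s t : ℝ, 0 < t ∧ p y = s • p a + t • p x

namespace IsSphereGraph

variable {L : Type*} {A : L → L → Prop} {p : L → Space3} {e : Space3}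

theorem ne (h : IsSphereGraph A p e) {x y : L} (hxy : A x y) : x ≠ y := by
  rintro rfl
  apply h.det_ne _ _ hxy
  simp only [det3_eq]
  ring

/-- The ends of one arc above another arc and the ends of the latter below the former. -/
theorem ind_disjoint (h : IsSphereGraph A p e) {x x' a y : L} (hx : A x x') (ha : A a y)
    (h1 : a ≠ x) (h2 : a ≠ x') (h3 : y ≠ x) (h4 : y ≠ x') :
    ind (InCone (p x) (p x') e (p a)) + ind (InCone (p x) (p x') e (p y)) =
      ind (InCone (p a) (p y) (-e) (p x)) + ind (InCone (p a) (p y) (-e) (p x')) := by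
  have hd := h.det_ne _ _ hx
  have hd' := h.det_ne _ _ (h.symm _ _ hx)
  obtain ⟨s, t, r, hs⟩ := exists_coords hd (p a)
  obtain ⟨s', t', r', hs'⟩ := exists_coords hd (p y)
  have g1 : ∀ (z w : L) (a b c : ℝ), z ≠ w → p w = a • p z + b • e → ¬ (0 < a) :=
    fun z w a b _ hzw hw ha => h.general z w hzw ⟨a, b, ha, hw⟩
  have hav : AvoidsFloor s t r s' t' r' :=
    { floor := by
        intro u v hu hv k1 k2 k3
        refine h.disjoint _ _ _ _ hx ha h1 h2 h3 h4 u v _ _ hu hv k1 k2 ?_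
        rw [hs, hs']
        have : u • (s • p x + t • p x' + r • e) + v • (s' • p x + t' • p x' + r' • e) =
          (u * s + v * s') • p x + (u * t + v * t') • p x' + (u * r + v * r') • e := by module
        rw [this, k3, zero_smul, add_zero]
      left := fun k => h.general x a h1.symm ⟨s, r, k.2, by rw [hs, k.1]; module⟩
      right := fun k => h.general x' a h2.symm ⟨t, r, k.2, by rw [hs, k.1]; module⟩
      left' := fun k => h.general x y h3.symm ⟨s', r', k.2, by rw [hs', k.1]; module⟩
      right' := fun k => h.general x' y h4.symm ⟨t', r', k.2, by rw [hs', k.1]; module⟩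
      minor := by
        intro k
        apply h.det_ne _ _ ha
        have : det3 (p a) (p y) e = -(t * s' - s * t') * det3 (p x) (p x') e := by
          rw [hs, hs']
          simp only [det3_eq, Pi.add_apply, Pi.smul_apply, smul_eq_mul]
          ring
        rw [this, k, neg_zero, zero_mul] }
  have e1 := inCone_iff hd (s := s) (t := t) (r := r)
  have e2 := inCone_iff hd (s := s') (t := t') (r := r')
  have e3 := inCone_neg_iff hd (s := s) (t := t) (r := r) (s' := s') (t' := t') (r' := r')
  have e4 := inCone_neg_iff hd' (s := t) (t := s) (r := r) (s' := t') (t' := s') (r' := r')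
  rw [add_comm (t • p x'), add_comm (t' • p x')] at e4
  rw [← hs, ← hs'] at e3 e4
  rw [← hs] at e1
  rw [← hs'] at e2
  rw [ind_congr e1, ind_congr e2, ind_congr e3, ind_congr e4]
  exact hav.ind_eq

/-- The same for two arcs with a common endpoint. -/
theorem ind_common (h : IsSphereGraph A p e) {a x y : L} (hx : A a x) (hxy : x ≠ y) :
    ind (InWedge (p a) (p x) e (p y)) + ind (InCone (p a) (p x) e (p y)) =
      ind (InCone (p a) (p y) (-e) (p x)) := by
  have hd := h.det_ne _ _ hx
  obtain ⟨s, t, r, hs⟩ := exists_coords hd (p y)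
  have e1 := inWedge_iff hd (s := s) (t := t) (r := r)
  have e2 := inCone_iff hd (s := s) (t := t) (r := r)
  rw [← hs] at e1 e2
  have e3 : InCone (p a) (p y) (-e) (p x) ↔ s < 0 ∧ 0 < t ∧ 0 < r := by
    constructor
    · rintro ⟨u, q, m, hu, hq, hm, hpx⟩
      rw [hs] at hpx
      have hx' : (0 : ℝ) • p a + (1 : ℝ) • p x + (0 : ℝ) • e =
          (u + q * s) • p a + (q * t) • p x + (q * r - m) • e := by
        calc (0 : ℝ) • p a + (1 : ℝ) • p x + (0 : ℝ) • e = p x := by module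
          _ = _ := hpx
          _ = _ := by module
      obtain ⟨k1, k2, k3⟩ := coords_unique hd hx'
      have ht : 0 < t := (pos_iff_pos_of_mul_pos (by linarith : 0 < q * t)).1 hq
      have hr : 0 < r := (pos_iff_pos_of_mul_pos (by linarith : 0 < q * r)).1 hq
      refine ⟨?_, ht, hr⟩
      by_contra hs0
      push Not at hs0
      linarith [mul_nonneg hq.le hs0]
    · rintro ⟨hs0, ht, hr⟩
      refine ⟨-s / t, 1 / t, r / t, div_pos (by linarith) ht, by positivity, by positivity, ?_⟩
      rw [hs]
      have : (-s / t) • p a + (1 / t) • (s • p a + t • p x + r • e) + (r / t) • -e =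
          (-s / t + 1 / t * s) • p a + (1 / t * t) • p x + (1 / t * r - r / t) • e := by module
      rw [this]
      have f1 : -s / t + 1 / t * s = 0 := by ring
      have f2 : 1 / t * t = 1 := by field_simp
      have f3 : 1 / t * r - r / t = 0 := by ring
      rw [f1, f2, f3]
      module
  rw [ind_congr e1, ind_congr e2, ind_congr e3]
  by_cases htr : 0 < t ∧ 0 < r
  · rcases lt_trichotomy s 0 with hs0 | hs0 | hs0
    · rw [ind_true htr, ind_false fun k => by linarith [k.1], ind_true ⟨hs0, htr⟩, add_zero]
    · refine absurd ⟨t, r, htr.1, ?_⟩ (h.general x y hxy)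
      rw [hs, hs0]
      module
    · rw [ind_true htr, ind_true ⟨hs0, htr⟩, ind_false fun k => by linarith [k.1]]
      decide
  · rw [ind_false htr, ind_false fun k => htr k.2, ind_false fun k => htr k.2, add_zero]

end IsSphereGraph

section Corner

/-- A wedge condition in terms of determinants. -/
theorem inWedge_iff_det {a x e : Space3} (h : det3 a x e ≠ 0) (z : Space3) :
    InWedge a x e z ↔ 0 < det3 a z e * det3 a x e ∧ 0 < det3 a x z * det3 a x e := by
  obtain ⟨s, t, r, rfl⟩ := exists_coords h z
  have e1 : det3 a (s • a + t • x + r • e) e = t * det3 a x e := by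
    simp only [det3_eq, Pi.add_apply, Pi.smul_apply, smul_eq_mul]
    ring
  have e2 : det3 a x (s • a + t • x + r • e) = r * det3 a x e := by
    simp only [det3_eq, Pi.add_apply, Pi.smul_apply, smul_eq_mul]
    ring
  rw [inWedge_iff h, e1, e2]
  have hp : 0 < det3 a x e * det3 a x e := mul_self_pos.2 h
  constructor
  · rintro ⟨ht, hr⟩
    exact ⟨by rw [mul_assoc]; exact mul_pos ht hp, by rw [mul_assoc]; exact mul_pos hr hp⟩
  · rintro ⟨ht, hr⟩
    rw [mul_assoc] at ht hr
    exact ⟨(pos_iff_pos_of_mul_pos ht).2 hp, (pos_iff_pos_of_mul_pos hr).2 hp⟩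

theorem det3_plucker (a x x' y e : Space3) :
    det3 a x x' * det3 a y e - det3 a x y * det3 a x' e + det3 a x e * det3 a x' y = 0 := by
  simp only [det3_eq]
  ring

/-- If `x` and `y` lie on the same side of the plane of `a` and `e` then the half-planes with
directions `x` and `y` are in a plane only if they coincide. -/
theorem eq_of_det_zero {a x y e : Space3} (h : det3 a x e ≠ 0)
    (hxy : ¬ ∃ s t : ℝ, 0 < t ∧ y = s • a + t • x) (h0 : det3 a x y = 0)  :
    ¬ 0 < det3 a x e * det3 a y e := by
  intro hpos
  obtain ⟨s, t, r, hy⟩ := exists_coords h y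
  have e1 : det3 a y e = t * det3 a x e := by
    rw [hy]
    simp only [det3_eq, Pi.add_apply, Pi.smul_apply, smul_eq_mul]
    ring
  have e2 : det3 a x y = r * det3 a x e := by
    rw [hy]
    simp only [det3_eq, Pi.add_apply, Pi.smul_apply, smul_eq_mul]
    ring
  rw [e1] at hpos
  have hp : 0 < det3 a x e * det3 a x e := mul_self_pos.2 h
  have ht : 0 < t := by
    have : 0 < t * (det3 a x e * det3 a x e) := by linarith
    exact (pos_iff_pos_of_mul_pos this).2 hp
  have hr : r = 0 := (mul_eq_zero.1 (e2.symm.trans h0)).resolve_right h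
  refine hxy ⟨s, t, ht, ?_⟩
  rw [hy, hr]
  module

end Corner

end SphereGraph

section Corner

theorem ind_eq_of_iff {a b c d f : Prop} (h : (a ↔ b) ↔ ((c ↔ d) ↔ ¬ f)) :
    ind a + ind b = ind c + ind d + ind f := by
  by_cases ha : a <;> by_cases hb : b <;> by_cases hc : c <;> by_cases hd : d <;>
    by_cases hf : f <;> simp only [ha, hb, hc, hd, hf, ind, not_true_eq_false, not_false_eq_true,
      iff_true, iff_false, iff_self] at h ⊢ <;> decide

theorem sign_sum_zero {x y z : ℝ} (h : x + y = z) :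
    (SignType.sign x = SignType.sign y → SignType.sign z = SignType.sign x) ∧
    (SignType.sign x = 0 → SignType.sign z = SignType.sign y) ∧
    (SignType.sign y = 0 → SignType.sign z = SignType.sign x) := by
  subst h
  refine ⟨fun hxy => ?_, fun hx => ?_, fun hy => ?_⟩
  · rcases lt_trichotomy x 0 with hx | hx | hx
    · rw [sign_neg hx] at hxy ⊢
      exact sign_neg (by linarith [sign_eq_neg_one_iff.1 hxy.symm])
    · rw [hx, zero_add, ← hx, hxy]
    · rw [sign_pos hx] at hxy ⊢
      exact sign_pos (by linarith [sign_eq_one_iff.1 hxy.symm])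
  · rw [sign_eq_zero_iff.1 hx, zero_add]
  · rw [sign_eq_zero_iff.1 hy, add_zero]

/-- Four directions `x₁, x₂, y, e` in an oriented plane, given by their pairwise determinants:
`y` lies between `x₁` and `e` or between `x₂` and `e` according to the sector of `x₁` and `x₂`
that contains it. -/
theorem sector_parity {u₁ u₂ v w y₁ y₂ : ℝ} (h1 : u₁ ≠ 0) (h2 : u₂ ≠ 0) (hv : v ≠ 0)
    (hp : w * v - y₁ * u₂ + u₁ * y₂ = 0) (hw : w = 0 → ¬ 0 < u₁ * u₂)
    (hy1 : y₁ = 0 → ¬ 0 < u₁ * v) (hy2 : y₂ = 0 → ¬ 0 < u₂ * v) :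
    ind (0 < v * u₁ ∧ 0 < y₁ * u₁) + ind (0 < v * u₂ ∧ 0 < y₂ * u₂) =
      ind (0 < u₂ * u₁ ∧ 0 < w * u₁) + ind (0 < u₂) +
        ind ((y₂ < 0 ∧ -y₁ < 0) ∨ (-y₁ < 0 ∧ w < 0) ∨ (w < 0 ∧ y₂ < 0)) := by
  obtain ⟨a, rfl⟩ : ∃ a, w = a * (u₁ * u₂) := ⟨w / (u₁ * u₂), by field_simp⟩
  obtain ⟨b, rfl⟩ : ∃ b, y₂ = b * (u₂ * v) := ⟨y₂ / (u₂ * v), by field_simp⟩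
  obtain ⟨c, rfl⟩ : ∃ c, y₁ = c * (u₁ * v) := ⟨y₁ / (u₁ * v), by field_simp⟩
  have hsum : a + b = c := by
    have : (a + b - c) * (u₁ * u₂ * v) = 0 := by linear_combination hp
    linarith [(mul_eq_zero.1 this).resolve_right (by positivity)]
  obtain ⟨s1, s2, s3⟩ := sign_sum_zero hsum
  apply ind_eq_of_iff
  rw [← sign_ne_zero] at h1 h2 hv
  rw [← sign_eq_zero_iff] at hw hy1 hy2
  simp only [← sign_eq_one_iff, ← sign_eq_neg_one_iff, sign_mul, Left.sign_neg] at *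
  generalize SignType.sign u₁ = x1 at *
  generalize SignType.sign u₂ = x2 at *
  generalize SignType.sign v = x3 at *
  generalize SignType.sign a = x4 at *
  generalize SignType.sign b = x5 at *
  generalize SignType.sign c = x6 at *
  clear hp hsum
  revert x1 x2 x3 x4 x5 x6
  decide

/-- The limit case of `sector_parity` at a corner with the directions `x₁`, `x₂`: the side of a
path, read off from its outgoing and from its incoming edge. -/
theorem corner_parity {u₁ u₂ w : ℝ} (h1 : u₁ ≠ 0) (h2 : u₂ ≠ 0)
    (hw : w = 0 → ¬ 0 < u₁ * u₂) :
    ind (0 < u₂ * u₁ ∧ 0 < w * u₁) + ind (0 < u₂) =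
      ind (0 < u₁ * u₂ ∧ 0 < -w * u₂) + ind (0 < -u₁) := by
  have := ind_eq_of_iff (a := 0 < u₂ * u₁ ∧ 0 < w * u₁) (b := 0 < u₂)
    (c := 0 < u₁ * u₂ ∧ 0 < -w * u₂) (d := 0 < -u₁) (f := False) ?_
  · rwa [ind_false id, add_zero] at this
  · rw [← sign_ne_zero] at h1 h2
    rw [← sign_eq_zero_iff] at hw
    simp only [← sign_eq_one_iff, sign_mul, Left.sign_neg] at *
    generalize SignType.sign u₁ = x1 at *
    generalize SignType.sign u₂ = x2 at *
    generalize SignType.sign w = x3 at *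
    revert x1 x2 x3
    decide

end Corner

section Sides

open scoped Classical

variable {L : Type*} [Fintype L] {A : L → L → Prop} {p : L → Space3} {e : Space3}
  {C J : L → L → Prop}

/-- The contribution of the arc `x x'` to the side of a point close to `d` in direction `y`:
whether that point lies above the arc, seen from the pole. -/
def arcSide (p : L → Space3) (e : Space3) (d y x x' : L) : ZMod 2 :=
  if x = d then (if x' = y then 0 else ind (InWedge (p d) (p x') e (p y)))
  else if x' = d then (if x = y then 0 else ind (InWedge (p d) (p x) e (p y)))
  else ind (InCone (p x) (p x') e (p d))

/-- The side of the closed curves `C` on which a point close to `d` in direction `y` lies: the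
number of arcs below that point, modulo two. -/
def curveSide (C : L → L → Prop) (p : L → Space3) (e : Space3) (d y : L) : ZMod 2 :=
  ∑ x, ∑ x', if C x x' then arcSide p e d y x x' else 0

theorem sum_sum_ite_out (hC : ∀ u v w, C u v → C u w → v = w) (f : L → ZMod 2) :
    (∑ x, ∑ x', if C x x' then f x else 0) = ∑ x, if ∃ x', C x x' then f x else 0 := by
  refine Finset.sum_congr rfl fun x _ => ?_
  by_cases hx : ∃ x', C x x'
  · rw [if_pos hx]
    obtain ⟨x', hx'⟩ := hx
    rw [Finset.sum_eq_single x', if_pos hx']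
    · intro y _ hy
      exact if_neg fun h => hy (hC _ _ _ h hx')
    · exact fun h => absurd (Finset.mem_univ _) h
  · rw [if_neg hx]
    exact Finset.sum_eq_zero fun y _ => if_neg fun h => hx ⟨y, h⟩

theorem sum_sum_ite_in (hC : ∀ u v w, C u w → C v w → u = v) (f : L → ZMod 2) :
    (∑ x, ∑ x', if C x x' then f x' else 0) = ∑ x', if ∃ x, C x x' then f x' else 0 := by
  rw [Finset.sum_comm]
  exact sum_sum_ite_out (C := fun x y => C y x) (fun u v w h h' => hC _ _ _ h h') f

namespace IsSphereGraph

/-- Both ends of an arc of the graph lie on the same side of a union of closed curves of the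
graph. -/
theorem curveSide_comm (h : IsSphereGraph A p e) (hC : IsCirculation C)
    (hCA : ∀ x y, C x y → A x y) {a y : L} (ha : A a y) :
    curveSide C p e a y = curveSide C p e y a := by
  have hay := h.ne ha
  have hya := h.symm _ _ ha
  -- `f x` tells whether `x` lies below the arc from `a` to `y`. Each arc of `C`
  -- contributes `f` of its two ends to the difference of the sides, and every vertex of `C` is
  -- an end of two of its arcs.
  let f : L → ZMod 2 := fun x => if x = a ∨ x = y then 0 else ind (InCone (p a) (p y) (-e) (p x))
  have hf : ∀ x, x ≠ a → x ≠ y → f x = ind (InCone (p a) (p y) (-e) (p x)) := fun x h1 h2 =>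
    if_neg (by tauto)
  have fa : f a = 0 := if_pos (Or.inl rfl)
  have fy : f y = 0 := if_pos (Or.inr rfl)
  have key : ∀ x x', C x x' → arcSide p e a y x x' + arcSide p e y a x x' = f x + f x' := by
    intro x x' hx
    have hxA := hCA _ _ hx
    have hne := h.ne hxA
    have hxA' := h.symm _ _ hxA
    unfold arcSide
    by_cases h1 : x = a
    · subst h1
      rw [if_pos rfl, if_neg hay, fa, zero_add]
      by_cases h2 : x' = y
      · subst h2
        rw [if_pos rfl, if_pos rfl, if_pos rfl, fy, add_zero]
      · rw [if_neg h2, if_neg h2, hf x' hne.symm h2]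
        exact h.ind_common hxA h2
    by_cases h2 : x = y
    · subst h2
      simp only [if_neg h1, if_true, fy, zero_add]
      by_cases h3 : x' = a
      · simp only [h3, if_true, fa, add_zero]
      · simp only [if_neg h3]
        rw [hf x' h3 hne.symm, ind_congr (inCone_comm (p a) (p x) (-e) _), add_comm]
        exact h.ind_common hxA h3
    simp only [if_neg h1, if_neg h2, hf x h1 h2]
    by_cases h3 : x' = a
    · subst h3
      simp only [if_true, if_neg hay, fa, add_zero]
      rw [ind_congr (inCone_comm (p x) (p x') e _)]
      exact h.ind_common hxA' h2
    by_cases h4 : x' = y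
    · subst h4
      simp only [if_neg h3, if_true, fy, add_zero]
      rw [ind_congr (inCone_comm (p x) (p x') e _), ind_congr (inCone_comm (p a) (p x') (-e) _),
        add_comm]
      exact h.ind_common hxA' h1
    simp only [if_neg h3, if_neg h4, hf x' h3 h4]
    exact h.ind_disjoint hxA ha (Ne.symm h1) (Ne.symm h3) (Ne.symm h2) (Ne.symm h4)
  have hsum : curveSide C p e a y + curveSide C p e y a =
      (∑ x, ∑ x', if C x x' then f x else 0) + ∑ x, ∑ x', if C x x' then f x' else 0 := by
    unfold curveSide
    rw [← Finset.sum_add_distrib, ← Finset.sum_add_distrib]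
    refine Finset.sum_congr rfl fun x _ => ?_
    rw [← Finset.sum_add_distrib, ← Finset.sum_add_distrib]
    refine Finset.sum_congr rfl fun x' _ => ?_
    by_cases hx : C x x'
    · simp only [if_pos hx]
      exact key x x' hx
    · simp only [if_neg hx]
  rw [sum_sum_ite_out hC.out_unique, sum_sum_ite_in hC.in_unique] at hsum
  have hio : ∀ x, (∃ x', C x x') ↔ ∃ x', C x' x := fun x =>
    ⟨fun ⟨w, hw⟩ => hC.in_of_out _ _ hw, fun ⟨w, hw⟩ => hC.out_of_in _ _ hw⟩
  simp only [hio, CharTwo.add_self_eq_zero] at hsum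
  exact CharTwo.add_eq_zero.1 hsum

/-- The side of `C` at a vertex `a` of `C`, towards `y`: the arcs of `C` that do not end at `a`
contribute a constant, and the other two depend on `y`. -/
theorem curveSide_eq_of_on (hC : IsCirculation C) {x₁ a x₂ : L} (h1 : C x₁ a) (h2 : C a x₂)
    (y : L) :
    curveSide C p e a y = (∑ x, ∑ x', if C x x' ∧ x ≠ a ∧ x' ≠ a then
        ind (InCone (p x) (p x') e (p a)) else 0) +
      (if x₁ = y then 0 else ind (InWedge (p a) (p x₁) e (p y))) +
      (if x₂ = y then 0 else ind (InWedge (p a) (p x₂) e (p y))) := by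
  have hs : ∀ (u v : L) (c : ZMod 2), (∑ x, ∑ x', if x = u ∧ x' = v then c else 0) = c := by
    intro u v c
    rw [Finset.sum_eq_single u, Finset.sum_eq_single v, if_pos ⟨rfl, rfl⟩]
    · exact fun b _ hb => if_neg fun hh => hb hh.2
    · exact fun hh => absurd (Finset.mem_univ _) hh
    · exact fun b _ hb => Finset.sum_eq_zero fun x' _ => if_neg fun hh => hb hh.1
    · exact fun hh => absurd (Finset.mem_univ _) hh
  conv_rhs => rw [← hs x₁ a (if x₁ = y then 0 else _), ← hs a x₂ (if x₂ = y then 0 else _)]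
  unfold curveSide
  rw [← Finset.sum_add_distrib, ← Finset.sum_add_distrib]
  refine Finset.sum_congr rfl fun x _ => ?_
  rw [← Finset.sum_add_distrib, ← Finset.sum_add_distrib]
  refine Finset.sum_congr rfl fun x' _ => ?_
  have hax := hC.ne _ _ h1
  by_cases hx : C x x'
  · simp only [if_pos hx, arcSide]
    by_cases g1 : x = a
    · have g2 : x' = x₂ := hC.out_unique _ _ _ hx (g1 ▸ h2)
      have g3 : ¬ (x = x₁ ∧ x' = a) := fun hh => hax (hh.1.symm.trans g1)
      simp only [g1, g2, ne_eq, not_true_eq_false, false_and, and_false, if_true, if_false, true_and,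
        hax.symm, zero_add]
    · by_cases g2 : x' = a
      · have g3 : x = x₁ := hC.in_unique _ _ _ hx (g2 ▸ h1)
        simp only [g3, g2, ne_eq, not_true_eq_false, and_false, if_true, if_false, and_true,
          hax, false_and, zero_add, add_zero]
      · simp only [g1, g2, ne_eq, not_false_eq_true, and_self, and_false, false_and, hx,
          if_true, if_false, add_zero]
  · have g1 : ¬ (x = x₁ ∧ x' = a) := fun hh => hx (hh.1 ▸ hh.2 ▸ h1)
    have g2 : ¬ (x = a ∧ x' = x₂) := fun hh => hx (hh.1 ▸ hh.2 ▸ h2)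
    simp only [hx, g1, g2, false_and, if_false, add_zero]

/-- Off the curves the side does not depend on the direction of `y`. -/
theorem curveSide_eq_of_off {d : L} (hd : ∀ x, ¬ C d x ∧ ¬ C x d) (y y' : L) :
    curveSide C p e d y = curveSide C p e d y' := by
  refine Finset.sum_congr rfl fun x _ => Finset.sum_congr rfl fun x' _ => ?_
  by_cases hx : C x x'
  · rw [if_pos hx, if_pos hx]
    have g1 : x ≠ d := by
      rintro rfl
      exact (hd _).1 hx
    have g2 : x' ≠ d := by
      rintro rfl
      exact (hd _).2 hx
    simp only [arcSide, if_neg g1, if_neg g2]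
  · rw [if_neg hx, if_neg hx]

/-- The left side of the oriented closed curves `C` near a vertex `a` of these curves. -/
def leftSide (C : L → L → Prop) (p : L → Space3) (e : Space3) (a : L) : ZMod 2 :=
  curveSide C p e a (circPerm C a) + ind (0 < det3 (p a) (p (circPerm C a)) e)

omit [Fintype L] in
theorem det_zero (h : IsSphereGraph A p e) {a x y : L} (hx : A a x) (hy : A a y) (hxy : x ≠ y) :
    det3 (p a) (p x) (p y) = 0 → ¬ 0 < det3 (p a) (p x) e * det3 (p a) (p y) e :=
  eq_of_det_zero (h.det_ne _ _ hx) (h.overlap _ _ _ hx hy hxy)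

theorem leftSide_eq (hC : IsCirculation C) {a x : L} (hx : C a x) :
    leftSide C p e a = curveSide C p e a x + ind (0 < det3 (p a) (p x) e) := by
  rw [leftSide, hC.circPerm_apply hx]

/-- The left side of `C`, read off from the incoming arc. -/
theorem leftSide_eq_in (h : IsSphereGraph A p e) (hC : IsCirculation C)
    (hanti : ∀ x y, C x y → ¬ C y x) (hCA : ∀ x y, C x y → A x y) {x₁ a : L} (h1 : C x₁ a) :
    leftSide C p e a = curveSide C p e a x₁ + ind (0 < det3 (p x₁) (p a) e) := by
  obtain ⟨x₂, h2⟩ := hC.out_of_in _ _ h1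
  have hne : x₁ ≠ x₂ := by
    rintro rfl
    exact hanti _ _ h1 h2
  have a1 := h.symm _ _ (hCA _ _ h1)
  have a2 := hCA _ _ h2
  rw [leftSide_eq hC h2, curveSide_eq_of_on hC h1 h2, curveSide_eq_of_on hC h1 h2, if_neg hne,
    if_pos rfl, if_pos rfl, if_neg hne.symm, add_zero, add_zero, add_assoc, add_assoc,
    ind_congr (inWedge_iff_det (h.det_ne _ _ a1) _), ind_congr (inWedge_iff_det (h.det_ne _ _ a2) _)]
  congr 1
  have e1 : det3 (p a) (p x₂) (p x₁) = -det3 (p a) (p x₁) (p x₂) := by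
    simp only [det3_eq]; ring
  rw [e1, det3_swap (p a) (p x₁)]
  exact corner_parity (h.det_ne _ _ a1) (h.det_ne _ _ a2) (h.det_zero a1 a2 hne)

/-- The left side is constant along the curves. -/
theorem leftSide_next (h : IsSphereGraph A p e) (hC : IsCirculation C)
    (hanti : ∀ x y, C x y → ¬ C y x) (hCA : ∀ x y, C x y → A x y) {a x : L} (hx : C a x) :
    leftSide C p e a = leftSide C p e x := by
  rw [leftSide_eq hC hx, h.leftSide_eq_in hC hanti hCA hx, h.curveSide_comm hC hCA (hCA _ _ hx)]

/-- The side towards which an arc leaves the curve `C` at the vertex `a`. -/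
theorem curveSide_eq_leftSide_add (h : IsSphereGraph A p e) (hC : IsCirculation C)
    (hanti : ∀ x y, C x y → ¬ C y x) (hCA : ∀ x y, C x y → A x y) {x₁ a x₂ y : L} (h1 : C x₁ a)
    (h2 : C a x₂) (hy : A a y) (hy1 : y ≠ x₁) (hy2 : y ≠ x₂) :
    curveSide C p e a y = leftSide C p e a + ind (IsLeftHanded (p a) (p x₂) (p y) (p x₁)) := by
  have hne : x₁ ≠ x₂ := by
    rintro rfl
    exact hanti _ _ h1 h2
  have a1 := h.symm _ _ (hCA _ _ h1)
  have a2 := hCA _ _ h2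
  rw [leftSide_eq hC h2, curveSide_eq_of_on hC h1 h2, curveSide_eq_of_on hC h1 h2, if_neg hne,
    if_pos rfl, if_neg hy1.symm, if_neg hy2.symm, add_zero, add_assoc, add_assoc, add_assoc,
    ind_congr (inWedge_iff_det (h.det_ne _ _ a1) _), ind_congr (inWedge_iff_det (h.det_ne _ _ a2) _),
    ind_congr (inWedge_iff_det (h.det_ne _ _ a1) _)]
  congr 1
  have e1 : det3 (p a) (p y) (p x₁) = -det3 (p a) (p x₁) (p y) := by
    simp only [det3_eq]; ring
  rw [IsLeftHanded, e1, ← add_assoc]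
  exact sector_parity (h.det_ne _ _ a1) (h.det_ne _ _ a2) (h.det_ne _ _ hy)
    (by linarith [det3_plucker (p a) (p x₁) (p x₂) (p y) e]) (h.det_zero a1 a2 hne)
    (h.det_zero a1 hy hy1.symm) (h.det_zero a2 hy hy2.symm)

/-- In a theta graph on the sphere, formed by a closed curve `C` and a path `J` from `b` to `a`
outside of it, the cyclic orders of the three arcs at `a` and `b` are opposite. -/
theorem isLeftHanded_iff (h : IsSphereGraph A p e) (hC : IsCirculation C)
    (hanti : ∀ x y, C x y → ¬ C y x) (hCA : ∀ x y, C x y → A x y)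
    (hconn : ∀ X : Set L, (∀ x y, C x y → (x ∈ X ↔ y ∈ X)) →
      ∀ x y x' y', C x x' → C y y' → x ∈ X → y ∈ X)
    (hJA : ∀ x y, J x y → A x y) (hJout : ∀ u v w, J u v → J u w → v = w)
    (hJin : ∀ u v w, J u w → J v w → u = v) (hJC : ∀ x y, J x y → ¬ C x y ∧ ¬ C y x)
    {a a₁ a₂ a₃ b b₁ b₂ b₃ : L} (ha1 : C a₁ a) (ha2 : C a a₂) (ha3 : J a₃ a)
    (hb1 : C b₁ b) (hb2 : C b b₂) (hb3 : J b b₃) (haJ : ∀ x, ¬ J a x) (hbJ : ∀ x, ¬ J x b)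
    (hJ : ∀ d, d ≠ a → d ≠ b → ((∃ x, J d x) ↔ ∃ x, J x d))
    (hJoff : ∀ d, d ≠ a → d ≠ b → (∃ x, J d x) → ∀ x, ¬ C d x ∧ ¬ C x d) :
    IsLeftHanded (p a) (p a₂) (p a₃) (p a₁) ↔ IsLeftHanded (p b) (p b₂) (p b₃) (p b₁) := by
  have hab : a ≠ b := by
    rintro rfl
    exact haJ _ hb3
  have hleft : leftSide C p e a = leftSide C p e b := by
    refine (hconn {x | leftSide C p e x = leftSide C p e a} (fun x y hxy => ?_) a b _ _ ha2 hb2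
      rfl).symm
    simp only [Set.mem_ofPred_eq, h.leftSide_next hC hanti hCA hxy]
  have sa := h.curveSide_eq_leftSide_add hC hanti hCA ha1 ha2 (h.symm _ _ (hJA _ _ ha3))
    (by rintro rfl; exact (hJC _ _ ha3).1 ha1) (by rintro rfl; exact (hJC _ _ ha3).2 ha2)
  have sb := h.curveSide_eq_leftSide_add hC hanti hCA hb1 hb2 (hJA _ _ hb3)
    (by rintro rfl; exact (hJC _ _ hb3).2 hb1) (by rintro rfl; exact (hJC _ _ hb3).1 hb2)
  suffices hs : curveSide C p e a a₃ = curveSide C p e b b₃ by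
    rw [sa, sb, hleft] at hs
    exact ind_eq_ind (add_left_cancel hs)
  -- The side does not change along the arcs of `J` nor, off `C`, at its vertices; summed over all
  -- arcs of `J`, the inner vertices contribute to both sums equally and only the ends remain.
  let F : L → ZMod 2 := fun x => if x = b then curveSide C p e b b₃ else curveSide C p e x x
  let F' : L → ZMod 2 := fun x => if x = a then curveSide C p e a a₃ else curveSide C p e x x
  have hF : ∀ x y, J x y → curveSide C p e x y = F x := by
    intro x y hxy
    by_cases hx : x = b
    · subst hx
      simp only [F, if_true, hJout _ _ _ hxy hb3]
    · have hxa : x ≠ a := by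
        rintro rfl
        exact haJ _ hxy
      simp only [F, if_neg hx]
      exact curveSide_eq_of_off (hJoff x hxa hx ⟨y, hxy⟩) _ _
  have hF' : ∀ x y, J x y → curveSide C p e y x = F' y := by
    intro x y hxy
    by_cases hy : y = a
    · subst hy
      simp only [F', if_true, hJin _ _ _ hxy ha3]
    · have hyb : y ≠ b := by
        rintro rfl
        exact hbJ _ hxy
      simp only [F', if_neg hy]
      exact curveSide_eq_of_off (hJoff y hy hyb ((hJ y hy hyb).2 ⟨x, hxy⟩)) _ _
  have e1 : (∑ x, ∑ y, if J x y then F x else 0) = ∑ x, ∑ y, if J x y then F' y else 0 := by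
    refine Finset.sum_congr rfl fun x _ => Finset.sum_congr rfl fun y _ => ?_
    by_cases hxy : J x y
    · rw [if_pos hxy, if_pos hxy, ← hF x y hxy, ← hF' x y hxy]
      exact h.curveSide_comm hC hCA (hJA _ _ hxy)
    · rw [if_neg hxy, if_neg hxy]
  rw [sum_sum_ite_out hJout, sum_sum_ite_in hJin] at e1
  have e2 : (∑ x, if ∃ y, J x y then F x else 0) = curveSide C p e b b₃ +
      ∑ x, if x ≠ a ∧ x ≠ b ∧ ∃ y, J x y then curveSide C p e x x else 0 := by
    rw [← Finset.sum_erase_add _ _ (Finset.mem_univ b),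
      ← Finset.sum_erase_add (Finset.univ : Finset L) (fun x => if x ≠ a ∧ x ≠ b ∧ ∃ y, J x y then
        curveSide C p e x x else 0) (Finset.mem_univ b), if_pos ⟨b₃, hb3⟩,
      if_neg (by tauto), add_zero, add_comm]
    congr 1
    · simp only [F, if_true]
    · refine Finset.sum_congr rfl fun x hx => ?_
      have hxb := Finset.ne_of_mem_erase hx
      by_cases hxJ : ∃ y, J x y
      · have hxa : x ≠ a := by
          rintro rfl
          exact haJ _ hxJ.choose_spec
        rw [if_pos hxJ, if_pos ⟨hxa, hxb, hxJ⟩]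
        simp only [F, if_neg hxb]
      · rw [if_neg hxJ, if_neg (by tauto)]
  have e3 : (∑ y, if ∃ x, J x y then F' y else 0) = curveSide C p e a a₃ +
      ∑ x, if x ≠ a ∧ x ≠ b ∧ ∃ y, J x y then curveSide C p e x x else 0 := by
    rw [← Finset.sum_erase_add _ _ (Finset.mem_univ a),
      ← Finset.sum_erase_add (Finset.univ : Finset L) (fun x => if x ≠ a ∧ x ≠ b ∧ ∃ y, J x y then
        curveSide C p e x x else 0) (Finset.mem_univ a), if_pos ⟨a₃, ha3⟩,
      if_neg (by tauto), add_zero, add_comm]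
    congr 1
    · simp only [F', if_true]
    · refine Finset.sum_congr rfl fun x hx => ?_
      have hxa := Finset.ne_of_mem_erase hx
      by_cases hxJ : ∃ y, J y x
      · have hxb : x ≠ b := by
          rintro rfl
          exact hbJ _ hxJ.choose_spec
        rw [if_pos hxJ, if_pos ⟨hxa, hxb, (hJ x hxa hxb).2 hxJ⟩]
        simp only [F', if_neg hxa]
      · rw [if_neg hxJ, if_neg]
        rintro ⟨-, hxb, hx⟩
        exact hxJ ((hJ x hxa hxb).1 hx)
  rw [e2, e3] at e1
  exact (add_right_cancel e1).symm

end IsSphereGraph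

end Sides

/-! ### The local structure of a foam -/

namespace GLFoam

variable {N : ℕ} {R : Type*} [CommRing R] (F : GLFoam N R)

/-- The vertices of the triangulation. -/
def Vert : Type := {v : Space3 // {v} ∈ F.K.faces}

theorem finite_triangle : Finite F.K.Triangle :=
  (F.finite.subset (fun _ ht => ht.1) :
    {t : Finset Space3 | t ∈ F.K.faces ∧ t.card = 3}.Finite).to_subtype

instance : Finite F.Vert := by
  have h : Set.InjOn (fun v : Space3 => ({v} : Finset Space3))
      ((fun v : Space3 => ({v} : Finset Space3)) ⁻¹' F.K.faces) :=
    fun _ _ _ _ h => Finset.singleton_injective h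
  exact (F.finite.preimage h).to_subtype

instance : Fintype F.Vert := Fintype.ofFinite _

instance : DecidableEq F.Vert := Classical.decEq _

/-- The vertices `u, v, w` form a triangle. -/
def IsTri (u v w : F.Vert) : Prop := F.K.IsTriangle u.1 v.1 w.1

variable {F}

theorem IsTri.swap {u v w : F.Vert} (h : F.IsTri u v w) : F.IsTri v u w := by
  unfold IsTri Complex3.IsTriangle at *
  rwa [Finset.insert_comm]

theorem IsTri.rot {u v w : F.Vert} (h : F.IsTri u v w) : F.IsTri v w u := by
  unfold IsTri Complex3.IsTriangle at *
  have : ({v.1, w.1, u.1} : Finset Space3) = {u.1, v.1, w.1} := by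
    ext x
    simp only [Finset.mem_insert, Finset.mem_singleton]
    tauto
  rwa [this]

theorem IsTri.swap_last {u v w : F.Vert} (h : F.IsTri u v w) : F.IsTri u w v := h.rot.rot.swap

theorem IsTri.ne {u v w : F.Vert} (h : F.IsTri u v w) : u ≠ v := by
  rintro rfl
  have h2 := h.2
  rw [Finset.insert_eq_of_mem (by simp)] at h2
  have := Finset.card_le_two (a := u.1) (b := w.1)
  omega

theorem IsTri.ne' {u v w : F.Vert} (h : F.IsTri u v w) : v ≠ w := h.rot.ne

theorem IsTri.ne'' {u v w : F.Vert} (h : F.IsTri u v w) : u ≠ w := h.swap_last.ne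

theorem IsTri.val_ne {u v w : F.Vert} (h : F.IsTri u v w) : u.1 ≠ v.1 :=
  fun e => h.ne (Subtype.ext e)

theorem IsTri.edge_mem {u v w : F.Vert} (h : F.IsTri u v w) :
    ({u.1, v.1} : Finset Space3) ∈ F.K.faces := by
  refine F.K.down_closed h.1 ?_ ⟨u.1, by simp⟩
  intro x
  simp only [Finset.mem_insert, Finset.mem_singleton]
  tauto

theorem singleton_mem_of_mem {s : Finset Space3} (hs : s ∈ F.K.faces) {x : Space3} (hx : x ∈ s) :
    ({x} : Finset Space3) ∈ F.K.faces :=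
  F.K.down_closed hs (by simpa using hx) ⟨x, by simp⟩

/-- A triangle with its vertices in a given order. -/
def IsTri.tri {u v w : F.Vert} (h : F.IsTri u v w) : F.K.Triangle := F.K.tri h

theorem exists_tri (t : F.K.Triangle) : ∃ (u v w : F.Vert) (h : F.IsTri u v w), h.tri = t := by
  obtain ⟨t, ht, h3⟩ := t
  obtain ⟨x, y, z, hxy, hxz, hyz, rfl⟩ := Finset.card_eq_three.1 h3
  exact ⟨⟨x, singleton_mem_of_mem ht (by simp)⟩, ⟨y, singleton_mem_of_mem ht (by simp)⟩,
    ⟨z, singleton_mem_of_mem ht (by simp)⟩, ⟨ht, h3⟩, rfl⟩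

theorem exists_apex {u v : F.Vert} (huv : u ≠ v) (t : F.K.Triangle)
    (ht : ({u.1, v.1} : Finset Space3) ⊆ t.1) : ∃ (w : F.Vert) (h : F.IsTri u v w), h.tri = t := by
  obtain ⟨t, htf, h3⟩ := t
  have hne : u.1 ≠ v.1 := fun h => huv (Subtype.ext h)
  have hc : (t \ {u.1, v.1}).card = 1 := by
    rw [Finset.card_sdiff_of_subset ht, h3, Finset.card_pair hne]
  obtain ⟨z, hz⟩ := Finset.card_eq_one.1 hc
  have hzt : z ∈ t := (Finset.mem_sdiff.1 (hz ▸ Finset.mem_singleton_self z)).1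
  have hte : t = {u.1, v.1, z} := by
    have ht' : ({u.1, v.1} : Finset Space3) ⊆ t := ht
    rw [← Finset.sdiff_union_of_subset ht', hz]
    ext x
    simp only [Finset.mem_union, Finset.mem_insert, Finset.mem_singleton]
    tauto
  subst hte
  exact ⟨⟨z, singleton_mem_of_mem htf hzt⟩, ⟨htf, h3⟩, rfl⟩

theorem tri_injective {u v w w' : F.Vert} (h : F.IsTri u v w) (h' : F.IsTri u v w')
    (he : h.tri = h'.tri) : w = w' := by
  have h1 : ({u.1, v.1, w.1} : Finset Space3) = {u.1, v.1, w'.1} := congrArg Subtype.val he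
  have hm : w.1 ∈ ({u.1, v.1, w'.1} : Finset Space3) := by rw [← h1]; simp
  simp only [Finset.mem_insert, Finset.mem_singleton] at hm
  rcases hm with hm | hm | hm
  · exact absurd (Subtype.ext hm).symm h.ne''
  · exact absurd (Subtype.ext hm).symm h.ne'
  · exact Subtype.ext hm

theorem tri_eq_of_set {u v w u' v' w' : F.Vert} (h : F.IsTri u v w) (h' : F.IsTri u' v' w')
    (he : ({u.1, v.1, w.1} : Finset Space3) = {u'.1, v'.1, w'.1}) : h.tri = h'.tri :=
  Subtype.ext he

theorem IsTri.tri_swap {u v w : F.Vert} (h : F.IsTri u v w) : h.swap.tri = h.tri :=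
  tri_eq_of_set _ _ (Finset.insert_comm _ _ _)

theorem IsTri.tri_rot {u v w : F.Vert} (h : F.IsTri u v w) : h.rot.tri = h.tri := by
  refine tri_eq_of_set _ _ ?_
  ext x
  simp only [Finset.mem_insert, Finset.mem_singleton]
  tauto

theorem edgeDegree_eq {u v : F.Vert} (huv : u ≠ v) :
    F.K.edgeDegree {u.1, v.1} = {w | F.IsTri u v w}.ncard := by
  symm
  refine Set.ncard_congr (fun w _ => {u.1, v.1, w.1}) ?_ ?_ ?_
  · intro w hw
    refine ⟨hw.1, hw.2, ?_⟩
    intro x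
    simp only [Finset.mem_insert, Finset.mem_singleton]
    tauto
  · intro w w' hw hw' he
    exact tri_injective hw hw' (Subtype.ext he)
  · rintro t ⟨ht, h3, hs⟩
    obtain ⟨w, hw, he⟩ := exists_apex huv ⟨t, ht, h3⟩ hs
    exact ⟨w, hw, congrArg Subtype.val he⟩

/-- The vertices of the link of `v`. -/
abbrev LinkVert (v : F.Vert) : Type :=
  {w : Space3 // w ≠ v.1 ∧ ({v.1, w} : Finset Space3) ∈ F.K.faces}

/-- A vertex of the link as a vertex of the triangulation. -/
def LinkVert.toVert {v : F.Vert} (x : LinkVert v) : F.Vert :=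
  ⟨x.1, singleton_mem_of_mem x.2.2 (by simp)⟩

theorem LinkVert.toVert_injective {v : F.Vert} {x y : LinkVert v} (h : LinkVert.toVert x = LinkVert.toVert y) :
    x = y := Subtype.ext (congrArg (fun z : F.Vert => z.1) h)

/-- A neighbour of `v` as a vertex of the link of `v`. -/
def IsTri.linkVert {v x y : F.Vert} (h : F.IsTri v x y) : LinkVert v := ⟨x.1, h.val_ne.symm, h.edge_mem⟩

theorem IsTri.toVert_linkVert {v x y : F.Vert} (h : F.IsTri v x y) : LinkVert.toVert h.linkVert = x := rfl

theorem link_adj {v : F.Vert} {x y : LinkVert v} :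
    (F.K.link v.1).Adj x y ↔ F.IsTri v (LinkVert.toVert x) (LinkVert.toVert y) := by
  rw [Complex3.link, SimpleGraph.fromRel_adj]
  have hcomm : ({v.1, y.1, x.1} : Finset Space3) = {v.1, x.1, y.1} := by
    rw [Finset.pair_comm]
  rw [hcomm, or_self]
  constructor
  · rintro ⟨hne, hf⟩
    refine ⟨hf, ?_⟩
    rw [Finset.card_eq_three]
    exact ⟨v.1, x.1, y.1, x.2.1.symm, y.2.1.symm, fun h => hne (Subtype.ext h), rfl⟩
  · intro h
    exact ⟨fun e => h.ne' (congrArg LinkVert.toVert e), h.1⟩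

theorem link_deg {v : F.Vert} (x : LinkVert v) :
    LinkGraph.deg (F.K.link v.1) x = {w | F.IsTri v (LinkVert.toVert x) w}.ncard := by
  refine Set.ncard_congr (fun w _ => LinkVert.toVert w) ?_ ?_ ?_
  · intro w hw
    exact link_adj.1 hw
  · intro w w' _ _ he
    exact LinkVert.toVert_injective he
  · intro w hw
    have h : F.IsTri v (LinkVert.toVert x) w := hw
    exact ⟨h.swap_last.linkVert, link_adj.2 h, rfl⟩

theorem isFoamLink (v : F.Vert) : LinkGraph.IsFoamLink (F.K.link v.1) := F.locallyFoam v.1 v.2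

theorem apex_ncard {u v x : F.Vert} (h : F.IsTri u v x) :
    {w | F.IsTri u v w}.ncard = 2 ∨ {w | F.IsTri u v w}.ncard = 3 := by
  have h1 := link_deg h.linkVert
  rw [h.toVert_linkVert] at h1
  rw [← h1]
  rcases F.isFoamLink u with hG | ⟨_, a, b, _, ha, hb, h2, _⟩ | ⟨_, q, _, h3, h2, _⟩
  · exact Or.inl (hG.2 _)
  · by_cases ea : h.linkVert = a
    · rw [ea]; exact Or.inr ha
    · by_cases eb : h.linkVert = b
      · rw [eb]; exact Or.inr hb
      · exact Or.inl (h2 _ ea eb)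
  · by_cases e : h.linkVert ∈ Set.range q
    · obtain ⟨m, hm⟩ := e
      rw [← hm]
      exact Or.inr (h3 m)
    · exact Or.inl (h2 _ e)

/-- The orientation of a triangle with ordered vertices. -/
def Pos (u v w : F.Vert) : Prop := F.orient u.1 v.1 w.1

theorem pos_rot {u v w : F.Vert} (h : F.IsTri u v w) : Pos v w u ↔ Pos u v w :=
  F.orient_rotate _ _ _ h

theorem pos_swap {u v w : F.Vert} (h : F.IsTri u v w) : Pos v u w ↔ ¬ Pos u v w :=
  F.orient_swap _ _ _ h

open scoped Classical in
/-- The colors of a triangle with ordered vertices. -/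
def col (c : F.Coloring) (u v w : F.Vert) : Finset (Fin N) :=
  if h : F.IsTri u v w then c.color h.tri else ∅

theorem col_eq (c : F.Coloring) {u v w : F.Vert} (h : F.IsTri u v w) :
    col c u v w = c.color h.tri := dif_pos h

theorem col_swap (c : F.Coloring) {u v w : F.Vert} (h : F.IsTri u v w) :
    col c v u w = col c u v w := by
  rw [col_eq c h, col_eq c h.swap, h.tri_swap]

theorem col_rot (c : F.Coloring) {u v w : F.Vert} (h : F.IsTri u v w) :
    col c v w u = col c u v w := by
  rw [col_eq c h, col_eq c h.rot, h.tri_rot]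

/-- A regular edge `u v`, with the two triangles that contain it. -/
structure IsRegularAt (F : GLFoam N R) (u v x y : F.Vert) : Prop where
  tx : F.IsTri u v x
  ty : F.IsTri u v y
  ne : x ≠ y
  all : ∀ z, F.IsTri u v z → z = x ∨ z = y
  col_eq : ∀ c : F.Coloring, col c u v y = col c u v x
  pos : Pos u v y ↔ ¬ Pos u v x

/-- A singular edge `u v`, with two thin triangles (at `a`, `b`) and a thick one (at `w`). -/
structure IsSingularAt (F : GLFoam N R) (u v a b w : F.Vert) : Prop where
  ta : F.IsTri u v a
  tb : F.IsTri u v b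
  tw : F.IsTri u v w
  ab : a ≠ b
  aw : a ≠ w
  bw : b ≠ w
  all : ∀ z, F.IsTri u v z → z = a ∨ z = b ∨ z = w
  disj : ∀ c : F.Coloring, Disjoint (col c u v a) (col c u v b)
  col_eq : ∀ c : F.Coloring, col c u v w = col c u v a ∪ col c u v b
  pos_b : Pos u v b ↔ Pos u v a
  pos_w : Pos u v w ↔ ¬ Pos u v a

theorem facetOf_eq_of_regular {u v x y : F.Vert} (hx : F.IsTri u v x) (hy : F.IsTri u v y)
    (h2 : {w | F.IsTri u v w}.ncard = 2) : F.K.facetOf hx.tri = F.K.facetOf hy.tri := by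
  refine Quot.sound ⟨{u.1, v.1}, ⟨hx.edge_mem, ?_, ?_⟩, ?_, ?_⟩
  · exact Finset.card_pair hx.val_ne
  · rw [edgeDegree_eq hx.ne, h2]
  · intro z
    change z ∈ ({u.1, v.1} : Finset Space3) → z ∈ ({u.1, v.1, x.1} : Finset Space3)
    simp only [Finset.mem_insert, Finset.mem_singleton]
    tauto
  · intro z
    change z ∈ ({u.1, v.1} : Finset Space3) → z ∈ ({u.1, v.1, y.1} : Finset Space3)
    simp only [Finset.mem_insert, Finset.mem_singleton]
    tauto

theorem isRegularAt_of_ncard {u v x y : F.Vert} (hx : F.IsTri u v x) (hy : F.IsTri u v y)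
    (hxy : x ≠ y) (h2 : {w | F.IsTri u v w}.ncard = 2) : IsRegularAt F u v x y where
  tx := hx
  ty := hy
  ne := hxy
  all z hz := by
    obtain ⟨a, b, hab, he⟩ := Set.ncard_eq_two.1 h2
    have m : ∀ z, F.IsTri u v z → z = a ∨ z = b := fun z hz => by
      have : z ∈ {w | F.IsTri u v w} := hz
      rwa [he] at this
    have h1 := m x hx
    have h3 := m y hy
    have h4 := m z hz
    rcases h1 with rfl | rfl <;> rcases h3 with rfl | rfl <;> rcases h4 with rfl | rfl <;> simp_all
  col_eq c := by
    rw [GLFoam.col_eq c hx, GLFoam.col_eq c hy, Coloring.color, Coloring.color,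
      facetOf_eq_of_regular hx hy h2]
  pos := by
    have := F.orient_coherent u.1 v.1 y.1 x.1
      ⟨hx.edge_mem, Finset.card_pair hx.val_ne, by rw [edgeDegree_eq hx.ne, h2]⟩ hy hx
      (fun e => hxy (Subtype.ext e).symm)
    exact this

/-- Every edge is regular or singular. -/
theorem edge_cases {u v x : F.Vert} (h : F.IsTri u v x) :
    (∃ y, IsRegularAt F u v x y) ∨ ∃ a b w, IsSingularAt F u v a b w := by
  rcases apex_ncard h with h2 | h3
  · left
    obtain ⟨y, hy, hxy⟩ := Set.exists_ne_of_one_lt_ncard (by omega : 1 < {w | F.IsTri u v w}.ncard) x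
    exact ⟨y, isRegularAt_of_ncard h hy hxy.symm h2⟩
  · right
    have hs : F.K.IsSingularEdge {u.1, v.1} :=
      ⟨h.edge_mem, Finset.card_pair h.val_ne, by rw [edgeDegree_eq h.ne, h3]⟩
    obtain ⟨a, b, w, ha, hb, hw, hab, haw, hbw, ht, o1, o2⟩ := F.seam u.1 v.1 hs
    have lift : ∀ z, F.K.IsTriangle u.1 v.1 z → ∃ z' : F.Vert, z'.1 = z := fun z hz =>
      ⟨⟨z, singleton_mem_of_mem hz.1 (by simp)⟩, rfl⟩
    obtain ⟨a, rfl⟩ := lift a ha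
    obtain ⟨b, rfl⟩ := lift b hb
    obtain ⟨w, rfl⟩ := lift w hw
    have hdc := fun c : F.Coloring => c.2.2 u.1 v.1 a.1 b.1 w.1 ha hb hw hs hab haw hbw ht
    have n1 : a ≠ b := fun e => hab (congrArg (fun z : F.Vert => z.1) e)
    have n2 : a ≠ w := fun e => haw (congrArg (fun z : F.Vert => z.1) e)
    have n3 : b ≠ w := fun e => hbw (congrArg (fun z : F.Vert => z.1) e)
    have ta : F.IsTri u v a := ha
    have tb : F.IsTri u v b := hb
    have tw : F.IsTri u v w := hw
    refine ⟨a, b, w, ta, tb, tw, n1, n2, n3, ?_, fun c => ?_, fun c => ?_, o1.symm, o2⟩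
    · intro z hz
      have hsub : ({a, b, w} : Set F.Vert) = {w | F.IsTri u v w} := by
        apply Set.eq_of_subset_of_ncard_le
        · rintro t (rfl | rfl | rfl)
          exacts [ta, tb, tw]
        · rw [h3, Set.ncard_insert_of_notMem (by
            rintro (h | h)
            exacts [n1 h, n2 h]), Set.ncard_pair n3]
        · exact Set.toFinite _
      have hz' : z ∈ {w | F.IsTri u v w} := hz
      rw [← hsub] at hz'
      exact hz'
    · rw [GLFoam.col_eq c ta, GLFoam.col_eq c tb]
      exact (hdc c).1
    · rw [GLFoam.col_eq c ta, GLFoam.col_eq c tb, GLFoam.col_eq c tw]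
      exact (hdc c).2

theorem IsSingularAt.ncard {u v a b w : F.Vert} (h : IsSingularAt F u v a b w) :
    {z | F.IsTri u v z}.ncard = 3 := by
  have : {z | F.IsTri u v z} = {a, b, w} := by
    ext z
    constructor
    · exact h.all z
    · rintro (rfl | rfl | rfl)
      exacts [h.ta, h.tb, h.tw]
  rw [this, Set.ncard_insert_of_notMem (by
    rintro (h' | h')
    exacts [h.ab h', h.aw h']), Set.ncard_pair h.bw]

end GLFoam

/-! ### The surfaces of a coloring -/

namespace GLFoam

variable {N : ℕ} {R : Type*} [CommRing R] {F : GLFoam N R}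

/-- A closed oriented surface formed by triangles of the foam. -/
structure IsClosedSurface (F : GLFoam N R) (O : F.Vert → F.Vert → F.Vert → Prop) : Prop where
  tri : ∀ {u v w}, O u v w → F.IsTri u v w
  rot : ∀ {u v w}, O u v w → O v w u
  uniq : ∀ {u v w w'}, O u v w → O u v w' → w = w'
  anti : ∀ {u v w}, O u v w → ¬ O v u w
  closed : ∀ {u v w}, O u v w → ∃ w', O v u w'

/-- The triangles of a surface. -/
def triangleSet (O : F.Vert → F.Vert → F.Vert → Prop) : Set F.K.Triangle :=
  {t | ∃ (u v w : F.Vert) (h : F.IsTri u v w), O u v w ∧ h.tri = t}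

/-- Every triangle of the foam, with its orientation and a multiplicity in `{-1, 0, 1}`, in such
a way that the boundary vanishes. -/
structure IsFlow (F : GLFoam N R) (g : F.Vert → F.Vert → F.Vert → ℤ) : Prop where
  tri : ∀ {u v w}, g u v w ≠ 0 → F.IsTri u v w
  swap : ∀ u v w, g v u w = - g u v w
  rot : ∀ u v w, g v w u = g u v w
  le : ∀ u v w, g u v w ≤ 1
  reg : ∀ {u v x y}, IsRegularAt F u v x y → g u v x + g u v y = 0
  sing : ∀ {u v a b w}, IsSingularAt F u v a b w → g u v a + g u v b + g u v w = 0

namespace IsFlow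

variable {g : F.Vert → F.Vert → F.Vert → ℤ}

theorem ge (hg : IsFlow F g) (u v w : F.Vert) : -1 ≤ g u v w := by
  have := hg.le v u w
  rw [hg.swap] at this
  omega

theorem swap_last (hg : IsFlow F g) (u v w : F.Vert) : g u w v = - g u v w := by
  rw [← hg.rot, ← hg.rot, hg.swap]

theorem cancel (hg : IsFlow F g) {u v x : F.Vert} (hx : g u v x = 1) :
    ∃ y, y ≠ x ∧ g u v y = -1 ∧ ∀ z, z ≠ x → z ≠ y → g u v z = 0 := by
  rcases edge_cases (hg.tri (by omega : g u v x ≠ 0)) with ⟨y, h⟩ | ⟨a, b, w, h⟩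
  · have := hg.reg h
    refine ⟨y, h.ne.symm, by omega, fun z h1 h2 => ?_⟩
    by_contra h0
    rcases h.all z (hg.tri h0) with h3 | h3
    exacts [h1 h3, h2 h3]
  · have hs := hg.sing h
    have hall : ∀ z, z ≠ a → z ≠ b → z ≠ w → g u v z = 0 := fun z h1 h2 h3 => by
      by_contra h0
      rcases h.all z (hg.tri h0) with h4 | h4 | h4
      exacts [h1 h4, h2 h4, h3 h4]
    have b1 := hg.ge u v a
    have b2 := hg.ge u v b
    have b3 := hg.ge u v w
    have c1 := hg.le u v a
    have c2 := hg.le u v b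
    have c3 := hg.le u v w
    have key : ∀ p q : F.Vert, g u v p + g u v q + g u v x = 0 → p ≠ x → q ≠ x → p ≠ q →
        -1 ≤ g u v p → -1 ≤ g u v q → g u v p ≤ 1 → g u v q ≤ 1 →
        (∀ z, z ≠ p → z ≠ q → z ≠ x → g u v z = 0) →
        ∃ y, y ≠ x ∧ g u v y = -1 ∧ ∀ z, z ≠ x → z ≠ y → g u v z = 0 := by
      intro p q h1 hp hq hpq k1 k2 k3 k4 hz
      by_cases h2 : g u v p = -1
      · refine ⟨p, hp, h2, fun z hx' hy => ?_⟩
        by_cases hzq : z = q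
        · subst hzq; omega
        · exact hz z hy hzq hx'
      · by_cases h3 : g u v q = -1
        · refine ⟨q, hq, h3, fun z hx' hy => ?_⟩
          by_cases hzq : z = p
          · subst hzq; omega
          · exact hz z hzq hy hx'
        · omega
    rcases h.all x (hg.tri (by omega : g u v x ≠ 0)) with rfl | rfl | rfl
    · exact key b w (by omega) h.ab.symm h.aw.symm h.bw b2 b3 c2 c3 fun z h1 h2 h3 =>
        hall z h3 h1 h2
    · exact key a w (by omega) h.ab h.bw.symm h.aw b1 b3 c1 c3 fun z h1 h2 h3 =>
        hall z h1 h3 h2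
    · exact key a b (by omega) h.aw h.bw h.ab b1 b2 c1 c2 fun z h1 h2 h3 => hall z h1 h2 h3

theorem isClosedSurface (hg : IsFlow F g) : IsClosedSurface F fun u v w => g u v w = 1 where
  tri h := hg.tri (by omega)
  rot h := by rw [hg.rot]; exact h
  uniq {u v w w'} h h' := by
    obtain ⟨y, hy, h1, h2⟩ := hg.cancel h
    by_contra hne
    by_cases e : w' = y
    · subst e; omega
    · have := h2 w' (Ne.symm hne) e
      omega
  anti h h' := by rw [hg.swap] at h'; omega
  closed h := by
    obtain ⟨y, _, h1, _⟩ := hg.cancel h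
    exact ⟨y, by rw [hg.swap]; omega⟩

/-- The triangles of nonzero multiplicity. -/
theorem mem_triangleSet (hg : IsFlow F g) {u v w : F.Vert} (h : F.IsTri u v w) :
    h.tri ∈ triangleSet (fun u v w => g u v w = 1) ↔ g u v w ≠ 0 := by
  have b1 := hg.ge u v w
  have c1 := hg.le u v w
  constructor
  · rintro ⟨u', v', w', h', h1, he⟩
    have hset : ({u'.1, v'.1, w'.1} : Finset Space3) = {u.1, v.1, w.1} := congrArg Subtype.val he
    have mem : ∀ x : F.Vert, x = u' ∨ x = v' ∨ x = w' → x = u ∨ x = v ∨ x = w := by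
      intro x hx
      have hx1 : x.1 ∈ ({u'.1, v'.1, w'.1} : Finset Space3) := by
        simp only [Finset.mem_insert, Finset.mem_singleton]
        rcases hx with rfl | rfl | rfl <;> simp
      rw [hset] at hx1
      simp only [Finset.mem_insert, Finset.mem_singleton] at hx1
      rcases hx1 with h | h | h
      exacts [Or.inl (Subtype.ext h), Or.inr (Or.inl (Subtype.ext h)),
        Or.inr (Or.inr (Subtype.ext h))]
    have n1 := h'.ne
    have n2 := h'.ne'
    have n3 := h'.ne''
    have s1 := hg.swap u v w
    have s2 := hg.rot u v w
    have s3 := hg.rot v w u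
    have s4 := hg.swap_last u v w
    have s5 := hg.rot v u w
    have s6 := hg.rot u w v
    have s7 := hg.rot w v u
    rcases mem u' (by simp) with e1 | e1 | e1 <;> rcases mem v' (by simp) with e2 | e2 | e2 <;>
      rcases mem w' (by simp) with e3 | e3 | e3 <;> rw [e1, e2, e3] at h1 <;>
      first
        | exact absurd (e1.trans e2.symm) n1
        | exact absurd (e2.trans e3.symm) n2
        | exact absurd (e1.trans e3.symm) n3
        | omega
  · intro h0
    by_cases h1 : g u v w = 1
    · exact ⟨u, v, w, h, h1, rfl⟩
    · exact ⟨v, u, w, h.swap, by change g v u w = 1; rw [hg.swap]; omega, h.tri_swap⟩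

end IsFlow

namespace IsClosedSurface

variable {O O' : F.Vert → F.Vert → F.Vert → Prop}

theorem isOrientedSurface (hO : IsClosedSurface F O) : IsOrientedSurface O where
  ne _ _ _ h := (hO.tri h).ne
  rot _ _ _ h := hO.rot h
  uniq _ _ _ _ h h' := hO.uniq h h'
  anti _ _ _ h := hO.anti h

/-- The link of a closed surface at a vertex. -/
theorem isTwoRegular (hO : IsClosedSurface F O) (v : F.Vert) :
    LinkGraph.IsTwoRegular (F.K.link v.1) fun x y =>
      O v (LinkVert.toVert x) (LinkVert.toVert y) ∨ O v (LinkVert.toVert y) (LinkVert.toVert x) where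
  symm x y h := h.symm
  adj x y h := by
    rcases h with h | h
    · exact link_adj.2 (hO.tri h)
    · exact (link_adj.2 (hO.tri h)).symm
  two := by
    have key : ∀ (x y : LinkVert v), O v (LinkVert.toVert x) (LinkVert.toVert y) →
        ∃ z : LinkVert v, z ≠ y ∧ O v (LinkVert.toVert z) (LinkVert.toVert x) := by
      intro x y h
      obtain ⟨z, hz⟩ := hO.closed h
      have hz' := hO.rot hz
      refine ⟨(hO.tri hz').linkVert, ?_, hz'⟩
      rintro rfl
      exact hO.anti h hz
    intro x y h
    rcases h with h | h
    · obtain ⟨z, hzy, hz⟩ := key x y h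
      refine ⟨z, hzy, Or.inr hz, ?_⟩
      rintro w (hw | hw)
      · exact Or.inl (LinkVert.toVert_injective (hO.uniq hw h))
      · exact Or.inr (LinkVert.toVert_injective (hO.uniq (hO.rot (hO.rot hw)) (hO.rot (hO.rot hz))))
    · have h' := hO.rot (hO.rot h)
      obtain ⟨z, hz⟩ := hO.closed h'
      refine ⟨(hO.tri hz).swap_last.linkVert, ?_, Or.inl hz, ?_⟩
      · rintro rfl
        exact hO.anti h' hz
      rintro w (hw | hw)
      · exact Or.inr (LinkVert.toVert_injective (hO.uniq hw hz))
      · exact Or.inl (LinkVert.toVert_injective (hO.uniq (hO.rot (hO.rot hw)) h'))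

theorem exists_out (hO : IsClosedSurface F O) {v x y : F.Vert} (h : O v x y) : ∃ z, O v y z := by
  obtain ⟨z, hz⟩ := hO.closed (hO.rot (hO.rot h))
  exact ⟨z, hz⟩

theorem exists_in (hO : IsClosedSurface F O) {v x y : F.Vert} (h : O v x y) : ∃ z, O v z x := by
  obtain ⟨z, hz⟩ := hO.closed h
  exact ⟨z, hO.rot hz⟩

/-- The link of a vertex in a closed surface is connected. -/
theorem mem_of_closed (hO : IsClosedSurface F O) {v : F.Vert} (X : Set F.Vert)
    (hX : ∀ x y, O v x y → (x ∈ X ↔ y ∈ X)) {x y z w : F.Vert} (hxy : O v x y) (hx : x ∈ X)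
    (hzw : O v z w) : z ∈ X := by
  have hxt := hO.tri hxy
  have hzt := hO.tri hzw
  exact (hO.isTwoRegular v).mem_of_closed (F.isFoamLink v) (LinkVert.toVert ⁻¹' X)
    (fun a b hab => by
      rcases hab with h | h
      · exact hX _ _ h
      · exact (hX _ _ h).symm)
    (x := hxt.linkVert) (y := hxt.swap_last.linkVert) (Or.inl hxy) hx
    (z := hzt.linkVert) (w := hzt.swap_last.linkVert) (Or.inl hzw)

/-- Two closed surfaces through a vertex have a common edge at this vertex. -/
theorem exists_common (hO : IsClosedSurface F O) (hO' : IsClosedSurface F O') {v x y x' y' : F.Vert}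
    (h : O v x y) (h' : O' v x' y') : ∃ z, (∃ w, O v z w) ∧ ∃ w, O' v z w := by
  have ht := hO.tri h
  have ht' := hO'.tri h'
  obtain ⟨z, ⟨w, hw⟩, ⟨w', hw'⟩⟩ := LinkGraph.IsTwoRegular.exists_common (F.isFoamLink v)
    (hO.isTwoRegular v) (hO'.isTwoRegular v)
    (x := ht.linkVert) (y := ht.swap_last.linkVert) (Or.inl h)
    (x' := ht'.linkVert) (y' := ht'.swap_last.linkVert) (Or.inl h')
  refine ⟨LinkVert.toVert z, ?_, ?_⟩
  · rcases hw with hw | hw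
    · exact ⟨_, hw⟩
    · exact hO.exists_out hw
  · rcases hw' with hw | hw
    · exact ⟨_, hw⟩
    · exact hO'.exists_out hw

end IsClosedSurface

/-! ### Euler characteristics -/

theorem isCirculation_empty {V : Type*} : IsCirculation fun _ _ : V => False :=
  ⟨fun _ _ h => h.elim, fun _ _ _ h => h.elim, fun _ _ _ h => h.elim, fun _ _ h => h.elim,
    fun _ _ h => h.elim⟩

theorem circleCount_empty {V : Type*} [Fintype V] [DecidableEq V] :
    circleCount (fun _ _ : V => False) = 0 := by
  have : circPerm (fun _ _ : V => False) = 1 := by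
    ext x
    rw [isCirculation_empty.circPerm_apply_of_not (by simp)]
    rfl
  rw [circleCount, this]
  simp

/-- The simplices of dimension `k - 1` of a union of triangles. -/
def simplices (F : GLFoam N R) (k : ℕ) (S : Set F.K.Triangle) : Set (Finset Space3) :=
  {s | s ∈ F.K.faces ∧ s.card = k ∧ ∃ t ∈ S, s ⊆ t.1}

theorem eulerChar_eq (S : Set F.K.Triangle) :
    F.K.eulerChar S = (simplices F 1 S).ncard - (simplices F 2 S).ncard + (simplices F 3 S).ncard :=
  rfl

theorem finite_simplices (k : ℕ) (S : Set F.K.Triangle) : (simplices F k S).Finite :=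
  F.finite.subset fun _ h => h.1

section

variable {O : F.Vert → F.Vert → F.Vert → Prop}

/-- The embedding of the vertices into space. -/
def valEmb (F : GLFoam N R) : F.Vert ↪ Space3 := ⟨Subtype.val, Subtype.val_injective⟩

theorem tri_subset_iff {u v w : F.Vert} (h : F.IsTri u v w) {s : Finset Space3} :
    s ⊆ h.tri.1 ↔ ∀ x ∈ s, x = u.1 ∨ x = v.1 ∨ x = w.1 := by
  refine forall_congr' fun x => ?_
  change (x ∈ s → x ∈ ({u.1, v.1, w.1} : Finset Space3)) ↔ _
  simp only [Finset.mem_insert, Finset.mem_singleton]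

theorem ncard_surfaceVertices (hO : IsOrientedSurface O) (ht : ∀ u v w, O u v w → F.IsTri u v w) :
    (surfaceVertices O).ncard = (simplices F 1 (triangleSet O)).ncard := by
  refine Set.ncard_congr (fun v _ => {v.1}) ?_ ?_ ?_
  · rintro v ⟨x, y, h⟩
    refine ⟨v.2, by simp, _, ⟨v, x, y, ht _ _ _ h, h, rfl⟩, ?_⟩
    rw [tri_subset_iff]
    simp
  · intro a b _ _ h
    exact Subtype.ext (Finset.singleton_injective h)
  · rintro s ⟨hs, h1, t, ⟨u, v, w, htri, h, rfl⟩, hst⟩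
    obtain ⟨x, rfl⟩ := Finset.card_eq_one.1 h1
    rw [tri_subset_iff] at hst
    rcases hst x (by simp) with rfl | rfl | rfl
    · exact ⟨u, ⟨v, w, h⟩, rfl⟩
    · exact ⟨v, ⟨w, u, hO.rot _ _ _ h⟩, rfl⟩
    · exact ⟨w, ⟨u, v, hO.rot _ _ _ (hO.rot _ _ _ h)⟩, rfl⟩

theorem ncard_surfaceEdges (hO : IsOrientedSurface O) (ht : ∀ u v w, O u v w → F.IsTri u v w) :
    (surfaceEdges O).ncard = (simplices F 2 (triangleSet O)).ncard := by
  refine Set.ncard_congr (fun e _ => e.map (valEmb F)) ?_ ?_ ?_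
  · rintro e ⟨u, v, ⟨w, h⟩, rfl⟩
    have h1 := ht _ _ _ h
    have hm : Finset.map (valEmb F) {u, v} = {u.1, v.1} := by
      rw [Finset.map_insert, Finset.map_singleton]
      rfl
    rw [hm]
    refine ⟨h1.edge_mem, Finset.card_pair h1.val_ne, _, ⟨u, v, w, h1, h, rfl⟩, ?_⟩
    rw [tri_subset_iff]
    simp only [Finset.mem_insert, Finset.mem_singleton]
    tauto
  · intro a b _ _ h
    exact Finset.map_injective _ h
  · rintro s ⟨hs, h1, t, ⟨u, v, w, htri, h, rfl⟩, hst⟩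
    obtain ⟨x, y, hxy, rfl⟩ := Finset.card_eq_two.1 h1
    rw [tri_subset_iff] at hst
    have h2 := hO.rot _ _ _ h
    have h3 := hO.rot _ _ _ h2
    have key : ∀ {p q r : F.Vert}, O p q r → ∃ e, ∃ _ : e ∈ surfaceEdges O,
        e.map (valEmb F) = {p.1, q.1} := by
      intro p q r h
      refine ⟨{p, q}, ⟨p, q, ⟨r, h⟩, rfl⟩, ?_⟩
      rw [Finset.map_insert, Finset.map_singleton]
      rfl
    rcases hst x (by simp) with rfl | rfl | rfl <;> rcases hst y (by simp) with rfl | rfl | rfl <;>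
      first
        | exact absurd rfl hxy
        | exact key h
        | exact key h2
        | exact key h3
        | (rw [Finset.pair_comm]; exact key h)
        | (rw [Finset.pair_comm]; exact key h2)
        | (rw [Finset.pair_comm]; exact key h3)

theorem ncard_surfaceTriangles (ht : ∀ u v w, O u v w → F.IsTri u v w) :
    (surfaceTriangles O).ncard = (simplices F 3 (triangleSet O)).ncard := by
  have hm : ∀ u v w : F.Vert, Finset.map (valEmb F) {u, v, w} = {u.1, v.1, w.1} := by
    intro u v w
    rw [Finset.map_insert, Finset.map_insert, Finset.map_singleton]
    rfl
  refine Set.ncard_congr (fun e _ => e.map (valEmb F)) ?_ ?_ ?_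
  · rintro e ⟨u, v, w, h, rfl⟩
    have h1 := ht _ _ _ h
    rw [hm]
    exact ⟨h1.1, h1.2, _, ⟨u, v, w, h1, h, rfl⟩, subset_rfl⟩
  · intro a b _ _ h
    exact Finset.map_injective _ h
  · rintro s ⟨hs, h1, t, ⟨u, v, w, htri, h, rfl⟩, hst⟩
    refine ⟨{u, v, w}, ⟨u, v, w, h, rfl⟩, ?_⟩
    rw [hm]
    exact (Finset.eq_of_subset_of_card_le hst (by rw [h1]; exact htri.2.le)).symm

/-- The parity of the Euler characteristic of a surface with boundary, as a union of triangles of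
the foam. -/
theorem even_eulerChar_add (hO : IsOrientedSurface O) (ht : ∀ u v w, O u v w → F.IsTri u v w)
    {B : F.Vert → F.Vert → Prop}
    (hB : IsCirculation B) (hBO : ∀ u v, B u v ↔ IsDart O u v ∧ ¬ IsDart O v u)
    (hconn : ∀ (v : F.Vert) (X : Set F.Vert), (∀ x y, O v x y → (x ∈ X ↔ y ∈ X)) →
      (∀ x y, B x v → B v y → (x ∈ X ↔ y ∈ X)) →
      ∀ x y, (IsDart O v x ∨ IsDart O x v) → (IsDart O v y ∨ IsDart O y v) → x ∈ X → y ∈ X) :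
    Even (F.K.eulerChar (triangleSet O) + circleCount B) := by
  have h := hO.even_euler hB hBO hconn
  rw [ncard_surfaceVertices hO ht, ncard_surfaceEdges hO ht, ncard_surfaceTriangles ht] at h
  rw [eulerChar_eq]
  obtain ⟨k, hk⟩ := h
  refine ⟨k - (simplices F 2 (triangleSet O)).ncard, ?_⟩
  omega

/-- The Euler characteristic of a closed oriented surface is even. -/
theorem IsClosedSurface.even_eulerChar (hO : IsClosedSurface F O) :
    Even (F.K.eulerChar (triangleSet O)) := by
  have hd : ∀ u v, IsDart O u v → IsDart O v u := fun u v ⟨w, h⟩ => hO.closed h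
  have h := even_eulerChar_add hO.isOrientedSurface (fun _ _ _ h => hO.tri h) isCirculation_empty
    (fun u v => ⟨fun h => h.elim, fun h => h.2 (hd _ _ h.1)⟩) ?_
  · simpa [circleCount_empty] using h
  · intro v X hX _ x y hx hy hxX
    have hx' : IsDart O v x := hx.elim id (hd _ _)
    have hy' : IsDart O v y := hy.elim id (hd _ _)
    obtain ⟨w, hw⟩ := hx'
    obtain ⟨w', hw'⟩ := hy'
    exact hO.mem_of_closed X hX hw hxX hw'

end

end GLFoam

/-! ### Seams -/

namespace GLFoam

variable {N : ℕ} {R : Type*} [CommRing R] {F : GLFoam N R}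

open scoped Classical in
/-- The triangle `u v w` has color `i`: with sign `1` if this order of the vertices agrees with
its orientation, with sign `-1` otherwise. -/
def eps (c : F.Coloring) (i : Fin N) (u v w : F.Vert) : ℤ :=
  if i ∈ col c u v w then (if Pos u v w then 1 else -1) else 0

theorem isTri_of_mem_col {c : F.Coloring} {i : Fin N} {u v w : F.Vert} (h : i ∈ col c u v w) :
    F.IsTri u v w := by
  by_contra hn
  rw [col, dif_neg hn] at h
  exact absurd h (Finset.notMem_empty i)

theorem isTri_of_eps {c : F.Coloring} {i : Fin N} {u v w : F.Vert} (h : eps c i u v w ≠ 0) :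
    F.IsTri u v w := by
  by_contra hn
  refine h (if_neg fun hm => hn (isTri_of_mem_col hm))

theorem eps_swap (c : F.Coloring) (i : Fin N) (u v w : F.Vert) :
    eps c i v u w = - eps c i u v w := by
  by_cases h : F.IsTri u v w
  · unfold eps
    rw [col_swap c h]
    have := pos_swap h
    split_ifs <;> simp_all
  · rw [not_ne_iff.1 (mt isTri_of_eps h), not_ne_iff.1 (mt isTri_of_eps fun h' => h h'.swap), neg_zero]

theorem eps_rot (c : F.Coloring) (i : Fin N) (u v w : F.Vert) :
    eps c i v w u = eps c i u v w := by
  by_cases h : F.IsTri u v w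
  · unfold eps
    rw [col_rot c h]
    have := pos_rot h
    split_ifs <;> simp_all
  · rw [not_ne_iff.1 (mt isTri_of_eps h), not_ne_iff.1 (mt isTri_of_eps fun h' => h h'.rot.rot)]

theorem eps_swap_last (c : F.Coloring) (i : Fin N) (u v w : F.Vert) :
    eps c i u w v = - eps c i u v w := by
  rw [← eps_rot, ← eps_rot, eps_swap]

theorem eps_mem (c : F.Coloring) (i : Fin N) (u v w : F.Vert) :
    eps c i u v w = 0 ∨ eps c i u v w = 1 ∨ eps c i u v w = -1 := by
  unfold eps
  split_ifs <;> simp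

/-- All colors of a triangle come with the same sign. -/
theorem eps_mul (c c' : F.Coloring) (i j : Fin N) (u v w : F.Vert) :
    0 ≤ eps c i u v w * eps c' j u v w := by
  unfold eps
  split_ifs <;> simp

theorem eps_sub_mem (c c' : F.Coloring) (i j : Fin N) (u v w : F.Vert) :
    eps c i u v w - eps c' j u v w = 0 ∨ eps c i u v w - eps c' j u v w = 1 ∨
      eps c i u v w - eps c' j u v w = -1 := by
  unfold eps
  split_ifs <;> simp

theorem eps_ne_zero_iff (c : F.Coloring) (i : Fin N) {u v w : F.Vert} (h : F.IsTri u v w) :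
    eps c i u v w ≠ 0 ↔ i ∈ c.color h.tri := by
  unfold eps
  rw [col_eq c h]
  split_ifs <;> simp [*]

theorem eps_reg (c : F.Coloring) (i : Fin N) {u v x y : F.Vert} (h : IsRegularAt F u v x y) :
    eps c i u v y = - eps c i u v x := by
  unfold eps
  rw [h.col_eq]
  have := h.pos
  split_ifs <;> simp_all

theorem eps_sing (c : F.Coloring) (i : Fin N) {u v a b w : F.Vert} (h : IsSingularAt F u v a b w) :
    eps c i u v a + eps c i u v b + eps c i u v w = 0 := by
  unfold eps
  rw [h.col_eq]
  have h1 := h.pos_b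
  have h2 := h.pos_w
  have hd : ¬ (i ∈ col c u v a ∧ i ∈ col c u v b) := fun hd =>
    Finset.disjoint_left.1 (h.disj c) hd.1 hd.2
  simp only [Finset.mem_union, h1, h2]
  by_cases k1 : Pos u v a <;> by_cases k2 : i ∈ col c u v a <;> by_cases k3 : i ∈ col c u v b <;>
    simp_all

theorem isFlow_eps (c : F.Coloring) (i : Fin N) : IsFlow F (eps c i) where
  tri := isTri_of_eps
  swap := eps_swap c i
  rot := eps_rot c i
  le u v w := by rcases eps_mem c i u v w with h | h | h <;> omega
  reg h := by rw [eps_reg c i h]; ring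
  sing h := eps_sing c i h

theorem isFlow_sub (c : F.Coloring) (i j : Fin N) :
    IsFlow F fun u v w => eps c i u v w - eps c j u v w where
  tri {u v w} h := by
    by_contra hn
    rw [not_ne_iff.1 (mt isTri_of_eps hn), not_ne_iff.1 (mt isTri_of_eps hn)] at h
    exact h rfl
  swap u v w := by rw [eps_swap, eps_swap c j]; ring
  rot u v w := by rw [eps_rot, eps_rot c j]
  le u v w := by rcases eps_sub_mem c c i j u v w with h | h | h <;> omega
  reg h := by rw [eps_reg c i h, eps_reg c j h]; ring
  sing h := by
    have h1 := eps_sing c i h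
    have h2 := eps_sing c j h
    linarith

/-- Along the directed edge `u v`, oriented as boundary of the thin facets, a triangle with the
color `i` only, a triangle with the color `j` only, and a triangle with both colors meet (with
apices `a`, `b`, `w`). -/
structure SeamAt (c : F.Coloring) (i j : Fin N) (u v a b w : F.Vert) : Prop where
  ia : eps c i u v a = 1
  ja : eps c j u v a = 0
  ib : eps c i u v b = 0
  jb : eps c j u v b = 1
  iw : eps c i u v w = -1
  jw : eps c j u v w = -1

/-- The directed edges along which the colors `i` and `j` meet. -/
def Seam (c : F.Coloring) (i j : Fin N) (u v : F.Vert) : Prop := ∃ a b w, SeamAt c i j u v a b w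

variable {c : F.Coloring} {i j : Fin N}

theorem IsFlow.eq_of_eq_one {g : F.Vert → F.Vert → F.Vert → ℤ} (hg : IsFlow F g)
    {u v x y : F.Vert} (hx : g u v x = 1) (hy : g u v y = 1) : x = y :=
  hg.isClosedSurface.uniq hx hy

theorem IsFlow.eq_of_eq_neg_one {g : F.Vert → F.Vert → F.Vert → ℤ} (hg : IsFlow F g)
    {u v x y : F.Vert} (hx : g u v x = -1) (hy : g u v y = -1) : x = y :=
  hg.isClosedSurface.uniq (u := v) (v := u) (by rw [hg.swap, hx, neg_neg])
    (by rw [hg.swap, hy, neg_neg])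

theorem SeamAt.eq (h : SeamAt c i j u v a b w) {a' b' w' : F.Vert}
    (h' : SeamAt c i j u v a' b' w') : a' = a ∧ b' = b ∧ w' = w :=
  ⟨(isFlow_eps c i).eq_of_eq_one h'.ia h.ia, (isFlow_eps c j).eq_of_eq_one h'.jb h.jb,
    (isFlow_eps c i).eq_of_eq_neg_one h'.iw h.iw⟩

theorem SeamAt.symm {u v a b w : F.Vert} (h : SeamAt c i j u v a b w) : SeamAt c j i u v b a w :=
  ⟨h.jb, h.ib, h.ja, h.ia, h.jw, h.iw⟩

theorem seam_comm {u v : F.Vert} : Seam c i j u v ↔ Seam c j i u v :=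
  ⟨fun ⟨_, _, _, h⟩ => ⟨_, _, _, h.symm⟩, fun ⟨_, _, _, h⟩ => ⟨_, _, _, h.symm⟩⟩

theorem SeamAt.eq_zero {u v a b w z : F.Vert} (h : SeamAt c i j u v a b w) (ha : z ≠ a)
    (hb : z ≠ b) (hw : z ≠ w) : eps c i u v z = 0 ∧ eps c j u v z = 0 := by
  constructor
  · rcases eps_mem c i u v z with h1 | h1 | h1
    · exact h1
    · exact absurd ((isFlow_eps c i).eq_of_eq_one h1 h.ia) ha
    · exact absurd ((isFlow_eps c i).eq_of_eq_neg_one h1 h.iw) hw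
  · rcases eps_mem c j u v z with h1 | h1 | h1
    · exact h1
    · exact absurd ((isFlow_eps c j).eq_of_eq_one h1 h.jb) hb
    · exact absurd ((isFlow_eps c j).eq_of_eq_neg_one h1 h.jw) hw

theorem SeamAt.ne {u v a b w : F.Vert} (h : SeamAt c i j u v a b w) : a ≠ b ∧ a ≠ w ∧ b ≠ w := by
  have h1 := h.ia
  have h2 := h.ib
  have h3 := h.iw
  refine ⟨?_, ?_, ?_⟩ <;> rintro rfl <;> omega

theorem SeamAt.ncard {u v a b w : F.Vert} (h : SeamAt c i j u v a b w) :
    {z | F.IsTri u v z}.ncard = 3 := by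
  have ta : F.IsTri u v a := isTri_of_eps (c := c) (i := i) (by rw [h.ia]; omega)
  obtain ⟨n1, n2, n3⟩ := h.ne
  rcases edge_cases ta with ⟨y, hr⟩ | ⟨a', b', w', hs⟩
  · have h2 := hr.all b (isTri_of_eps (c := c) (i := j) (by rw [h.jb]; omega))
    have h3 := hr.all w (isTri_of_eps (c := c) (i := j) (by rw [h.jw]; omega))
    rcases h2 with h2 | h2
    · exact absurd h2.symm n1
    · rcases h3 with h3 | h3
      · exact absurd h3.symm n2
      · exact absurd (h2.trans h3.symm) n3
  · exact hs.ncard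

/-- The colors `i` and `j` near an edge: either the edge is a seam, or there are two triangles
with the same colors among `i, j` and opposite signs, and the other triangles have neither color. -/
theorem edge_pair (c : F.Coloring) (i j : Fin N) {u v t : F.Vert} (h : F.IsTri u v t) :
    Seam c i j u v ∨ Seam c i j v u ∨ ∃ x y, F.IsTri u v x ∧ F.IsTri u v y ∧
      x ≠ y ∧ eps c i u v y = - eps c i u v x ∧
      eps c j u v y = - eps c j u v x ∧
      ∀ z, z ≠ x → z ≠ y → eps c i u v z = 0 ∧ eps c j u v z = 0 := by
  have hz0 : ∀ z, ¬ F.IsTri u v z → eps c i u v z = 0 ∧ eps c j u v z = 0 := fun z hz =>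
    ⟨not_ne_iff.1 (mt isTri_of_eps hz), not_ne_iff.1 (mt isTri_of_eps hz)⟩
  rcases edge_cases h with ⟨y, hr⟩ | ⟨a, b, w, hs⟩
  · refine Or.inr (Or.inr ⟨t, y, hr.tx, hr.ty, hr.ne, eps_reg c i hr, eps_reg c j hr,
      fun z h1 h2 => hz0 z fun hz => ?_⟩)
    rcases hr.all z hz with h3 | h3
    exacts [h1 h3, h2 h3]
  · have si := eps_sing c i hs
    have sj := eps_sing c j hs
    have hall : ∀ z, z ≠ a → z ≠ b → z ≠ w → eps c i u v z = 0 ∧ eps c j u v z = 0 :=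
      fun z h1 h2 h3 => hz0 z fun hz => by
        rcases hs.all z hz with h4 | h4 | h4
        exacts [h1 h4, h2 h4, h3 h4]
    have hseam : ∀ {a b w : F.Vert}, SeamAt c i j u v a b w → Seam c i j u v :=
      fun h => ⟨_, _, _, h⟩
    have hseam' : ∀ {a b w : F.Vert}, eps c i u v a = -1 → eps c j u v a = 0 →
        eps c i u v b = 0 → eps c j u v b = -1 → eps c i u v w = 1 → eps c j u v w = 1 →
        Seam c i j v u := by
      intro a b w h1 h2 h3 h4 h5 h6
      refine ⟨a, b, w, ?_, ?_, ?_, ?_, ?_, ?_⟩ <;> rw [eps_swap] <;> omega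
    by_cases za : eps c i u v a = 0 ∧ eps c j u v a = 0
    · refine Or.inr (Or.inr ⟨b, w, hs.tb, hs.tw, hs.bw, by omega, by omega, fun z h1 h2 => ?_⟩)
      by_cases e : z = a
      · rw [e]; exact za
      · exact hall z e h1 h2
    by_cases zb : eps c i u v b = 0 ∧ eps c j u v b = 0
    · refine Or.inr (Or.inr ⟨a, w, hs.ta, hs.tw, hs.aw, by omega, by omega, fun z h1 h2 => ?_⟩)
      by_cases e : z = b
      · rw [e]; exact zb
      · exact hall z h1 e h2
    by_cases zw : eps c i u v w = 0 ∧ eps c j u v w = 0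
    · refine Or.inr (Or.inr ⟨a, b, hs.ta, hs.tb, hs.ab, by omega, by omega, fun z h1 h2 => ?_⟩)
      by_cases e : z = w
      · rw [e]; exact zw
      · exact hall z h1 h2 e
    have hfin : ∀ p q r : F.Vert,
        eps c i u v p + eps c i u v q + eps c i u v r = 0 →
        eps c j u v p + eps c j u v q + eps c j u v r = 0 →
        ((eps c i u v p = 1 ∨ eps c i u v p = -1) ∧ eps c j u v p = 0) →
        (eps c i u v q = 0 ∧ (eps c j u v q = 1 ∨ eps c j u v q = -1)) →
        (eps c i u v r = eps c j u v r) →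
        (Seam c i j u v ∨ Seam c i j v u) := by
      rintro p q r h1 h2 ⟨h3, h4⟩ ⟨h5, h6⟩ h7
      rcases h3 with h3 | h3
      · exact Or.inl (hseam (a := p) (b := q) (w := r) ⟨h3, h4, h5, by omega, by omega, by omega⟩)
      · exact Or.inr (hseam' (a := p) (b := q) (w := r) h3 h4 h5 (by omega) (by omega) (by omega))
    rw [← or_assoc]
    left
    have st : ∀ z, ¬ (eps c i u v z = 0 ∧ eps c j u v z = 0) →
        ((eps c i u v z = 1 ∨ eps c i u v z = -1) ∧ eps c j u v z = 0) ∨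
        (eps c i u v z = 0 ∧ (eps c j u v z = 1 ∨ eps c j u v z = -1)) ∨
        (eps c i u v z = eps c j u v z ∧ (eps c i u v z = 1 ∨ eps c i u v z = -1)) := by
      intro z hz
      have m1 := eps_mem c i u v z
      have m2 := eps_mem c j u v z
      have m3 := eps_sub_mem c c i j u v z
      omega
    have ca := st a za
    have cb := st b zb
    have cw := st w zw
    clear st za zb zw hseam hseam' hall
    rcases ca with ca | ca | ca
    · rcases cb with cb | cb | cb
      · exfalso; omega
      · exact hfin a b w (by omega) (by omega) ca cb (by omega)
      · exact hfin a w b (by omega) (by omega) ca (by omega) cb.1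
    · rcases cb with cb | cb | cb
      · exact hfin b a w (by omega) (by omega) cb ca (by omega)
      · exfalso; omega
      · exact hfin w a b (by omega) (by omega) (by omega) ca cb.1
    · rcases cb with cb | cb | cb
      · exact hfin b w a (by omega) (by omega) cb (by omega) ca.1
      · exact hfin w b a (by omega) (by omega) (by omega) cb ca.1
      · exfalso; omega

/-- Transport along an arc of the link of `v` between two singular edges at `v`. -/
theorem exists_transport {v x y : F.Vert} (hx : {z | F.IsTri v x z}.ncard = 3)
    (hy : {z | F.IsTri v y z}.ncard = 3) (hxy : x ≠ y) :
    ∃ x' y', F.IsTri v x x' ∧ ∀ (c : F.Coloring) (i : Fin N), eps c i v y y' = - eps c i v x x' := by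
  have hne : ∀ {x : F.Vert}, {z | F.IsTri v x z}.ncard = 3 → ∃ z, F.IsTri v x z := by
    intro x hx
    have : {z | F.IsTri v x z}.Nonempty := by
      rw [← Set.ncard_pos]
      omega
    exact this
  obtain ⟨zx, tx⟩ := hne hx
  obtain ⟨zy, ty⟩ := hne hy
  have hdx : LinkGraph.deg (F.K.link v.1) tx.linkVert = 3 := by
    rw [link_deg]; exact hx
  have hdy : LinkGraph.deg (F.K.link v.1) ty.linkVert = 3 := by
    rw [link_deg]; exact hy
  have hab : tx.linkVert ≠ ty.linkVert := fun h => hxy (congrArg LinkVert.toVert h)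
  obtain ⟨p, hp⟩ := (F.isFoamLink v).exists_arc hdx hdy hab
  have key : ∀ (a b : LinkVert v) (p : (F.K.link v.1).Walk a b), LinkGraph.IsArc p → a ≠ b →
      ∃ x' y', F.IsTri v (LinkVert.toVert a) x' ∧ ∀ (c : F.Coloring) (i : Fin N),
        eps c i v (LinkVert.toVert b) y' = - eps c i v (LinkVert.toVert a) x' := by
    intro a b p hp hab
    cases p with
    | nil => exact absurd rfl hab
    | @cons _ x₁ _ h p =>
      obtain ⟨y₁, h1, h2⟩ := hp.propagate (fun a' b' => ∀ (c : F.Coloring) (i : Fin N),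
        eps c i v (LinkVert.toVert a') (LinkVert.toVert b') =
          eps c i v (LinkVert.toVert a) (LinkVert.toVert x₁)) (by
          intro a' b' d hab hbd had hdeg hQ c i
          rw [← hQ c i]
          have t1 := (link_adj.1 hab).swap_last
          have t2 := link_adj.1 hbd
          rw [link_deg] at hdeg
          have hr := isRegularAt_of_ncard t1 t2 (fun e => had (LinkVert.toVert_injective e)) hdeg
          rw [eps_reg c i hr, eps_swap_last, neg_neg]) (fun _ _ => rfl)
      refine ⟨LinkVert.toVert x₁, LinkVert.toVert y₁, link_adj.1 h, fun c i => ?_⟩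
      rw [← h2 c i, eps_swap_last]
  exact key _ _ p hp hab

theorem Seam.tri {u v : F.Vert} (h : Seam c i j u v) : ∃ w, F.IsTri u v w := by
  obtain ⟨a, b, w, h⟩ := h
  exact ⟨a, isTri_of_eps (c := c) (i := i) (by rw [h.ia]; omega)⟩

theorem SeamAt.values {u v a b w : F.Vert} (h : SeamAt c i j u v a b w) (z : F.Vert) :
    (eps c i u v z = 1 ∧ eps c j u v z = 0) ∨ (eps c i u v z = 0 ∧ eps c j u v z = 1) ∨
      (eps c i u v z = -1 ∧ eps c j u v z = -1) ∨ (eps c i u v z = 0 ∧ eps c j u v z = 0) := by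
  by_cases h1 : z = a
  · rw [h1]; exact Or.inl ⟨h.ia, h.ja⟩
  by_cases h2 : z = b
  · rw [h2]; exact Or.inr (Or.inl ⟨h.ib, h.jb⟩)
  by_cases h3 : z = w
  · rw [h3]; exact Or.inr (Or.inr (Or.inl ⟨h.iw, h.jw⟩))
  · exact Or.inr (Or.inr (Or.inr (h.eq_zero h1 h2 h3)))

theorem SeamAt.nonzero {u v a b w z : F.Vert} (h : SeamAt c i j u v a b w) (hz : F.IsTri u v z) :
    eps c i u v z ≠ 0 ∨ eps c j u v z ≠ 0 := by
  obtain ⟨n1, n2, n3⟩ := h.ne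
  have hmem : z ∈ ({a, b, w} : Set F.Vert) := by
    have hsub : ({a, b, w} : Set F.Vert) = {z | F.IsTri u v z} := by
      apply Set.eq_of_subset_of_ncard_le
      · rintro t (rfl | rfl | rfl)
        · exact isTri_of_eps (c := c) (i := i) (by rw [h.ia]; omega)
        · exact isTri_of_eps (c := c) (i := j) (by rw [h.jb]; omega)
        · exact isTri_of_eps (c := c) (i := i) (by rw [h.iw]; omega)
      · rw [h.ncard, Set.ncard_insert_of_notMem (by
          rintro (h | h)
          exacts [n1 h, n2 h]), Set.ncard_pair n3]
      · exact Set.toFinite _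
    rw [hsub]
    exact hz
  have h1 := h.ia
  have h2 := h.jb
  have h3 := h.iw
  rcases hmem with rfl | rfl | rfl <;> omega

end GLFoam

/-! ### The links of the vertices as graphs on the sphere -/

namespace GLFoam

variable {N : ℕ} {R : Type*} [CommRing R] {F : GLFoam N R}

theorem add_smul_add_smul_mem {C : Set Space3} (hC : Convex ℝ C) {v x y : Space3} (hv : v ∈ C)
    (hx : x ∈ C) (hy : y ∈ C) {a b : ℝ} (ha : 0 ≤ a) (hb : 0 ≤ b) (hab : a + b ≤ 1) :
    v + (a • (x - v) + b • (y - v)) ∈ C := by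
  have h := hC.sum_mem (t := (Finset.univ : Finset (Fin 3))) (w := ![1 - a - b, a, b])
    (z := ![v, x, y]) (by intro i _; fin_cases i <;> simp <;> linarith)
    (by simp [Fin.sum_univ_three]; ring) (by intro i _; fin_cases i <;> simpa)
  rw [Fin.sum_univ_three] at h
  convert h using 1
  simp
  module

/-- The cones at `v` over two simplices that have only the vertex `v` in common meet in `0`. -/
theorem cone_inter {S T : Finset Space3} (hS : S ∈ F.K.faces) (hT : T ∈ F.K.faces)
    {v x y x' y' : Space3} (hvS : v ∈ S) (hxS : x ∈ S) (hyS : y ∈ S) (hvT : v ∈ T) (hxT : x' ∈ T)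
    (hyT : y' ∈ T) (hST : ∀ z ∈ S, z ∈ T → z = v) {s t u w : ℝ} (hs : 0 ≤ s) (ht : 0 ≤ t)
    (hu : 0 ≤ u) (hw : 0 ≤ w)
    (he : s • (x - v) + t • (y - v) = u • (x' - v) + w • (y' - v)) :
    s • (x - v) + t • (y - v) = 0 := by
  set δ : ℝ := 1 / (1 + s + t + u + w) with hδ
  have hpos : 0 < 1 + s + t + u + w := by linarith
  have hδ0 : 0 < δ := by positivity
  have hδ1 : δ * (1 + s + t + u + w) = 1 := by
    rw [hδ]; field_simp
  have hP : v + δ • (s • (x - v) + t • (y - v)) ∈ convexHull ℝ (S : Set Space3) := by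
    rw [smul_add, smul_smul, smul_smul]
    exact add_smul_add_smul_mem (convex_convexHull ℝ _) (subset_convexHull ℝ _ hvS)
      (subset_convexHull ℝ _ hxS) (subset_convexHull ℝ _ hyS) (by positivity) (by positivity)
      (by nlinarith)
  have hP' : v + δ • (s • (x - v) + t • (y - v)) ∈ convexHull ℝ (T : Set Space3) := by
    rw [he, smul_add, smul_smul, smul_smul]
    exact add_smul_add_smul_mem (convex_convexHull ℝ _) (subset_convexHull ℝ _ hvT)
      (subset_convexHull ℝ _ hxT) (subset_convexHull ℝ _ hyT) (by positivity) (by positivity)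
      (by nlinarith)
  have h := F.K.inter_subset_convexHull hS hT ⟨hP, hP'⟩
  have hsub : ((S : Set Space3) ∩ T) ⊆ {v} := fun z hz => hST z hz.1 hz.2
  have h1 := convexHull_mono (𝕜 := ℝ) hsub h
  rw [convexHull_singleton, Set.mem_singleton_iff, add_eq_left, smul_eq_zero] at h1
  exact h1.resolve_left hδ0.ne'

theorem IsTri.smul_eq_zero {v x y : F.Vert} (h : F.IsTri v x y) {s t : ℝ}
    (he : s • (x.1 - v.1) + t • (y.1 - v.1) = 0) : s = 0 ∧ t = 0 := by
  have hi := F.K.indep h.1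
  rw [affineIndependent_iff] at hi
  have n1 : v.1 ≠ x.1 := h.val_ne
  have n2 : x.1 ≠ y.1 := h.rot.val_ne
  have n3 : v.1 ≠ y.1 := h.swap_last.val_ne
  classical
  let f : Space3 → ℝ := fun z => if z = x.1 then s else if z = y.1 then t else -(s + t)
  have fx : f x.1 = s := by simp [f]
  have fy : f y.1 = t := by simp [f, n2.symm]
  have fv : f v.1 = -(s + t) := by simp [f, n1, n3]
  have h1 : v.1 ∉ ({x.1, y.1} : Finset Space3) := by simp [n1, n3]
  have h2 : x.1 ∉ ({y.1} : Finset Space3) := by simp [n2]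
  have key := hi Finset.univ (fun z => f z.1) (by
    rw [Finset.sum_coe_sort ({v.1, x.1, y.1} : Finset Space3) f, Finset.sum_insert h1,
      Finset.sum_insert h2, Finset.sum_singleton, fx, fy, fv]
    ring) (by
    rw [Finset.sum_coe_sort ({v.1, x.1, y.1} : Finset Space3) (fun z => f z • z),
      Finset.sum_insert h1, Finset.sum_insert h2, Finset.sum_singleton, fx, fy, fv, ← he]
    module)
  have kx := key ⟨x.1, by simp⟩ (Finset.mem_univ _)
  have ky := key ⟨y.1, by simp⟩ (Finset.mem_univ _)
  exact ⟨fx.symm.trans kx, fy.symm.trans ky⟩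

/-- A direction outside of finitely many planes. -/
theorem exists_generic {L : Type*} [Finite L] (p : L → Space3) :
    ∃ e : Space3, ∀ x y, e ∉ Submodule.span ℝ {p x, p y} := by
  classical
  have := Fintype.ofFinite L
  let s : Finset (Subspace ℝ Space3) :=
    Finset.univ.image fun q : L × L => Submodule.span ℝ {p q.1, p q.2}
  have hs : (⊤ : Subspace ℝ Space3) ∉ s := by
    intro h
    obtain ⟨q, -, hq⟩ := Finset.mem_image.1 h
    have h1 := finrank_span_le_card (R := ℝ) ({p q.1, p q.2} : Set Space3)
    have h2 : Module.finrank ℝ (Submodule.span ℝ ({p q.1, p q.2} : Set Space3)) = 3 := by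
      rw [hq]
      simp
    have h3 : ({p q.1, p q.2} : Set Space3).toFinset.card ≤ 2 := by
      rw [Set.toFinset_insert, Set.toFinset_singleton]
      exact Finset.card_le_two
    omega
  have h := Subspace.biUnion_ne_univ_of_top_notMem hs
  obtain ⟨e, he⟩ := (Set.ne_univ_iff_exists_notMem _).1 h
  refine ⟨e, fun x y hxy => he ?_⟩
  exact Set.mem_biUnion (Finset.mem_image_of_mem _ (Finset.mem_univ (x, y))) hxy

theorem det3_ne_zero {x y e : Space3} (h : ∀ s t : ℝ, s • x + t • y = 0 → s = 0 ∧ t = 0)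
    (he : e ∉ Submodule.span ℝ {x, y}) : det3 x y e ≠ 0 := by
  have hli : LinearIndependent ℝ ![e, x, y] := by
    refine linearIndependent_finCons.2 ⟨LinearIndependent.pair_iff.2 h, ?_⟩
    rwa [show Set.range ![x, y] = {x, y} by simp [Matrix.range_cons, Set.pair_comm]]
  have hu : IsUnit (Matrix.of ![e, x, y]) :=
    Matrix.linearIndependent_rows_iff_isUnit.1 hli
  rw [Matrix.isUnit_iff_isUnit_det] at hu
  have h1 : det3 e x y ≠ 0 := hu.ne_zero
  rw [det3_eq] at h1 ⊢
  intro h2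
  apply h1
  linarith

/-- The direction of a vertex of the link. -/
def dir {v : F.Vert} (x : LinkVert v) : Space3 := x.1 - v.1

theorem LinkVert.val_ne {v : F.Vert} {x y : LinkVert v} (h : x ≠ y) : x.1 ≠ y.1 :=
  fun e => h (Subtype.ext e)

theorem dir_ne_zero {v : F.Vert} (x : LinkVert v) : dir x ≠ 0 := sub_ne_zero.2 x.2.1

theorem dir_cone_inter {v : F.Vert} {S T : Finset Space3} (hS : S ∈ F.K.faces) (hT : T ∈ F.K.faces)
    {x y x' y' : LinkVert v} (hvS : v.1 ∈ S) (hxS : x.1 ∈ S) (hyS : y.1 ∈ S) (hvT : v.1 ∈ T)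
    (hxT : x'.1 ∈ T) (hyT : y'.1 ∈ T) (hST : ∀ z ∈ S, z ∈ T → z = v.1) {s t u w : ℝ} (hs : 0 ≤ s)
    (ht : 0 ≤ t) (hu : 0 ≤ u) (hw : 0 ≤ w)
    (he : s • dir x + t • dir y = u • dir x' + w • dir y') : s • dir x + t • dir y = 0 :=
  cone_inter hS hT hvS hxS hyS hvT hxT hyT hST hs ht hu hw he

theorem not_smul_dir {v : F.Vert} {x y : LinkVert v} (hxy : x ≠ y) {l : ℝ} (hl : 0 < l) :
    dir y ≠ l • dir x := by
  intro h
  have hne := LinkVert.val_ne hxy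
  have h1 := dir_cone_inter y.2.2 x.2.2 (x := y) (y := y) (x' := x) (y' := x) (s := 1) (t := 0)
    (u := l) (w := 0) (by simp) (by simp) (by simp) (by simp) (by simp) (by simp) (by
      intro z hz hz'
      simp only [Finset.mem_insert, Finset.mem_singleton] at hz hz'
      rcases hz with hz | hz
      · exact hz
      · rcases hz' with hz' | hz'
        · exact hz'
        · exact absurd (hz'.symm.trans hz) hne) zero_le_one le_rfl hl.le le_rfl (by
      rw [h]; module)
  rw [one_smul, zero_smul, add_zero] at h1
  exact dir_ne_zero y h1

theorem adj_face {v : F.Vert} {x y : LinkVert v} (h : (F.K.link v.1).Adj x y) :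
    ({v.1, x.1, y.1} : Finset Space3) ∈ F.K.faces := (link_adj.1 h).1

/-- The link of a vertex of a foam, embedded in the sphere of directions at this vertex. -/
theorem isSphereGraph {v : F.Vert} {e : Space3}
    (he : ∀ x y : LinkVert v, e ∉ Submodule.span ℝ {dir x, dir y}) :
    IsSphereGraph (F.K.link v.1).Adj (fun x : LinkVert v => dir x) e where
  symm _ _ h := h.symm
  det_ne x y h := det3_ne_zero (fun s t hst => (link_adj.1 h).smul_eq_zero hst) (he x y)
  general x y hxy := by
    rintro ⟨s, r, hs, h⟩
    have hr : r = 0 := by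
      by_contra hr
      refine he x y ?_
      have : e = r⁻¹ • (dir y - s • dir x) := by
        rw [h, add_sub_cancel_left, smul_smul, inv_mul_cancel₀ hr, one_smul]
      rw [this]
      exact Submodule.smul_mem _ _ (Submodule.sub_mem _ (Submodule.subset_span (by simp))
        (Submodule.smul_mem _ _ (Submodule.subset_span (by simp))))
    rw [hr, zero_smul, add_zero] at h
    exact not_smul_dir hxy hs h
  disjoint x x' a y hx ha h1 h2 h3 h4 s t u w hs ht hu hw h := by
    refine (link_adj.1 ha).smul_eq_zero ?_
    refine dir_cone_inter (adj_face ha) (adj_face hx) (x := a) (y := y) (x' := x) (y' := x')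
      (by simp) (by simp) (by simp) (by simp) (by simp) (by simp) ?_ hs ht hu hw h
    intro z hz hz'
    simp only [Finset.mem_insert, Finset.mem_singleton] at hz hz'
    have n1 := LinkVert.val_ne h1
    have n2 := LinkVert.val_ne h2
    have n3 := LinkVert.val_ne h3
    have n4 := LinkVert.val_ne h4
    rcases hz with rfl | rfl | rfl <;> rcases hz' with h | h | h <;> first | rfl | contradiction |
      exact h
  overlap a x y hx hy hxy := by
    rintro ⟨s, t, ht, h⟩
    have nax := LinkVert.val_ne hx.ne
    have nay := LinkVert.val_ne hy.ne
    have nxy := LinkVert.val_ne hxy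
    rcases le_or_gt 0 s with hs | hs
    · have h1 := dir_cone_inter y.2.2 (adj_face hx) (x := y) (y := y) (x' := a) (y' := x) (s := 1)
        (t := 0) (by simp) (by simp) (by simp) (by simp) (by simp) (by simp) (by
          intro z hz hz'
          simp only [Finset.mem_insert, Finset.mem_singleton] at hz hz'
          rcases hz with rfl | rfl <;> rcases hz' with h | h | h <;> first
            | rfl
            | exact h
            | exact absurd h.symm nay
            | exact absurd h.symm nxy) zero_le_one le_rfl hs ht.le (by
          rw [← h]; module)
      rw [one_smul, zero_smul, add_zero] at h1
      exact dir_ne_zero y h1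
    · have h1 := dir_cone_inter x.2.2 (adj_face hy) (x := x) (y := x) (x' := a) (y' := y) (s := t)
        (t := 0) (u := -s) (w := 1) (by simp) (by simp) (by simp) (by simp) (by simp) (by simp) (by
          intro z hz hz'
          simp only [Finset.mem_insert, Finset.mem_singleton] at hz hz'
          rcases hz with rfl | rfl <;> rcases hz' with h | h | h <;> first
            | rfl
            | exact h
            | exact absurd h nxy
            | exact absurd h.symm nax) ht.le le_rfl (by linarith) zero_le_one (by
          rw [h]; module)
      rw [zero_smul, add_zero, smul_eq_zero] at h1
      rcases h1 with h1 | h1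
      · exact ht.ne' h1
      · exact dir_ne_zero x h1

end GLFoam

theorem IsSphereGraph.mul_pos_of_det_eq_zero {L : Type*} {A : L → L → Prop} {p : L → Space3}
    {e : Space3} (h : IsSphereGraph A p e) {a x y z : L} (hx : A a x) (hy : A a y) (hz : A a z)
    (hxy : x ≠ y) (hyz : y ≠ z) (hxz : x ≠ z) (h0 : det3 (p a) (p x) (p y) = 0) :
    0 < det3 (p a) (p y) (p z) * det3 (p a) (p z) (p x) := by
  have hd := h.det_ne _ _ hx
  have opp : ∀ {w}, A a w → x ≠ w → det3 (p a) (p x) (p w) = 0 →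
      ∃ s t : ℝ, t < 0 ∧ p w = s • p a + t • p x := by
    intro w hw hxw hw0
    obtain ⟨s, t, r, hst⟩ := exists_coords hd (p w)
    have hr : r = 0 := by
      have : det3 (p a) (p x) (p w) = r * det3 (p a) (p x) e := by
        rw [hst]
        simp only [det3_eq, Pi.add_apply, Pi.smul_apply, smul_eq_mul]
        ring
      rw [this] at hw0
      exact (mul_eq_zero.1 hw0).resolve_right hd
    rw [hr, zero_smul, add_zero] at hst
    refine ⟨s, t, ?_, hst⟩
    rcases lt_trichotomy t 0 with ht | ht | ht
    · exact ht
    · exfalso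
      apply h.det_ne _ _ hw
      rw [hst, ht]
      simp only [det3_eq, Pi.add_apply, Pi.smul_apply, smul_eq_mul]
      ring
    · exact absurd ⟨s, t, ht, hst⟩ (h.overlap a x w hx hw hxw)
  obtain ⟨s, t, ht, hst⟩ := opp hy hxy h0
  have e1 : det3 (p a) (p y) (p z) = -t * det3 (p a) (p z) (p x) := by
    rw [hst]
    simp only [det3_eq, Pi.add_apply, Pi.smul_apply, smul_eq_mul]
    ring
  have hne : det3 (p a) (p z) (p x) ≠ 0 := by
    intro h1
    have h2 : det3 (p a) (p x) (p z) = 0 := by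
      rw [det3_eq] at h1 ⊢
      linarith
    obtain ⟨s', t', ht', hst'⟩ := opp hz hxz h2
    refine h.overlap a y z hy hz hyz ⟨s' - t' / t * s, t' / t, div_pos_of_neg_of_neg ht' ht, ?_⟩
    rw [hst', hst]
    have : t' / t * t = t' := div_mul_cancel₀ _ ht.ne
    rw [smul_add, smul_smul, smul_smul, this]
    module
  rw [e1, mul_assoc]
  have := mul_self_pos.2 hne
  nlinarith

theorem two_of_three_signs {α β γ : ℝ} (z1 : α = 0 → 0 < β * γ) (z2 : β = 0 → 0 < γ * α)
    (z3 : γ = 0 → 0 < α * β) :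
    ((α < 0 ∧ β < 0) ∨ (β < 0 ∧ γ < 0) ∨ (γ < 0 ∧ α < 0)) ∨
      ((0 < β ∧ 0 < α) ∨ (0 < α ∧ 0 < γ) ∨ (0 < γ ∧ 0 < β)) := by
  rcases eq_or_ne α 0 with h0 | h0
  · rcases mul_pos_iff.1 (z1 h0) with hp | hp <;> simp [hp.1, hp.2]
  rcases eq_or_ne β 0 with h0' | h0'
  · rcases mul_pos_iff.1 (z2 h0') with hp | hp <;> simp [hp.1, hp.2]
  rcases eq_or_ne γ 0 with h0'' | h0''
  · rcases mul_pos_iff.1 (z3 h0'') with hp | hp <;> simp [hp.1, hp.2]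
  rcases lt_or_gt_of_ne h0 with k1 | k1 <;> rcases lt_or_gt_of_ne h0' with k2 | k2 <;>
    rcases lt_or_gt_of_ne h0'' with k3 | k3 <;> simp [k1, k2, k3]

/-- Three distinct half-planes are met in one of the two possible cyclic orders. -/
theorem IsSphereGraph.isLeftHanded_reverse {L : Type*} {A : L → L → Prop} {p : L → Space3}
    {e : Space3} (h : IsSphereGraph A p e) {a x y z : L} (hx : A a x) (hy : A a y) (hz : A a z)
    (hxy : x ≠ y) (hyz : y ≠ z) (hxz : x ≠ z) :
    IsLeftHanded (p a) (p x) (p y) (p z) ↔ ¬ IsLeftHanded (p a) (p z) (p y) (p x) := by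
  have s1 : det3 (p a) (p z) (p y) = - det3 (p a) (p y) (p z) := by simp only [det3_eq]; ring
  have s2 : det3 (p a) (p y) (p x) = - det3 (p a) (p x) (p y) := by simp only [det3_eq]; ring
  have s3 : det3 (p a) (p x) (p z) = - det3 (p a) (p z) (p x) := by simp only [det3_eq]; ring
  have z1 := h.mul_pos_of_det_eq_zero hx hy hz hxy hyz hxz
  have z2 := h.mul_pos_of_det_eq_zero hy hz hx hyz hxz.symm hxy.symm
  have z3 := h.mul_pos_of_det_eq_zero hz hx hy hxz.symm hxy hyz.symm
  unfold IsLeftHanded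
  rw [s1, s2, s3]
  generalize det3 (p a) (p x) (p y) = α at *
  generalize det3 (p a) (p y) (p z) = β at *
  generalize det3 (p a) (p z) (p x) = γ at *
  constructor
  · rintro (h1 | h1 | h1) (h2 | h2 | h2) <;> linarith [h1.1, h1.2, h2.1, h2.2]
  · intro h1
    simp only [neg_neg_iff_pos] at h1
    exact (two_of_three_signs z1 z2 z3).resolve_right h1

/-! ### Seams form circles, along which the sign is constant -/

namespace GLFoam

variable {N : ℕ} {R : Type*} [CommRing R] {F : GLFoam N R} {c : F.Coloring} {i j : Fin N}

theorem Seam.out_unique {v x y : F.Vert} (hx : Seam c i j v x) (hy : Seam c i j v y) : x = y := by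
  by_contra hxy
  obtain ⟨a, b, w, hx⟩ := hx
  obtain ⟨a', b', w', hy⟩ := hy
  obtain ⟨x', y', ht, h⟩ := exists_transport hx.ncard hy.ncard hxy
  have h1 := hx.nonzero ht
  have h2 := hx.values x'
  have h3 := hy.values y'
  rw [h, h] at h3
  omega

theorem Seam.in_unique {v x y : F.Vert} (hx : Seam c i j x v) (hy : Seam c i j y v) : x = y := by
  by_contra hxy
  obtain ⟨a, b, w, hx⟩ := hx
  obtain ⟨a', b', w', hy⟩ := hy
  have hc : ∀ {x : F.Vert}, {z | F.IsTri x v z}.ncard = 3 → {z | F.IsTri v x z}.ncard = 3 := by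
    intro x h
    rw [← h]
    congr 1
    ext z
    exact ⟨IsTri.swap, IsTri.swap⟩
  obtain ⟨x', y', ht, h⟩ := exists_transport (hc hx.ncard) (hc hy.ncard) hxy
  have h1 := hx.nonzero ht.swap
  have h2 := hx.values x'
  have h3 := hy.values y'
  rw [eps_swap c i v y, eps_swap c j v y, h, h, eps_swap c i x v, eps_swap c j x v] at h3
  omega

/-- The edges of the link of `v` in triangles with color `i` but not `j`, directed. -/
def OnlyAt (c : F.Coloring) (i j : Fin N) (v x y : F.Vert) : Prop :=
  eps c i v x y = 1 ∧ eps c j v x y = 0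

theorem OnlyAt.out_unique {v x y y' : F.Vert} (h : OnlyAt c i j v x y) (h' : OnlyAt c i j v x y') :
    y = y' := (isFlow_eps c i).eq_of_eq_one h.1 h'.1

theorem OnlyAt.in_unique {v x y x' : F.Vert} (h : OnlyAt c i j v x y) (h' : OnlyAt c i j v x' y) :
    x = x' := by
  refine (isFlow_eps c i).eq_of_eq_neg_one (u := v) (v := y) ?_ ?_ <;> rw [eps_swap_last]
  · rw [h.1]
  · rw [h'.1]

theorem SeamAt.onlyAt {v x a b w : F.Vert} (h : SeamAt c i j v x a b w) : OnlyAt c i j v x a :=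
  ⟨h.ia, h.ja⟩

theorem SeamAt.onlyAt_in {v x a b w : F.Vert} (h : SeamAt c i j x v a b w) : OnlyAt c i j v a x := by
  constructor
  · rw [eps_swap_last, eps_swap, h.ia, neg_neg]
  · rw [eps_swap_last, eps_swap, h.ja, neg_neg]

theorem Seam.not_onlyAt_in {v x y : F.Vert} (h : Seam c i j v x) : ¬ OnlyAt c i j v y x := by
  rintro ⟨h1, h2⟩
  obtain ⟨a, b, w, h⟩ := h
  have := h.values y
  rw [eps_swap_last] at h1 h2
  omega

theorem Seam.not_onlyAt_out {v x y : F.Vert} (h : Seam c i j x v) : ¬ OnlyAt c i j v x y := by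
  rintro ⟨h1, h2⟩
  obtain ⟨a, b, w, h⟩ := h
  have := h.values y
  rw [eps_swap] at h1 h2
  omega

/-- At a link vertex that is not on a seam, an edge with color `i` only ends where one begins. -/
theorem exists_onlyAt_iff {v x z : F.Vert} (hz : F.IsTri v x z) (h1 : ¬ Seam c i j v x)
    (h2 : ¬ Seam c i j x v) : (∃ y, OnlyAt c i j v x y) ↔ ∃ y, OnlyAt c i j v y x := by
  obtain ⟨p, q, -, -, hpq, hi, hj, h0⟩ := ((edge_pair c i j hz).resolve_left h1).resolve_left h2
  constructor
  · rintro ⟨y, hy⟩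
    by_cases e : y = p
    · subst e
      refine ⟨q, ?_, ?_⟩ <;> rw [eps_swap_last]
      · rw [hi, hy.1, neg_neg]
      · rw [hj, hy.2, neg_neg]
    · by_cases e' : y = q
      · subst e'
        refine ⟨p, ?_, ?_⟩ <;> rw [eps_swap_last]
        · rw [← hi, hy.1]
        · rw [← hj, hy.2]
      · have := (h0 y e e').1
        have := hy.1
        omega
  · rintro ⟨y, hy⟩
    have hy1 := hy.1
    have hy2 := hy.2
    rw [eps_swap_last] at hy1 hy2
    by_cases e : y = p
    · subst e
      exact ⟨q, by rw [hi]; omega, by rw [hj]; omega⟩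
    · by_cases e' : y = q
      · subst e'
        exact ⟨p, by omega, by omega⟩
      · have := (h0 y e e').1
        omega

theorem ncard_onlyAt (v : F.Vert) : {x | ∃ y, OnlyAt c i j v x y}.ncard =
    {x | ∃ y, OnlyAt c i j v y x}.ncard := by
  refine Set.ncard_congr (fun x hx => hx.choose) ?_ ?_ ?_
  · intro x hx
    exact ⟨x, hx.choose_spec⟩
  · intro x x' hx hx' he
    have h1 := hx.choose_spec
    rw [he] at h1
    exact h1.in_unique hx'.choose_spec
  · rintro y ⟨x, hx⟩
    exact ⟨x, ⟨y, hx⟩, (Exists.choose_spec ⟨y, hx⟩ : OnlyAt c i j v x _).out_unique hx⟩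

theorem OnlyAt.isTri {v x y : F.Vert} (h : OnlyAt c i j v x y) : F.IsTri v x y :=
  isTri_of_eps (c := c) (i := i) (by rw [h.1]; omega)

/-- The seams of a coloring form disjoint circles. At a vertex at most one seam begins and at most
one ends. The edges of the link with color `i` only, directed as in the `i`-colored surface, have
as many sources as targets. A source that is not a target is the end of the seam that begins at the
vertex, a target that is not a source the start of the one that ends there; so both exist or none. -/
theorem isCirculation_seam (c : F.Coloring) (i j : Fin N) : IsCirculation (Seam c i j) where
  ne u v h := by
    obtain ⟨w, hw⟩ := h.tri
    exact hw.ne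
  out_unique u v w h h' := h.out_unique h'
  in_unique u v w h h' := h.in_unique h'
  out_of_in u v h := by
    by_contra hno
    have hsub : {x | ∃ y, OnlyAt c i j v x y} ⊆ {x | ∃ y, OnlyAt c i j v y x} := by
      rintro x ⟨y, hy⟩
      exact (exists_onlyAt_iff hy.isTri (fun hs => hno ⟨x, hs⟩)
        (fun hs => hs.not_onlyAt_out hy)).1 ⟨y, hy⟩
    have he := Set.eq_of_subset_of_ncard_le hsub (ncard_onlyAt v).ge (Set.toFinite _)
    obtain ⟨a, b, w, h'⟩ := id h
    have : u ∈ {x | ∃ y, OnlyAt c i j v y x} := ⟨a, h'.onlyAt_in⟩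
    rw [← he] at this
    obtain ⟨y, hy⟩ := this
    exact h.not_onlyAt_out hy
  in_of_out v w h := by
    by_contra hno
    have hsub : {x | ∃ y, OnlyAt c i j v y x} ⊆ {x | ∃ y, OnlyAt c i j v x y} := by
      rintro x ⟨y, hy⟩
      exact (exists_onlyAt_iff hy.isTri.swap_last (fun hs => hs.not_onlyAt_in hy)
        (fun hs => hno ⟨x, hs⟩)).2 ⟨y, hy⟩
    have he := Set.eq_of_subset_of_ncard_le hsub (ncard_onlyAt v).le (Set.toFinite _)
    obtain ⟨a, b, w', h'⟩ := id h
    have : w ∈ {x | ∃ y, OnlyAt c i j v x y} := ⟨a, h'.onlyAt⟩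
    rw [← he] at this
    obtain ⟨y, hy⟩ := this
    exact h.not_onlyAt_in hy

/-- The facets with color `i` only, with color `j` only and with both colors are met in this
cyclic order, by the left hand rule, around the directed edge `u v` of a seam. -/
def IsPositive (c : F.Coloring) (i j : Fin N) (u v : F.Vert) : Prop :=
  ∃ a b w, SeamAt c i j u v a b w ∧
    IsLeftHanded (v.1 - u.1) (a.1 - u.1) (b.1 - u.1) (w.1 - u.1)

theorem SeamAt.isPositive_iff {u v a b w : F.Vert} (h : SeamAt c i j u v a b w) :
    IsPositive c i j u v ↔ IsLeftHanded (v.1 - u.1) (a.1 - u.1) (b.1 - u.1) (w.1 - u.1) := by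
  constructor
  · rintro ⟨a', b', w', h', hl⟩
    obtain ⟨rfl, rfl, rfl⟩ := h.eq h'
    exact hl
  · intro hl
    exact ⟨a, b, w, h, hl⟩

theorem isLeftHanded_neg_base (x y a b w : Space3) :
    IsLeftHanded (x - y) (a - y) (b - y) (w - y) ↔
      IsLeftHanded (y - x) (w - x) (b - x) (a - x) := by
  have key : ∀ p q : Space3, det3 (x - y) (p - y) (q - y) = det3 (y - x) (q - x) (p - x) := by
    intro p q
    simp only [det3_eq, Pi.sub_apply]
    ring
  unfold IsLeftHanded
  rw [key, key, key]
  tauto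

instance (v : F.Vert) : Finite (LinkVert v) :=
  Finite.of_injective LinkVert.toVert fun _ _ => LinkVert.toVert_injective

instance (v : F.Vert) : Fintype (LinkVert v) := Fintype.ofFinite _

/-- The sign of a seam does not change at a vertex. -/
theorem isPositive_iff_of_seam {x v y : F.Vert} (hx : Seam c i j x v) (hy : Seam c i j v y) :
    IsPositive c i j x v ↔ IsPositive c i j v y := by
  obtain ⟨a', b', w', hx'⟩ := id hx
  obtain ⟨a, b, w, hy'⟩ := id hy
  rw [hx'.isPositive_iff, hy'.isPositive_iff, isLeftHanded_neg_base]
  obtain ⟨e, he⟩ := exists_generic fun x : LinkVert v => dir x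
  have hG := isSphereGraph he
  have mk : ∀ {x y : F.Vert}, F.IsTri v x y → ∃ X : LinkVert v, LinkVert.toVert X = x :=
    fun h => ⟨h.linkVert, rfl⟩
  have t1 : F.IsTri v y a := isTri_of_eps (c := c) (i := i) (by rw [hy'.ia]; omega)
  have t2 : F.IsTri v y b := isTri_of_eps (c := c) (i := j) (by rw [hy'.jb]; omega)
  have t3 : F.IsTri v y w := isTri_of_eps (c := c) (i := i) (by rw [hy'.iw]; omega)
  have t1' : F.IsTri v x a' := (isTri_of_eps (c := c) (i := i) (by rw [hx'.ia]; omega)).swap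
  have t2' : F.IsTri v x b' := (isTri_of_eps (c := c) (i := j) (by rw [hx'.jb]; omega)).swap
  have t3' : F.IsTri v x w' := (isTri_of_eps (c := c) (i := i) (by rw [hx'.iw]; omega)).swap
  obtain ⟨n1, n2, n3⟩ := hy'.ne
  obtain ⟨n1', n2', n3'⟩ := hx'.ne
  obtain ⟨y, rfl⟩ := mk t1
  obtain ⟨a, rfl⟩ := mk t1.swap_last
  obtain ⟨b, rfl⟩ := mk t2.swap_last
  obtain ⟨w, rfl⟩ := mk t3.swap_last
  obtain ⟨x, rfl⟩ := mk t1'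
  obtain ⟨a', rfl⟩ := mk t1'.swap_last
  obtain ⟨b', rfl⟩ := mk t2'.swap_last
  obtain ⟨w', rfl⟩ := mk t3'.swap_last
  change IsLeftHanded (dir x) (dir w') (dir b') (dir a') ↔
    IsLeftHanded (dir y) (dir a) (dir b) (dir w)
  have ne_of : ∀ {p q : LinkVert v}, LinkVert.toVert p ≠ LinkVert.toVert q → p ≠ q :=
    fun h h' => h (congrArg _ h')
  have r1 := hG.isLeftHanded_reverse (link_adj.2 t1) (link_adj.2 t2) (link_adj.2 t3) (ne_of n1)
    (ne_of n3) (ne_of n2)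
  have r2 := hG.isLeftHanded_reverse (link_adj.2 t3') (link_adj.2 t2') (link_adj.2 t1')
    (ne_of n3'.symm) (ne_of n1'.symm) (ne_of n2'.symm)
  rw [r1, r2, not_iff_not]
  -- the closed curve is the link of the surface of color `i`; the path consists of the triangles
  -- with the color `j` only
  let C : LinkVert v → LinkVert v → Prop := fun p q =>
    eps c i v (LinkVert.toVert p) (LinkVert.toVert q) = -1
  let J : LinkVert v → LinkVert v → Prop := fun p q =>
    eps c j v (LinkVert.toVert p) (LinkVert.toVert q) = -1 ∧
      eps c i v (LinkVert.toVert p) (LinkVert.toVert q) = 0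
  have flip : ∀ (k : Fin N) (p q : LinkVert v), eps c k v (LinkVert.toVert p) (LinkVert.toVert q) =
      - eps c k v (LinkVert.toVert q) (LinkVert.toVert p) := fun k p q => eps_swap_last _ _ _ _ _
  have hS := (isFlow_eps c i).isClosedSurface
  have outu : ∀ (k : Fin N) (p q q' : LinkVert v),
      eps c k v (LinkVert.toVert p) (LinkVert.toVert q) = -1 →
      eps c k v (LinkVert.toVert p) (LinkVert.toVert q') = -1 → q = q' := fun k p q q' h h' =>
    LinkVert.toVert_injective ((isFlow_eps c k).eq_of_eq_neg_one h h')
  have inu : ∀ (k : Fin N) (p q q' : LinkVert v),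
      eps c k v (LinkVert.toVert q) (LinkVert.toVert p) = -1 →
      eps c k v (LinkVert.toVert q') (LinkVert.toVert p) = -1 → q = q' := fun k p q q' h h' =>
    LinkVert.toVert_injective ((isFlow_eps c k).eq_of_eq_one
      (by rw [eps_swap_last, h, neg_neg]) (by rw [eps_swap_last, h', neg_neg]))
  have adj : ∀ (k : Fin N) (p q : LinkVert v),
      eps c k v (LinkVert.toVert p) (LinkVert.toVert q) = -1 → (F.K.link v.1).Adj p q :=
    fun k p q h => link_adj.2 (isTri_of_eps (c := c) (i := k) (by rw [h]; omega))
  have hC : IsCirculation C :=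
    { ne := fun p q h => (adj i p q h).ne
      out_unique := fun p q r h h' => outu i p q r h h'
      in_unique := fun p q r h h' => inu i r p q h h'
      out_of_in := fun p q h => by
        obtain ⟨z, hz⟩ := hS.exists_in (v := v) (x := LinkVert.toVert q) (y := LinkVert.toVert p)
          (by rw [eps_swap_last, h, neg_neg])
        have hz' : eps c i v (LinkVert.toVert q) z = -1 := by rw [eps_swap_last, hz]
        exact ⟨(isTri_of_eps (c := c) (i := i) (by rw [hz']; omega)).swap_last.linkVert, hz'⟩
      in_of_out := fun p q h => by
        obtain ⟨z, hz⟩ := hS.exists_out (v := v) (x := LinkVert.toVert q) (y := LinkVert.toVert p)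
          (by rw [eps_swap_last, h, neg_neg])
        have hz' : eps c i v z (LinkVert.toVert p) = -1 := by rw [eps_swap_last, hz]
        exact ⟨(isTri_of_eps (c := c) (i := i) (by rw [hz']; omega)).linkVert, hz'⟩ }
  have key := hG.isLeftHanded_iff (C := C) (J := J) (a := y) (a₁ := a) (a₂ := w) (a₃ := b) (b := x)
    (b₁ := w') (b₂ := a') (b₃ := b') hC
    (fun p q h h' => by
      have h1 : eps c i v (LinkVert.toVert p) (LinkVert.toVert q) = -1 := h
      have h2 : eps c i v (LinkVert.toVert q) (LinkVert.toVert p) = -1 := h'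
      rw [flip] at h1
      omega)
    (fun p q h => adj i p q h)
    (by
      intro X hX p q p' q' hp hq hpX
      have h1 := hS.mem_of_closed (v := v) {z | ∀ Z : LinkVert v, LinkVert.toVert Z = z → Z ∈ X}
        (by
          intro p q hpq
          have ht := hS.tri hpq
          have h2 : C ht.swap_last.linkVert ht.linkVert := by
            change eps c i v q p = -1
            rw [eps_swap_last, hpq]
          have h3 := hX _ _ h2
          constructor
          · rintro hp Z rfl
            exact h3.2 (hp _ rfl)
          · rintro hq Z rfl
            exact h3.1 (hq _ rfl))
        (x := LinkVert.toVert p) (y := LinkVert.toVert (hC.in_of_out _ _ hp).choose)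
        (by
          have := (hC.in_of_out _ _ hp).choose_spec
          have h2 : eps c i v (LinkVert.toVert (hC.in_of_out _ _ hp).choose) (LinkVert.toVert p) =
            -1 := this
          rw [eps_swap_last, h2, neg_neg])
        (by
          intro Z hZ
          rw [LinkVert.toVert_injective hZ]
          exact hpX)
        (z := LinkVert.toVert q) (w := LinkVert.toVert (hC.in_of_out _ _ hq).choose)
        (by
          have := (hC.in_of_out _ _ hq).choose_spec
          have h2 : eps c i v (LinkVert.toVert (hC.in_of_out _ _ hq).choose) (LinkVert.toVert q) =
            -1 := this
          rw [eps_swap_last, h2, neg_neg])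
      exact h1 q rfl)
    (fun p q h => adj j p q h.1)
    (fun p q r h h' => outu j p q r h.1 h'.1)
    (fun p q r h h' => inu j r p q h.1 h'.1)
    (fun p q h => by
      have h1 := h.2
      refine ⟨fun h2 => ?_, fun h2 => ?_⟩
      · have h2' : eps c i v (LinkVert.toVert p) (LinkVert.toVert q) = -1 := h2
        omega
      · have h2' : eps c i v (LinkVert.toVert q) (LinkVert.toVert p) = -1 := h2
        rw [flip] at h2'
        omega)
    (by change eps c i v _ _ = -1; rw [flip, hy'.ia])
    hy'.iw
    (by refine ⟨?_, ?_⟩ <;> rw [flip]; rw [hy'.jb]; rw [hy'.ib]; rfl)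
    (by change eps c i v _ _ = -1; rw [flip, eps_swap, hx'.iw, neg_neg])
    (by change eps c i v _ _ = -1; rw [eps_swap, hx'.ia])
    (by refine ⟨?_, ?_⟩ <;> rw [eps_swap]; rw [hx'.jb]; rw [hx'.ib]; rfl)
    (by
      rintro p ⟨h1, h2⟩
      have := hy'.values (LinkVert.toVert p)
      omega)
    (by
      rintro p ⟨h1, h2⟩
      have := hx'.values (LinkVert.toVert p)
      rw [flip, eps_swap] at h1 h2
      omega)
    (by
      intro d hdy hdx
      have hJiff : ∀ p q : LinkVert v,
          J p q ↔ OnlyAt c j i v (LinkVert.toVert q) (LinkVert.toVert p) := by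
        intro p q
        change (_ ∧ _) ↔ (_ ∧ _)
        rw [flip j p q, flip i p q]
        omega
      have hex1 : (∃ p, J d p) ↔ ∃ p, OnlyAt c j i v p (LinkVert.toVert d) := by
        constructor
        · rintro ⟨p, hp⟩
          exact ⟨_, (hJiff _ _).1 hp⟩
        · rintro ⟨p, hp⟩
          exact ⟨hp.isTri.linkVert, (hJiff _ _).2 hp⟩
      have hex2 : (∃ p, J p d) ↔ ∃ p, OnlyAt c j i v (LinkVert.toVert d) p := by
        constructor
        · rintro ⟨p, hp⟩
          exact ⟨_, (hJiff _ _).1 hp⟩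
        · rintro ⟨p, hp⟩
          exact ⟨hp.isTri.swap_last.linkVert, (hJiff _ _).2 hp⟩
      rw [hex1, hex2]
      have hn1 : ¬ Seam c j i v (LinkVert.toVert d) := fun h =>
        hdy (LinkVert.toVert_injective (Seam.out_unique (seam_comm.1 h) hy))
      have hn2 : ¬ Seam c j i (LinkVert.toVert d) v := fun h =>
        hdx (LinkVert.toVert_injective (Seam.in_unique (seam_comm.1 h) hx))
      constructor
      · rintro ⟨p, hp⟩
        exact (exists_onlyAt_iff hp.isTri.swap_last hn1 hn2).2 ⟨p, hp⟩
      · rintro ⟨p, hp⟩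
        exact (exists_onlyAt_iff hp.isTri hn1 hn2).1 ⟨p, hp⟩)
    (by
      rintro d hdy hdx ⟨p, hp1, hp2⟩ z
      have hn1 : ¬ Seam c i j v (LinkVert.toVert d) := fun h =>
        hdy (LinkVert.toVert_injective (Seam.out_unique h hy))
      have hn2 : ¬ Seam c i j (LinkVert.toVert d) v := fun h =>
        hdx (LinkVert.toVert_injective (Seam.in_unique h hx))
      have ht : F.IsTri v (LinkVert.toVert d) (LinkVert.toVert p) :=
        isTri_of_eps (c := c) (i := j) (by rw [hp1]; omega)
      obtain ⟨p0, q0, -, -, hpq, hi, hj, h0⟩ := ((edge_pair c i j ht).resolve_left hn1).resolve_left hn2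
      have hp0 : eps c i v (LinkVert.toVert d) p0 = 0 := by
        by_cases e : LinkVert.toVert p = p0
        · rw [← e, hp2]
        · by_cases e' : LinkVert.toVert p = q0
          · rw [← e'] at hi
            omega
          · have := (h0 _ e e').2
            omega
      have hall : ∀ z, eps c i v (LinkVert.toVert d) z = 0 := by
        intro z
        by_cases e : z = p0
        · rw [e, hp0]
        · by_cases e' : z = q0
          · rw [e', hi, hp0, neg_zero]
          · exact (h0 z e e').1
      refine ⟨fun h => ?_, fun h => ?_⟩
      · have h2 : eps c i v (LinkVert.toVert d) (LinkVert.toVert z) = -1 := h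
        rw [hall] at h2
        omega
      · have h2 : eps c i v (LinkVert.toVert z) (LinkVert.toVert d) = -1 := h
        rw [flip, hall] at h2
        omega)
  exact key.symm

end GLFoam

/-! ### Counting the positive seams -/

namespace GLFoam

variable {N : ℕ} {R : Type*} [CommRing R] {F : GLFoam N R} {c : F.Coloring} {i j : Fin N}

theorem IsPositive.seam {u v : F.Vert} (h : IsPositive c i j u v) : Seam c i j u v := by
  obtain ⟨a, b, w, h, -⟩ := h
  exact ⟨a, b, w, h⟩

/-- The positive seams form disjoint circles. -/
theorem isCirculation_isPositive (c : F.Coloring) (i j : Fin N) :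
    IsCirculation (IsPositive c i j) where
  ne u v h := (isCirculation_seam c i j).ne _ _ h.seam
  out_unique u v w h h' := h.seam.out_unique h'.seam
  in_unique u v w h h' := h.seam.in_unique h'.seam
  out_of_in u v h := by
    obtain ⟨w, hw⟩ := (isCirculation_seam c i j).out_of_in _ _ h.seam
    exact ⟨w, (isPositive_iff_of_seam h.seam hw).1 h⟩
  in_of_out u v h := by
    obtain ⟨w, hw⟩ := (isCirculation_seam c i j).in_of_out _ _ h.seam
    exact ⟨w, (isPositive_iff_of_seam hw h.seam).2 h⟩

theorem SeamAt.of_ne_zero {u v a b w a' b' w' : F.Vert} (h : SeamAt c i j u v a' b' w')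
    (h1 : eps c i u v a ≠ 0) (h2 : eps c j u v a = 0) (h3 : eps c i u v b = 0)
    (h4 : eps c j u v b ≠ 0) (h5 : eps c i u v w ≠ 0) (h6 : eps c j u v w ≠ 0) :
    SeamAt c i j u v a b w := by
  have ha := h.values a
  have hb := h.values b
  have hw := h.values w
  exact ⟨by omega, by omega, by omega, by omega, by omega, by omega⟩

theorem isSeam_iff {u v a b w : F.Vert} : c.IsSeam i j u.1 v.1 a.1 b.1 w.1 ↔
    SeamAt c i j u v a b w ∨ SeamAt c i j v u a b w := by
  constructor
  · rintro ⟨ha, hb, hw, ⟨a1, a2⟩, ⟨b1, b2⟩, w1, w2⟩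
    have ta : F.IsTri u v a := ha
    have tb : F.IsTri u v b := hb
    have tw : F.IsTri u v w := hw
    have a1' := (eps_ne_zero_iff c i ta).2 a1
    have a2' := not_ne_iff.1 (mt (eps_ne_zero_iff c j ta).1 a2)
    have b1' := (eps_ne_zero_iff c j tb).2 b1
    have b2' := not_ne_iff.1 (mt (eps_ne_zero_iff c i tb).1 b2)
    have w1' := (eps_ne_zero_iff c i tw).2 w1
    have w2' := (eps_ne_zero_iff c j tw).2 w2
    rcases edge_pair c i j ta with ⟨_, _, _, h⟩ | ⟨_, _, _, h⟩ | ⟨x, y, -, -, -, hi, hj, h0⟩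
    · exact Or.inl (h.of_ne_zero a1' a2' b2' b1' w1' w2')
    · refine Or.inr (h.of_ne_zero ?_ ?_ ?_ ?_ ?_ ?_) <;> rw [eps_swap] <;> omega
    · exfalso
      have hx : eps c i u v x ≠ 0 ∧ eps c j u v x = 0 := by
        by_cases e : a = x
        · rw [← e]; exact ⟨a1', a2'⟩
        · by_cases e' : a = y
          · rw [← e'] at hi hj
            omega
          · exact absurd (h0 a e e').1 a1'
      by_cases e : b = x
      · rw [e] at b1'; exact b1' hx.2
      · by_cases e' : b = y
        · rw [e', hj, hx.2] at b1'
          exact b1' rfl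
        · exact b1' (h0 b e e').2
  · have key : ∀ {u v : F.Vert}, SeamAt c i j u v a b w → c.IsSeam i j u.1 v.1 a.1 b.1 w.1 := by
      intro u v h
      have ta : F.IsTri u v a := isTri_of_eps (c := c) (i := i) (by rw [h.ia]; omega)
      have tb : F.IsTri u v b := isTri_of_eps (c := c) (i := j) (by rw [h.jb]; omega)
      have tw : F.IsTri u v w := isTri_of_eps (c := c) (i := i) (by rw [h.iw]; omega)
      refine ⟨ta, tb, tw, ⟨(eps_ne_zero_iff c i ta).1 ?_, mt (eps_ne_zero_iff c j ta).2 ?_⟩,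
        ⟨(eps_ne_zero_iff c j tb).1 ?_, mt (eps_ne_zero_iff c i tb).2 ?_⟩,
        (eps_ne_zero_iff c i tw).1 ?_, (eps_ne_zero_iff c j tw).1 ?_⟩
      · rw [h.ia]; omega
      · rw [h.ja]; omega
      · rw [h.jb]; omega
      · rw [h.ib]; omega
      · rw [h.iw]; omega
      · rw [h.jw]; omega
    rintro (h | h)
    · exact key h
    · have h' := key h
      obtain ⟨ha, hb, hw, h1, h2, h3⟩ := h'
      have e : ∀ x : Space3, ({v.1, u.1, x} : Finset Space3) = {u.1, v.1, x} :=
        fun x => Finset.insert_comm _ _ _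
      unfold Coloring.IsSeam Complex3.IsTriangle
      unfold Complex3.IsTriangle at ha hb hw
      unfold Complex3.tri at h1 h2 h3 ⊢
      simp only [e] at ha hb hw h1 h2 h3
      exact ⟨ha, hb, hw, h1, h2, h3⟩

theorem exists_vert {u v a b w : Space3} (h : c.IsSeam i j u v a b w) :
    ∃ u' v' a' b' w' : F.Vert, u'.1 = u ∧ v'.1 = v ∧ a'.1 = a ∧ b'.1 = b ∧ w'.1 = w := by
  obtain ⟨ha, hb, hw, -⟩ := h
  exact ⟨⟨u, singleton_mem_of_mem ha.1 (by simp)⟩, ⟨v, singleton_mem_of_mem ha.1 (by simp)⟩,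
    ⟨a, singleton_mem_of_mem ha.1 (by simp)⟩, ⟨b, singleton_mem_of_mem hb.1 (by simp)⟩,
    ⟨w, singleton_mem_of_mem hw.1 (by simp)⟩, rfl, rfl, rfl, rfl, rfl⟩

theorem seamGraph_adj {u v : Space3} : (c.seamGraph i j).Adj u v ↔
    ∃ u' v' : F.Vert, u'.1 = u ∧ v'.1 = v ∧ (Seam c i j u' v' ∨ Seam c i j v' u') := by
  rw [Coloring.seamGraph, SimpleGraph.fromRel_adj]
  constructor
  · rintro ⟨-, ⟨a, b, w, h⟩ | ⟨a, b, w, h⟩⟩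
    · obtain ⟨u, v, a, b, w, rfl, rfl, rfl, rfl, rfl⟩ := exists_vert h
      refine ⟨u, v, rfl, rfl, ?_⟩
      rcases isSeam_iff.1 h with h | h
      exacts [Or.inl ⟨_, _, _, h⟩, Or.inr ⟨_, _, _, h⟩]
    · obtain ⟨v, u, a, b, w, rfl, rfl, rfl, rfl, rfl⟩ := exists_vert h
      refine ⟨u, v, rfl, rfl, ?_⟩
      rcases isSeam_iff.1 h with h | h
      exacts [Or.inr ⟨_, _, _, h⟩, Or.inl ⟨_, _, _, h⟩]
  · rintro ⟨u, v, rfl, rfl, h⟩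
    have hne : u ≠ v := by
      rcases h with h | h
      · exact (isCirculation_seam c i j).ne _ _ h
      · exact ((isCirculation_seam c i j).ne _ _ h).symm
    refine ⟨fun e => hne (Subtype.ext e), Or.inl ?_⟩
    rcases h with ⟨a, b, w, h⟩ | ⟨a, b, w, h⟩
    · exact ⟨a.1, b.1, w.1, isSeam_iff.2 (Or.inl h)⟩
    · exact ⟨a.1, b.1, w.1, isSeam_iff.2 (Or.inr h)⟩

theorem isPositiveEdge_iff {u v : Space3} : c.IsPositiveEdge i j u v ↔
    ∃ u' v' : F.Vert, u'.1 = u ∧ v'.1 = v ∧ IsPositive c i j u' v' := by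
  constructor
  · rintro ⟨a, b, w, h, ho, hl⟩
    obtain ⟨u, v, a, b, w, rfl, rfl, rfl, rfl, rfl⟩ := exists_vert h
    refine ⟨u, v, rfl, rfl, a, b, w, ?_, hl⟩
    rcases isSeam_iff.1 h with h' | h'
    · exact h'
    · exfalso
      have h1 := h'.ia
      rw [eps_swap] at h1
      have hp : Pos u v a := ho
      unfold eps at h1
      rw [if_pos hp] at h1
      split_ifs at h1 <;> omega
  · rintro ⟨u, v, rfl, rfl, a, b, w, h, hl⟩
    refine ⟨a.1, b.1, w.1, isSeam_iff.2 (Or.inl h), ?_, hl⟩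
    have h1 := h.ia
    unfold eps at h1
    by_contra hn
    have hn' : ¬ Pos u v a := hn
    rw [if_neg hn'] at h1
    split_ifs at h1 <;> omega

/-- The number of positive seams, as a number of circles of a circulation. -/
theorem thetaPlus_eq (c : F.Coloring) (i j : Fin N) :
    c.thetaPlus i j = circleCount (IsPositive c i j) := by
  have hP := isCirculation_isPositive c i j
  have hS := isCirculation_seam c i j
  rw [circleCount, card_cycleType_eq_ncard_image (circPerm (IsPositive c i j))
    (fun x => (c.seamGraph i j).connectedComponentMk x.1), Coloring.thetaPlus]
  · congr 1
    ext C
    simp only [Set.mem_ofPred_eq, Set.mem_image, Finset.mem_coe]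
    constructor
    · rintro ⟨u, v, h, rfl⟩
      obtain ⟨u, v, rfl, rfl, h'⟩ := isPositiveEdge_iff.1 h
      exact ⟨u, hP.mem_support.2 ⟨v, h'⟩, rfl⟩
    · rintro ⟨u, hu, rfl⟩
      obtain ⟨v, h⟩ := hP.mem_support.1 hu
      exact ⟨u.1, v.1, isPositiveEdge_iff.2 ⟨u, v, rfl, rfl, h⟩, rfl⟩
  · intro x hx y hy
    constructor
    · intro h
      have hr := SimpleGraph.ConnectedComponent.exact h
      let Q : Space3 → Prop := fun z => ∃ z' : F.Vert, z'.1 = z ∧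
        (∃ w, IsPositive c i j z' w) ∧ (circPerm (IsPositive c i j)).SameCycle x z'
      have step : ∀ z w, (c.seamGraph i j).Adj z w → Q z → Q w := by
        rintro z w hzw ⟨z', rfl, ⟨t, ht⟩, hsame⟩
        obtain ⟨z₁, w', hz, rfl, hs⟩ := seamGraph_adj.1 hzw
        obtain rfl : z₁ = z' := Subtype.ext hz
        refine ⟨w', rfl, ?_⟩
        rcases hs with hs | hs
        · obtain rfl := hs.out_unique ht.seam
          refine ⟨hP.out_of_in _ _ ht, ?_⟩
          rwa [← hP.circPerm_apply ht, Equiv.Perm.sameCycle_apply_right]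
        · obtain ⟨t', ht'⟩ := hP.in_of_out _ _ ht
          obtain rfl := hs.in_unique ht'.seam
          refine ⟨⟨_, ht'⟩, ?_⟩
          rw [← Equiv.Perm.sameCycle_apply_right, hP.circPerm_apply ht']
          exact hsame
      have walk : ∀ a b, (c.seamGraph i j).Walk a b → Q a → Q b := by
        intro a b p
        induction p with
        | nil => exact id
        | cons hab p ih => exact fun ha => ih (step _ _ hab ha)
      obtain ⟨p⟩ := hr
      obtain ⟨y', hy', -, hsame⟩ := walk _ _ p ⟨x, rfl, hP.mem_support.1 hx,
        Equiv.Perm.SameCycle.refl _ _⟩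
      obtain rfl : y' = y := Subtype.ext hy'
      exact hsame
    · intro h
      refine sameCycle_invariant (π := circPerm (IsPositive c i j))
        (f := fun x : F.Vert => (c.seamGraph i j).connectedComponentMk x.1) ?_ h
      intro z
      by_cases hz : ∃ w, IsPositive c i j z w
      · obtain ⟨w, hw⟩ := hz
        rw [hP.circPerm_apply hw]
        refine (SimpleGraph.ConnectedComponent.sound (SimpleGraph.Adj.reachable ?_)).symm
        exact seamGraph_adj.2 ⟨z, w, rfl, rfl, Or.inl hw.seam⟩
      · rw [hP.circPerm_apply_of_not hz]

end GLFoam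

/-! ### Kempe moves -/

namespace GLFoam

variable {N : ℕ} {R : Type*} [CommRing R] {F : GLFoam N R} {c : F.Coloring} {i j : Fin N}

/-- The triangles with exactly one of the colors `i` and `j`. -/
def pairSet (c : F.Coloring) (i j : Fin N) : Set F.K.Triangle :=
  {t | (i ∈ c.color t ∧ j ∉ c.color t) ∨ (j ∈ c.color t ∧ i ∉ c.color t)}

theorem mem_pairSet_iff {u v w : F.Vert} (h : F.IsTri u v w) :
    h.tri ∈ pairSet c i j ↔ eps c i u v w - eps c j u v w ≠ 0 := by
  have h1 := eps_ne_zero_iff c i h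
  have h2 := eps_ne_zero_iff c j h
  have h3 := eps_sub_mem c c i j u v w
  have h4 := eps_mem c i u v w
  have h5 := eps_mem c j u v w
  change (_ ∧ _) ∨ (_ ∧ _) ↔ _
  rw [← h1, ← h2]
  omega

theorem triangleSet_eps (c : F.Coloring) (i : Fin N) :
    triangleSet (fun u v w => eps c i u v w = 1) = {t | i ∈ c.color t} := by
  ext t
  obtain ⟨u, v, w, h, rfl⟩ := exists_tri t
  rw [(isFlow_eps c i).mem_triangleSet h, eps_ne_zero_iff c i h]
  rfl

theorem triangleSet_sub (c : F.Coloring) (i j : Fin N) :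
    triangleSet (fun u v w => eps c i u v w - eps c j u v w = 1) = pairSet c i j := by
  ext t
  obtain ⟨u, v, w, h, rfl⟩ := exists_tri t
  rw [(isFlow_sub c i j).mem_triangleSet h, mem_pairSet_iff h]

theorem even_chi (c : F.Coloring) (i : Fin N) : Even (c.chi i) := by
  have h := (isFlow_eps c i).isClosedSurface.even_eulerChar
  rwa [triangleSet_eps] at h

theorem even_chiPair (c : F.Coloring) (i j : Fin N) : Even (c.chiPair i j) := by
  have h := (isFlow_sub c i j).isClosedSurface.even_eulerChar
  rwa [triangleSet_sub] at h

theorem exists_tri_of_mem {v : F.Vert} {t : F.K.Triangle} (hv : v.1 ∈ t.1) :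
    ∃ (x y : F.Vert) (h : F.IsTri v x y), h.tri = t := by
  obtain ⟨a, b, d, h, rfl⟩ := exists_tri t
  have hv' : v.1 ∈ ({a.1, b.1, d.1} : Finset Space3) := hv
  simp only [Finset.mem_insert, Finset.mem_singleton] at hv'
  rcases hv' with e | e | e
  · obtain rfl := Subtype.ext e
    exact ⟨_, _, h, rfl⟩
  · obtain rfl := Subtype.ext e
    exact ⟨_, _, h.rot, h.tri_rot⟩
  · obtain rfl := Subtype.ext e
    exact ⟨_, _, h.rot.rot, h.rot.tri_rot.trans h.tri_rot⟩

theorem IsTri.tri_swap_last {u v w : F.Vert} (h : F.IsTri u v w) : h.swap_last.tri = h.tri :=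
  h.rot.rot.tri_swap.trans (h.rot.tri_rot.trans h.tri_rot)

theorem IsTri.mem_left {u v w : F.Vert} (h : F.IsTri u v w) : u.1 ∈ h.tri.1 :=
  Finset.mem_insert_self _ _

theorem exists_flow_of_mem {g : F.Vert → F.Vert → F.Vert → ℤ} (hg : IsFlow F g) {v : F.Vert}
    {t : F.K.Triangle} (hv : v.1 ∈ t.1)
    (ht : t ∈ triangleSet fun u v w => g u v w = 1) :
    ∃ (x y : F.Vert) (h : F.IsTri v x y), h.tri = t ∧ g v x y = 1 := by
  obtain ⟨x, y, h, rfl⟩ := exists_tri_of_mem hv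
  rw [hg.mem_triangleSet h] at ht
  by_cases h1 : g v x y = 1
  · exact ⟨x, y, h, rfl, h1⟩
  · refine ⟨y, x, h.swap_last, h.tri_swap_last, ?_⟩
    have h2 := hg.ge v x y
    have h3 := hg.le v x y
    rw [hg.swap_last]
    omega

/-- A union of connected components of the surface `F_ij(c)`: a set of its triangles that is closed
under passing to a triangle of `F_ij(c)` with a common edge. -/
structure IsPart (c : F.Coloring) (i j : Fin N) (S : Set F.K.Triangle) : Prop where
  sub : S ⊆ pairSet c i j
  closed : ∀ {u v x y : F.Vert} (hx : F.IsTri u v x) (hy : F.IsTri u v y), hx.tri ∈ S →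
    hy.tri ∈ pairSet c i j → hy.tri ∈ S

/-- A common vertex suffices, because the links of the vertices in `F_ij(c)` are connected. -/
theorem IsPart.mem_of_vertex {S : Set F.K.Triangle} (hS : IsPart c i j S) {v : F.Vert}
    {t t' : F.K.Triangle} (hv : v.1 ∈ t.1) (hv' : v.1 ∈ t'.1) (ht : t ∈ S)
    (ht' : t' ∈ pairSet c i j) : t' ∈ S := by
  have hg := isFlow_sub c i j
  obtain ⟨x, y, h, rfl, hxy⟩ := exists_flow_of_mem hg hv (by
    rw [triangleSet_sub]; exact hS.sub ht)
  obtain ⟨z, w, h', rfl, hzw⟩ := exists_flow_of_mem hg hv' (by rw [triangleSet_sub]; exact ht')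
  obtain ⟨y', hy', hz⟩ := hg.isClosedSurface.mem_of_closed (v := v)
    {x | ∃ (y : F.Vert) (h : F.IsTri v x y), h.tri ∈ S} (by
      intro x y hxy
      have hxt : F.IsTri v x y := hg.isClosedSurface.tri hxy
      have hp : hxt.tri ∈ pairSet c i j := by
        rw [mem_pairSet_iff]
        omega
      constructor
      · rintro ⟨y', h, hyS⟩
        exact ⟨x, hxt.swap_last, by rw [hxt.tri_swap_last]; exact hS.closed h hxt hyS hp⟩
      · rintro ⟨x', h, hyS⟩
        refine ⟨y, hxt, ?_⟩
        have := hS.closed h hxt.swap_last hyS (by rw [hxt.tri_swap_last]; exact hp)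
        rwa [hxt.tri_swap_last] at this) hxy ⟨y, h, ht⟩ hzw
  exact hS.closed hy' h' hz ht'

/-- The simplex `s` is a face of a triangle of `S`. -/
def Touches (S : Set F.K.Triangle) (s : Finset Space3) : Prop := ∃ t ∈ S, s ⊆ t.1

/-- The exchange of two colors. -/
def swapColors (i j : Fin N) (A : Finset (Fin N)) : Finset (Fin N) :=
  A.map (Equiv.swap i j).toEmbedding

theorem mem_swapColors {i j k : Fin N} {A : Finset (Fin N)} :
    k ∈ swapColors i j A ↔ Equiv.swap i j k ∈ A := by
  rw [swapColors, Finset.mem_map_equiv, Equiv.symm_swap]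

theorem swapColors_swapColors (i j : Fin N) (A : Finset (Fin N)) :
    swapColors i j (swapColors i j A) = A := by
  ext k
  rw [mem_swapColors, mem_swapColors, Equiv.swap_apply_self]

theorem swapColors_eq_self {i j : Fin N} {A : Finset (Fin N)} (h : i ∈ A ↔ j ∈ A) :
    swapColors i j A = A := by
  ext k
  rw [mem_swapColors]
  by_cases h1 : k = i
  · rw [h1, Equiv.swap_apply_left, h]
  · by_cases h2 : k = j
    · rw [h2, Equiv.swap_apply_right, h]
    · rw [Equiv.swap_apply_of_ne_of_ne h1 h2]

theorem swapColors_of_notMem_pairSet {t : F.K.Triangle} (h : t ∉ pairSet c i j) :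
    swapColors i j (c.color t) = c.color t := by
  refine swapColors_eq_self ?_
  have h' : ¬ ((i ∈ c.color t ∧ j ∉ c.color t) ∨ (j ∈ c.color t ∧ i ∉ c.color t)) := h
  tauto

theorem color_congr (c : F.Coloring) {t t' : F.K.Triangle} (h : F.K.facetOf t = F.K.facetOf t') :
    c.color t = c.color t' := by
  rw [Coloring.color, Coloring.color, h]

/-- A part of `F_ij(c)` consists of whole facets. -/
theorem IsPart.mem_iff_of_facetRel {S : Set F.K.Triangle} (hS : IsPart c i j S)
    {s t : F.K.Triangle} (h : F.K.FacetRel s t) : s ∈ S ↔ t ∈ S := by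
  have key : ∀ {s t : F.K.Triangle}, F.K.FacetRel s t → s ∈ S → t ∈ S := by
    intro s t h hs
    have hc : c.color s = c.color t := color_congr c (Quot.sound h)
    obtain ⟨e, he, h1, h2⟩ := h
    obtain ⟨x, hx⟩ := F.K.nonempty_of_mem_faces he.1
    refine hS.mem_of_vertex (v := ⟨x, singleton_mem_of_mem he.1 hx⟩) (h1 hx) (h2 hx) hs ?_
    have := hS.sub hs
    unfold pairSet at this ⊢
    rw [Set.mem_ofPred_eq] at this ⊢
    rwa [hc] at this
  refine ⟨key h, key ?_⟩
  obtain ⟨e, he, h1, h2⟩ := h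
  exact ⟨e, he, h2, h1⟩

theorem IsPart.mem_iff_of_facetOf_eq {S : Set F.K.Triangle} (hS : IsPart c i j S)
    {s t : F.K.Triangle} (h : F.K.facetOf s = F.K.facetOf t) : s ∈ S ↔ t ∈ S := by
  have h1 := congrArg (Quot.lift (fun t => t ∈ S) fun s t h =>
    propext (hS.mem_iff_of_facetRel h)) h
  exact iff_of_eq h1

/-- The facet is contained in `S`. -/
def facetIn (S : Set F.K.Triangle) (f : F.K.Facet) : Prop := ∃ t, F.K.facetOf t = f ∧ t ∈ S

theorem IsPart.facetIn_facetOf {S : Set F.K.Triangle} (hS : IsPart c i j S) (t : F.K.Triangle) :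
    facetIn S (F.K.facetOf t) ↔ t ∈ S :=
  ⟨fun ⟨_, h, hs⟩ => (hS.mem_iff_of_facetOf_eq h).1 hs, fun h => ⟨t, rfl, h⟩⟩

open scoped Classical in
/-- The exchange of the colors `i` and `j` on the facets in `S`. -/
def kempeFun (c : F.Coloring) (i j : Fin N) (S : Set F.K.Triangle) (f : F.K.Facet) :
    Finset (Fin N) :=
  if facetIn S f then swapColors i j (c.1 f) else c.1 f

open scoped Classical in
theorem kempeFun_facetOf {S : Set F.K.Triangle} (hS : IsPart c i j S) (t : F.K.Triangle) :
    kempeFun c i j S (F.K.facetOf t) =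
      if t ∈ S then swapColors i j (c.color t) else c.color t := by
  unfold kempeFun
  simp only [hS.facetIn_facetOf]
  rfl

/-- Near a simplex that touches `S`, all facets exchange the colors. -/
theorem kempeFun_of_touches {S : Set F.K.Triangle} (hS : IsPart c i j S) {v : F.Vert}
    (hv : Touches S {v.1}) {t : F.K.Triangle} (ht : v.1 ∈ t.1) :
    kempeFun c i j S (F.K.facetOf t) = swapColors i j (c.color t) := by
  classical
  rw [kempeFun_facetOf hS]
  split_ifs with h
  · rfl
  · obtain ⟨t', ht', hvt⟩ := hv
    rw [swapColors_of_notMem_pairSet]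
    exact fun hp => h (hS.mem_of_vertex (hvt (by simp)) ht ht' hp)

theorem kempeFun_of_not_touches {S : Set F.K.Triangle} (hS : IsPart c i j S) {v : F.Vert}
    (hv : ¬ Touches S {v.1}) {t : F.K.Triangle} (ht : v.1 ∈ t.1) :
    kempeFun c i j S (F.K.facetOf t) = c.color t := by
  classical
  rw [kempeFun_facetOf hS, if_neg]
  exact fun h => hv ⟨t, h, by simpa using ht⟩

theorem isColoring_kempeFun {S : Set F.K.Triangle} (hS : IsPart c i j S) :
    F.IsColoring (kempeFun c i j S) := by
  constructor
  · intro f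
    unfold kempeFun
    split_ifs
    · rw [swapColors, Finset.card_map, c.2.1]
    · exact c.2.1 f
  · intro u v a b w ha hb hw hs hab haw hbw ht
    obtain ⟨h1, h2⟩ := c.2.2 u v a b w ha hb hw hs hab haw hbw ht
    have hu : ({u} : Finset Space3) ∈ F.K.faces := singleton_mem_of_mem ha.1 (by simp)
    have ma : u ∈ (F.K.tri ha).1 := Finset.mem_insert_self _ _
    have mb : u ∈ (F.K.tri hb).1 := Finset.mem_insert_self _ _
    have mw : u ∈ (F.K.tri hw).1 := Finset.mem_insert_self _ _
    by_cases hT : Touches S {u}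
    · rw [kempeFun_of_touches hS (v := ⟨u, hu⟩) hT ma, kempeFun_of_touches hS (v := ⟨u, hu⟩) hT mb,
        kempeFun_of_touches hS (v := ⟨u, hu⟩) hT mw]
      constructor
      · rw [swapColors, swapColors, Finset.disjoint_map]
        exact h1
      · rw [swapColors, swapColors, swapColors, ← Finset.map_union]
        exact congrArg _ h2
    · rw [kempeFun_of_not_touches hS (v := ⟨u, hu⟩) hT ma,
        kempeFun_of_not_touches hS (v := ⟨u, hu⟩) hT mb,
        kempeFun_of_not_touches hS (v := ⟨u, hu⟩) hT mw]
      exact ⟨h1, h2⟩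

/-- The coloring obtained from `c` by exchanging the colors `i` and `j` on a union `S` of
connected components of `F_ij(c)`. -/
def kempe (c : F.Coloring) (i j : Fin N) {S : Set F.K.Triangle} (hS : IsPart c i j S) :
    F.Coloring := ⟨kempeFun c i j S, isColoring_kempeFun hS⟩

section

variable {S : Set F.K.Triangle} (hS : IsPart c i j S)

open scoped Classical in
theorem color_kempe (t : F.K.Triangle) : (kempe c i j hS).color t =
    if t ∈ S then swapColors i j (c.color t) else c.color t := kempeFun_facetOf hS t

theorem color_kempe_of_touches {v : F.Vert} (hv : Touches S {v.1}) {t : F.K.Triangle}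
    (ht : v.1 ∈ t.1) : (kempe c i j hS).color t = swapColors i j (c.color t) :=
  kempeFun_of_touches hS hv ht

theorem color_kempe_of_not_touches {v : F.Vert} (hv : ¬ Touches S {v.1}) {t : F.K.Triangle}
    (ht : v.1 ∈ t.1) : (kempe c i j hS).color t = c.color t :=
  kempeFun_of_not_touches hS hv ht

theorem eps_kempe_of_touches {v : F.Vert} (hv : Touches S {v.1}) (k : Fin N) (x y : F.Vert) :
    eps (kempe c i j hS) k v x y = eps c (Equiv.swap i j k) v x y := by
  by_cases h : F.IsTri v x y
  · unfold eps
    rw [col_eq _ h, col_eq _ h, color_kempe_of_touches hS hv h.mem_left]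
    simp only [mem_swapColors]
  · rw [not_ne_iff.1 (mt isTri_of_eps h), not_ne_iff.1 (mt isTri_of_eps h)]

theorem eps_kempe_of_not_touches {v : F.Vert} (hv : ¬ Touches S {v.1}) (k : Fin N) (x y : F.Vert) :
    eps (kempe c i j hS) k v x y = eps c k v x y := by
  by_cases h : F.IsTri v x y
  · unfold eps
    rw [col_eq _ h, col_eq _ h, color_kempe_of_not_touches hS hv h.mem_left]
  · rw [not_ne_iff.1 (mt isTri_of_eps h), not_ne_iff.1 (mt isTri_of_eps h)]

end

/-! ### Euler characteristics under Kempe moves -/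

/-- The sign with which a simplex contributes to Euler characteristics. -/
def simplexSign (s : Finset Space3) : ℤ :=
  if s.card = 1 then 1 else if s.card = 2 then -1 else if s.card = 3 then 1 else 0

open scoped Classical in
theorem eulerChar_eq_sum (S : Set F.K.Triangle) : F.K.eulerChar S =
    ∑ s ∈ F.finite.toFinset, simplexSign s * if Touches S s then 1 else 0 := by
  have hk : ∀ k, (simplices F k S).ncard = ∑ s ∈ F.finite.toFinset,
      if s.card = k ∧ Touches S s then 1 else 0 := by
    intro k
    rw [Finset.sum_boole, Nat.cast_id, ← Set.ncard_coe_finset]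
    congr 1
    ext s
    rw [Finset.mem_coe, Finset.mem_filter, Set.Finite.mem_toFinset]
    exact Iff.rfl
  rw [eulerChar_eq, hk, hk, hk]
  push_cast
  rw [← Finset.sum_sub_distrib, ← Finset.sum_add_distrib]
  refine Finset.sum_congr rfl fun s _ => ?_
  unfold simplexSign
  by_cases h : Touches S s <;> simp only [h, and_true, and_false]
  · split_ifs <;> omega
  · simp

/-- The change at the simplex `s` of the indicator of the union of all triangles whose colors
satisfy `Q`, when the colors are exchanged everywhere. -/
def simplexChange (c : F.Coloring) (i j : Fin N) (Q : Finset (Fin N) → Prop)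
    (s : Finset Space3) : ℤ := by
  classical exact
    (if Touches {t : F.K.Triangle | Q (swapColors i j (c.color t))} s then 1 else 0) -
      if Touches {t : F.K.Triangle | Q (c.color t)} s then 1 else 0

/-- The change of the Euler characteristic of the union of all triangles whose colors
satisfy `Q` under a Kempe move. -/
def eulerChange (c : F.Coloring) (i j : Fin N) (Q : Finset (Fin N) → Prop)
    (S : Set F.K.Triangle) : ℤ := by
  classical exact
    ∑ s ∈ F.finite.toFinset, if Touches S s then simplexSign s * simplexChange c i j Q s else 0

theorem touches_congr {S S' : Set F.K.Triangle} {s : Finset Space3}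
    (h : ∀ t : F.K.Triangle, s ⊆ t.1 → (t ∈ S ↔ t ∈ S')) : Touches S s ↔ Touches S' s :=
  exists_congr fun t => ⟨fun ⟨h1, h2⟩ => ⟨(h t h2).1 h1, h2⟩, fun ⟨h1, h2⟩ => ⟨(h t h2).2 h1, h2⟩⟩

theorem Touches.mono {S : Set F.K.Triangle} {s s' : Finset Space3} (h : Touches S s) (hs : s' ⊆ s) :
    Touches S s' := by
  obtain ⟨t, ht, hst⟩ := h
  exact ⟨t, ht, hs.trans hst⟩

/-- The Kempe move exchanges `i, j` in all triangles at a simplex on `S` and changes none at the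
other simplices. So the Euler characteristics change by a sum over the simplices of `S`. -/
theorem eulerChar_kempe {S : Set F.K.Triangle} (hS : IsPart c i j S) (Q : Finset (Fin N) → Prop) :
    F.K.eulerChar {t | Q ((kempe c i j hS).color t)} =
      F.K.eulerChar {t | Q (c.color t)} + eulerChange c i j Q S := by
  classical
  rw [eulerChar_eq_sum, eulerChar_eq_sum, eulerChange, ← Finset.sum_add_distrib]
  refine Finset.sum_congr rfl fun s hs => ?_
  rw [Set.Finite.mem_toFinset] at hs
  obtain ⟨x, hx⟩ := F.K.nonempty_of_mem_faces hs
  by_cases hT : Touches S s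
  · have hv : Touches S {(⟨x, singleton_mem_of_mem hs hx⟩ : F.Vert).1} :=
      hT.mono (by simpa using hx)
    have e : Touches {t | Q ((kempe c i j hS).color t)} s ↔
        Touches {t : F.K.Triangle | Q (swapColors i j (c.color t))} s :=
      touches_congr fun t ht => by
        rw [Set.mem_ofPred_eq, Set.mem_ofPred_eq, color_kempe_of_touches hS hv (ht hx)]
    rw [if_pos hT, simplexChange]
    simp only [e]
    ring
  · rw [if_neg hT, add_zero]
    have e : Touches {t | Q ((kempe c i j hS).color t)} s ↔ Touches {t | Q (c.color t)} s :=
      touches_congr fun t ht => by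
        rw [Set.mem_ofPred_eq, Set.mem_ofPred_eq, color_kempe, if_neg]
        exact fun h => hT ⟨t, h, ht⟩
    simp only [e]

theorem eulerChange_swap (Q : Finset (Fin N) → Prop) (S : Set F.K.Triangle) :
    eulerChange c i j (fun A => Q (swapColors i j A)) S = - eulerChange c i j Q S := by
  classical
  rw [eulerChange, eulerChange, ← Finset.sum_neg_distrib]
  refine Finset.sum_congr rfl fun s _ => ?_
  split_ifs
  · rw [simplexChange, simplexChange]
    simp only [swapColors_swapColors]
    ring
  · simp

theorem eulerChange_congr {Q Q' : Finset (Fin N) → Prop} (h : ∀ A, Q A ↔ Q' A)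
    (S : Set F.K.Triangle) : eulerChange c i j Q S = eulerChange c i j Q' S := by
  rw [show Q = Q' from funext fun A => propext (h A)]

theorem eulerChange_eq_zero {Q : Finset (Fin N) → Prop} (h : ∀ A, Q (swapColors i j A) ↔ Q A)
    (S : Set F.K.Triangle) : eulerChange c i j Q S = 0 := by
  have h1 := eulerChange_swap (c := c) (i := i) (j := j) Q S
  rw [eulerChange_congr h] at h1
  omega

open scoped Classical in
/-- The change of an Euler characteristic is the sum of the contributions of the connected
components. -/
theorem eulerChange_biUnion (Q : Finset (Fin N) → Prop) {ι : Type*} (U : Finset ι)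
    (S : ι → Set F.K.Triangle) (hS : ∀ k ∈ U, IsPart c i j (S k))
    (hd : ∀ k ∈ U, ∀ l ∈ U, k ≠ l → Disjoint (S k) (S l)) :
    eulerChange c i j Q {t | ∃ k ∈ U, t ∈ S k} = ∑ k ∈ U, eulerChange c i j Q (S k) := by
  unfold eulerChange
  rw [Finset.sum_comm]
  refine Finset.sum_congr rfl fun s hs => ?_
  rw [Set.Finite.mem_toFinset] at hs
  obtain ⟨x, hx⟩ := F.K.nonempty_of_mem_faces hs
  by_cases hT : Touches {t | ∃ k ∈ U, t ∈ S k} s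
  · obtain ⟨t, ⟨k, hk, ht⟩, hst⟩ := id hT
    rw [if_pos hT, Finset.sum_eq_single_of_mem k hk, if_pos ⟨t, ht, hst⟩]
    intro l hl hlk
    rw [if_neg]
    rintro ⟨t', ht', hst'⟩
    have := (hS k hk).mem_of_vertex (v := ⟨x, singleton_mem_of_mem hs hx⟩) (hst hx) (hst' hx) ht
      ((hS l hl).sub ht')
    exact Set.disjoint_left.1 (hd l hl k hk hlk) ht' this
  · rw [if_neg hT, Finset.sum_eq_zero]
    intro k hk
    rw [if_neg]
    rintro ⟨t, ht, hst⟩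
    exact hT ⟨t, ⟨k, hk, ht⟩, hst⟩

open scoped Classical in
theorem eulerChar_biUnion {ι : Type*} (U : Finset ι)
    (S : ι → Set F.K.Triangle) (hS : ∀ k ∈ U, IsPart c i j (S k))
    (hd : ∀ k ∈ U, ∀ l ∈ U, k ≠ l → Disjoint (S k) (S l)) :
    F.K.eulerChar {t | ∃ k ∈ U, t ∈ S k} = ∑ k ∈ U, F.K.eulerChar (S k) := by
  simp only [eulerChar_eq_sum]
  rw [Finset.sum_comm]
  refine Finset.sum_congr rfl fun s hs => ?_
  rw [Set.Finite.mem_toFinset] at hs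
  obtain ⟨x, hx⟩ := F.K.nonempty_of_mem_faces hs
  by_cases hT : Touches {t | ∃ k ∈ U, t ∈ S k} s
  · obtain ⟨t, ⟨k, hk, ht⟩, hst⟩ := id hT
    rw [if_pos hT, Finset.sum_eq_single_of_mem k hk, if_pos ⟨t, ht, hst⟩]
    intro l hl hlk
    rw [if_neg, mul_zero]
    rintro ⟨t', ht', hst'⟩
    have := (hS k hk).mem_of_vertex (v := ⟨x, singleton_mem_of_mem hs hx⟩) (hst hx) (hst' hx) ht
      ((hS l hl).sub ht')
    exact Set.disjoint_left.1 (hd l hl k hk hlk) ht' this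
  · rw [if_neg hT, mul_zero, Finset.sum_eq_zero]
    intro k hk
    rw [if_neg, mul_zero]
    rintro ⟨t, ht, hst⟩
    exact hT ⟨t, ⟨k, hk, ht⟩, hst⟩

end GLFoam

/-! ### Seams under Kempe moves -/

theorem IsCirculation.restrict {V : Type*} {B : V → V → Prop} (hB : IsCirculation B) (X : Set V)
    (hX : ∀ u v, B u v → (u ∈ X ↔ v ∈ X)) : IsCirculation fun u v => B u v ∧ u ∈ X where
  ne u v h := hB.ne _ _ h.1
  out_unique u v w h h' := hB.out_unique _ _ _ h.1 h'.1
  in_unique u v w h h' := hB.in_unique _ _ _ h.1 h'.1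
  out_of_in u v h := by
    obtain ⟨w, hw⟩ := hB.out_of_in _ _ h.1
    exact ⟨w, hw, (hX _ _ h.1).1 h.2⟩
  in_of_out u v h := by
    obtain ⟨w, hw⟩ := hB.in_of_out _ _ h.1
    exact ⟨w, hw, (hX _ _ hw).2 h.2⟩

namespace GLFoam

variable {N : ℕ} {R : Type*} [CommRing R] {F : GLFoam N R} {c : F.Coloring} {i j : Fin N}
  {S : Set F.K.Triangle}

/-- The vertices of `S`. -/
def verts (S : Set F.K.Triangle) : Set F.Vert := {v | Touches S {v.1}}

theorem mem_verts_of_mem {v : F.Vert} {t : F.K.Triangle} (ht : t ∈ S) (hv : v.1 ∈ t.1) :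
    v ∈ verts S := ⟨t, ht, by simpa using hv⟩

theorem IsPart.mem_of_mem_verts (hS : IsPart c i j S) {v : F.Vert} (hv : v ∈ verts S)
    {t : F.K.Triangle} (ht : v.1 ∈ t.1) (hp : t ∈ pairSet c i j) : t ∈ S := by
  obtain ⟨t', ht', hvt⟩ := hv
  exact hS.mem_of_vertex (hvt (by simp)) ht ht' hp

theorem isPositive_kempe_of_mem (hS : IsPart c i j S) (k l : Fin N) {u : F.Vert} (hu : u ∈ verts S)
    (v : F.Vert) : IsPositive (kempe c i j hS) k l u v ↔
      IsPositive c (Equiv.swap i j k) (Equiv.swap i j l) u v := by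
  have h := eps_kempe_of_touches hS hu
  refine exists_congr fun a => exists_congr fun b => exists_congr fun w => and_congr_left fun _ => ?_
  constructor
  · rintro ⟨h1, h2, h3, h4, h5, h6⟩
    rw [h] at h1 h2 h3 h4 h5 h6
    exact ⟨h1, h2, h3, h4, h5, h6⟩
  · rintro ⟨h1, h2, h3, h4, h5, h6⟩
    constructor <;> rw [h] <;> assumption

theorem isPositive_kempe_of_notMem (hS : IsPart c i j S) (k l : Fin N) {u : F.Vert}
    (hu : u ∉ verts S) (v : F.Vert) :
    IsPositive (kempe c i j hS) k l u v ↔ IsPositive c k l u v := by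
  have h := eps_kempe_of_not_touches hS hu
  refine exists_congr fun a => exists_congr fun b => exists_congr fun w => and_congr_left fun _ => ?_
  constructor
  · rintro ⟨h1, h2, h3, h4, h5, h6⟩
    rw [h] at h1 h2 h3 h4 h5 h6
    exact ⟨h1, h2, h3, h4, h5, h6⟩
  · rintro ⟨h1, h2, h3, h4, h5, h6⟩
    constructor <;> rw [h] <;> assumption

/-- On `S`, the positive seams of the colors `k, l` become those of the exchanged colors, and
conversely, so the total number of their circles keeps its parity. -/
theorem even_thetaPlus_exchange (hS : IsPart c i j S) (k l : Fin N) :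
    Even ((kempe c i j hS).thetaPlus k l +
      (kempe c i j hS).thetaPlus (Equiv.swap i j k) (Equiv.swap i j l) +
      (c.thetaPlus k l + c.thetaPlus (Equiv.swap i j k) (Equiv.swap i j l))) := by
  simp only [thetaPlus_eq]
  refine even_circleCount_exchange (isCirculation_isPositive _ _ _)
    (isCirculation_isPositive _ _ _) (isCirculation_isPositive _ _ _)
    (isCirculation_isPositive _ _ _) (verts S) (fun u hu v => ⟨?_, ?_⟩) (fun u hu v => ⟨?_, ?_⟩)
  · exact isPositive_kempe_of_mem hS k l hu v
  · rw [isPositive_kempe_of_mem hS _ _ hu v, Equiv.swap_apply_self, Equiv.swap_apply_self]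
  · exact isPositive_kempe_of_notMem hS _ _ hu v
  · exact isPositive_kempe_of_notMem hS _ _ hu v

theorem thetaPlus_kempe_of_fixed (hS : IsPart c i j S) {k l : Fin N} (hk : Equiv.swap i j k = k)
    (hl : Equiv.swap i j l = l) : (kempe c i j hS).thetaPlus k l = c.thetaPlus k l := by
  rw [thetaPlus_eq, thetaPlus_eq]
  refine circleCount_congr fun u v => ?_
  by_cases hu : u ∈ verts S
  · rw [isPositive_kempe_of_mem hS _ _ hu, hk, hl]
  · exact isPositive_kempe_of_notMem hS _ _ hu v

/-- Exchanging the roles of the two colors changes the sign of a seam. -/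
theorem isPositive_comm {u v : F.Vert} (h : Seam c i j u v) :
    IsPositive c j i u v ↔ ¬ IsPositive c i j u v := by
  obtain ⟨a, b, w, h⟩ := h
  rw [h.isPositive_iff, h.symm.isPositive_iff]
  obtain ⟨e, he⟩ := exists_generic fun x : LinkVert u => dir x
  have hG := isSphereGraph he
  have ta : F.IsTri u v a := isTri_of_eps (c := c) (i := i) (by rw [h.ia]; omega)
  have tb : F.IsTri u v b := isTri_of_eps (c := c) (i := j) (by rw [h.jb]; omega)
  have tw : F.IsTri u v w := isTri_of_eps (c := c) (i := i) (by rw [h.iw]; omega)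
  obtain ⟨n1, n2, n3⟩ := h.ne
  have key := hG.isLeftHanded_reverse (a := ta.linkVert) (x := tb.swap_last.linkVert)
    (y := ta.swap_last.linkVert) (z := tw.swap_last.linkVert) (link_adj.2 tb) (link_adj.2 ta)
    (link_adj.2 tw) (fun e => n1 (congrArg LinkVert.toVert e).symm)
    (fun e => n2 (congrArg LinkVert.toVert e)) (fun e => n3 (congrArg LinkVert.toVert e))
  change IsLeftHanded (v.1 - u.1) (b.1 - u.1) (a.1 - u.1) (w.1 - u.1) ↔
    ¬ IsLeftHanded (v.1 - u.1) (w.1 - u.1) (a.1 - u.1) (b.1 - u.1) at key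
  rw [key]
  unfold IsLeftHanded
  tauto

theorem SeamAt.isTri {u v a b w : F.Vert} (h : SeamAt c i j u v a b w) :
    F.IsTri u v a ∧ F.IsTri u v b ∧ F.IsTri u v w :=
  ⟨isTri_of_eps (c := c) (i := i) (by rw [h.ia]; omega),
    isTri_of_eps (c := c) (i := j) (by rw [h.jb]; omega),
    isTri_of_eps (c := c) (i := i) (by rw [h.iw]; omega)⟩

theorem IsTri.mem_right {u v w : F.Vert} (h : F.IsTri u v w) : v.1 ∈ h.tri.1 :=
  Finset.mem_insert_of_mem (Finset.mem_insert_self _ _)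

theorem seam_mem_verts_iff (hS : IsPart c i j S) {u v : F.Vert} (h : Seam c i j u v) :
    u ∈ verts S ↔ v ∈ verts S := by
  obtain ⟨a, b, w, h⟩ := h
  have ta := h.isTri.1
  have hp : ta.tri ∈ pairSet c i j := by
    rw [mem_pairSet_iff, h.ia, h.ja]
    omega
  exact ⟨fun hu => mem_verts_of_mem (hS.mem_of_mem_verts hu ta.mem_left hp) ta.mem_right,
    fun hv => mem_verts_of_mem (hS.mem_of_mem_verts hv ta.mem_right hp) ta.mem_left⟩

/-- The seams on `S`. -/
def SeamOn (c : F.Coloring) (i j : Fin N) (S : Set F.K.Triangle) (u v : F.Vert) : Prop :=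
  Seam c i j u v ∧ u ∈ verts S

theorem isCirculation_seamOn (hS : IsPart c i j S) : IsCirculation (SeamOn c i j S) :=
  (isCirculation_seam c i j).restrict _ fun _ _ h => seam_mem_verts_iff hS h

/-- A Kempe move changes the signs of the seams on `S`. -/
theorem even_thetaPlus_kempe (hS : IsPart c i j S) :
    Even ((kempe c i j hS).thetaPlus i j + c.thetaPlus i j + circleCount (SeamOn c i j S)) := by
  have hP := isCirculation_isPositive c i j
  have hP' := isCirculation_isPositive (kempe c i j hS) i j
  have hX : ∀ u v, IsPositive c i j u v → (u ∈ verts S ↔ v ∈ verts S) :=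
    fun u v h => seam_mem_verts_iff hS h.seam
  have hon : ∀ u ∈ verts S, ∀ v, IsPositive (kempe c i j hS) i j u v ↔
      Seam c i j u v ∧ ¬ IsPositive c i j u v := by
    intro u hu v
    rw [isPositive_kempe_of_mem hS _ _ hu, Equiv.swap_apply_left, Equiv.swap_apply_right]
    constructor
    · intro h
      have hs := seam_comm.1 h.seam
      exact ⟨hs, (isPositive_comm hs).1 h⟩
    · rintro ⟨hs, h⟩
      exact (isPositive_comm hs).2 h
  have hX' : ∀ u v, IsPositive (kempe c i j hS) i j u v → (u ∈ verts S ↔ v ∈ verts S) := by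
    intro u v h
    by_cases hu : u ∈ verts S
    · exact seam_mem_verts_iff hS ((hon u hu v).1 h).1
    · exact hX u v ((isPositive_kempe_of_notMem hS _ _ hu v).1 h)
  have hon1 := hP.restrict (verts S) hX
  have hon1' := hP'.restrict (verts S) hX'
  have hoff := hP.restrict (verts S)ᶜ fun u v h => not_congr (hX u v h)
  have e1 : c.thetaPlus i j = circleCount (fun u v => IsPositive c i j u v ∧ u ∈ verts S) +
      circleCount (fun u v => IsPositive c i j u v ∧ u ∈ (verts S)ᶜ) := by
    rw [thetaPlus_eq, ← circleCount_or hon1 hoff fun u v w h h' => h'.2 h.2]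
    refine circleCount_congr fun u v => ?_
    by_cases hu : u ∈ verts S <;> simp [hu]
  have e2 : (kempe c i j hS).thetaPlus i j =
      circleCount (fun u v => IsPositive (kempe c i j hS) i j u v ∧ u ∈ verts S) +
      circleCount (fun u v => IsPositive c i j u v ∧ u ∈ (verts S)ᶜ) := by
    rw [thetaPlus_eq, ← circleCount_or hon1' hoff fun u v w h h' => h'.2 h.2]
    refine circleCount_congr fun u v => ?_
    by_cases hu : u ∈ verts S
    · simp [hu]
    · simp [hu, isPositive_kempe_of_notMem hS _ _ hu]
  have e3 : circleCount (SeamOn c i j S) =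
      circleCount (fun u v => IsPositive c i j u v ∧ u ∈ verts S) +
      circleCount (fun u v => IsPositive (kempe c i j hS) i j u v ∧ u ∈ verts S) := by
    rw [← circleCount_or hon1 hon1']
    · refine circleCount_congr fun u v => ?_
      constructor
      · rintro ⟨h, hu⟩
        by_cases hpos : IsPositive c i j u v
        · exact Or.inl ⟨hpos, hu⟩
        · exact Or.inr ⟨(hon u hu v).2 ⟨h, hpos⟩, hu⟩
      · rintro (⟨h, hu⟩ | ⟨h, hu⟩)
        · exact ⟨h.seam, hu⟩
        · exact ⟨((hon u hu v).1 h).1, hu⟩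
    · rintro u v w ⟨h, hu⟩ ⟨h', -⟩
      rw [hon u hu] at h'
      obtain rfl := h.seam.out_unique h'.1
      exact h'.2 h
  rw [e1, e2, e3]
  exact ⟨circleCount (fun u v => IsPositive c i j u v ∧ u ∈ verts S) +
    circleCount (fun u v => IsPositive (kempe c i j hS) i j u v ∧ u ∈ verts S) +
    circleCount (fun u v => IsPositive c i j u v ∧ u ∈ (verts S)ᶜ), by ring⟩

/-! ### The side of one color -/

/-- The triangles of `S` that have the color `k`. -/
def side (c : F.Coloring) (k : Fin N) (S : Set F.K.Triangle) : Set F.K.Triangle :=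
  {t | t ∈ S ∧ k ∈ c.color t}

theorem pairSet_comm : pairSet c j i = pairSet c i j := by
  ext t
  exact or_comm

theorem IsPart.symm (hS : IsPart c i j S) : IsPart c j i S where
  sub := by rw [pairSet_comm]; exact hS.sub
  closed hx hy h h' := hS.closed hx hy h (by rwa [pairSet_comm] at h')

theorem Seam.anti {u v : F.Vert} (h : Seam c i j u v) : ¬ Seam c i j v u := by
  rintro ⟨a', b', w', h'⟩
  obtain ⟨a, b, w, h⟩ := h
  have h1 := h'.values a
  rw [eps_swap, eps_swap c j, h.ia, h.ja] at h1
  omega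

theorem mem_side_iff {u v w : F.Vert} (h : F.IsTri u v w) (k : Fin N) :
    h.tri ∈ side c k S ↔ h.tri ∈ S ∧ eps c k u v w ≠ 0 := by
  rw [eps_ne_zero_iff c k h]
  rfl

theorem exists_apex_of_edge {s : Finset Space3} (hs : s.card = 2) {t : F.K.Triangle}
    (hst : s ⊆ t.1) : ∃ u v : F.Vert, u ≠ v ∧ s = {u.1, v.1} := by
  obtain ⟨x, y, hxy, rfl⟩ := Finset.card_eq_two.1 hs
  refine ⟨⟨x, singleton_mem_of_mem t.2.1 (hst (by simp))⟩,
    ⟨y, singleton_mem_of_mem t.2.1 (hst (by simp))⟩, fun e => hxy ?_, rfl⟩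
  exact congrArg (fun z : F.Vert => z.1) e

/-- An edge at which both sides of `S` meet is a seam. -/
theorem seam_of_touches (hS : IsPart c i j S) {u v : F.Vert} (huv : u ≠ v)
    (hi : Touches (side c i S) {u.1, v.1}) (hj : Touches (side c j S) {u.1, v.1}) :
    Seam c i j u v ∨ Seam c i j v u := by
  obtain ⟨t, ht, hst⟩ := hi
  obtain ⟨t', ht', hst'⟩ := hj
  obtain ⟨x, hx, rfl⟩ := exists_apex huv t hst
  obtain ⟨y, hy, rfl⟩ := exists_apex huv t' hst'
  rw [mem_side_iff] at ht ht'
  have p1 := (mem_pairSet_iff hx).1 (hS.sub ht.1)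
  have p2 := (mem_pairSet_iff hy).1 (hS.sub ht'.1)
  have m1 := eps_sub_mem c c i j u v x
  have m2 := eps_sub_mem c c i j u v y
  have a1 := eps_mem c i u v x
  have a2 := eps_mem c j u v y
  have a3 := eps_mem c j u v x
  have a4 := eps_mem c i u v y
  rcases edge_pair c i j hx with h | h | ⟨p, q, -, -, hpq, hi, hj, h0⟩
  · exact Or.inl h
  · exact Or.inr h
  · exfalso
    have hxpq : x = p ∨ x = q := by
      by_contra hn
      rw [not_or] at hn
      exact ht.2 (h0 x hn.1 hn.2).1
    have hypq : y = p ∨ y = q := by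
      by_contra hn
      rw [not_or] at hn
      exact ht'.2 (h0 y hn.1 hn.2).2
    have h1 := ht.2
    have h2 := ht'.2
    clear h0
    have hx0 : eps c j u v x = 0 := by omega
    have hy0 : eps c i u v y = 0 := by omega
    rcases hxpq with rfl | rfl <;> rcases hypq with rfl | rfl <;> omega

theorem touches_side_edge (hS : IsPart c i j S) {u v : F.Vert} (huv : u ≠ v)
    (hT : Touches S {u.1, v.1}) (hi : Touches {t | i ∈ c.color t} {u.1, v.1}) :
    Touches (side c i S) {u.1, v.1} := by
  obtain ⟨t, ht, hst⟩ := hT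
  obtain ⟨t', ht', hst'⟩ := hi
  obtain ⟨x, hx, rfl⟩ := exists_apex huv t hst
  obtain ⟨y, hy, rfl⟩ := exists_apex huv t' hst'
  have p1 := (mem_pairSet_iff hx).1 (hS.sub ht)
  have p2 : eps c i u v y ≠ 0 := (eps_ne_zero_iff c i hy).2 ht'
  rcases edge_pair c i j hx with ⟨a, b, w, h⟩ | ⟨a, b, w, h⟩ | ⟨p, q, -, -, hpq, hi, hj, h0⟩
  · have ta := h.isTri.1
    refine ⟨ta.tri, (mem_side_iff ta i).2 ⟨hS.closed hx ta ht ?_, by rw [h.ia]; omega⟩, ?_⟩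
    · rw [mem_pairSet_iff, h.ia, h.ja]; omega
    · rw [tri_subset_iff]; simp
  · have ta := h.isTri.1.swap
    refine ⟨ta.tri, (mem_side_iff ta i).2 ⟨hS.closed hx ta ht ?_, ?_⟩, ?_⟩
    · rw [mem_pairSet_iff, eps_swap, eps_swap c j, h.ia, h.ja]; omega
    · rw [eps_swap, h.ia]; omega
    · rw [tri_subset_iff]; simp
  · refine ⟨hx.tri, (mem_side_iff hx i).2 ⟨ht, ?_⟩, hst⟩
    have hxpq : x = p ∨ x = q := by
      by_contra hn
      rw [not_or] at hn
      have := h0 x hn.1 hn.2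
      omega
    have hypq : y = p ∨ y = q := by
      by_contra hn
      rw [not_or] at hn
      exact p2 (h0 y hn.1 hn.2).1
    clear h0
    rcases hxpq with rfl | rfl <;> rcases hypq with rfl | rfl <;> omega

/-- A simplex of `S` that belongs to a triangle with color `i` belongs to a triangle of `S` with
color `i`. -/
theorem touches_side (hS : IsPart c i j S) {s : Finset Space3} (hs : s.Nonempty)
    (hT : Touches S s) (hi : Touches {t | i ∈ c.color t} s) : Touches (side c i S) s := by
  obtain ⟨t, ht, hst⟩ := id hT
  obtain ⟨t', ht', hst'⟩ := id hi
  have h3 : s.card ≤ 3 := by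
    rw [← t.2.2]
    exact Finset.card_le_card hst
  have h1 : 0 < s.card := Finset.card_pos.2 hs
  have hcard : s.card = 1 ∨ s.card = 2 ∨ s.card = 3 := by omega
  rcases hcard with h | h | h
  · obtain ⟨x, rfl⟩ := Finset.card_eq_one.1 h
    obtain ⟨v, rfl⟩ : ∃ v : F.Vert, v.1 = x :=
      ⟨⟨x, singleton_mem_of_mem t.2.1 (hst (by simp))⟩, rfl⟩
    have hv : v.1 ∈ t.1 := hst (by simp)
    have hv' : v.1 ∈ t'.1 := hst' (by simp)
    obtain ⟨x, y, hx, -, hxy⟩ := exists_flow_of_mem (isFlow_sub c i j) hv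
      (by rw [triangleSet_sub]; exact hS.sub ht)
    obtain ⟨x', y', hx', -, hxy'⟩ := exists_flow_of_mem (isFlow_eps c i) hv'
      (by rw [triangleSet_eps]; exact ht')
    obtain ⟨z, ⟨w, hw⟩, w', hw'⟩ := (isFlow_sub c i j).isClosedSurface.exists_common
      (isFlow_eps c i).isClosedSurface hxy hxy'
    have tw : F.IsTri v z w := (isFlow_sub c i j).tri (by omega)
    have tw' : F.IsTri v z w' := (isFlow_eps c i).tri (by omega)
    refine (touches_side_edge hS tw.ne ⟨tw.tri, ?_, ?_⟩ ⟨tw'.tri, ?_, ?_⟩).mono (by simp)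
    · exact hS.mem_of_mem_verts (mem_verts_of_mem ht hv) tw.mem_left
        ((mem_pairSet_iff tw).2 (by omega))
    · rw [tri_subset_iff]; simp
    · exact (eps_ne_zero_iff c i tw').1 (by omega)
    · rw [tri_subset_iff]; simp
  · obtain ⟨u, v, huv, rfl⟩ := exists_apex_of_edge h hst
    exact touches_side_edge hS huv hT hi
  · have e : s = t.1 := Finset.eq_of_subset_of_card_le hst (by rw [h, t.2.2])
    have e' : s = t'.1 := Finset.eq_of_subset_of_card_le hst' (by rw [h, t'.2.2])
    obtain rfl : t = t' := Subtype.ext (e.symm.trans e')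
    exact ⟨t, ⟨ht, ht'⟩, hst⟩

theorem touches_or (hS : IsPart c i j S) {s : Finset Space3} (hT : Touches S s) :
    Touches (side c i S) s ∨ Touches (side c j S) s := by
  obtain ⟨t, ht, hst⟩ := hT
  rcases hS.sub ht with h | h
  · exact Or.inl ⟨t, ⟨ht, h.1⟩, hst⟩
  · exact Or.inr ⟨t, ⟨ht, h.1⟩, hst⟩

/-- A vertex at which both sides of `S` meet lies on a seam. -/
theorem exists_seam_of_touches (hS : IsPart c i j S) {v : F.Vert}
    (hi : Touches (side c i S) {v.1}) (hj : Touches (side c j S) {v.1}) :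
    ∃ w, Seam c i j v w := by
  by_contra hno
  have hno' : ∀ w, ¬ Seam c i j v w ∧ ¬ Seam c i j w v := fun w =>
    ⟨fun h => hno ⟨w, h⟩, fun h => hno ((isCirculation_seam c i j).out_of_in _ _ h)⟩
  have hedge : ∀ {x y z : F.Vert} (h : F.IsTri v x y) (h' : F.IsTri v x z), h.tri ∈ side c i S →
      h'.tri ∉ side c j S := by
    intro x y z h h' h1 h2
    have := seam_of_touches hS h.ne ⟨h.tri, h1, by rw [tri_subset_iff]; simp⟩
      ⟨h'.tri, h2, by rw [tri_subset_iff]; simp⟩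
    exact this.elim (hno' x).1 (hno' x).2
  obtain ⟨t, ht, hvt⟩ := hi
  obtain ⟨t', ht', hvt'⟩ := hj
  have hg := isFlow_sub c i j
  obtain ⟨x, y, h, rfl, hxy⟩ := exists_flow_of_mem (v := v) hg (hvt (by simp)) (by
    rw [triangleSet_sub]; exact hS.sub ht.1)
  obtain ⟨z, w, h', rfl, hzw⟩ := exists_flow_of_mem (v := v) hg (hvt' (by simp)) (by
    rw [triangleSet_sub]; exact hS.sub ht'.1)
  have hvS : v ∈ verts S := mem_verts_of_mem ht.1 (hvt (by simp))
  obtain ⟨y', hy', hz⟩ := hg.isClosedSurface.mem_of_closed (v := v)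
    {x | ∃ (y : F.Vert) (h : F.IsTri v x y), h.tri ∈ side c i S} (by
      intro x y hxy
      have hxt : F.IsTri v x y := hg.isClosedSurface.tri hxy
      have hp : hxt.tri ∈ pairSet c i j := by
        rw [mem_pairSet_iff]
        omega
      have hxS := hS.mem_of_mem_verts hvS hxt.mem_left hp
      have hor : hxt.tri ∈ side c i S ∨ hxt.tri ∈ side c j S := by
        rcases hp with h | h
        · exact Or.inl ⟨hxS, h.1⟩
        · exact Or.inr ⟨hxS, h.1⟩
      constructor
      · rintro ⟨y', h, hyS⟩
        refine ⟨x, hxt.swap_last, ?_⟩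
        rw [hxt.tri_swap_last]
        exact hor.resolve_right (hedge h hxt hyS)
      · rintro ⟨x', h, hyS⟩
        refine ⟨y, hxt, hor.resolve_right fun hj => hedge h hxt.swap_last hyS ?_⟩
        rwa [hxt.tri_swap_last]) hxy ⟨y, h, ht⟩ hzw
  exact hedge hy' h' hz ht'

end GLFoam

/-! ### The sign of a Kempe move -/

namespace GLFoam

variable {N : ℕ} {R : Type*} [CommRing R] {F : GLFoam N R} {c : F.Coloring} {i j : Fin N}
  {S : Set F.K.Triangle}

open scoped Classical in
/-- The simplices common to both sides of `S` form circles, of Euler characteristic zero. -/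
theorem sum_touches_both (hS : IsPart c i j S) :
    ∑ s ∈ F.finite.toFinset, simplexSign s *
      (if Touches (side c i S) s ∧ Touches (side c j S) s then 1 else 0) = 0 := by
  -- `W 1` and `W 2` are the vertices and the edges of the seams on `S`, and `W 3` is empty. The
  -- sources of the edges of circles are their vertices.
  let W : ℕ → Set (Finset Space3) := fun k =>
    {s | s ∈ F.K.faces ∧ s.card = k ∧ Touches (side c i S) s ∧ Touches (side c j S) s}
  let A : Set F.Vert := {u | ∃ v, SeamOn c i j S u v}
  have hk : ∀ k, (W k).ncard = ∑ s ∈ F.finite.toFinset,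
      if s.card = k ∧ Touches (side c i S) s ∧ Touches (side c j S) s then 1 else 0 := by
    intro k
    rw [Finset.sum_boole, Nat.cast_id, ← Set.ncard_coe_finset]
    congr 1
    ext s
    rw [Finset.mem_coe, Finset.mem_filter, Set.Finite.mem_toFinset]
    exact Iff.rfl
  have hsides : ∀ {u v : F.Vert}, SeamOn c i j S u v → ({u.1, v.1} : Finset Space3) ∈ F.K.faces ∧
      Touches (side c i S) {u.1, v.1} ∧ Touches (side c j S) {u.1, v.1} := by
    rintro u v ⟨⟨a, b, w, h⟩, hu⟩
    obtain ⟨ta, tb, -⟩ := h.isTri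
    refine ⟨ta.edge_mem, ⟨ta.tri, (mem_side_iff ta i).2 ⟨hS.mem_of_mem_verts hu ta.mem_left ?_, ?_⟩, ?_⟩,
      ⟨tb.tri, (mem_side_iff tb j).2 ⟨hS.mem_of_mem_verts hu tb.mem_left ?_, ?_⟩, ?_⟩⟩
    · rw [mem_pairSet_iff, h.ia, h.ja]; omega
    · rw [h.ia]; omega
    · rw [tri_subset_iff]; simp
    · rw [mem_pairSet_iff, h.ib, h.jb]; omega
    · rw [h.jb]; omega
    · rw [tri_subset_iff]; simp
  have h1 : A.ncard = (W 1).ncard := by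
    refine Set.ncard_congr (fun u _ => {u.1}) ?_ ?_ ?_
    · rintro u ⟨v, h⟩
      exact ⟨u.2, by simp, (hsides h).2.1.mono (by simp), (hsides h).2.2.mono (by simp)⟩
    · intro a b _ _ h
      exact Subtype.ext (Finset.singleton_injective h)
    · rintro s ⟨hs, hc, hi, hj⟩
      obtain ⟨x, rfl⟩ := Finset.card_eq_one.1 hc
      obtain ⟨w, hw⟩ := exists_seam_of_touches (v := ⟨x, hs⟩) hS hi hj
      obtain ⟨t, ht, hst⟩ := hi
      exact ⟨⟨x, hs⟩, ⟨w, hw, t, ht.1, hst⟩, rfl⟩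
  have h2 : A.ncard = (W 2).ncard := by
    refine Set.ncard_congr (fun u hu => {u.1, hu.choose.1}) ?_ ?_ ?_
    · rintro u hu
      have h := hu.choose_spec
      refine ⟨(hsides h).1, ?_, (hsides h).2⟩
      obtain ⟨w, hw⟩ := h.1.tri
      exact Finset.card_pair hw.val_ne
    · intro a b ha hb h
      have hsa := ha.choose_spec.1
      have hsb := hb.choose_spec.1
      obtain ⟨w, hw⟩ := hsa.tri
      have m1 : a.1 ∈ ({b.1, hb.choose.1} : Finset Space3) := by rw [← h]; simp
      have m2 : (hb.choose).1 ∈ ({a.1, ha.choose.1} : Finset Space3) := by rw [h]; simp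
      simp only [Finset.mem_insert, Finset.mem_singleton] at m1 m2
      rcases m1 with m1 | m1
      · exact Subtype.ext m1
      · have e : a = hb.choose := Subtype.ext m1
        have m3 : b.1 ∈ ({a.1, ha.choose.1} : Finset Space3) := by rw [h]; simp
        simp only [Finset.mem_insert, Finset.mem_singleton] at m3
        rcases m3 with m3 | m3
        · exact (Subtype.ext m3).symm
        · have e' : b = ha.choose := Subtype.ext m3
          rw [← e] at hsb
          rw [← e'] at hsa
          exact absurd hsb hsa.anti
    · rintro s ⟨hs, hc, hi, hj⟩
      obtain ⟨t, ht, hst⟩ := id hi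
      obtain ⟨u, v, huv, rfl⟩ := exists_apex_of_edge hc hst
      have hu : u ∈ verts S := ⟨t, ht.1, fun z hz => hst (by simp at hz; simp [hz])⟩
      have hv : v ∈ verts S := ⟨t, ht.1, fun z hz => hst (by simp at hz; simp [hz])⟩
      have huniq : ∀ {u v : F.Vert} (h : ∃ v, SeamOn c i j S u v), Seam c i j u v →
          h.choose = v := fun h hs => h.choose_spec.1.out_unique hs
      rcases seam_of_touches hS huv hi hj with h | h
      · have hA : u ∈ A := ⟨v, h, hu⟩
        exact ⟨u, hA, by rw [huniq hA h]⟩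
      · have hA : v ∈ A := ⟨u, h, hv⟩
        exact ⟨v, hA, by rw [huniq hA h, Finset.pair_comm]⟩
  have h3 : ∀ s ∈ F.finite.toFinset, simplexSign s *
      (if Touches (side c i S) s ∧ Touches (side c j S) s then (1 : ℤ) else 0) =
      (if s.card = 1 ∧ Touches (side c i S) s ∧ Touches (side c j S) s then 1 else 0) -
      (if s.card = 2 ∧ Touches (side c i S) s ∧ Touches (side c j S) s then 1 else 0) := by
    intro s hs
    by_cases h : Touches (side c i S) s ∧ Touches (side c j S) s
    · have hc : s.card ≠ 3 := by
        intro hc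
        obtain ⟨⟨t, ht, hst⟩, ⟨t', ht', hst'⟩⟩ := h
        have e : s = t.1 := Finset.eq_of_subset_of_card_le hst (by rw [hc, t.2.2])
        have e' : s = t'.1 := Finset.eq_of_subset_of_card_le hst' (by rw [hc, t'.2.2])
        obtain rfl : t = t' := Subtype.ext (e.symm.trans e')
        have hp := hS.sub ht.1
        rcases hp with hp | hp
        · exact hp.2 ht'.2
        · exact hp.2 ht.2
      simp only [h, and_true, if_true, mul_one]
      unfold simplexSign
      split_ifs <;> omega
    · simp only [h, and_false, if_false, mul_zero, sub_zero]
  rw [Finset.sum_congr rfl h3, Finset.sum_sub_distrib]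
  have h4 := h1.symm.trans h2
  rw [hk, hk] at h4
  have h5 := congrArg (Nat.cast : ℕ → ℤ) h4
  push_cast at h5
  rw [h5, sub_self]

/-- The Euler characteristic of `S` and its change are related to the side of one color. -/
theorem eulerChar_add_eulerChange (hS : IsPart c i j S) :
    F.K.eulerChar S + eulerChange c i j (fun A => i ∈ A) S = 2 * F.K.eulerChar (side c j S) := by
  classical
  have h0 := sum_touches_both hS
  rw [eulerChar_eq_sum, eulerChar_eq_sum, eulerChange, ← Finset.sum_add_distrib, Finset.mul_sum,
    ← sub_eq_zero, ← Finset.sum_sub_distrib]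
  rw [← neg_eq_zero, ← Finset.sum_neg_distrib] at h0
  refine (Finset.sum_congr rfl fun s hs => ?_).trans h0
  rw [Set.Finite.mem_toFinset] at hs
  have hne := F.K.nonempty_of_mem_faces hs
  have hmono : ∀ k, Touches (side c k S) s → Touches {t | k ∈ c.color t} s :=
    fun k ⟨t, ht, h⟩ => ⟨t, ht.2, h⟩
  have hmono' : ∀ k, Touches (side c k S) s → Touches S s := fun k ⟨t, ht, h⟩ => ⟨t, ht.1, h⟩
  by_cases hT : Touches S s
  · have hi : Touches {t | i ∈ c.color t} s ↔ Touches (side c i S) s :=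
      ⟨touches_side hS hne hT, hmono i⟩
    have hj : Touches {t | j ∈ c.color t} s ↔ Touches (side c j S) s :=
      ⟨touches_side hS.symm hne hT, hmono j⟩
    have hor := touches_or hS hT
    rw [if_pos hT, if_pos hT, simplexChange]
    simp only [mem_swapColors, Equiv.swap_apply_left, hi, hj]
    by_cases h1 : Touches (side c i S) s <;> by_cases h2 : Touches (side c j S) s
    · simp only [h1, h2, and_self, if_true]; ring
    · simp only [h1, h2, and_false, if_true, if_false]; ring
    · simp only [h1, h2, false_and, if_true, if_false]; ring
    · exact absurd hor (by tauto)
  · rw [if_neg hT, if_neg hT, if_neg (fun h => hT (hmono' _ h)), if_neg (fun h => hT (hmono' _ h.1))]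
    simp

/-- The triangles of `S` with color `j` (and not `i`), oriented as in the foam. -/
def sideSurface (c : F.Coloring) (i j : Fin N) (S : Set F.K.Triangle) (u v w : F.Vert) : Prop :=
  eps c j u v w = 1 ∧ eps c i u v w = 0 ∧ u ∈ verts S

theorem sideSurface_tri {u v w : F.Vert} (h : sideSurface c i j S u v w) : F.IsTri u v w :=
  isTri_of_eps (c := c) (i := j) (by rw [h.1]; omega)

theorem sideSurface_mem (hS : IsPart c i j S) {u v w : F.Vert} (h : sideSurface c i j S u v w) :
    (sideSurface_tri h).tri ∈ S :=
  hS.mem_of_mem_verts h.2.2 (sideSurface_tri h).mem_left (by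
    rw [mem_pairSet_iff, h.1, h.2.1]; omega)

theorem isOrientedSurface_side (hS : IsPart c i j S) :
    IsOrientedSurface (sideSurface c i j S) where
  ne u v w h := (sideSurface_tri h).ne
  rot u v w h := ⟨by rw [eps_rot, h.1], by rw [eps_rot, h.2.1],
    mem_verts_of_mem (sideSurface_mem hS h) (sideSurface_tri h).mem_right⟩
  uniq u v w w' h h' := (isFlow_eps c j).eq_of_eq_one h.1 h'.1
  anti u v w h h' := by
    have h1 := h.1
    have h2 := h'.1
    rw [eps_swap] at h2
    omega

theorem triangleSet_side (hS : IsPart c i j S) :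
    triangleSet (sideSurface c i j S) = side c j S := by
  ext t
  constructor
  · rintro ⟨u, v, w, h, ho, rfl⟩
    rw [mem_side_iff, ho.1]
    exact ⟨sideSurface_mem hS ho, by omega⟩
  · intro ht
    obtain ⟨u, v, w, h, rfl⟩ := exists_tri t
    have h1 := ((mem_side_iff h j).1 ht).2
    have h2 := (mem_pairSet_iff h).1 (hS.sub ht.1)
    have m1 := eps_mem c j u v w
    have m2 := eps_sub_mem c c i j u v w
    have m3 := eps_mem c i u v w
    by_cases h3 : eps c j u v w = 1
    · exact ⟨u, v, w, h, ⟨h3, by omega, mem_verts_of_mem ht.1 h.mem_left⟩, rfl⟩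
    · exact ⟨v, u, w, h.swap, ⟨by rw [eps_swap]; omega, by rw [eps_swap]; omega,
        mem_verts_of_mem ht.1 h.mem_right⟩, h.tri_swap⟩

theorem seamOn_iff (hS : IsPart c i j S) (u v : F.Vert) : SeamOn c i j S u v ↔
    IsDart (sideSurface c i j S) u v ∧ ¬ IsDart (sideSurface c i j S) v u := by
  constructor
  · rintro ⟨⟨a, b, w, h⟩, hu⟩
    refine ⟨⟨b, h.jb, h.ib, hu⟩, ?_⟩
    rintro ⟨z, h1, h2, -⟩
    rw [eps_swap] at h1 h2
    have := h.values z
    omega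
  · rintro ⟨⟨z, h⟩, hno⟩
    obtain ⟨h1, h2, hu⟩ := id h
    have ht := sideSurface_tri h
    have hv := mem_verts_of_mem (sideSurface_mem hS h) ht.mem_right
    rcases edge_pair c i j ht with hs | ⟨a, b, w, hs⟩ | ⟨p, q, -, -, hpq, hi, hj, h0⟩
    · exact ⟨hs, hu⟩
    · have := hs.values z
      rw [eps_swap, eps_swap c j] at this
      omega
    · exfalso
      by_cases e : z = p
      · subst e
        exact hno ⟨q, by rw [eps_swap, hj, h1, neg_neg], by rw [eps_swap, hi, h2, neg_neg, ], hv⟩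
      · by_cases e' : z = q
        · subst e'
          exact hno ⟨p, by rw [eps_swap, ← hj, h1], by rw [eps_swap, ← hi, h2], hv⟩
        · have := h0 z e e'
          omega

/-- The part of `S` with color `j` is an oriented surface bounded by the seams on `S`, whose number
thus has the parity of its Euler characteristic. -/
theorem even_eulerChar_side (hS : IsPart c i j S) :
    Even (F.K.eulerChar (side c j S) + circleCount (SeamOn c i j S)) := by
  have hO := isOrientedSurface_side hS
  rw [← triangleSet_side hS]
  refine even_eulerChar_add hO (fun _ _ _ => sideSurface_tri) (isCirculation_seamOn hS)
    (seamOn_iff hS) ?_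
  intro v X hX hB x y hx hy hxX
  -- a vertex of the link of `v` lies in the side of `j`
  let D : F.Vert → Prop := fun x =>
    IsDart (sideSurface c i j S) v x ∨ IsDart (sideSurface c i j S) x v
  have hg := isFlow_sub c i j
  have hvS : ∀ {x}, D x → v ∈ verts S := by
    rintro x (⟨w, h⟩ | ⟨w, h⟩)
    · exact h.2.2
    · exact mem_verts_of_mem (sideSurface_mem hS h) (sideSurface_tri h).mem_right
  have hv := hvS hx
  -- the vertices next to an edge in both sides are those of seams
  have hseam : ∀ {x z}, D x → eps c i v x z ≠ 0 → eps c j v x z = 0 →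
      Seam c i j v x ∨ Seam c i j x v := by
    intro x z hD h1 h2
    have hz : F.IsTri v x z := isTri_of_eps h1
    obtain ⟨w, hw1, hw2⟩ : ∃ w, eps c j v x w ≠ 0 ∧ eps c i v x w = 0 := by
      rcases hD with ⟨w, h⟩ | ⟨w, h⟩
      · exact ⟨w, by rw [h.1]; omega, h.2.1⟩
      · exact ⟨w, by rw [eps_swap, h.1]; omega, by rw [eps_swap, h.2.1]; omega⟩
    have hw : F.IsTri v x w := isTri_of_eps hw1
    refine seam_of_touches hS hz.ne ⟨hz.tri, (mem_side_iff hz i).2 ⟨?_, h1⟩, ?_⟩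
      ⟨hw.tri, (mem_side_iff hw j).2 ⟨?_, hw1⟩, ?_⟩
    · exact hS.mem_of_mem_verts hv hz.mem_left ((mem_pairSet_iff hz).2 (by omega))
    · rw [tri_subset_iff]; simp
    · exact hS.mem_of_mem_verts hv hw.mem_left ((mem_pairSet_iff hw).2 (by omega))
    · rw [tri_subset_iff]; simp
  have hsX : ∀ {x}, (Seam c i j v x ∨ Seam c i j x v) → (x ∈ X ↔ ∃ y, Seam c i j v y ∧ y ∈ X) := by
    rintro x (h | h)
    · constructor
      · exact fun hx => ⟨x, h, hx⟩
      · rintro ⟨y, hy, hyX⟩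
        rwa [h.out_unique hy]
    · obtain ⟨z, hz⟩ := (isCirculation_seam c i j).out_of_in _ _ h
      rw [hB x z ⟨h, (seam_mem_verts_iff hS h).2 hv⟩ ⟨hz, hv⟩]
      constructor
      · exact fun hx => ⟨z, hz, hx⟩
      · rintro ⟨y, hy, hyX⟩
        rwa [hz.out_unique hy]
  -- the set `X`, extended over the other side
  let X' : Set F.Vert := {x | (D x ∧ x ∈ X) ∨ (¬ D x ∧ ∃ y, Seam c i j v y ∧ y ∈ X)}
  have hX' : ∀ x y, eps c i v x y - eps c j v x y = 1 → (x ∈ X' ↔ y ∈ X') := by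
    intro x y hxy
    have m1 := eps_mem c i v x y
    have m2 := eps_mem c j v x y
    have m3 := eps_mul c c i j v x y
    by_cases hi : eps c i v x y = 0
    · have hj : eps c j v x y = -1 := by omega
      have hs : sideSurface c i j S v y x :=
        ⟨by rw [eps_swap_last, hj, neg_neg], by rw [eps_swap_last, hi, neg_zero], hv⟩
      have hDy : D y := Or.inl ⟨x, hs⟩
      have hDx : D x := Or.inr ⟨y, hO.rot _ _ _ (hO.rot _ _ _ hs)⟩
      have := hX y x hs
      simp only [X', Set.mem_ofPred_eq, hDx, hDy, not_true, true_and, false_and, or_false]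
      exact this.symm
    · have hj : eps c j v x y = 0 := by
        rcases m1 with m1 | m1 | m1 <;> rcases m2 with m2 | m2 | m2 <;> rw [m1, m2] at m3 <;> omega
      have key : ∀ {x y}, eps c i v x y ≠ 0 → eps c j v x y = 0 →
          (x ∈ X' ↔ ∃ y, Seam c i j v y ∧ y ∈ X) := by
        intro x y h1 h2
        by_cases hD : D x
        · simp only [X', Set.mem_ofPred_eq, hD, not_true, true_and, false_and, or_false]
          exact hsX (hseam hD h1 h2)
        · simp only [X', Set.mem_ofPred_eq, hD, not_false_iff, true_and, false_and, false_or]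
      rw [key hi hj, key (x := y) (y := x) (by rw [eps_swap_last]; omega)
        (by rw [eps_swap_last]; omega)]
  have hout : ∀ {x}, D x → ∃ y, eps c i v x y - eps c j v x y = 1 := by
    intro x hD
    have hC := hg.isClosedSurface
    rcases hD with ⟨w, h⟩ | ⟨w, h⟩
    · have h1 : eps c i v w x - eps c j v w x = 1 := by
        rw [eps_swap_last, eps_swap_last c j, h.1, h.2.1]; omega
      exact hC.exists_out (v := v) h1
    · exact ⟨w, by rw [eps_swap, eps_swap c j, h.1, h.2.1]; omega⟩
  obtain ⟨x₁, hx₁⟩ := hout hx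
  obtain ⟨y₁, hy₁⟩ := hout hy
  have hfin := hg.isClosedSurface.mem_of_closed (v := v) X' hX' hx₁ (Or.inl ⟨hx, hxX⟩) hy₁
  rcases hfin with h | h
  · exact h.2
  · exact absurd hy h.1

/-! ### The sign exponent -/

theorem chi_kempe (hS : IsPart c i j S) (k : Fin N) :
    (kempe c i j hS).chi k = c.chi k + eulerChange c i j (fun A => k ∈ A) S :=
  eulerChar_kempe hS fun A => k ∈ A

theorem eulerChange_right (S : Set F.K.Triangle) :
    eulerChange c i j (fun A => j ∈ A) S = - eulerChange c i j (fun A => i ∈ A) S := by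
  rw [← eulerChange_swap]
  exact eulerChange_congr (fun A => by rw [mem_swapColors, Equiv.swap_apply_left]) S

theorem eulerChange_of_ne {k : Fin N} (hi : k ≠ i) (hj : k ≠ j) (S : Set F.K.Triangle) :
    eulerChange c i j (fun A => k ∈ A) S = 0 :=
  eulerChange_eq_zero (fun A => by rw [mem_swapColors, Equiv.swap_apply_of_ne_of_ne hi hj]) S

theorem swap_lt_swap {i j k l : Fin N} (hij : i.val + 1 = j.val) (hkl : k < l)
    (hne : (k, l) ≠ (i, j)) : Equiv.swap i j k < Equiv.swap i j l := by
  have hne' : ¬ (k = i ∧ l = j) := fun h => hne (by rw [h.1, h.2])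
  rw [Fin.ext_iff, Fin.ext_iff] at hne'
  rw [Fin.lt_def] at hkl
  rw [Equiv.swap_apply_def, Equiv.swap_apply_def]
  simp only [Fin.ext_iff]
  rw [Fin.lt_def]
  split_ifs <;> omega

/-- Under a Kempe move on `S` for two neighbouring colors the sign of a coloring changes by
`(-1) ^ (χ(S) / 2)`. The numbers of positive seams of the pairs other than `i, j` change by an even
number in total, that of `i, j` by the number of seams on `S`, i.e. the Euler characteristic of the
`j`-colored part of `S`, and `χ_i / 2`, `χ_j / 2` change by opposite numbers. -/
theorem even_signExponent_kempe (hS : IsPart c i j S) (hij : i.val + 1 = j.val) :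
    Even ((kempe c i j hS).signExponent - c.signExponent - F.K.eulerChar S / 2) := by
  classical
  have hne : i ≠ j := by
    rintro rfl
    omega
  have hlt : i < j := by
    rw [Fin.lt_def]
    omega
  set c' := kempe c i j hS with hc'
  let P := {q : Fin N × Fin N // q.1 < q.2}
  let q₀ : P := ⟨(i, j), hlt⟩
  -- the pairs other than `i, j` cancel
  have hθ : ∑ q : P, ((c'.thetaPlus q.1.1 q.1.2 : ZMod 2) + c.thetaPlus q.1.1 q.1.2) =
      circleCount (SeamOn c i j S) := by
    rw [← Finset.add_sum_erase _ _ (Finset.mem_univ q₀)]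
    have h0 := even_thetaPlus_kempe hS
    rw [← ZMod.natCast_eq_zero_iff_even] at h0
    push_cast at h0
    have two : ∀ a b : ZMod 2, a + b = 0 → a = b := by decide
    have h1 := two _ _ h0
    have h2 : ∑ q ∈ Finset.univ.erase q₀,
        ((c'.thetaPlus q.1.1 q.1.2 : ZMod 2) + c.thetaPlus q.1.1 q.1.2) = 0 := by
      refine Finset.sum_involution (fun q hq => ⟨(Equiv.swap i j q.1.1, Equiv.swap i j q.1.2),
        swap_lt_swap hij q.2 fun h => Finset.ne_of_mem_erase hq (Subtype.ext h)⟩) ?_ ?_ ?_ ?_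
      · intro q hq
        have h3 := even_thetaPlus_exchange hS q.1.1 q.1.2
        rw [← ZMod.natCast_eq_zero_iff_even] at h3
        push_cast at h3
        rw [← h3]
        ring
      · intro q hq hq0 he
        apply hq0
        have e1 : Equiv.swap i j q.1.1 = q.1.1 := congrArg (fun q : P => q.1.1) he
        have e2 : Equiv.swap i j q.1.2 = q.1.2 := congrArg (fun q : P => q.1.2) he
        rw [hc', thetaPlus_kempe_of_fixed hS e1 e2]
        exact CharTwo.add_self_eq_zero _
      · intro q hq
        refine Finset.mem_erase.2 ⟨fun h => ?_, Finset.mem_univ _⟩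
        have e1 : Equiv.swap i j q.1.1 = i := congrArg (fun q : P => q.1.1) h
        have e2 : Equiv.swap i j q.1.2 = j := congrArg (fun q : P => q.1.2) h
        have e1' : q.1.1 = j := by
          rw [← Equiv.swap_apply_self i j q.1.1, e1, Equiv.swap_apply_left]
        have e2' : q.1.2 = i := by
          rw [← Equiv.swap_apply_self i j q.1.2, e2, Equiv.swap_apply_right]
        have := q.2
        rw [e1', e2'] at this
        exact absurd this (not_lt.2 hlt.le)
      · intro q hq
        refine Subtype.ext (Prod.ext ?_ ?_)
        · exact Equiv.swap_apply_self i j q.1.1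
        · exact Equiv.swap_apply_self i j q.1.2
    rw [h2, add_zero]
    exact h1
  -- the weighted sum of the Euler characteristics
  set δ := eulerChange c i j (fun A => i ∈ A) S with hδ
  have hi : c'.chi i = c.chi i + δ := chi_kempe hS i
  have hj : c'.chi j = c.chi j - δ := by
    rw [hc', chi_kempe hS j, eulerChange_right, sub_eq_add_neg]
  have hχ : (∑ k : Fin N, (k.val : ℤ) * (c'.chi k / 2)) - ∑ k : Fin N, (k.val : ℤ) * (c.chi k / 2) =
      - (δ / 2) := by
    rw [← Finset.sum_sub_distrib, Finset.sum_eq_add i j hne]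
    · have e1 := even_chi c i
      have e2 := even_chi c' i
      have e3 := even_chi c j
      rw [hi] at e2
      obtain ⟨a, ha⟩ := e1
      obtain ⟨b, hb⟩ := e2
      obtain ⟨d, hd⟩ := e3
      rw [hi, hj, hb, ha, hd, show δ = 2 * (b - a) by omega,
        show b + b = 2 * b by ring, show a + a = 2 * a by ring,
        show d + d - 2 * (b - a) = 2 * (d - (b - a)) by ring, show d + d = 2 * d by ring]
      simp only [Int.mul_ediv_cancel_left _ (two_ne_zero : (2 : ℤ) ≠ 0)]
      rw [← hij]
      push_cast
      ring
    · intro k _ hk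
      rw [hc', chi_kempe hS k, eulerChange_of_ne hk.1 hk.2, add_zero, sub_self]
    · simp
    · simp
  have hE := eulerChar_add_eulerChange hS
  have hside := even_eulerChar_side hS
  have hδ2 : Even δ := by
    have e1 := even_chi c i
    have e2 := even_chi c' i
    rw [hi] at e2
    exact (Int.even_add.1 e2).1 e1
  have hT : Even (∑ q : P, (c'.thetaPlus q.1.1 q.1.2 : ℤ) + ∑ q : P, (c.thetaPlus q.1.1 q.1.2 : ℤ) +
      circleCount (SeamOn c i j S)) := by
    rw [← ZMod.intCast_eq_zero_iff_even]
    push_cast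
    rw [← Finset.sum_add_distrib, hθ]
    exact CharTwo.add_self_eq_zero _
  unfold Coloring.signExponent
  obtain ⟨d, hd⟩ := hδ2
  obtain ⟨n, hn⟩ := hside
  obtain ⟨m, hm⟩ := hT
  refine ⟨m - (∑ q : P, (c.thetaPlus q.1.1 q.1.2 : ℤ)) - n, ?_⟩
  rw [← hδ] at hE
  have h2 : F.K.eulerChar S / 2 = F.K.eulerChar (side c j S) - d := by omega
  have h3 : δ / 2 = d := by omega
  rw [h3] at hχ
  rw [h2]
  linarith

end GLFoam

/-! ### Connected components of the two-colored surfaces -/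

namespace GLFoam

variable {N : ℕ} {R : Type*} [CommRing R] {F : GLFoam N R} {c : F.Coloring} {i j : Fin N}
  {S : Set F.K.Triangle}

/-- Two triangles of `F_ij(c)` with a common vertex. -/
def pairRel (c : F.Coloring) (i j : Fin N) (s t : {t // t ∈ pairSet c i j}) : Prop :=
  ∃ v : F.Vert, v.1 ∈ s.1.1 ∧ v.1 ∈ t.1.1

/-- The connected components of `F_ij(c)`. -/
def Comp (c : F.Coloring) (i j : Fin N) : Type := Quot (pairRel c i j)

instance : Finite F.K.Triangle := F.finite_triangle

instance : Finite (Comp c i j) := Quot.finite _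

instance : Fintype (Comp c i j) := Fintype.ofFinite _

/-- The triangles of a component. -/
def compSet (k : Comp c i j) : Set F.K.Triangle :=
  {t | ∃ h : t ∈ pairSet c i j, Quot.mk (pairRel c i j) ⟨t, h⟩ = k}

/-- The triangles of a set of components. -/
def unionSet (U : Finset (Comp c i j)) : Set F.K.Triangle := {t | ∃ k ∈ U, t ∈ compSet k}

theorem isPart_compSet (k : Comp c i j) : IsPart c i j (compSet k) where
  sub := fun _ ⟨h, _⟩ => h
  closed {u v x y} hx hy := by
    rintro ⟨h, hk⟩ hp
    refine ⟨hp, ?_⟩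
    rw [← hk]
    exact (Quot.sound ⟨u, hx.mem_left, hy.mem_left⟩).symm

theorem isPart_unionSet (U : Finset (Comp c i j)) : IsPart c i j (unionSet U) where
  sub := fun _ ⟨_, _, h, _⟩ => h
  closed hx hy := by
    rintro ⟨k, hk, h⟩ hp
    exact ⟨k, hk, (isPart_compSet k).closed hx hy h hp⟩

theorem compSet_disjoint {k l : Comp c i j} (h : k ≠ l) : Disjoint (compSet k) (compSet l) := by
  rw [Set.disjoint_left]
  rintro t ⟨h1, rfl⟩ ⟨h2, rfl⟩
  exact h rfl

theorem compSet_nonempty (k : Comp c i j) : (compSet k).Nonempty := by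
  induction k using Quot.ind with
  | mk t => exact ⟨t.1, t.2, rfl⟩

theorem unionSet_univ : unionSet (Finset.univ : Finset (Comp c i j)) = pairSet c i j := by
  ext t
  exact ⟨fun ⟨_, _, h, _⟩ => h, fun h => ⟨_, Finset.mem_univ _, h, rfl⟩⟩

theorem IsPart.mem_iff_of_comp_eq (hS : IsPart c i j S) {s t : {t // t ∈ pairSet c i j}}
    (h : Quot.mk (pairRel c i j) s = Quot.mk (pairRel c i j) t) : s.1 ∈ S ↔ t.1 ∈ S := by
  have h1 := congrArg (Quot.lift (fun t : {t // t ∈ pairSet c i j} => t.1 ∈ S) fun s t h => by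
    obtain ⟨v, hs, ht⟩ := h
    exact propext ⟨fun h => hS.mem_of_vertex hs ht h t.2, fun h => hS.mem_of_vertex ht hs h s.2⟩) h
  exact iff_of_eq h1

/-- A component contains no smaller parts. -/
theorem IsPart.compSet_subset (hS : IsPart c i j S) {k : Comp c i j} {t : F.K.Triangle}
    (ht : t ∈ S) (htk : t ∈ compSet k) : compSet k ⊆ S := by
  obtain ⟨h, rfl⟩ := htk
  rintro t' ⟨h', he⟩
  exact (hS.mem_iff_of_comp_eq he).2 ht

theorem ncard_verts (S : Set F.K.Triangle) : (verts S).ncard = (simplices F 1 S).ncard := by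
  refine Set.ncard_congr (fun v _ => {v.1}) ?_ ?_ ?_
  · rintro v hv
    exact ⟨v.2, by simp, hv⟩
  · intro a b _ _ h
    exact Subtype.ext (Finset.singleton_injective h)
  · rintro s ⟨hs, h1, hT⟩
    obtain ⟨x, rfl⟩ := Finset.card_eq_one.1 h1
    exact ⟨⟨x, hs⟩, hT, rfl⟩

/-- The Euler characteristic of a connected closed surface is at most `2`. -/
theorem eulerChar_compSet_le (k : Comp c i j) : F.K.eulerChar (compSet k) ≤ 2 := by
  classical
  set S := compSet k with hSk
  have hS : IsPart c i j S := isPart_compSet k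
  have hg := isFlow_sub c i j
  let Vs : Finset Space3 := (Set.toFinite (verts S)).toFinset.map (valEmb F)
  let E := (finite_simplices 2 S).toFinset
  let T := (finite_simplices 3 S).toFinset
  have hVs : Vs.card = (simplices F 1 S).ncard := by
    rw [Finset.card_map, ← ncard_verts, Set.ncard_eq_toFinset_card _ (Set.toFinite _)]
  have hEc : E.card = (simplices F 2 S).ncard :=
    (Set.ncard_eq_toFinset_card _ (finite_simplices 2 S)).symm
  have hTc : T.card = (simplices F 3 S).ncard :=
    (Set.ncard_eq_toFinset_card _ (finite_simplices 3 S)).symm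
  have memV : ∀ {v : F.Vert}, v ∈ verts S → v.1 ∈ Vs := fun {v} hv =>
    Finset.mem_map.2 ⟨v, (Set.Finite.mem_toFinset _).2 hv, rfl⟩
  have memE : ∀ {s}, s ∈ E ↔ s ∈ F.K.faces ∧ s.card = 2 ∧ Touches S s := fun {s} =>
    Set.Finite.mem_toFinset _
  have memT : ∀ {s}, s ∈ T ↔ ∃ t ∈ S, t.1 = s := by
    intro s
    refine (Set.Finite.mem_toFinset _).trans ⟨?_, ?_⟩
    · rintro ⟨hs, h3, t, ht, hst⟩
      exact ⟨t, ht, (Finset.eq_of_subset_of_card_le hst (by rw [h3, t.2.2])).symm⟩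
    · rintro ⟨t, ht, rfl⟩
      exact ⟨t.2.1, t.2.2, t, ht, subset_rfl⟩
  have hedge : ∀ {u v w : F.Vert} (h : F.IsTri u v w), h.tri ∈ S → ({u.1, v.1} : Finset Space3) ∈ E := by
    intro u v w h hS
    exact memE.2 ⟨h.edge_mem, Finset.card_pair h.val_ne, h.tri, hS, by rw [tri_subset_iff]; simp⟩
  have hmain := card_vertices_add_card_triangles_le Vs E T
    (by
      intro e he
      obtain ⟨hf, h2, t, ht, hst⟩ := memE.1 he
      obtain ⟨u, v, huv, rfl⟩ := exists_apex_of_edge h2 hst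
      exact ⟨u.1, v.1, fun h => huv (Subtype.ext h), memV (mem_verts_of_mem ht (hst (by simp))),
        memV (mem_verts_of_mem ht (hst (by simp))), rfl⟩)
    (by
      intro t ht
      obtain ⟨t, htS, rfl⟩ := memT.1 ht
      obtain ⟨u, v, w, h, rfl⟩ := exists_tri t
      refine ⟨u.1, v.1, w.1, h.val_ne, h.rot.val_ne, h.swap_last.val_ne, rfl, hedge h htS,
        hedge h.rot (by rwa [h.tri_rot]), hedge h.swap_last (by rwa [h.tri_swap_last])⟩)
    (by
      intro v hv
      obtain ⟨v, hv', rfl⟩ := Finset.mem_map.1 hv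
      obtain ⟨t, ht, hst⟩ := (Set.Finite.mem_toFinset _).1 hv'
      exact ⟨t.1, memT.2 ⟨t, ht, rfl⟩, hst (Finset.mem_singleton_self _)⟩)
    (by
      intro e he
      obtain ⟨hf, h2, t, ht, hst⟩ := memE.1 he
      obtain ⟨u, v, huv, rfl⟩ := exists_apex_of_edge h2 hst
      have main : ∀ {u v x : F.Vert} (h : F.IsTri u v x), h.tri ∈ S →
          eps c i u v x - eps c j u v x = 1 → ∃ t ∈ T, ∃ t' ∈ T, t ≠ t' ∧
            ∀ s ∈ T, {u.1, v.1} ⊆ s ↔ s = t ∨ s = t' := by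
        intro u v x h hxS hx
        obtain ⟨y, hyx, hy, h0⟩ := hg.cancel hx
        have hty : F.IsTri u v y := hg.tri (by rw [hy]; omega)
        have hyS : hty.tri ∈ S := hS.closed h hty hxS ((mem_pairSet_iff hty).2 (by rw [hy]; omega))
        refine ⟨h.tri.1, memT.2 ⟨_, hxS, rfl⟩, hty.tri.1, memT.2 ⟨_, hyS, rfl⟩, ?_, ?_⟩
        · intro he
          exact hyx (tri_injective h hty (Subtype.ext he)).symm
        · intro s hs
          constructor
          · intro hsub
            obtain ⟨t, ht, rfl⟩ := memT.1 hs
            obtain ⟨z, hz, rfl⟩ := exists_apex h.ne t hsub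
            have hz0 := (mem_pairSet_iff hz).1 (hS.sub ht)
            by_cases e1 : z = x
            · subst e1; exact Or.inl rfl
            · by_cases e2 : z = y
              · subst e2; exact Or.inr rfl
              · exact absurd (h0 z e1 e2) hz0
          · rintro (rfl | rfl) <;> rw [tri_subset_iff] <;> simp
      obtain ⟨x, hx, rfl⟩ := exists_apex huv t hst
      have hp := (mem_pairSet_iff hx).1 (hS.sub ht)
      by_cases h1 : eps c i u v x - eps c j u v x = 1
      · exact main hx ht h1
      · have h2 := hg.le u v x
        have h3 := hg.ge u v x
        have := main hx.swap (by rwa [hx.tri_swap])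
          (by rw [eps_swap, eps_swap c j]; omega)
        rwa [Finset.pair_comm] at this)
    (by
      intro X hXT ⟨s, hs⟩ hX
      refine Finset.Subset.antisymm hXT fun s' hs' => ?_
      obtain ⟨t, htS, rfl⟩ := memT.1 (hXT hs)
      obtain ⟨t', htS', rfl⟩ := memT.1 hs'
      have hpart : IsPart c i j {t | t ∈ S ∧ t.1 ∈ X} :=
        { sub := fun t ht => hS.sub ht.1
          closed := by
            rintro u v x y hx hy ⟨h1, h2⟩ hp
            have hyS := hS.closed hx hy h1 hp
            refine ⟨hyS, hX _ h2 _ (memT.2 ⟨_, hyS, rfl⟩) _ (hedge hx h1) ?_ ?_⟩ <;>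
              rw [tri_subset_iff] <;> simp }
      exact (hpart.compSet_subset (k := k) ⟨htS, hs⟩ htS htS').2)
  rw [hVs, hEc, hTc] at hmain
  rw [eulerChar_eq]
  omega

/-- A union of components of the closed surface `F_ij(c)` is a closed surface. -/
theorem isClosedSurface_part (hS : IsPart c i j S) :
    IsClosedSurface F fun u v w => ∃ h : F.IsTri u v w, h.tri ∈ S ∧
      eps c i u v w - eps c j u v w = 1 := by
  have hg := isFlow_sub c i j
  have hC := hg.isClosedSurface
  exact
    { tri := fun ⟨h, _⟩ => h
      rot := fun ⟨h, hs, h1⟩ => ⟨h.rot, by rwa [h.tri_rot], hC.rot h1⟩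
      uniq := fun ⟨_, _, h1⟩ ⟨_, _, h1'⟩ => hC.uniq h1 h1'
      anti := fun ⟨_, _, h1⟩ ⟨_, _, h1'⟩ => hC.anti h1 h1'
      closed := by
        rintro u v w ⟨h, hs, h1⟩
        obtain ⟨w', h1'⟩ := hC.closed h1
        have h' := hC.tri h1'
        refine ⟨w', h', ?_, h1'⟩
        have := hS.closed h h'.swap hs ((mem_pairSet_iff h'.swap).2 (by
          rw [eps_swap, eps_swap c j]
          have := h1'
          omega))
        rwa [h'.tri_swap] at this }

/-- The Euler characteristic of a union of components is even. -/
theorem even_eulerChar_part (hS : IsPart c i j S) : Even (F.K.eulerChar S) := by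
  have h := (isClosedSurface_part hS).even_eulerChar
  convert h using 2
  ext t
  constructor
  · intro ht
    obtain ⟨u, v, w, h, rfl⟩ := exists_tri t
    have hp := (mem_pairSet_iff h).1 (hS.sub ht)
    have hm := eps_sub_mem c c i j u v w
    by_cases h1 : eps c i u v w - eps c j u v w = 1
    · exact ⟨u, v, w, h, ⟨h, ht, h1⟩, rfl⟩
    · exact ⟨v, u, w, h.swap, ⟨h.swap, by rwa [h.tri_swap], by
        rw [eps_swap, eps_swap c j]; omega⟩, h.tri_swap⟩
  · rintro ⟨u, v, w, h, ⟨_, ht, _⟩, rfl⟩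
    exact ht

theorem even_eulerChange (hS : IsPart c i j S) (k : Fin N) :
    Even (eulerChange c i j (fun A => k ∈ A) S) := by
  have h1 := even_chi (kempe c i j hS) k
  rw [chi_kempe] at h1
  exact (Int.even_add.1 h1).1 (even_chi c k)

/-! ### Kempe classes -/

theorem eq_or_eq_swapColors {A B : Finset (Fin N)} (h : A \ {i, j} = B \ {i, j})
    (hc : A.card = B.card) : B = A ∨ B = swapColors i j A := by
  have hmem : ∀ k, k ≠ i → k ≠ j → (k ∈ A ↔ k ∈ B) := by
    intro k hi hj
    have := congrArg (k ∈ ·) h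
    simpa [hi, hj] using this
  have hcard : (A ∩ {i, j}).card = (B ∩ {i, j}).card := by
    have h1 := Finset.card_sdiff_add_card_inter A {i, j}
    have h2 := Finset.card_sdiff_add_card_inter B {i, j}
    rw [h] at h1
    omega
  by_cases hij : i = j
  · subst hij
    left
    ext k
    by_cases hk : k = i
    · subst hk
      have : ∀ C : Finset (Fin N), (C ∩ {k, k}).card = if k ∈ C then 1 else 0 := by
        intro C
        rw [Finset.pair_eq_singleton]
        split_ifs with h
        · rw [Finset.inter_singleton_of_mem h, Finset.card_singleton]
        · rw [Finset.inter_singleton_of_notMem h, Finset.card_empty]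
      rw [this, this] at hcard
      split_ifs at hcard <;> simp_all
    · exact (hmem k hk hk).symm
  · have hcnt : ∀ C : Finset (Fin N), (C ∩ {i, j}).card =
        (if i ∈ C then 1 else 0) + if j ∈ C then 1 else 0 := by
      intro C
      rw [Finset.inter_comm, ← Finset.filter_mem_eq_inter, Finset.card_filter,
        Finset.sum_pair hij]
    rw [hcnt, hcnt] at hcard
    by_cases hiA : i ∈ A <;> by_cases hjA : j ∈ A <;> by_cases hiB : i ∈ B <;>
      by_cases hjB : j ∈ B <;> simp only [hiA, hjA, hiB, hjB, if_true, if_false] at hcard <;>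
      first
        | omega
        | (left
           ext k
           by_cases h1 : k = i
           · subst h1; simp [hiA, hiB]
           · by_cases h2 : k = j
             · subst h2; simp [hjA, hjB]
             · exact (hmem k h1 h2).symm)
        | (right
           ext k
           rw [mem_swapColors]
           by_cases h1 : k = i
           · subst h1; simp [hjA, hiB]
           · by_cases h2 : k = j
             · subst h2; simp [hiA, hjB]
             · rw [Equiv.swap_apply_of_ne_of_ne h1 h2]
               exact (hmem k h1 h2).symm)

theorem swapColors_sdiff (A : Finset (Fin N)) : swapColors i j A \ {i, j} = A \ {i, j} := by
  ext k
  rw [Finset.mem_sdiff, Finset.mem_sdiff, mem_swapColors]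
  refine and_congr_left fun hk => ?_
  simp only [Finset.mem_insert, Finset.mem_singleton, not_or] at hk
  rw [Equiv.swap_apply_of_ne_of_ne hk.1 hk.2]

theorem swapColors_ne_self {A : Finset (Fin N)} (h : (i ∈ A ∧ j ∉ A) ∨ (j ∈ A ∧ i ∉ A)) :
    swapColors i j A ≠ A := by
  intro he
  have : i ∈ swapColors i j A ↔ i ∈ A := by rw [he]
  rw [mem_swapColors, Equiv.swap_apply_left] at this
  tauto

theorem eps_of_color_eq {c' : F.Coloring} {u v w : F.Vert} (h : F.IsTri u v w)
    (hc : c'.color h.tri = swapColors i j (c.color h.tri)) (k : Fin N) :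
    eps c' k u v w = eps c (Equiv.swap i j k) u v w := by
  unfold eps
  rw [col_eq _ h, col_eq _ h, hc]
  simp only [mem_swapColors]

theorem eps_of_color_eq' {c' : F.Coloring} {u v w : F.Vert} (h : F.IsTri u v w)
    (hc : c'.color h.tri = c.color h.tri) (k : Fin N) :
    eps c' k u v w = eps c k u v w := by
  unfold eps
  rw [col_eq _ h, col_eq _ h, hc]

/-- Two colorings that differ only in the colors `i` and `j` are related by a Kempe move. -/
theorem isPart_of_sdiff_eq {c' : F.Coloring} (h : ∀ f, c'.1 f \ {i, j} = c.1 f \ {i, j}) :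
    IsPart c i j {t | t ∈ pairSet c i j ∧ c'.color t ≠ c.color t} where
  sub := fun _ h => h.1
  closed {u v x y} hx hy hxS hp := by
    refine ⟨hp, fun hyc => ?_⟩
    have hxc : c'.color hx.tri = swapColors i j (c.color hx.tri) :=
      (eq_or_eq_swapColors (h _).symm ((c.2.1 _).trans (c'.2.1 _).symm)).resolve_left hxS.2
    have hg := isFlow_sub c i j
    have hg' := isFlow_sub c' i j
    have e1 := eps_of_color_eq hx hxc i
    have e2 := eps_of_color_eq hx hxc j
    rw [Equiv.swap_apply_left] at e1
    rw [Equiv.swap_apply_right] at e2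
    have e3 := eps_of_color_eq' hy hyc i
    have e4 := eps_of_color_eq' hy hyc j
    have p1 := (mem_pairSet_iff hx).1 hxS.1
    have p2 := (mem_pairSet_iff hy).1 hp
    have m1 := eps_sub_mem c c i j u v x
    have m2 := eps_sub_mem c c i j u v y
    by_cases hxy : x = y
    · subst hxy
      omega
    by_cases hs : eps c i u v x - eps c j u v x = eps c i u v y - eps c j u v y
    · rcases m1 with m1 | m1 | m1
      · exact p1 m1
      · exact hxy (hg.eq_of_eq_one m1 (hs ▸ m1))
      · exact hxy (hg.eq_of_eq_neg_one m1 (hs ▸ m1))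
    · rcases m1 with m1 | m1 | m1
      · exact p1 m1
      · exact hxy (hg'.eq_of_eq_neg_one (u := u) (v := v) (by rw [e1, e2]; omega)
          (by rw [e3, e4]; omega))
      · exact hxy (hg'.eq_of_eq_one (u := u) (v := v) (by rw [e1, e2]; omega)
          (by rw [e3, e4]; omega))

theorem ext_color {c c' : F.Coloring} (h : ∀ t, c.color t = c'.color t) : c = c' := by
  refine Subtype.ext (funext fun f => ?_)
  induction f using Quot.ind with
  | mk t => exact h t

open scoped Classical in
/-- A sum over the Kempe class of `c` as a sum over the sets of components of `F_ij(c)`. -/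
theorem sum_kempe_class {A : Type*} [AddCommMonoid A] (c : F.Coloring) (i j : Fin N)
    (f : F.Coloring → A) :
    ∑ c' : F.Coloring with ∀ g, c'.1 g \ {i, j} = c.1 g \ {i, j}, f c' =
      ∑ U : Finset (Comp c i j), f (kempe c i j (isPart_unionSet U)) := by
  symm
  refine Finset.sum_bij (fun U _ => kempe c i j (isPart_unionSet U)) ?_ ?_ ?_ (fun _ _ => rfl)
  · intro U _
    refine Finset.mem_filter.2 ⟨Finset.mem_univ _, fun g => ?_⟩
    change kempeFun c i j (unionSet U) g \ {i, j} = _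
    unfold kempeFun
    split_ifs
    · exact swapColors_sdiff _
    · rfl
  · have key : ∀ U U' : Finset (Comp c i j), kempe c i j (isPart_unionSet U) =
        kempe c i j (isPart_unionSet U') → U ⊆ U' := by
      intro U U' h k hk
      obtain ⟨t, ht⟩ := compSet_nonempty k
      have h1 := congrArg (fun c' : F.Coloring => c'.color t) h
      simp only [color_kempe] at h1
      rw [if_pos ⟨k, hk, ht⟩] at h1
      by_contra hk'
      rw [if_neg] at h1
      · exact swapColors_ne_self ht.1 h1
      · rintro ⟨l, hl, htl⟩
        by_cases e : k = l
        · subst e; exact hk' hl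
        · exact Set.disjoint_left.1 (compSet_disjoint e) ht htl
    exact fun U _ U' _ h => Finset.Subset.antisymm (key _ _ h) (key _ _ h.symm)
  · intro c' hc'
    have h := (Finset.mem_filter.1 hc').2
    have hS := isPart_of_sdiff_eq h
    let U : Finset (Comp c i j) := Finset.univ.filter fun k =>
      ∃ t ∈ {t | t ∈ pairSet c i j ∧ c'.color t ≠ c.color t}, t ∈ compSet k
    refine ⟨U, Finset.mem_univ _, ext_color fun t => ?_⟩
    have hU : t ∈ unionSet U ↔ t ∈ {t | t ∈ pairSet c i j ∧ c'.color t ≠ c.color t} := by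
      constructor
      · rintro ⟨k, hk, ht⟩
        obtain ⟨t', ht', htk'⟩ := (Finset.mem_filter.1 hk).2
        exact hS.compSet_subset ht' htk' ht
      · intro ht
        exact ⟨Quot.mk _ ⟨t, ht.1⟩, Finset.mem_filter.2 ⟨Finset.mem_univ _, t, ht, ht.1, rfl⟩,
          ht.1, rfl⟩
    have hor := eq_or_eq_swapColors (A := c.color t) (B := c'.color t) (h _).symm ((c.2.1 _).trans (c'.2.1 _).symm)
    rw [color_kempe]
    split_ifs with ht
    · exact (hor.resolve_left (hU.1 ht).2).symm
    · rcases hor with h1 | h1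
      · exact h1.symm
      · by_cases hp : t ∈ pairSet c i j
        · by_contra hne
          exact ht (hU.2 ⟨hp, fun e => hne e.symm⟩)
        · rw [h1, swapColors_of_notMem_pairSet hp]

end GLFoam

/-! ### Divisibility of power series by differences of variables -/

namespace MvPowerSeries

variable {σ R : Type*} [CommRing R]

theorem coeff_X_sub_X_mul [DecidableEq σ] (a b : σ) (f : MvPowerSeries σ R) (n : σ →₀ ℕ) :
    coeff n ((X a - X b) * f) =
      (if 1 ≤ n a then coeff (n - Finsupp.single a 1) f else 0) -
        if 1 ≤ n b then coeff (n - Finsupp.single b 1) f else 0 := by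
  rw [sub_mul, map_sub, X_def, X_def, coeff_monomial_mul, coeff_monomial_mul]
  simp only [Finsupp.single_le_iff, one_mul]

theorem X_sub_X_mem_nonZeroDivisors {a b : σ} (h : a ≠ b) :
    (X a - X b : MvPowerSeries σ R) ∈ nonZeroDivisors (MvPowerSeries σ R) := by
  classical
  rw [mem_nonZeroDivisors_iff_right]
  intro f hf
  rw [mul_comm] at hf
  suffices H : ∀ m (n : σ →₀ ℕ), n b = m → coeff n f = 0 by
    ext n
    exact H _ n rfl
  intro m
  induction m with
  | zero =>
    intro n hn
    have := congrArg (coeff (n + Finsupp.single a 1)) hf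
    rw [coeff_X_sub_X_mul] at this
    simpa [hn, h.symm] using this
  | succ m ih =>
    intro n hn
    have := congrArg (coeff (n + Finsupp.single a 1)) hf
    rw [coeff_X_sub_X_mul, ih (n + Finsupp.single a 1 - Finsupp.single b 1)] at this
    · simpa [h.symm] using this
    · simp [hn, h.symm]

end MvPowerSeries

/-- The map of indices that replaces `j` by `i`. -/
def mergeIndex {N : ℕ} (i j k : Fin N) : Fin N := if k = j then i else k

section Merge

variable {N : ℕ} {R : Type*} [CommRing R] {i j : Fin N}

theorem mapDomain_mergeIndex (n : Fin N →₀ ℕ) :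
    n.mapDomain (mergeIndex i j) = n.erase j + Finsupp.single i (n j) := by
  conv_lhs => rw [← Finsupp.erase_add_single j n]
  rw [Finsupp.mapDomain_add, Finsupp.mapDomain_single]
  congr 1
  · conv_rhs => rw [← Finsupp.mapDomain_id (v := n.erase j)]
    refine Finsupp.mapDomain_congr fun k hk => ?_
    rw [Finsupp.support_erase, Finset.mem_erase] at hk
    simp [mergeIndex, hk.1]
  · simp [mergeIndex]

theorem coeff_rename_mergeIndex (hij : i ≠ j) (f : MvPowerSeries (Fin N) R) {n : Fin N →₀ ℕ}
    (hn : n j = 0) :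
    coeff n (rename (mergeIndex i j) f) = ∑ m ∈ Finset.range (n i + 1),
      coeff (n - Finsupp.single i m + Finsupp.single j m) f := by
  rw [coeff_rename]
  symm
  refine Finset.sum_bij' (fun m _ => n - Finsupp.single i m + Finsupp.single j m)
    (fun x _ => x j) ?_ ?_ ?_ ?_ ?_
  · intro m hm
    rw [Finset.mem_range] at hm
    simp only [Set.Finite.mem_toFinset, Set.mem_preimage, Set.mem_singleton_iff,
      mapDomain_mergeIndex]
    ext k
    by_cases hk : k = i
    · subst hk
      simp [hij, hn]
      omega
    · by_cases hk' : k = j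
      · subst hk'
        simp [hk, hn]
      · simp [Finsupp.erase_ne hk', hk, Finsupp.single_apply]
  · intro x hx
    simp only [Set.Finite.mem_toFinset, Set.mem_preimage, Set.mem_singleton_iff,
      mapDomain_mergeIndex] at hx
    rw [← hx]
    simp [Finsupp.erase_ne hij]
  · intro m hm
    simp [hn, hij]
  · intro x hx
    simp only [Set.Finite.mem_toFinset, Set.mem_preimage, Set.mem_singleton_iff,
      mapDomain_mergeIndex] at hx
    rw [← hx]
    ext k
    by_cases hk' : k = j
    · subst hk'
      simp
    · simp [Finsupp.erase_ne hk', hk']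
  · intro m hm
    rfl

/-- A power series that vanishes for `x_i = x_j` is divisible by `x_i - x_j`. The quotient is
obtained from the coefficients by summation along the direction `x_i / x_j`. -/
theorem X_sub_X_dvd_of_rename_mergeIndex (hij : i ≠ j) {f : MvPowerSeries (Fin N) R}
    (hf : rename (mergeIndex i j) f = 0) : (X i - X j) ∣ f := by
  let q : MvPowerSeries (Fin N) R := fun n => - ∑ m ∈ Finset.range (n i + 1),
    coeff (n - Finsupp.single i m + Finsupp.single j (m + 1)) f
  have hq : ∀ n, coeff n q = - ∑ m ∈ Finset.range (n i + 1),
      coeff (n - Finsupp.single i m + Finsupp.single j (m + 1)) f := fun n => rfl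
  refine ⟨q, ?_⟩
  ext n
  rw [coeff_X_sub_X_mul]
  have h1 : (if 1 ≤ n i then coeff (n - Finsupp.single i 1) q else 0) =
      - ∑ m ∈ Finset.range (n i),
        coeff (n - Finsupp.single i (m + 1) + Finsupp.single j (m + 1)) f := by
    split_ifs with h
    · rw [hq]
      have e : (n - Finsupp.single i 1 : Fin N →₀ ℕ) i + 1 = n i := by simp; omega
      rw [e]
      congr 1
      refine Finset.sum_congr rfl fun m _ => ?_
      congr 2
      rw [tsub_tsub, ← Finsupp.single_add, add_comm 1 m]
    · have e : n i = 0 := by omega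
      simp [e]
  have h2 : ∑ m ∈ Finset.range (n i + 1), coeff (n - Finsupp.single i m + Finsupp.single j m) f =
      ∑ m ∈ Finset.range (n i),
        coeff (n - Finsupp.single i (m + 1) + Finsupp.single j (m + 1)) f + coeff n f := by
    rw [Finset.sum_range_succ']
    simp
  rw [h1]
  split_ifs with h
  · rw [hq]
    have e : (n - Finsupp.single j 1 : Fin N →₀ ℕ) i = n i := by simp [hij]
    have h3 : ∑ m ∈ Finset.range (n i + 1), coeff (n - Finsupp.single j 1 -
        Finsupp.single i m + Finsupp.single j (m + 1)) f =
        ∑ m ∈ Finset.range (n i + 1), coeff (n - Finsupp.single i m + Finsupp.single j m) f := by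
      refine Finset.sum_congr rfl fun m _ => ?_
      congr 2
      ext k
      by_cases hk : k = j
      · subst hk
        simp [hij]
        omega
      · simp [Finsupp.single_apply, Ne.symm hk]
    rw [e, h3, h2]
    ring
  · have e : n j = 0 := by omega
    have h4 := coeff_rename_mergeIndex hij f e
    rw [hf, h2] at h4
    simp only [map_zero] at h4
    linear_combination -h4

theorem rename_mergeIndex_swap (f : MvPowerSeries (Fin N) R) :
    rename (mergeIndex i j) (rename (Equiv.swap i j) f) = rename (mergeIndex i j) f := by
  rw [rename_rename]
  congr 2
  funext k
  simp only [Function.comp, mergeIndex, Equiv.swap_apply_def]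
  split_ifs <;> simp_all

/-- Exchanging `x_i` and `x_j` changes a power series by a multiple of `x_i - x_j`. -/
theorem X_sub_X_dvd_sub_swap (hij : i ≠ j) (f : MvPowerSeries (Fin N) R) :
    (X i - X j) ∣ f - rename (Equiv.swap i j) f := by
  apply X_sub_X_dvd_of_rename_mergeIndex hij
  rw [map_sub, rename_mergeIndex_swap, sub_self]

variable (R) in
/-- The power series that remain regular for `x_i = x_j`. All `x_a - x_b` but `± (x_i - x_j)`
are among them. -/
def regularOnDiagonal (i j : Fin N) : Submonoid (MvPowerSeries (Fin N) R) :=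
  (nonZeroDivisors (MvPowerSeries (Fin N) R)).comap
    (rename (R := R) (mergeIndex i j))

theorem mem_regularOnDiagonal {f : MvPowerSeries (Fin N) R} :
    f ∈ regularOnDiagonal R i j ↔
      rename (mergeIndex i j) f ∈ nonZeroDivisors (MvPowerSeries (Fin N) R) := Iff.rfl

theorem X_sub_X_mem_regularOnDiagonal {a b : Fin N} (hab : a ≠ b) (h1 : ¬ (a = i ∧ b = j))
    (h2 : ¬ (a = j ∧ b = i)) : (X a - X b : MvPowerSeries (Fin N) R) ∈ regularOnDiagonal R i j := by
  rw [mem_regularOnDiagonal, map_sub, rename_X, rename_X]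
  apply X_sub_X_mem_nonZeroDivisors
  simp only [mergeIndex]
  split_ifs <;> simp_all
  · exact fun h => h2 h.symm

theorem swap_mem_regularOnDiagonal {f : MvPowerSeries (Fin N) R} (hf : f ∈ regularOnDiagonal R i j) :
    rename (Equiv.swap i j) f ∈ regularOnDiagonal R i j := by
  rw [mem_regularOnDiagonal, rename_mergeIndex_swap]
  exact hf

theorem rename_perm_mem_nonZeroDivisors (w : Equiv.Perm (Fin N)) {f : MvPowerSeries (Fin N) R}
    (hf : f ∈ nonZeroDivisors (MvPowerSeries (Fin N) R)) :
    rename w f ∈ nonZeroDivisors (MvPowerSeries (Fin N) R) := by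
  rw [mem_nonZeroDivisors_iff_right] at hf ⊢
  intro x hx
  have h := congrArg (rename w.symm) hx
  rw [map_mul, rename_rename, map_zero] at h
  simp only [Equiv.symm_comp_self, rename_id_apply] at h
  have h' := congrArg (rename w) (hf _ h)
  rw [rename_rename, map_zero] at h'
  simpa using h'

theorem rename_perm_mem_regularOnDiagonal (w : Equiv.Perm (Fin N)) {f : MvPowerSeries (Fin N) R}
    (hf : f ∈ regularOnDiagonal R i j) : rename w f ∈ regularOnDiagonal R (w i) (w j) := by
  have : mergeIndex (w i) (w j) ∘ w = w ∘ mergeIndex i j := by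
    funext k
    simp only [Function.comp, mergeIndex, EmbeddingLike.apply_eq_iff_eq]
    split_ifs <;> rfl
  have h2 : rename (mergeIndex (w i) (w j)) (rename w f) = rename w (rename (mergeIndex i j) f) := by
    rw [rename_rename, rename_rename]
    simp only [this]
  rw [mem_regularOnDiagonal, h2]
  exact rename_perm_mem_nonZeroDivisors w hf

/-- Factors that remain regular on the diagonal `x_i = x_j` can be cancelled from a divisibility by
a power of `x_i - x_j`. -/
theorem pow_dvd_of_dvd_mul (hij : i ≠ j) {E : MvPowerSeries (Fin N) R}
    (hE : E ∈ regularOnDiagonal R i j) (m : ℕ) {x : MvPowerSeries (Fin N) R}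
    (h : (X i - X j) ^ m ∣ E * x) : (X i - X j) ^ m ∣ x := by
  induction m generalizing x with
  | zero => simp
  | succ m ih =>
    have h1 : (X i - X j) ∣ x := by
      apply X_sub_X_dvd_of_rename_mergeIndex hij
      obtain ⟨y, hy⟩ := (dvd_pow_self _ (Nat.succ_ne_zero m)).trans h
      have h2 := congrArg (rename (mergeIndex i j)) hy
      rw [map_mul, map_mul, map_sub, rename_X, rename_X] at h2
      have e : mergeIndex i j i = mergeIndex i j j := by simp [mergeIndex, hij]
      rw [e, sub_self, zero_mul, mul_comm] at h2
      exact (mem_nonZeroDivisors_iff_right.1 hE) _ h2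
    obtain ⟨y, rfl⟩ := h1
    rw [pow_succ']
    refine mul_dvd_mul_left _ (ih ?_)
    obtain ⟨z, hz⟩ := h
    refine ⟨z, ?_⟩
    have hr := X_sub_X_mem_nonZeroDivisors (R := R) hij
    refine mul_cancel_left_mem_nonZeroDivisors hr |>.1 ?_
    linear_combination hz

end Merge

/-! ### The symmetric group acting on the ring of evaluations -/

section Action

variable {N : ℕ} {R : Type*} [CommRing R]

variable (R) in
theorem isUnit_X_sub_X {a b : Fin N} (h : a ≠ b) :
    IsUnit (algebraMap (MvPowerSeries (Fin N) R) (EvalRing N R) (X a - X b)) := by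
  rcases lt_or_gt_of_ne h with h | h
  · exact isUnit_root N R ⟨(a, b), h⟩
  · have := (isUnit_root N R ⟨(b, a), h⟩).neg
    rwa [← map_neg, neg_sub] at this

theorem isUnit_rename_discr (w : Equiv.Perm (Fin N)) :
    IsUnit (((algebraMap (MvPowerSeries (Fin N) R) (EvalRing N R)).comp
      (rename (R := R) w : MvPowerSeries (Fin N) R →ₐ[R] _).toRingHom) (discr N R)) := by
  change IsUnit (((algebraMap (MvPowerSeries (Fin N) R) (EvalRing N R)).comp
      (rename (R := R) w : MvPowerSeries (Fin N) R →ₐ[R] _).toRingHom)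
      (∏ q : {q : Fin N × Fin N // q.1 < q.2}, (X q.1.1 - X q.1.2)))
  rw [map_prod]
  refine IsUnit.prod_univ_iff.2 fun q => ?_
  have : ((algebraMap (MvPowerSeries (Fin N) R) (EvalRing N R)).comp
      (rename (R := R) w : MvPowerSeries (Fin N) R →ₐ[R] _).toRingHom) (X q.1.1 - X q.1.2) =
      algebraMap (MvPowerSeries (Fin N) R) (EvalRing N R) (X (w q.1.1) - X (w q.1.2)) := by
    simp [rename_X]
  rw [this]
  exact isUnit_X_sub_X R (w.injective.ne q.2.ne)

/-- Permutation of the variables in the ring of evaluations. -/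
def permHom (w : Equiv.Perm (Fin N)) : EvalRing N R →+* EvalRing N R :=
  IsLocalization.Away.lift (discr N R) (isUnit_rename_discr w)

@[simp]
theorem permHom_algebraMap (w : Equiv.Perm (Fin N)) (f : MvPowerSeries (Fin N) R) :
    permHom w (algebraMap (MvPowerSeries (Fin N) R) (EvalRing N R) f) =
      algebraMap (MvPowerSeries (Fin N) R) (EvalRing N R) (rename w f) :=
  IsLocalization.Away.lift_eq _ _ _

theorem ringHom_ext_algebraMap {f g : EvalRing N R →+* EvalRing N R}
    (h : ∀ x, f (algebraMap (MvPowerSeries (Fin N) R) (EvalRing N R) x) =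
      g (algebraMap (MvPowerSeries (Fin N) R) (EvalRing N R) x)) : f = g :=
  IsLocalization.ringHom_ext (Submonoid.powers (discr N R)) (RingHom.ext h)

theorem permHom_one : permHom (R := R) (1 : Equiv.Perm (Fin N)) = RingHom.id _ :=
  ringHom_ext_algebraMap fun x => by
    rw [permHom_algebraMap]
    simp only [Equiv.Perm.coe_one, rename_id_apply, RingHom.id_apply]

theorem permHom_mul (w w' : Equiv.Perm (Fin N)) :
    permHom (R := R) (w * w') = (permHom w).comp (permHom w') :=
  ringHom_ext_algebraMap fun x => by
    rw [RingHom.comp_apply, permHom_algebraMap, permHom_algebraMap, permHom_algebraMap,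
      rename_rename]
    rfl

theorem algebraMap_evalRing_injective :
    Function.Injective (algebraMap (MvPowerSeries (Fin N) R) (EvalRing N R)) := by
  refine IsLocalization.injective _ (M := Submonoid.powers (discr N R)) ?_
  rw [Submonoid.powers_le]
  exact prod_mem fun q _ => X_sub_X_mem_nonZeroDivisors q.2.ne

end Action

/-! ### Regularity along a diagonal -/

section Diagonal

variable {N : ℕ} {R : Type*} [CommRing R]

variable (R) in
/-- The elements of the ring of evaluations that are regular along `x_i = x_j`: they have a
denominator that is regular for `x_i = x_j`. -/
def diagSubring (i j : Fin N) : Subring (EvalRing N R) where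
  carrier := {z | ∃ E ∈ regularOnDiagonal R i j, ∃ f : MvPowerSeries (Fin N) R,
    algebraMap (MvPowerSeries (Fin N) R) (EvalRing N R) E * z = algebraMap _ _ f}
  mul_mem' := by
    rintro a b ⟨E, hE, f, h⟩ ⟨E', hE', f', h'⟩
    refine ⟨E * E', mul_mem hE hE', f * f', ?_⟩
    rw [map_mul, map_mul, ← h, ← h']
    ring
  one_mem' := ⟨1, one_mem _, 1, by rw [map_one, one_mul]⟩
  add_mem' := by
    rintro a b ⟨E, hE, f, h⟩ ⟨E', hE', f', h'⟩
    refine ⟨E * E', mul_mem hE hE', E' * f + E * f', ?_⟩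
    rw [map_mul, map_add, map_mul, map_mul, ← h, ← h']
    ring
  zero_mem' := ⟨1, one_mem _, 0, by rw [mul_zero, map_zero]⟩
  neg_mem' := by
    rintro a ⟨E, hE, f, h⟩
    exact ⟨E, hE, -f, by rw [mul_neg, h, map_neg]⟩

theorem algebraMap_mem_diagSubring (i j : Fin N) (f : MvPowerSeries (Fin N) R) :
    algebraMap (MvPowerSeries (Fin N) R) (EvalRing N R) f ∈ diagSubring R i j :=
  ⟨1, one_mem _, f, by rw [map_one, one_mul]⟩

theorem permHom_mem_diagSubring {i j : Fin N} (w : Equiv.Perm (Fin N)) {z : EvalRing N R}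
    (hz : z ∈ diagSubring R i j) : permHom w z ∈ diagSubring R (w i) (w j) := by
  obtain ⟨E, hE, f, h⟩ := hz
  refine ⟨rename w E, rename_perm_mem_regularOnDiagonal w hE, rename w f, ?_⟩
  rw [← permHom_algebraMap, ← permHom_algebraMap, ← map_mul, h]

variable {i j : Fin N}

theorem permHom_swap_mem_diagSubring {z : EvalRing N R} (hz : z ∈ diagSubring R i j) :
    permHom (Equiv.swap i j) z ∈ diagSubring R i j := by
  obtain ⟨E, hE, f, h⟩ := hz
  refine ⟨rename (Equiv.swap i j) E, swap_mem_regularOnDiagonal hE,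
    rename (Equiv.swap i j) f, ?_⟩
  rw [← permHom_algebraMap, ← permHom_algebraMap, ← map_mul, h]

/-- The element vanishes along `x_i = x_j`: it is a multiple of `x_i - x_j` by an element that is
regular there. -/
def VanishesOn (i j : Fin N) (z : EvalRing N R) : Prop :=
  ∃ a ∈ diagSubring R i j,
    z = algebraMap (MvPowerSeries (Fin N) R) (EvalRing N R) (X i - X j) * a

theorem VanishesOn.mem {z : EvalRing N R} (h : VanishesOn i j z) : z ∈ diagSubring R i j := by
  obtain ⟨a, ha, rfl⟩ := h
  exact mul_mem (algebraMap_mem_diagSubring _ _ _) ha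

theorem VanishesOn.mul {z a : EvalRing N R} (h : VanishesOn i j z) (ha : a ∈ diagSubring R i j) :
    VanishesOn i j (z * a) := by
  obtain ⟨b, hb, rfl⟩ := h
  exact ⟨b * a, mul_mem hb ha, by ring⟩

theorem VanishesOn.add {z z' : EvalRing N R} (h : VanishesOn i j z) (h' : VanishesOn i j z') :
    VanishesOn i j (z + z') := by
  obtain ⟨b, hb, rfl⟩ := h
  obtain ⟨b', hb', rfl⟩ := h'
  exact ⟨b + b', add_mem hb hb', by ring⟩

theorem VanishesOn.neg {z : EvalRing N R} (h : VanishesOn i j z) : VanishesOn i j (-z) := by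
  obtain ⟨b, hb, rfl⟩ := h
  exact ⟨-b, neg_mem hb, by ring⟩

/-- An element that is regular along `x_i = x_j` and its image under the exchange of `x_i` and
`x_j` agree there. -/
theorem vanishesOn_sub_swap (hij : i ≠ j) {z : EvalRing N R} (hz : z ∈ diagSubring R i j) :
    VanishesOn i j (z - permHom (Equiv.swap i j) z) := by
  obtain ⟨E, hE, f, h⟩ := hz
  obtain ⟨u, hu⟩ := isUnit_X_sub_X R hij
  obtain ⟨g, hg⟩ := X_sub_X_dvd_sub_swap hij (rename (Equiv.swap i j) E * f)
  have hs : rename (Equiv.swap i j) (rename (Equiv.swap i j) E) = E := by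
    rw [rename_rename]
    have : (Equiv.swap i j : Fin N → Fin N) ∘ Equiv.swap i j = id := by
      funext k; simp
    simp [this]
  have h' := congrArg (permHom (Equiv.swap i j)) h
  rw [map_mul, permHom_algebraMap, permHom_algebraMap] at h'
  refine ⟨(z - permHom (Equiv.swap i j) z) * (u⁻¹ : (EvalRing N R)ˣ),
    ⟨E * rename (Equiv.swap i j) E, mul_mem hE (swap_mem_regularOnDiagonal hE), g, ?_⟩, ?_⟩
  · rw [← mul_assoc, Units.mul_inv_eq_iff_eq_mul, hu, mul_comm (algebraMap _ _ g), ← map_mul, ← hg,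
      map_sub, map_mul, map_mul (rename _), hs, map_mul, map_mul]
    linear_combination
      (algebraMap (MvPowerSeries (Fin N) R) (EvalRing N R) (rename (Equiv.swap i j) E)) * h -
        (algebraMap (MvPowerSeries (Fin N) R) (EvalRing N R) E) * h'
  · rw [← hu, mul_comm, mul_assoc, Units.inv_mul, mul_one]

variable (R) in
/-- The invertible elements that are regular along `x_i = x_j` together with their inverses. -/
def diagUnits (i j : Fin N) : Subgroup (EvalRing N R)ˣ where
  carrier := {v | (v : EvalRing N R) ∈ diagSubring R i j ∧
    ((v⁻¹ : (EvalRing N R)ˣ) : EvalRing N R) ∈ diagSubring R i j}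
  mul_mem' := by
    rintro a b ⟨h1, h2⟩ ⟨h3, h4⟩
    refine ⟨mul_mem h1 h3, ?_⟩
    rw [mul_inv]
    exact mul_mem h2 h4
  one_mem' := by
    refine ⟨one_mem _, ?_⟩
    rw [inv_one]
    exact one_mem _
  inv_mem' := by
    rintro a ⟨h1, h2⟩
    exact ⟨h2, by rwa [inv_inv]⟩

variable (R) in
/-- The invertible elements that are equal to `1` along `x_i = x_j`. -/
def diagOne (i j : Fin N) : Subgroup (EvalRing N R)ˣ where
  carrier := {v | VanishesOn i j ((v : EvalRing N R) - 1) ∧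
    VanishesOn i j (((v⁻¹ : (EvalRing N R)ˣ) : EvalRing N R) - 1)}
  mul_mem' := by
    have key : ∀ a b : EvalRing N R, VanishesOn i j (a - 1) → VanishesOn i j (b - 1) →
        VanishesOn i j (a * b - 1) := by
      intro a b ha hb
      have hb' : b ∈ diagSubring R i j := by simpa using add_mem hb.mem (one_mem _)
      have := (ha.mul hb').add hb
      rwa [show (a - 1) * b + (b - 1) = a * b - 1 by ring] at this
    rintro a b ⟨h1, h2⟩ ⟨h3, h4⟩
    refine ⟨key _ _ h1 h3, ?_⟩
    rw [mul_inv]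
    exact key _ _ h2 h4
  one_mem' := by
    have : VanishesOn i j (0 : EvalRing N R) := ⟨0, zero_mem _, by rw [mul_zero]⟩
    simpa using this
  inv_mem' := by
    rintro a ⟨h1, h2⟩
    exact ⟨h2, by rwa [inv_inv]⟩

/-- A unit that is regular along the diagonal agrees there with its image under the exchange of
`x_i` and `x_j`. -/
theorem div_permHom_mem_diagOne (hij : i ≠ j) {u : (EvalRing N R)ˣ} (hu : u ∈ diagUnits R i j) :
    u / Units.map (permHom (R := R) (Equiv.swap i j)).toMonoidHom u ∈ diagOne R i j := by
  set v := Units.map (permHom (R := R) (Equiv.swap i j)).toMonoidHom u with hv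
  have hvu : (v : EvalRing N R) = permHom (Equiv.swap i j) u := rfl
  have h := vanishesOn_sub_swap hij hu.1
  have hinv : ((v⁻¹ : (EvalRing N R)ˣ) : EvalRing N R) ∈ diagSubring R i j := by
    rw [hv, ← map_inv]
    exact permHom_swap_mem_diagSubring hu.2
  rw [← hvu] at h
  refine ⟨?_, ?_⟩
  · have := h.mul hinv
    rw [sub_mul, Units.mul_inv] at this
    rwa [div_eq_mul_inv, Units.val_mul]
  · have := (h.mul hu.2).neg
    rw [sub_mul, Units.mul_inv, neg_sub] at this
    rwa [inv_div, div_eq_mul_inv, Units.val_mul]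

theorem unit_map_mem_diagUnits (i j : Fin N) {f : MvPowerSeries (Fin N) R} (hf : IsUnit f) :
    (hf.map (algebraMap (MvPowerSeries (Fin N) R) (EvalRing N R))).unit ∈ diagUnits R i j := by
  refine ⟨algebraMap_mem_diagSubring i j f, ?_⟩
  obtain ⟨u, rfl⟩ := hf
  have : ((u.isUnit.map (algebraMap (MvPowerSeries (Fin N) R) (EvalRing N R))).unit)⁻¹ =
      Units.map (algebraMap (MvPowerSeries (Fin N) R) (EvalRing N R)).toMonoidHom u⁻¹ := by
    rw [map_inv]
    congr 1
    ext
    rfl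
  rw [this]
  exact algebraMap_mem_diagSubring i j _

theorem pUnit_mem_diagUnits (p : MvPowerSeries (Fin 2) R) (hp : constantCoeff p = 1)
    (i j k l : Fin N) : pUnit N p hp k l ∈ diagUnits R i j :=
  unit_map_mem_diagUnits i j (isUnit_pSeries N p hp k l)

theorem rootUnit_mem_diagUnits {q : {q : Fin N × Fin N // q.1 < q.2}} (hij : i < j)
    (hq : q.1 ≠ (i, j)) : rootUnit N R q ∈ diagUnits R i j := by
  refine ⟨algebraMap_mem_diagSubring i j _, X q.1.1 - X q.1.2,
    X_sub_X_mem_regularOnDiagonal q.2.ne (fun h => hq (Prod.ext h.1 h.2)) ?_, 1, ?_⟩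
  · rintro ⟨h1, h2⟩
    have := q.2
    rw [h1, h2] at this
    exact absurd this hij.not_gt
  · rw [map_one]
    exact Units.mul_inv (rootUnit N R q)

end Diagonal

/-! ### Denominators that vanish -/

section Descent

variable {N : ℕ} {R : Type*} [CommRing R]

/-- An element of the ring of evaluations that is regular along all diagonals is a power
series. -/
theorem mem_range_algebraMap_of_mem_diagSubring {z : EvalRing N R}
    (hz : ∀ i j : Fin N, i < j → z ∈ diagSubring R i j) :
    z ∈ Set.range (algebraMap (MvPowerSeries (Fin N) R) (EvalRing N R)) := by
  obtain ⟨m, h, hh⟩ := IsLocalization.Away.surj (discr N R) z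
  have key : ∀ T : Finset {q : Fin N × Fin N // q.1 < q.2},
      (∏ q ∈ T, (X q.1.1 - X q.1.2 : MvPowerSeries (Fin N) R) ^ m) ∣ h := by
    classical
    intro T
    induction T using Finset.induction_on with
    | empty => simp
    | insert q T hq ih =>
      rw [Finset.prod_insert hq]
      obtain ⟨y, hy⟩ := ih
      suffices H : (X q.1.1 - X q.1.2 : MvPowerSeries (Fin N) R) ^ m ∣ y by
        rw [hy, mul_comm]
        exact mul_dvd_mul_left _ H
      have hreg : ∀ q' : {q : Fin N × Fin N // q.1 < q.2}, q' ≠ q →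
          (X q'.1.1 - X q'.1.2 : MvPowerSeries (Fin N) R) ∈ regularOnDiagonal R q.1.1 q.1.2 := by
        intro q' hne
        refine X_sub_X_mem_regularOnDiagonal q'.2.ne
          (fun e => hne (Subtype.ext (Prod.ext e.1 e.2))) ?_
        rintro ⟨e1, e2⟩
        have := q'.2
        rw [e1, e2] at this
        exact absurd this q.2.not_gt
      refine pow_dvd_of_dvd_mul q.2.ne (E := ∏ q ∈ T, (X q.1.1 - X q.1.2) ^ m)
        (prod_mem fun q' hq' => pow_mem (hreg q' fun e => hq (e ▸ hq')) m) m ?_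
      rw [← hy]
      obtain ⟨E, hE, f, hf⟩ := hz _ _ q.2
      refine pow_dvd_of_dvd_mul q.2.ne hE m ?_
      have e : E * h = discr N R ^ m * f := by
        apply algebraMap_evalRing_injective
        rw [map_mul, map_mul, ← hh, ← hf, map_pow]
        ring
      rw [e]
      exact (pow_dvd_pow_of_dvd (Finset.dvd_prod_of_mem
        (fun q : {q : Fin N × Fin N // q.1 < q.2} =>
          (X q.1.1 - X q.1.2 : MvPowerSeries (Fin N) R)) (Finset.mem_univ q)) m).mul_right f
  obtain ⟨g, hg⟩ := key Finset.univ
  rw [Finset.prod_pow] at hg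
  refine ⟨g, (IsLocalization.Away.algebraMap_pow_isUnit (discr N R) m).mul_left_cancel ?_⟩
  rw [← map_pow, ← map_mul]
  change algebraMap _ _ ((∏ q : {q : Fin N × Fin N // q.1 < q.2}, (X q.1.1 - X q.1.2)) ^ m * g) = _
  rw [← hg, ← hh, map_pow, mul_comm]

end Descent

/-! ### Change of the weight of a coloring under Kempe moves -/

section SwapUnits

variable {N : ℕ} {R : Type*} [CommRing R]

/-- Permutation of the variables of an invertible element. -/
def permUnits (w : Equiv.Perm (Fin N)) : (EvalRing N R)ˣ →* (EvalRing N R)ˣ :=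
  Units.map (permHom (R := R) w).toMonoidHom

theorem permUnits_pUnit (w : Equiv.Perm (Fin N)) (p : MvPowerSeries (Fin 2) R)
    (hp : constantCoeff p = 1) (k l : Fin N) :
    permUnits w (pUnit N p hp k l) = pUnit N p hp (w k) (w l) := by
  ext
  change permHom w (algebraMap _ _ (pSeries N p k l)) = algebraMap _ _ (pSeries N p (w k) (w l))
  rw [permHom_algebraMap, pSeries, pSeries, rename_rename]
  congr 3
  funext m
  fin_cases m <;> rfl

/-- The pairs of indices `k < l` are permuted by the exchange of two consecutive indices, if the
pair formed by the two is kept fixed. -/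
def swapPair (i j : Fin N) (hij : i.val + 1 = j.val) (q : {q : Fin N × Fin N // q.1 < q.2}) :
    {q : Fin N × Fin N // q.1 < q.2} := by
  classical exact
    if h : q.1 = (i, j) then q
    else ⟨(Equiv.swap i j q.1.1, Equiv.swap i j q.1.2), GLFoam.swap_lt_swap hij q.2 h⟩

variable {i j : Fin N}

theorem swapPair_of_eq (hij : i.val + 1 = j.val) {q : {q : Fin N × Fin N // q.1 < q.2}} (h : q.1 = (i, j)) :
    swapPair i j hij q = q := dif_pos h

theorem swapPair_of_ne (hij : i.val + 1 = j.val) {q : {q : Fin N × Fin N // q.1 < q.2}} (h : q.1 ≠ (i, j)) :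
    (swapPair i j hij q).1 = (Equiv.swap i j q.1.1, Equiv.swap i j q.1.2) := by
  rw [swapPair, dif_neg h]

theorem swapPair_ne (hij : i.val + 1 = j.val) {q : {q : Fin N × Fin N // q.1 < q.2}}
    (h : q.1 ≠ (i, j)) :
    (swapPair i j hij q).1 ≠ (i, j) := by
  rw [swapPair_of_ne hij h]
  intro e
  rw [Prod.mk.injEq, Equiv.swap_apply_eq_iff, Equiv.swap_apply_eq_iff, Equiv.swap_apply_left,
    Equiv.swap_apply_right] at e
  have := q.2
  rw [e.1, e.2, Fin.lt_def] at this
  omega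

theorem swapPair_swapPair (hij : i.val + 1 = j.val) (q : {q : Fin N × Fin N // q.1 < q.2}) :
    swapPair i j hij (swapPair i j hij q) = q := by
  by_cases h : q.1 = (i, j)
  · rw [swapPair_of_eq hij h, swapPair_of_eq hij h]
  · apply Subtype.ext
    rw [swapPair_of_ne hij (swapPair_ne hij h), swapPair_of_ne hij h]
    simp

theorem permUnits_rootUnit (hij : i.val + 1 = j.val)
    {q : {q : Fin N × Fin N // q.1 < q.2}} (h : q.1 ≠ (i, j)) :
    permUnits (Equiv.swap i j) (rootUnit N R q) = rootUnit N R (swapPair i j hij q) := by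
  ext
  change permHom _ (algebraMap _ _ (X q.1.1 - X q.1.2)) =
    algebraMap _ _ (X (swapPair i j hij q).1.1 - X (swapPair i j hij q).1.2)
  rw [swapPair_of_ne hij h, permHom_algebraMap, map_sub, rename_X, rename_X]

theorem permUnits_rootUnit_of_eq {q : {q : Fin N × Fin N // q.1 < q.2}} (h : q.1 = (i, j)) :
    permUnits (Equiv.swap i j) (rootUnit N R q) = - rootUnit N R q := by
  ext
  change permHom _ (algebraMap _ _ (X q.1.1 - X q.1.2)) =
    - algebraMap _ _ (X q.1.1 - X q.1.2)
  rw [h, permHom_algebraMap, map_sub, rename_X, rename_X, Equiv.swap_apply_left,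
    Equiv.swap_apply_right, ← map_neg, neg_sub]

end SwapUnits

namespace GLFoam

variable {N : ℕ} {R : Type*} [CommRing R] {F : GLFoam N R} {c : F.Coloring} {i j : Fin N}
  {S : Set F.K.Triangle}

/-- The change of `χ_k` under the Kempe move on `S`. -/
def chiChange (c : F.Coloring) (i j : Fin N) (S : Set F.K.Triangle) (k : Fin N) : ℤ :=
  eulerChange c i j (fun A => k ∈ A) S

/-- The change of `χ_kl` under the Kempe move on `S`. -/
def chiPairChange (c : F.Coloring) (i j : Fin N) (S : Set F.K.Triangle) (k l : Fin N) : ℤ :=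
  eulerChange c i j (fun A => (k ∈ A ∧ l ∉ A) ∨ (l ∈ A ∧ k ∉ A)) S

theorem chiPair_kempe (hS : IsPart c i j S) (k l : Fin N) :
    (kempe c i j hS).chiPair k l = c.chiPair k l + chiPairChange c i j S k l :=
  eulerChar_kempe hS fun A => (k ∈ A ∧ l ∉ A) ∨ (l ∈ A ∧ k ∉ A)

theorem even_chiChange (hS : IsPart c i j S) (k : Fin N) : Even (chiChange c i j S k) :=
  even_eulerChange hS k

theorem even_chiPairChange (hS : IsPart c i j S) (k l : Fin N) :
    Even (chiPairChange c i j S k l) := by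
  have h1 := even_chiPair (kempe c i j hS) k l
  rw [chiPair_kempe] at h1
  exact (Int.even_add.1 h1).1 (even_chiPair c k l)

theorem chiChange_swap (k : Fin N) :
    chiChange c i j S (Equiv.swap i j k) = - chiChange c i j S k := by
  rw [chiChange, chiChange, ← eulerChange_swap]
  exact eulerChange_congr (fun A => by rw [mem_swapColors]) S

theorem chiPairChange_swap (k l : Fin N) :
    chiPairChange c i j S (Equiv.swap i j k) (Equiv.swap i j l) = - chiPairChange c i j S k l := by
  rw [chiPairChange, chiPairChange, ← eulerChange_swap]
  exact eulerChange_congr (fun A => by simp only [mem_swapColors]) S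

variable (p : MvPowerSeries (Fin 2) R) (hp : constantCoeff p = 1)

/-- The factor that the pair of colors `q` contributes to the change of the weight under the Kempe
move on `S`. -/
def pairRatio (c : F.Coloring) (i j : Fin N) (S : Set F.K.Triangle)
    (q : {q : Fin N × Fin N // q.1 < q.2}) : (EvalRing N R)ˣ :=
  pUnit N p hp q.1.1 q.1.2 ^ (chiChange c i j S q.1.1 / 2) *
    pUnit N p hp q.1.2 q.1.1 ^ (chiChange c i j S q.1.2 / 2) /
      rootUnit N R q ^ (chiPairChange c i j S q.1.1 q.1.2 / 2)

/-- The factor by which the weight changes under the Kempe move on `S`, up to the sign. -/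
def kempeRatio (c : F.Coloring) (i j : Fin N) (S : Set F.K.Triangle) : (EvalRing N R)ˣ :=
  ∏ q : {q : Fin N × Fin N // q.1 < q.2}, pairRatio p hp c i j S q

/-- The factor of the pair `q` in the weight of a coloring. -/
def pairFactor (c : F.Coloring) (q : {q : Fin N × Fin N // q.1 < q.2}) : (EvalRing N R)ˣ :=
  pUnit N p hp q.1.1 q.1.2 ^ (c.chi q.1.1 / 2) * pUnit N p hp q.1.2 q.1.1 ^ (c.chi q.1.2 / 2) /
    rootUnit N R q ^ (c.chiPair q.1.1 q.1.2 / 2)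

/-- The weight of a coloring: its contribution to the evaluation without the decorations. -/
def weight (c : F.Coloring) : (EvalRing N R)ˣ :=
  (-1) ^ c.signExponent * ∏ q : {q : Fin N × Fin N // q.1 < q.2}, pairFactor p hp c q

theorem evaluation_eq (c : F.Coloring) : c.evaluation p hp = (weight p hp c : EvalRing N R) *
    algebraMap (MvPowerSeries (Fin N) R) (EvalRing N R) (∏ f, c.facetValue f) := by
  rw [Coloring.evaluation, weight, Units.val_mul, mul_right_comm]
  rfl

theorem pairFactor_kempe (hS : IsPart c i j S) (q : {q : Fin N × Fin N // q.1 < q.2}) :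
    pairFactor p hp (kempe c i j hS) q = pairFactor p hp c q * pairRatio p hp c i j S q := by
  have e : ∀ k, (kempe c i j hS).chi k / 2 = c.chi k / 2 + chiChange c i j S k / 2 := by
    intro k
    rw [chi_kempe]
    exact Int.add_ediv_of_dvd_left (even_chi c k).two_dvd
  rw [pairFactor, pairFactor, pairRatio, e, e, chiPair_kempe,
    Int.add_ediv_of_dvd_left (even_chiPair c _ _).two_dvd, zpow_add, zpow_add, zpow_add,
    div_mul_div_comm, mul_mul_mul_comm]

theorem neg_one_zpow_eq_of_even_sub {G : Type*} [Group G] [HasDistribNeg G] {a b : ℤ}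
    (h : Even (a - b)) : (-1 : G) ^ a = (-1) ^ b := by
  rw [← sub_add_cancel a b, zpow_add, h.neg_one_zpow, one_mul]

/-- The sign and the other factors of the weight under a Kempe move on `S`. -/
theorem weight_kempe (hS : IsPart c i j S) (hij : i.val + 1 = j.val) :
    weight p hp (kempe c i j hS) =
      weight p hp c * ((-1) ^ (F.K.eulerChar S / 2) * kempeRatio p hp c i j S) := by
  have h : Even ((kempe c i j hS).signExponent - (c.signExponent + F.K.eulerChar S / 2)) := by
    rw [← sub_sub]
    exact even_signExponent_kempe hS hij
  simp only [weight, kempeRatio, pairFactor_kempe, Finset.prod_mul_distrib,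
    neg_one_zpow_eq_of_even_sub h, zpow_add]
  rw [mul_mul_mul_comm]

theorem sum_ediv_two {ι : Type*} (U : Finset ι) (a : ι → ℤ) (h : ∀ k ∈ U, Even (a k)) :
    (∑ k ∈ U, a k) / 2 = ∑ k ∈ U, a k / 2 := by
  have : ∑ k ∈ U, a k = 2 * ∑ k ∈ U, a k / 2 := by
    rw [Finset.mul_sum]
    exact Finset.sum_congr rfl fun k hk => (Int.mul_ediv_cancel' (h k hk).two_dvd).symm
  rw [this]
  exact Int.mul_ediv_cancel_left _ two_ne_zero

theorem zpow_sum_eq {G ι : Type*} [CommGroup G] (g : G) (U : Finset ι) (a : ι → ℤ) :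
    g ^ (∑ k ∈ U, a k) = ∏ k ∈ U, g ^ a k := by
  classical
  induction U using Finset.induction_on with
  | empty => simp
  | insert k U hk ih => rw [Finset.sum_insert hk, Finset.prod_insert hk, zpow_add, ih]

theorem kempeRatio_unionSet (U : Finset (Comp c i j)) :
    kempeRatio p hp c i j (unionSet U) = ∏ k ∈ U, kempeRatio p hp c i j (compSet k) := by
  have e1 : ∀ Q, eulerChange c i j Q (unionSet U) = ∑ k ∈ U, eulerChange c i j Q (compSet k) :=
    fun Q => eulerChange_biUnion Q U compSet (fun k _ => isPart_compSet k)
      (fun k _ l _ h => compSet_disjoint h)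
  have e2 : ∀ m, chiChange c i j (unionSet U) m / 2 =
      ∑ k ∈ U, chiChange c i j (compSet k) m / 2 := by
    intro m
    rw [chiChange, e1]
    exact sum_ediv_two U _ fun k _ => even_chiChange (isPart_compSet k) m
  have e3 : ∀ m n, chiPairChange c i j (unionSet U) m n / 2 =
      ∑ k ∈ U, chiPairChange c i j (compSet k) m n / 2 := by
    intro m n
    rw [chiPairChange, e1]
    exact sum_ediv_two U _ fun k _ => even_chiPairChange (isPart_compSet k) m n
  unfold kempeRatio
  rw [Finset.prod_comm]
  refine Finset.prod_congr rfl fun q _ => ?_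
  simp only [pairRatio, e2, e3, zpow_sum_eq, Finset.prod_div_distrib, Finset.prod_mul_distrib]

theorem sign_unionSet (U : Finset (Comp c i j)) :
    (-1 : (EvalRing N R)ˣ) ^ (F.K.eulerChar (unionSet U) / 2) =
      ∏ k ∈ U, (-1) ^ (F.K.eulerChar (compSet k) / 2) := by
  have e1 : F.K.eulerChar (unionSet U) = ∑ k ∈ U, F.K.eulerChar (compSet k) :=
    eulerChar_biUnion U compSet (fun k _ => isPart_compSet k)
      (fun k _ l _ h => compSet_disjoint h)
  rw [e1, sum_ediv_two U _ fun k _ => even_eulerChar_part (isPart_compSet k), zpow_sum_eq]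

theorem permUnits_pairRatio (hS : IsPart c i j S) (hij : i.val + 1 = j.val)
    {q : {q : Fin N × Fin N // q.1 < q.2}} (h : q.1 ≠ (i, j)) :
    permUnits (Equiv.swap i j) (pairRatio p hp c i j S q) =
      (pairRatio p hp c i j S (swapPair i j hij q))⁻¹ := by
  have e : ∀ k, chiChange c i j S (Equiv.swap i j k) / 2 = - (chiChange c i j S k / 2) := by
    intro k
    rw [chiChange_swap, Int.neg_ediv_of_dvd (even_chiChange hS k).two_dvd]
  have e' : ∀ k l, chiPairChange c i j S (Equiv.swap i j k) (Equiv.swap i j l) / 2 =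
      - (chiPairChange c i j S k l / 2) := by
    intro k l
    rw [chiPairChange_swap, Int.neg_ediv_of_dvd (even_chiPairChange hS k l).two_dvd]
  rw [pairRatio, pairRatio, map_div, map_mul, map_zpow, map_zpow, map_zpow, permUnits_pUnit,
    permUnits_pUnit, permUnits_rootUnit hij h]
  simp only [swapPair_of_ne hij h, e, e', zpow_neg, div_eq_mul_inv, mul_inv, inv_inv]

/-- For the pair `i, j` itself the ratio is a quotient of powers of `p_ij` and `p_ji`, with the same
exponent, which agree along `x_i = x_j`. -/
theorem pairRatio_mem_diagOne (c : F.Coloring) (S : Set F.K.Triangle) (hS : IsPart c i j S)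
    (hne : i ≠ j) {q : {q : Fin N × Fin N // q.1 < q.2}} (h : q.1 = (i, j)) :
    pairRatio p hp c i j S q ∈ diagOne R i j := by
  have e1 : chiChange c i j S j / 2 = - (chiChange c i j S i / 2) := by
    rw [← Int.neg_ediv_of_dvd (even_chiChange hS i).two_dvd, ← chiChange_swap,
      Equiv.swap_apply_left]
  have e2 : chiPairChange c i j S i j = 0 :=
    eulerChange_eq_zero (fun A => by
      rw [mem_swapColors, mem_swapColors, Equiv.swap_apply_left, Equiv.swap_apply_right,
        or_comm]) S
  rw [pairRatio, h, e1, e2]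
  have := div_permHom_mem_diagOne hne
    (zpow_mem (pUnit_mem_diagUnits p hp i j i j) (chiChange c i j S i / 2))
  change _ / permUnits (Equiv.swap i j) _ ∈ _ at this
  rw [map_zpow, permUnits_pUnit, Equiv.swap_apply_left, Equiv.swap_apply_right] at this
  simpa [div_eq_mul_inv] using this

theorem pairFactor_zpow_mem_diagUnits (hlt : i < j) {q : {q : Fin N × Fin N // q.1 < q.2}}
    (h : q.1 ≠ (i, j)) (a b d : ℤ) :
    pUnit N p hp q.1.1 q.1.2 ^ a * pUnit N p hp q.1.2 q.1.1 ^ b / rootUnit N R q ^ d ∈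
      diagUnits R i j :=
  div_mem (mul_mem (zpow_mem (pUnit_mem_diagUnits p hp i j _ _) _)
    (zpow_mem (pUnit_mem_diagUnits p hp i j _ _) _)) (zpow_mem (rootUnit_mem_diagUnits hlt h) _)

/-- Along `x_i = x_j` the weight changes under a Kempe move by a sign only: the factors of the
pairs `q` and `s q`, where `s` exchanges `i` and `j`, cancel there. -/
theorem kempeRatio_mem_diagOne (hS : IsPart c i j S) (hij : i.val + 1 = j.val) :
    kempeRatio p hp c i j S ∈ diagOne R i j := by
  have hne : i ≠ j := by rintro rfl; omega
  have hlt : i < j := by rw [Fin.lt_def]; omega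
  rw [← QuotientGroup.eq_one_iff, kempeRatio, ← QuotientGroup.mk'_apply, map_prod]
  have h0 : ∀ q : {q : Fin N × Fin N // q.1 < q.2}, q.1 = (i, j) →
      QuotientGroup.mk' (diagOne R i j) (pairRatio p hp c i j S q) = 1 := fun q h =>
    (QuotientGroup.eq_one_iff _).2 (pairRatio_mem_diagOne p hp c S hS hne h)
  refine Finset.prod_involution (fun q _ => swapPair i j hij q) ?_ ?_
    (fun _ _ => Finset.mem_univ _) (fun q _ => swapPair_swapPair hij q)
  · intro q _
    by_cases h : q.1 = (i, j)
    · rw [swapPair_of_eq hij h, h0 q h]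
      exact one_mul (1 : (EvalRing N R)ˣ ⧸ diagOne R i j)
    · rw [← map_mul, QuotientGroup.mk'_apply, QuotientGroup.eq_one_iff]
      have := div_permHom_mem_diagOne hne (u := pairRatio p hp c i j S q)
        (pairFactor_zpow_mem_diagUnits p hp hlt h _ _ _)
      change _ / permUnits (Equiv.swap i j) _ ∈ _ at this
      rwa [permUnits_pairRatio p hp hS hij h, div_inv_eq_mul] at this
  · intro q _ hq hs
    have h : q.1 ≠ (i, j) := fun h => hq (h0 q h)
    have hs' := congrArg Subtype.val hs
    rw [swapPair_of_ne hij h, Prod.ext_iff] at hs'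
    obtain ⟨h1, h2⟩ := hs'
    dsimp only at h1 h2
    have z1 : chiChange c i j S q.1.1 = 0 := by
      have := chiChange_swap (c := c) (i := i) (j := j) (S := S) q.1.1
      rw [h1] at this
      omega
    have z2 : chiChange c i j S q.1.2 = 0 := by
      have := chiChange_swap (c := c) (i := i) (j := j) (S := S) q.1.2
      rw [h2] at this
      omega
    have z3 : chiPairChange c i j S q.1.1 q.1.2 = 0 := by
      have := chiPairChange_swap (c := c) (i := i) (j := j) (S := S) q.1.1 q.1.2
      rw [h1, h2] at this
      omega
    apply hq
    rw [pairRatio, z1, z2, z3]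
    simp

end GLFoam

/-! ### Sums over Kempe classes are regular along a diagonal -/

namespace GLFoam

variable {N : ℕ} {R : Type*} [CommRing R] {F : GLFoam N R} {c : F.Coloring} {i j : Fin N}
  {S : Set F.K.Triangle}

/-- Permuting the colors of a facet permutes the variables of its decoration. This uses that the
decoration is symmetric: the colors need not stay in order. -/
theorem facetValue_eq_rename {c c' : F.Coloring} {f : F.K.Facet} (w : Equiv.Perm (Fin N))
    (h : ∀ k, w k ∈ c'.1 f ↔ k ∈ c.1 f) : c'.facetValue f = rename w (c.facetValue f) := by
  set e := (c.1 f).orderEmbOfFin (c.2.1 f) with he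
  set e' := (c'.1 f).orderEmbOfFin (c'.2.1 f) with he'
  have hr : ∀ m, ∃ n, e' n = w (e m) := by
    intro m
    have : w (e m) ∈ Set.range e' := by
      rw [he', Finset.range_orderEmbOfFin, Finset.mem_coe, h]
      exact Finset.orderEmbOfFin_mem _ _ _
    exact this
  -- `τ` compares the two increasing enumerations of the colors.
  choose τ hτ using hr
  have hinj : Function.Injective τ := by
    intro m n hmn
    have := hτ m
    rw [hmn, hτ n] at this
    exact e.injective (w.injective this.symm)
  let τ' : Equiv.Perm (Fin (F.thickness f)) := Equiv.ofBijective τ (Finite.injective_iff_bijective.1 hinj)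
  have hsym : MvPolynomial.rename τ' (F.dots f) = F.dots f := F.dots_symmetric f τ'
  unfold Coloring.facetValue
  rw [← he, ← he']
  conv_lhs => rw [← hsym]
  rw [MvPolynomial.aeval_rename, ← AlgHom.comp_apply, MvPolynomial.comp_aeval]
  congr 2
  funext m
  change X (e' (τ m)) = rename w (X (e m))
  rw [rename_X, hτ m]

open scoped Classical in
theorem facetValue_kempe (hS : IsPart c i j S) (f : F.K.Facet) :
    (kempe c i j hS).facetValue f =
      if facetIn S f then rename (Equiv.swap i j) (c.facetValue f) else c.facetValue f := by
  split_ifs with h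
  · refine facetValue_eq_rename _ fun k => ?_
    change _ ∈ kempeFun c i j S f ↔ _
    rw [kempeFun, if_pos h, mem_swapColors, Equiv.swap_apply_self]
  · have := facetValue_eq_rename (c := c) (c' := kempe c i j hS) (f := f) 1 fun k => by
      change _ ∈ kempeFun c i j S f ↔ _
      rw [kempeFun, if_neg h, Equiv.Perm.one_apply]
    rw [this]
    simp only [Equiv.Perm.coe_one, rename_id_apply]

open scoped Classical in
/-- The product of the decorations of the facets in a component of `F_ij(c)`. -/
def compValue (k : Comp c i j) : MvPowerSeries (Fin N) R :=
  ∏ f, if facetIn (compSet k) f then c.facetValue f else 1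

open scoped Classical in
/-- The product of the decorations of the facets that are not in `F_ij(c)`. -/
def restValue (c : F.Coloring) (i j : Fin N) : MvPowerSeries (Fin N) R :=
  ∏ f, if facetIn (pairSet c i j) f then 1 else c.facetValue f

theorem isPart_pairSet (c : F.Coloring) (i j : Fin N) : IsPart c i j (pairSet c i j) where
  sub := fun _ h => h
  closed _ _ _ hp := hp

open scoped Classical in
/-- Under Kempe moves on several components the decorations change component by component. -/
theorem prod_facetValue_kempe (U : Finset (Comp c i j)) :
    ∏ f, (kempe c i j (isPart_unionSet U)).facetValue f = restValue c i j *
      ∏ k, if k ∈ U then rename (Equiv.swap i j) (compValue k) else compValue k := by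
  have e : ∀ k : Comp c i j,
      (if k ∈ U then rename (Equiv.swap i j) (compValue k) else compValue k) =
      ∏ f, if facetIn (compSet k) f then
        (if k ∈ U then rename (Equiv.swap i j) (c.facetValue f) else c.facetValue f) else 1 := by
    intro k
    split_ifs with hk
    · rw [compValue, map_prod]
      refine Finset.prod_congr rfl fun f _ => ?_
      split_ifs
      · rfl
      · exact map_one _
    · rfl
  simp only [e]
  rw [Finset.prod_comm, restValue, ← Finset.prod_mul_distrib]
  refine Finset.prod_congr rfl fun f _ => ?_
  rw [facetValue_kempe]
  obtain ⟨t, rfl⟩ : ∃ t, F.K.facetOf t = f := Quot.exists_rep f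
  by_cases ht : t ∈ pairSet c i j
  · obtain ⟨k₀, hk0⟩ : ∃ k : Comp c i j, t ∈ compSet k := ⟨Quot.mk _ ⟨t, ht⟩, ht, rfl⟩
    rw [if_pos ((isPart_pairSet c i j).facetIn_facetOf t |>.2 ht), one_mul,
      Finset.prod_eq_single k₀]
    · rw [if_pos (((isPart_compSet _).facetIn_facetOf t).2 hk0)]
      refine if_congr ?_ rfl rfl
      rw [(isPart_unionSet U).facetIn_facetOf]
      constructor
      · rintro ⟨k, hk, h⟩
        by_cases e : k = k₀
        · exact e ▸ hk
        · exact absurd hk0 (Set.disjoint_left.1 (compSet_disjoint e) h)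
      · exact fun h => ⟨_, h, hk0⟩
    · intro k _ hk
      rw [if_neg]
      rw [(isPart_compSet _).facetIn_facetOf]
      exact fun h => Set.disjoint_left.1 (compSet_disjoint hk) h hk0
    · exact fun h => absurd (Finset.mem_univ _) h
  · rw [if_neg (fun h => ht ((isPart_pairSet c i j).facetIn_facetOf t |>.1 h)),
      if_neg (fun h => ht ((isPart_unionSet U).sub (((isPart_unionSet U).facetIn_facetOf t).1 h))),
      Finset.prod_eq_one, mul_one]
    · intro k _
      rw [if_neg]
      rw [(isPart_compSet _).facetIn_facetOf]
      exact fun h => ht ((isPart_compSet _).sub h)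

variable (p : MvPowerSeries (Fin 2) R) (hp : constantCoeff p = 1)

/-- The factor by which the weight changes under the Kempe move on a component. -/
def compRatio (k : Comp c i j) : (EvalRing N R)ˣ :=
  (-1) ^ (F.K.eulerChar (compSet k) / 2) * kempeRatio p hp c i j (compSet k)

open scoped Classical in
/-- The sum over a Kempe class is a product over the connected components of `F_ij(c)`. -/
theorem sum_kempe_class_evaluation (hij : i.val + 1 = j.val) :
    ∑ c' : F.Coloring with ∀ g, c'.1 g \ {i, j} = c.1 g \ {i, j}, c'.evaluation p hp =
      (weight p hp c : EvalRing N R) *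
        algebraMap (MvPowerSeries (Fin N) R) (EvalRing N R) (restValue c i j) *
        ∏ k : Comp c i j,
          ((compRatio p hp k : EvalRing N R) *
            algebraMap (MvPowerSeries (Fin N) R) (EvalRing N R)
              (rename (Equiv.swap i j) (compValue k)) +
            algebraMap (MvPowerSeries (Fin N) R) (EvalRing N R) (compValue k)) := by
  rw [sum_kempe_class, Finset.prod_add, Finset.mul_sum, Finset.powerset_univ]
  refine Finset.sum_congr rfl fun U _ => ?_
  have h1 : weight p hp (kempe c i j (isPart_unionSet U)) =
      weight p hp c * ∏ k ∈ U, compRatio p hp k := by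
    rw [weight_kempe p hp _ hij, kempeRatio_unionSet, sign_unionSet, ← Finset.prod_mul_distrib]
    rfl
  have h2 : (∏ k : Comp c i j,
      if k ∈ U then rename (Equiv.swap i j) (compValue k) else compValue k) =
      (∏ k ∈ U, rename (Equiv.swap i j) (compValue k)) * ∏ k ∈ Finset.univ \ U, compValue k := by
    rw [Finset.prod_ite]
    congr 1
    · refine Finset.prod_congr ?_ fun _ _ => rfl
      ext; simp
    · refine Finset.prod_congr ?_ fun _ _ => rfl
      ext; simp
  rw [evaluation_eq, prod_facetValue_kempe, h1, h2, Finset.prod_mul_distrib, Units.val_mul,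
    Units.coe_prod]
  simp only [map_mul, map_prod]
  ring

/-- The factor of a component is divisible by the power of `x_i - x_j` that it brings into the
denominator. On a sphere, where this power is the first, the two colorings of the component
contribute with opposite signs and cancel for `x_i = x_j`; all other components have no
denominator. -/
theorem comp_factor_mem (hij : i.val + 1 = j.val) (hlt : i < j) (k : Comp c i j) :
    ((rootUnit N R ⟨(i, j), hlt⟩ ^ (-(F.K.eulerChar (compSet k) / 2)) : (EvalRing N R)ˣ) :
      EvalRing N R) * ((compRatio p hp k : EvalRing N R) *
            algebraMap (MvPowerSeries (Fin N) R) (EvalRing N R)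
              (rename (Equiv.swap i j) (compValue k)) +
            algebraMap (MvPowerSeries (Fin N) R) (EvalRing N R) (compValue k)) ∈
      diagSubring R i j := by
  have hH := kempeRatio_mem_diagOne p hp (isPart_compSet k) hij
  have hv : VanishesOn i j ((kempeRatio p hp c i j (compSet k) : EvalRing N R) - 1) := hH.1
  have hA := algebraMap_mem_diagSubring (R := R) i j
  obtain ⟨m, hm⟩ := (even_eulerChar_part (isPart_compSet k)).two_dvd
  have hle := eulerChar_compSet_le k
  have hm' : F.K.eulerChar (compSet k) / 2 = m := by omega
  unfold compRatio
  rw [hm']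
  have hm1 : m ≤ 1 := by omega
  rcases hm1.lt_or_eq with h | h
  · obtain ⟨n, hn⟩ := Int.eq_ofNat_of_zero_le (show 0 ≤ -m by omega)
    rw [hn, zpow_natCast]
    refine mul_mem ?_ (add_mem (mul_mem ?_ (hA _)) (hA _))
    · rw [Units.val_pow_eq_pow_val]
      exact pow_mem (hA _) n
    · have : (kempeRatio p hp c i j (compSet k) : EvalRing N R) ∈ diagSubring R i j := by
        simpa using add_mem hv.mem (one_mem _)
      rw [Units.val_mul]
      refine mul_mem ?_ this
      rcases Int.even_or_odd m with h' | h'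
      · rw [h'.neg_one_zpow]
        exact one_mem _
      · rw [h'.neg_one_zpow]
        exact neg_mem (one_mem _)
  · subst h
    have h2 := (vanishesOn_sub_swap (by rintro rfl; omega : i ≠ j) (hA (compValue k))).add
      (hv.mul (hA (rename (Equiv.swap i j) (compValue k)))).neg
    rw [permHom_algebraMap] at h2
    obtain ⟨a, ha, h2⟩ := h2
    have h3 : ((((-1) ^ (1 : ℤ) * kempeRatio p hp c i j (compSet k) : (EvalRing N R)ˣ) :
        EvalRing N R) * algebraMap (MvPowerSeries (Fin N) R) (EvalRing N R)
              (rename (Equiv.swap i j) (compValue k)) +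
            algebraMap (MvPowerSeries (Fin N) R) (EvalRing N R) (compValue k)) =
        (rootUnit N R ⟨(i, j), hlt⟩ : EvalRing N R) * a := by
      change _ = algebraMap _ _ (X i - X j) * a
      rw [← h2, zpow_one, Units.val_mul, Units.val_neg, Units.val_one]
      ring
    rw [h3, zpow_neg_one, Units.inv_mul_cancel_left]
    exact ha

/-- The only pole of a weight along `x_i = x_j` is of order `χ_ij / 2`. -/
theorem weight_mul_mem_diagUnits (hlt : i < j) :
    weight p hp c * rootUnit N R ⟨(i, j), hlt⟩ ^ (c.chiPair i j / 2) ∈ diagUnits R i j := by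
  classical
  have hq := Finset.mul_prod_erase Finset.univ (pairFactor p hp c)
    (Finset.mem_univ (⟨(i, j), hlt⟩ : {q : Fin N × Fin N // q.1 < q.2}))
  have h0 : pairFactor p hp c ⟨(i, j), hlt⟩ * rootUnit N R ⟨(i, j), hlt⟩ ^ (c.chiPair i j / 2) =
      pUnit N p hp i j ^ (c.chi i / 2) * pUnit N p hp j i ^ (c.chi j / 2) := by
    rw [pairFactor, div_mul_cancel]
  have h1 : weight p hp c * rootUnit N R ⟨(i, j), hlt⟩ ^ (c.chiPair i j / 2) =
      (-1) ^ c.signExponent *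
        ((pUnit N p hp i j ^ (c.chi i / 2) * pUnit N p hp j i ^ (c.chi j / 2)) *
          ∏ q ∈ Finset.univ.erase (⟨(i, j), hlt⟩ : {q : Fin N × Fin N // q.1 < q.2}),
            pairFactor p hp c q) := by
    rw [weight, ← hq, ← h0]
    simp only [mul_assoc, mul_comm]
  rw [h1]
  refine mul_mem (zpow_mem ?_ _) (mul_mem (mul_mem (zpow_mem (pUnit_mem_diagUnits p hp i j _ _) _)
    (zpow_mem (pUnit_mem_diagUnits p hp i j _ _) _)) (prod_mem fun q hq => ?_))
  · refine ⟨?_, ?_⟩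
    · rw [Units.val_neg, Units.val_one]
      exact neg_mem (one_mem _)
    · rw [inv_neg, inv_one, Units.val_neg, Units.val_one]
      exact neg_mem (one_mem _)
  · refine pairFactor_zpow_mem_diagUnits p hp hlt ?_ _ _ _
    exact fun h => (Finset.mem_erase.1 hq).1 (Subtype.ext h)

open scoped Classical in
theorem sum_kempe_class_mem (c : F.Coloring) (hij : i.val + 1 = j.val) :
    ∑ c' : F.Coloring with ∀ g, c'.1 g \ {i, j} = c.1 g \ {i, j}, c'.evaluation p hp ∈
      diagSubring R i j := by
  have hlt : i < j := by rw [Fin.lt_def]; omega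
  rw [sum_kempe_class_evaluation p hp hij]
  have e1 : c.chiPair i j = ∑ k : Comp c i j, F.K.eulerChar (compSet k) := by
    rw [← eulerChar_biUnion Finset.univ compSet (fun k _ => isPart_compSet k)
      (fun k _ l _ h => compSet_disjoint h)]
    change _ = F.K.eulerChar (unionSet Finset.univ)
    rw [unionSet_univ]
    rfl
  have e2 : c.chiPair i j / 2 = ∑ k : Comp c i j, F.K.eulerChar (compSet k) / 2 := by
    rw [e1, sum_ediv_two _ _ fun k _ => even_eulerChar_part (isPart_compSet k)]
  have e3 : (weight p hp c : EvalRing N R) =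
      ((weight p hp c * rootUnit N R ⟨(i, j), hlt⟩ ^ (c.chiPair i j / 2) : (EvalRing N R)ˣ) :
        EvalRing N R) * ∏ k : Comp c i j,
        ((rootUnit N R ⟨(i, j), hlt⟩ ^ (-(F.K.eulerChar (compSet k) / 2)) : (EvalRing N R)ˣ) :
          EvalRing N R) := by
    rw [← Units.coe_prod, ← Units.val_mul, ← zpow_sum_eq, Finset.sum_neg_distrib, ← e2, zpow_neg,
      mul_inv_cancel_right]
  rw [e3, mul_right_comm _ (∏ k : Comp c i j, _), mul_assoc, ← Finset.prod_mul_distrib]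
  exact mul_mem (mul_mem (weight_mul_mem_diagUnits p hp hlt).1
    (algebraMap_mem_diagSubring i j _)) (prod_mem fun k _ => comp_factor_mem p hp hij hlt k)

theorem evaluation_mem_diagSubring_of_consecutive (hij : i.val + 1 = j.val) :
    F.evaluation p hp ∈ diagSubring R i j := by
  classical
  rw [GLFoam.evaluation, ← Finset.sum_fiberwise Finset.univ (fun c : F.Coloring => fun g => c.1 g \ {i, j})]
  refine sum_mem fun b _ => ?_
  rcases (Finset.univ.filter fun c : F.Coloring =>
    (fun g => c.1 g \ {i, j}) = b).eq_empty_or_nonempty with h | ⟨c, hc⟩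
  · rw [h, Finset.sum_empty]
    exact zero_mem _
  · have hc := (Finset.mem_filter.1 hc).2
    subst hc
    have := sum_kempe_class_mem p hp c hij
    simpa only [funext_iff] using this

end GLFoam

/-! ### Symmetry of the evaluation -/

namespace GLFoam

variable {N : ℕ} {R : Type*} [CommRing R] {F : GLFoam N R} {c : F.Coloring} {i j : Fin N}

/-- The coloring with the colors `i` and `j` exchanged on all facets. -/
def swapColoring (c : F.Coloring) (i j : Fin N) : F.Coloring := kempe c i j (isPart_pairSet c i j)

theorem color_swapColoring (t : F.K.Triangle) :
    (swapColoring c i j).color t = swapColors i j (c.color t) := by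
  rw [swapColoring, color_kempe]
  split_ifs with h
  · rfl
  · exact (swapColors_of_notMem_pairSet h).symm

theorem swapColoring_swapColoring (c : F.Coloring) (i j : Fin N) :
    swapColoring (swapColoring c i j) i j = c :=
  ext_color fun t => by rw [color_swapColoring, color_swapColoring, swapColors_swapColors]

theorem chi_swapColoring (k : Fin N) :
    (swapColoring c i j).chi (Equiv.swap i j k) = c.chi k := by
  simp only [Coloring.chi, color_swapColoring, mem_swapColors, Equiv.swap_apply_self]

theorem chiPair_swapColoring (k l : Fin N) :
    (swapColoring c i j).chiPair (Equiv.swap i j k) (Equiv.swap i j l) = c.chiPair k l := by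
  simp only [Coloring.chiPair, color_swapColoring, mem_swapColors, Equiv.swap_apply_self]

theorem facetValue_swapColoring (f : F.K.Facet) :
    (swapColoring c i j).facetValue f = rename (Equiv.swap i j) (c.facetValue f) := by
  refine facetValue_eq_rename _ fun k => ?_
  obtain ⟨t, rfl⟩ : ∃ t, F.K.facetOf t = f := Quot.exists_rep f
  change _ ∈ (swapColoring c i j).color t ↔ _ ∈ c.color t
  rw [color_swapColoring, mem_swapColors, Equiv.swap_apply_self]

variable (p : MvPowerSeries (Fin 2) R) (hp : constantCoeff p = 1)

theorem permUnits_pairFactor (hij : i.val + 1 = j.val)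
    {q : {q : Fin N × Fin N // q.1 < q.2}} (h : q.1 ≠ (i, j)) :
    permUnits (Equiv.swap i j) (pairFactor p hp c q) =
      pairFactor p hp (swapColoring c i j) (swapPair i j hij q) := by
  rw [pairFactor, pairFactor, map_div, map_mul, map_zpow, map_zpow, map_zpow, permUnits_pUnit,
    permUnits_pUnit, permUnits_rootUnit hij h]
  simp only [swapPair_of_ne hij h, chi_swapColoring, chiPair_swapColoring]

theorem chiPair_comm (c : F.Coloring) (k l : Fin N) : c.chiPair k l = c.chiPair l k := by
  simp only [Coloring.chiPair, or_comm]

theorem permUnits_pairFactor_of_eq {q : {q : Fin N × Fin N // q.1 < q.2}} (h : q.1 = (i, j)) :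
    permUnits (Equiv.swap i j) (pairFactor p hp c q) =
      (-1) ^ (c.chiPair i j / 2) * pairFactor p hp (swapColoring c i j) q := by
  have e1 := chi_swapColoring (c := c) (i := i) (j := j) i
  have e2 := chi_swapColoring (c := c) (i := i) (j := j) j
  have e3 := chiPair_swapColoring (c := c) (i := i) (j := j) i j
  rw [Equiv.swap_apply_left] at e1
  rw [Equiv.swap_apply_right] at e2
  rw [Equiv.swap_apply_left, Equiv.swap_apply_right, chiPair_comm] at e3
  have e4 : ((-1 : (EvalRing N R)ˣ) ^ (c.chiPair i j / 2))⁻¹ = (-1) ^ (c.chiPair i j / 2) := by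
    rw [← inv_zpow, inv_neg, inv_one]
  rw [pairFactor, pairFactor, map_div, map_mul, map_zpow, map_zpow, map_zpow, permUnits_pUnit,
    permUnits_pUnit, permUnits_rootUnit_of_eq h]
  simp only [h, e1, e2, e3, Equiv.swap_apply_left, Equiv.swap_apply_right]
  rw [neg_eq_neg_one_mul (rootUnit N R q), mul_zpow, div_eq_mul_inv, div_eq_mul_inv, mul_inv, e4,
    mul_comm (pUnit N p hp i j ^ _), mul_left_comm]

theorem permUnits_weight (hij : i.val + 1 = j.val) :
    permUnits (Equiv.swap i j) (weight p hp c) = weight p hp (swapColoring c i j) := by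
  classical
  have hlt : i < j := by rw [Fin.lt_def]; omega
  have h1 : ∀ q, permUnits (Equiv.swap i j) (pairFactor p hp c q) =
      (if q = ⟨(i, j), hlt⟩ then (-1) ^ (c.chiPair i j / 2) else 1) *
        pairFactor p hp (swapColoring c i j) (swapPair i j hij q) := by
    intro q
    split_ifs with h
    · have h' : q.1 = (i, j) := congrArg Subtype.val h
      rw [permUnits_pairFactor_of_eq p hp h', swapPair_of_eq hij h']
    · rw [permUnits_pairFactor p hp hij (fun h' => h (Subtype.ext h')), one_mul]
  have h2 : ∏ q, pairFactor p hp (swapColoring c i j) (swapPair i j hij q) =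
      ∏ q, pairFactor p hp (swapColoring c i j) q :=
    Equiv.prod_comp (Function.Involutive.toPerm _ (swapPair_swapPair hij))
      (pairFactor p hp (swapColoring c i j))
  have h3 : Even ((swapColoring c i j).signExponent - (c.signExponent + c.chiPair i j / 2)) := by
    rw [← sub_sub]
    exact even_signExponent_kempe (isPart_pairSet c i j) hij
  have h4 : permUnits (R := R) (Equiv.swap i j) (-1) = -1 := by
    ext
    change permHom _ (-1) = -1
    rw [map_neg, map_one]
  rw [weight, weight, map_mul, map_prod, map_zpow, h4]
  simp only [h1]
  rw [Finset.prod_mul_distrib, h2, Finset.prod_ite_eq' , if_pos (Finset.mem_univ _),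
    neg_one_zpow_eq_of_even_sub h3, zpow_add, mul_assoc]

theorem permHom_swap_evaluation (hij : i.val + 1 = j.val) :
    permHom (Equiv.swap i j) (F.evaluation p hp) = F.evaluation p hp := by
  have h1 : ∀ c : F.Coloring, permHom (Equiv.swap i j) (c.evaluation p hp) =
      (swapColoring c i j).evaluation p hp := by
    intro c
    rw [evaluation_eq, evaluation_eq, map_mul, permHom_algebraMap, map_prod (rename _),
      ← permUnits_weight p hp hij]
    simp only [facetValue_swapColoring]
    rfl
  rw [GLFoam.evaluation, map_sum]
  simp only [h1]
  exact Equiv.sum_comp (Function.Involutive.toPerm (fun c : F.Coloring => swapColoring c i j)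
    fun c => swapColoring_swapColoring c i j) fun c => c.evaluation p hp

/-- The consecutive transpositions, treated in `permHom_swap_evaluation`, generate. -/
theorem permHom_evaluation (w : Equiv.Perm (Fin N)) :
    permHom w (F.evaluation p hp) = F.evaluation p hp := by
  cases N with
  | zero =>
    rw [Subsingleton.elim w 1, permHom_one]
    rfl
  | succ n =>
    have hw : w ∈ Submonoid.closure
        (Set.range fun i : Fin n => Equiv.swap i.castSucc i.succ) := by
      rw [Equiv.Perm.mclosure_swap_castSucc_succ]
      trivial
    induction hw using Submonoid.closure_induction with
    | mem x hx =>
      obtain ⟨i, rfl⟩ := hx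
      exact permHom_swap_evaluation p hp (by simp)
    | one =>
      rw [permHom_one]
      rfl
    | mul x y _ _ hx hy => rw [permHom_mul, RingHom.comp_apply, hy, hx]

/-- Every pair of variables is conjugate to a pair of consecutive ones. -/
theorem evaluation_mem_diagSubring {k l : Fin N} (h : k < l) :
    F.evaluation p hp ∈ diagSubring R k l := by
  have hk : k.val + 1 < N := by
    have := l.2
    rw [Fin.lt_def] at h
    omega
  have hij := evaluation_mem_diagSubring_of_consecutive (F := F) p hp (i := k)
    (j := ⟨k.val + 1, hk⟩) rfl
  have := permHom_mem_diagSubring (Equiv.swap ⟨k.val + 1, hk⟩ l) hij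
  rwa [Equiv.swap_apply_left, Equiv.swap_apply_of_ne_of_ne, permHom_evaluation] at this
  · intro e
    have := congrArg Fin.val e
    simp at this
  · exact h.ne

end GLFoam

end

theorem theorem2 {N : ℕ} {R : Type*} [CommRing R]
    (p : MvPowerSeries (Fin 2) R) (hp : MvPowerSeries.constantCoeff p = 1) (F : GLFoam N R) :
    (∀ (c : F.Coloring) (i : Fin N), Even (c.chi i)) ∧
    (∀ (c : F.Coloring) (i j : Fin N), i ≠ j → Even (c.chiPair i j)) ∧
    ∃ g : MvPowerSeries (Fin N) R,
      (∀ σ : Equiv.Perm (Fin N), MvPowerSeries.rename σ g = g) ∧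
      algebraMap (MvPowerSeries (Fin N) R) (EvalRing N R) g = F.evaluation p hp := by
  obtain ⟨g, hg⟩ := mem_range_algebraMap_of_mem_diagSubring fun _ _ h =>
    F.evaluation_mem_diagSubring p hp h
  refine ⟨fun c i => GLFoam.even_chi c i, fun c i j _ => GLFoam.even_chiPair c i j, g,
    fun σ => algebraMap_evalRing_injective ?_, hg⟩
  rw [← permHom_algebraMap, hg, GLFoam.permHom_evaluation]
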